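/- Let $\Gamma$ be a finite simplicial graph with vertex set $V$, let $A_\Gamma$ be its right-angled Artin group, and let $V^{\pm}=\{v,v^{-1}\mid v\in V\}$. Write $lk(v)$, $st(v)$ for the link and star of a vertex (set of neighbours, without resp. with $v$), also for $v\in V^\pm$, and $v\le w$ if $lk(v)\subseteq st(w)$, $v\sim w$ if $v\le w\le v$. Let $Out_\ell\le Out(A_\Gamma)$ be the subgroup generated by graph automorphisms, inversions, partial conjugations and transvections $v\mapsto vw$ with $v\le w$, $v\ne w$ non-adjacent. *Whitehead pairs and partitions.* A pair $(P,m)$ with $P\subset V^\pm$, $|P|\ge 2$, $m\in P$, $m^{-1}\notin P$ is a Whitehead pair if (1) no element of $P$ is adjacent to $m$; (2) $x\in P$, $x^{-1}\notin P$ imply $x\le m$; (3) if $v,v^{-1}\in P$ then $w,w^{-1}\in P$ for all $w$ in the component of $v$ in $\Gamma\setminus st(m)$. Its Whitehead automorphism is the automorphism of $A_\Gamma$ given, for $v\in V^\pm$, by $m\mapsto m^{-1}$ and, for $v\ne m^{\pm1}$, $v\mapsto vm^{-1}$ if $v\in P\not\ni v^{-1}$; $v\mapsto mv$ if $v^{-1}\in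 P\not\ni v$; $v\mapsto mvm^{-1}$ if $v,v^{-1}\in P$; $v\mapsto v$ otherwise. Put $lk(P)=lk(m)^\pm$, $P^*=V^\pm\setminus(P\cup lk(P))$, $\max(P)=\{x\in P: x^{-1}\notin P,\ x\sim m\}$. The triple $\mathbf P=\{P,lk(P),P^*\}$ is a Whitehead partition with sides $P,P^*$, and $lk(\mathbf P)=lk(m)\subseteq V$. Partitions $\mathbf P,\mathbf Q$ commute if every element of $\max(P)$ is adjacent to every element of $\max(Q)$; they are compatible if they commute or some side of $\mathbf P$ is disjoint from some side of $\mathbf Q$. *Blow-ups.* Let $\mathbb S$ be the Salvetti complex of $\Gamma$ (one vertex, an edge $e_v$ for each $v\in V$, and one cube for each set of pairwise adjacent vertices), so $\pi_1(\mathbb S)=A_\Gamma$. Let $\mathcal P=\{\mathbf P_1,\dots,\mathbf P_k\}$ be a set of $k\geq 0$ distinct, pairwise compatible Whitehead partitions. A region $R$ is a choice of sides $P_i^\times\in\{P_i,P_i^*\}$ such that the chosen sides of any two non-commuting partitions intersect; $I(R)=\bigcap_i(P_i^\times\cup lk(P_i))$. The blow-up $\mathbb S^{\mathcal P}$ is the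 cube complex whose vertices are the regions, with an edge labelled $e_{\mathbf P_i}$ between regions differing exactly in the side of $\mathbf P_i$, an edge labelled $e_v$ from a region $R'$ to a region $R$ whenever $v\in I(R)$, $v^{-1}\in I(R')$ and $R,R'$ differ exactly in the $\mathbf P_i$ for which $v,v^{-1}$ lie in different sides, and an $n$-cube wherever $n$ edges at a vertex have pairwise commuting labels (labels $e_v,e_w$ commute if $v,w$ are adjacent; $e_v,e_{\mathbf P_i}$ if $v\in lk(\mathbf P_i)$; $e_{\mathbf P_i},e_{\mathbf P_j}$, $i\neq j$, if $\mathbf P_i,\mathbf P_j$ commute). The canonical collapse $c_{\mathcal P}:\mathbb S^{\mathcal P}\to\mathbb S$ collapses all edges $e_{\mathbf P_i}$ and maps edges $e_v$ to $e_v$. For a set $\mathcal H$ of hyperplanes, $c_{\mathcal H}:\mathbb S^{\mathcal P}\to\mathbb S^{\mathcal P}_{\mathcal H}$ denotes the collapse of every cube to the intersection of its midplanes lying in hyperplanes of $\mathcal H$. *Tree-like sets.* For a link $L$ of a partition in $\mathcal P$, let $\mathcal P_L\subseteq\mathcal P$ be the set of all partitions with link $L$, and let the base graph $\mathfrak g_L$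 be the subgraph of the 1-skeleton of $\mathbb S^{\mathcal P_L}$ consisting of all vertices and all edges $e_{\mathbf P}$, $\mathbf P\in\mathcal P_L$, and $e_v$ with $lk(v)=L$. A set $\mathcal H$ of hyperplanes of $\mathbb S^{\mathcal P}$ is tree-like if every hyperplane in $\mathcal H$ is dual to edges with a label that occurs in some $\mathfrak g_L$, and for every $L$ the edges of $\mathfrak g_L$ with labels dual to $\mathcal H$ form a maximal tree of $\mathfrak g_L$. *Marked Salvettis.* A rose is (the class of) $\sigma=(\mathbb S,\alpha)$ where $\alpha:\mathbb S\to\mathbb S$ is a homotopy equivalence inducing an element of $Out_\ell$. Marked complexes $(X,\alpha)$, $(X',\alpha')$ are equivalent if $\alpha'\circ h\simeq\alpha$ for an isomorphism of cube complexes $h:X\to X'$. Put $\sigma^{\mathcal P}=(\mathbb S^{\mathcal P},\alpha\circ c_{\mathcal P})$ and $\sigma^{\mathcal P}_{\mathcal H}=(\mathbb S^{\mathcal P}_{\mathcal H},\alpha\circ c_{\mathcal P}\circ c_{\mathcal H}^{-1})$. A Whitehead move connects $(\mathbb S,\alpha)$ to (the class of) $(\mathbb S,\alpha\circ\phi)$,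 where $\phi$ realizes the Whitehead automorphism of a Whitehead pair. **Theorem.** Let $\mathcal P=\{\mathbf P_1,\dots,\mathbf P_k\}$ be a compatible collection of Whitehead partitions and $\mathcal H$ a tree-like set of hyperplanes in $\mathbb S^{\mathcal P}$. Then: 1. $c_{\mathcal P}$ and $c_{\mathcal H}$ are homotopy equivalences, $\mathbb S^{\mathcal P}_{\mathcal H}\cong\mathbb S$ as cube complexes, and for every such isomorphism the outer automorphism of $A_\Gamma$ induced by $\mathbb S\xleftarrow{c_{\mathcal P}}\mathbb S^{\mathcal P}\xrightarrow{c_{\mathcal H}}\mathbb S^{\mathcal P}_{\mathcal H}\cong\mathbb S$ lies in $Out_\ell$. 2. (Factorization Lemma) For every rose $\sigma=(\mathbb S,\alpha)$ there are an ordering $H_1,\dots,H_k$ of the elements of $\mathcal H$, an ordering $K_1,\dots,K_k$ of the hyperplanes dual to the edges $e_{\mathbf P_1},\dots,e_{\mathbf P_k}$, and a chain of roses $\sigma=\sigma_0,\sigma_1,\dots,\sigma_k=\sigma^{\mathcal P}_{\mathcal H}$ such that each $\sigma_i$ is connected to $\sigma_{i-1}$ by a Whitehead move; moreover, for $0\le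 i\le k$ the set $\mathcal H_i=\{H_1,\dots,H_i,K_{i+1},\dots,K_k\}$ is tree-like, its collapse is a homotopy equivalence, and $\sigma_i=\sigma^{\mathcal P}_{\mathcal H_i}$. -/

import Mathlib

universe u

open CategoryTheory

noncomputable section

namespace OutSpace

/-! ### Right-angled Artin groups and their outer automorphisms -/

/-- The relators `[v, w]`, for adjacent vertices `v`, `w`. -/
def raagRels {V : Type u} (Γ : SimpleGraph V) : Set (FreeGroup V) :=
  {r | ∃ v w, Γ.Adj v w ∧ r = FreeGroup.of v * FreeGroup.of w *
    (FreeGroup.of v)⁻¹ * (FreeGroup.of w)⁻¹}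

/-- The right-angled Artin group `A_Γ`. -/
abbrev RAAG {V : Type u} (Γ : SimpleGraph V) : Type u := PresentedGroup (raagRels Γ)

/-- The symmetric set `V^±`: the pair `(v, true)` stands for `v` and `(v, false)` for `v⁻¹`. -/
abbrev Letter (V : Type u) : Type u := V × Bool

/-- The formal inverse on `V^±`. -/
def Letter.inv {V : Type u} (x : Letter V) : Letter V := (x.1, !x.2)

/-- The element of `A_Γ` represented by a letter. -/
def gen {V : Type u} (Γ : SimpleGraph V) (x : Letter V) : RAAG Γ :=
  if x.2 then PresentedGroup.of x.1 else (PresentedGroup.of x.1)⁻¹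

/-- `lk(v)`. -/
def lk {V : Type u} (Γ : SimpleGraph V) (v : V) : Set V := Γ.neighborSet v

/-- `st(v)`. -/
def st {V : Type u} (Γ : SimpleGraph V) (v : V) : Set V := insert v (lk Γ v)

/-- The relation `v ≤ w`, that is, `lk(v) ⊆ st(w)`. -/
def VLE {V : Type u} (Γ : SimpleGraph V) (v w : V) : Prop := lk Γ v ⊆ st Γ w

/-- `x` and `y` lie in the same component of `Γ ∖ st(v)`. -/
def SameComponent {V : Type u} (Γ : SimpleGraph V) (v x y : V) : Prop :=
  ∃ (hx : x ∈ (st Γ v)ᶜ) (hy : y ∈ (st Γ v)ᶜ),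
    (Γ.induce (st Γ v)ᶜ).Reachable ⟨x, hx⟩ ⟨y, hy⟩

/-- The automorphism of `A_Γ` induced by an automorphism of the graph `Γ`. -/
def IsGraphAut {V : Type u} (Γ : SimpleGraph V) (f : MulAut (RAAG Γ)) : Prop :=
  ∃ s : Γ ≃g Γ, ∀ v : V, f (PresentedGroup.of v) = PresentedGroup.of (s v)

/-- The automorphism `v ↦ v⁻¹` fixing all other generators. -/
def IsInversion {V : Type u} (Γ : SimpleGraph V) (f : MulAut (RAAG Γ)) : Prop :=
  ∃ v : V, f (PresentedGroup.of v) = (PresentedGroup.of v)⁻¹ ∧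
    ∀ x, x ≠ v → f (PresentedGroup.of x) = PresentedGroup.of x

/-- The automorphism `v ↦ v w` fixing all other generators, for distinct non-adjacent
`v ≤ w`. -/
def IsNonadjacentTransvection {V : Type u} (Γ : SimpleGraph V) (f : MulAut (RAAG Γ)) : Prop :=
  ∃ v w : V, v ≠ w ∧ ¬ Γ.Adj v w ∧ VLE Γ v w ∧
    f (PresentedGroup.of v) = PresentedGroup.of v * PresentedGroup.of w ∧
    ∀ x, x ≠ v → f (PresentedGroup.of x) = PresentedGroup.of x

/-- The automorphism `x ↦ v x v⁻¹` for all `x` in the component of `Γ ∖ st(v)` containing `c`,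
fixing all other generators. -/
def IsPartialConjugation {V : Type u} (Γ : SimpleGraph V) (f : MulAut (RAAG Γ)) : Prop :=
  ∃ v c : V, c ∉ st Γ v ∧
    (∀ x, SameComponent Γ v c x → f (PresentedGroup.of x) =
      PresentedGroup.of v * PresentedGroup.of x * (PresentedGroup.of v)⁻¹) ∧
    ∀ x, ¬ SameComponent Γ v c x → f (PresentedGroup.of x) = PresentedGroup.of x

/-- The inner automorphisms. -/
def Inn (G : Type u) [Group G] : Subgroup (MulAut G) := (MulAut.conj : G →* MulAut G).range

instance Inn.normal (G : Type u) [Group G] : (Inn G).Normal := by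
  constructor
  rintro _ ⟨g, rfl⟩ f
  refine ⟨f g, ?_⟩
  ext x
  simp [MulAut.conj_apply]

/-- The outer automorphism group. -/
abbrev Out (G : Type u) [Group G] : Type u := MulAut G ⧸ Inn G

/-- The outer class of an automorphism. -/
def outClass {G : Type u} [Group G] (f : MulAut G) : Out G := QuotientGroup.mk' (Inn G) f

/-- The subgroup `Out_ℓ(A_Γ)` of long-range outer automorphisms: it is generated by the
graph automorphisms, inversions, partial conjugations and non-adjacent transvections. -/
def OutL {V : Type u} (Γ : SimpleGraph V) : Subgroup (Out (RAAG Γ)) :=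
  Subgroup.closure (outClass '' {f | IsGraphAut Γ f ∨ IsInversion Γ f ∨
    IsPartialConjugation Γ f ∨ IsNonadjacentTransvection Γ f})

/-! ### Whitehead pairs and partitions -/

/-- `(P, m)` is a `Γ`-Whitehead pair. -/
structure IsWhiteheadPair {V : Type u} (Γ : SimpleGraph V) (P : Set (Letter V))
    (m : Letter V) : Prop where
  mem : m ∈ P
  inv_notMem : m.inv ∉ P
  two_le : P.Nontrivial
  not_adj : ∀ x ∈ P, ¬ Γ.Adj x.1 m.1
  le_of_single : ∀ x ∈ P, x.inv ∉ P → VLE Γ x.1 m.1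
  component : ∀ v ∈ P, v.inv ∈ P → ∀ w : Letter V, SameComponent Γ m.1 v.1 w.1 → w ∈ P

/-- `f` is the Whitehead automorphism `(P, m)` of `A_Γ`. -/
structure IsWhiteheadAut {V : Type u} (Γ : SimpleGraph V) (P : Set (Letter V)) (m : Letter V)
    (f : MulAut (RAAG Γ)) : Prop where
  base : f (gen Γ m) = (gen Γ m)⁻¹
  left : ∀ v : Letter V, v.1 ≠ m.1 → v ∈ P → v.inv ∉ P →
    f (gen Γ v) = gen Γ v * (gen Γ m)⁻¹
  right : ∀ v : Letter V, v.1 ≠ m.1 → v ∉ P → v.inv ∈ P →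
    f (gen Γ v) = gen Γ m * gen Γ v
  both : ∀ v : Letter V, v.1 ≠ m.1 → v ∈ P → v.inv ∈ P →
    f (gen Γ v) = gen Γ m * gen Γ v * (gen Γ m)⁻¹
  neither : ∀ v : Letter V, v.1 ≠ m.1 → v ∉ P → v.inv ∉ P → f (gen Γ v) = gen Γ v

/-- A `Γ`-Whitehead partition `{P, lk(P), P^*}` of `V^±`, recorded by a side `P` which is part of
a Whitehead pair `(P, m)`. The same partition may be recorded by its other side,
see `SamePartition`. -/
structure WhiteheadPartition {V : Type u} (Γ : SimpleGraph V) where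
  side : Set (Letter V)
  isPair : ∃ m, IsWhiteheadPair Γ side m

namespace WhiteheadPartition

variable {V : Type u} {Γ : SimpleGraph V}

/-- `max(P)`: the elements of `single(P)` equivalent to `m`, where `(P, m)` is a pair. -/
def max (P : WhiteheadPartition Γ) : Set (Letter V) :=
  {x | x ∈ P.side ∧ x.inv ∉ P.side ∧
    ∃ m, IsWhiteheadPair Γ P.side m ∧ VLE Γ x.1 m.1 ∧ VLE Γ m.1 x.1}

/-- The link of the partition as a set of vertices: `lk(m)`, where `(P, m)` is a pair. -/
def link (P : WhiteheadPartition Γ) : Set V :=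
  {v | ∃ m, IsWhiteheadPair Γ P.side m ∧ v ∈ lk Γ m.1}

/-- The other side `P^*`. -/
def coside (P : WhiteheadPartition Γ) : Set (Letter V) :=
  {x | x ∉ P.side ∧ x.1 ∉ P.link}

/-- The two sides; `0` stands for `P` and `1` for `P^*`. -/
def sideAt (P : WhiteheadPartition Γ) (a : ZMod 2) : Set (Letter V) :=
  if a = 0 then P.side else P.coside

/-- `single(𝐏)`: the vertices `v` such that `v` and `v⁻¹` lie in different sides. -/
def single (P : WhiteheadPartition Γ) : Set V :=
  {v | ((v, true) ∈ P.side ∧ (v, false) ∈ P.coside) ∨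
    ((v, true) ∈ P.coside ∧ (v, false) ∈ P.side)}

/-- Two recorded sides give the same partition. -/
def SamePartition (P Q : WhiteheadPartition Γ) : Prop :=
  P.side = Q.side ∨ P.side = Q.coside

/-- Commuting partitions: the elements of `max(P)` and `max(Q)` are distinct and commute. -/
def Commute (P Q : WhiteheadPartition Γ) : Prop :=
  ∀ m ∈ P.max, ∀ n ∈ Q.max, Γ.Adj m.1 n.1

/-- Compatible partitions: they commute, or some side of one is disjoint from some side of the
other. -/
def Compatible (P Q : WhiteheadPartition Γ) : Prop :=
  P.Commute Q ∨ ∃ a b : ZMod 2, P.sideAt a ∩ Q.sideAt b = ∅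

end WhiteheadPartition

/-- A compatible collection of (distinct) Whitehead partitions, indexed by `ι`. -/
def IsCompatibleCollection {V : Type u} {Γ : SimpleGraph V} {ι : Type}
    (P : ι → WhiteheadPartition Γ) : Prop :=
  ∀ i j, i ≠ j → ¬ (P i).SamePartition (P j) ∧ (P i).Compatible (P j)

/-! ### Cube complexes -/

/-- An embedding of `[0,1]^m` onto a face of `[0,1]^n`. The origin goes to `corner`, and the
`i`-th edge at the origin goes to the edge at `corner` in the direction of `axis i`. -/
@[ext] structure FaceMap (m n : ℕ) where
  corner : Fin n → ZMod 2
  axis : Fin m ↪ Fin n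

namespace FaceMap

/-- The identity of `[0,1]^n`. -/
def id (n : ℕ) : FaceMap n n := ⟨0, Function.Embedding.refl _⟩

/-- Composition of face embeddings (first `ψ`, then `φ`). -/
def comp {l m n : ℕ} (φ : FaceMap m n) (ψ : FaceMap l m) : FaceMap l n :=
  ⟨fun j => φ.corner j + Function.extend φ.axis ψ.corner 0 j, ψ.axis.trans φ.axis⟩

/-- The vertex `c` of the cube. -/
def vertex {n : ℕ} (c : Fin n → ZMod 2) : FaceMap 0 n := ⟨c, Function.Embedding.ofIsEmpty⟩

/-- The edge of the cube that starts at the vertex `c` in direction `j`. -/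
def edge {n : ℕ} (c : Fin n → ZMod 2) (j : Fin n) : FaceMap 1 n :=
  ⟨c, ⟨fun _ => j, fun _ _ _ => Subsingleton.elim _ _⟩⟩

/-- The face of codimension one where the first coordinate is `a`. -/
def face {n : ℕ} (a : ZMod 2) : FaceMap n (n + 1) := ⟨Fin.cons a 0, Fin.succEmb n⟩

/-- The product of a face embedding with the identity of an additional first coordinate. -/
def suspend {m n : ℕ} (φ : FaceMap m n) : FaceMap (m + 1) (n + 1) :=
  ⟨Fin.cons 0 φ.corner, ⟨Fin.cons 0 (fun i => (φ.axis i).succ), by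
    intro i j
    refine Fin.cases ?_ (fun i => ?_) i <;> refine Fin.cases ?_ (fun j => ?_) j
    · simp
    · intro h; simp only [Fin.cons_zero, Fin.cons_succ] at h; exact absurd h.symm (Fin.succ_ne_zero _)
    · intro h; simp only [Fin.cons_zero, Fin.cons_succ] at h; exact absurd h (Fin.succ_ne_zero _)
    · intro h
      simp only [Fin.cons_succ, Fin.succ_inj] at h
      rw [φ.axis.injective h]⟩⟩

theorem suspend_comp_face {m n : ℕ} (φ : FaceMap m n) (a : ZMod 2) :
    φ.suspend.comp (face a) = (face a).comp φ := by
  apply FaceMap.ext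
  · funext j
    refine Fin.cases ?_ (fun j => ?_) j
    · have h1 : (Function.extend φ.suspend.axis (Fin.cons a 0 : Fin (m + 1) → ZMod 2) 0) 0 = a :=
        φ.suspend.axis.injective.extend_apply _ _ (0 : Fin (m + 1))
      have h2 : (Function.extend (Fin.succEmb n) φ.corner 0) 0 = 0 := by
        rw [Function.extend_apply']; · rfl
        rintro ⟨i, hi⟩; exact Fin.succ_ne_zero _ hi
      change (0 : ZMod 2) + _ = a + _
      exact (congrArg _ h1).trans (by rw [zero_add]; exact ((congrArg _ h2).trans (add_zero a)).symm)
    · have h2 : (Function.extend (Fin.succEmb n) φ.corner 0) j.succ = φ.corner j :=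
        (Fin.succEmb n).injective.extend_apply _ _ j
      have h1 : (Function.extend φ.suspend.axis (Fin.cons a 0 : Fin (m + 1) → ZMod 2) 0) j.succ
          = 0 := by
        by_cases h : ∃ i, φ.suspend.axis i = j.succ
        · obtain ⟨i, hi⟩ := h
          rw [← hi, φ.suspend.axis.injective.extend_apply]
          revert hi
          refine Fin.cases ?_ (fun i => ?_) i
          · intro hi; exact absurd hi.symm (Fin.succ_ne_zero _)
          · intro _; rfl
        · rw [Function.extend_apply' _ _ _ h]; rfl
      change φ.corner j + _ = 0 + _
      exact (congrArg _ h1).trans (by rw [add_zero, zero_add]; exact h2.symm)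
  · ext i
    rfl

end FaceMap

/-- A (combinatorial) cube complex: `Cube n` is the set of characteristic maps
`[0,1]^n → X` of the `n`-cubes, so that every `n`-cube occurs once for each of the
parametrizations obtained by the symmetries of `[0,1]^n`, and `restr φ` is the restriction along
a face embedding or a symmetry `φ`. The symmetries are not required to act freely on the
parametrizations (they do so on the complexes below); this makes all collapses cube complexes. -/
structure CubeComplex where
  Cube : ℕ → Type u
  restr : ∀ {m n : ℕ}, FaceMap m n → Cube n → Cube m
  restr_id : ∀ {n : ℕ} (C : Cube n), restr (FaceMap.id n) C = C
  restr_comp : ∀ {l m n : ℕ} (φ : FaceMap m n) (ψ : FaceMap l m) (C : Cube n),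
    restr ψ (restr φ C) = restr (φ.comp ψ) C

namespace CubeComplex

/-- Vertices. -/
abbrev Vertex (X : CubeComplex.{u}) : Type u := X.Cube 0

/-- Oriented edges. -/
abbrev Edge (X : CubeComplex.{u}) : Type u := X.Cube 1

/-- The initial vertex. -/
def src (X : CubeComplex.{u}) (e : X.Edge) : X.Vertex := X.restr (FaceMap.vertex 0) e

/-- The terminal vertex. -/
def tgt (X : CubeComplex.{u}) (e : X.Edge) : X.Vertex := X.restr (FaceMap.vertex 1) e

/-- The same edge with the opposite orientation. -/
def rev (X : CubeComplex.{u}) (e : X.Edge) : X.Edge := X.restr (FaceMap.edge 1 0) e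

/-- Isomorphisms of cube complexes. -/
structure Iso (X Y : CubeComplex.{u}) where
  equiv : ∀ n, X.Cube n ≃ Y.Cube n
  comm : ∀ {m n : ℕ} (φ : FaceMap m n) (C : X.Cube n),
    equiv m (X.restr φ C) = Y.restr φ (equiv n C)

/-- Two oriented edges are parallel in a cube (this includes an edge and its reverse). -/
inductive Parallel (X : CubeComplex.{u}) : X.Edge → X.Edge → Prop
  | mk {n : ℕ} (C : X.Cube n) (c d : Fin n → ZMod 2) (j : Fin n) :
      Parallel X (X.restr (FaceMap.edge c j) C) (X.restr (FaceMap.edge d j) C)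

/-- Hyperplanes: classes of edges for the equivalence relation generated by being parallel in a
cube. -/
def Hyperplane (X : CubeComplex.{u}) : Type u := Quot X.Parallel

/-- The hyperplane dual to an edge. -/
def hyp (X : CubeComplex.{u}) (e : X.Edge) : X.Hyperplane := Quot.mk _ e

theorem hyp_eq (X : CubeComplex.{u}) {n : ℕ} (C : X.Cube n) (c d : Fin n → ZMod 2) (j : Fin n) :
    X.hyp (X.restr (FaceMap.edge c j) C) = X.hyp (X.restr (FaceMap.edge d j) C) :=
  Quot.sound (Parallel.mk C c d j)

theorem faceMap_one_eq {n : ℕ} (φ : FaceMap 1 n) : φ = FaceMap.edge φ.corner (φ.axis 0) := by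
  apply FaceMap.ext
  · rfl
  · ext i
    rw [Subsingleton.elim i 0]
    rfl

theorem edge_zero (X : CubeComplex.{u}) (e : X.Edge) : X.restr (FaceMap.edge 0 0) e = e := by
  conv_rhs => rw [← X.restr_id e]
  rw [faceMap_one_eq (FaceMap.id 1)]; rfl

theorem hyp_rev (X : CubeComplex.{u}) (e : X.Edge) : X.hyp (X.rev e) = X.hyp e := by
  conv_rhs => rw [← X.edge_zero e]
  exact X.hyp_eq e 1 0 0

/-! #### Homotopy classes of edge paths -/

/-- `l` is an edge path from `x` to `y`. -/
def IsPath (X : CubeComplex.{u}) : X.Vertex → List X.Edge → X.Vertex → Prop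
  | x, [], y => x = y
  | x, e :: l, y => X.src e = x ∧ IsPath X (X.tgt e) l y

theorem isPath_append (X : CubeComplex.{u}) {x y z : X.Vertex} {l l' : List X.Edge}
    (h : X.IsPath x l y) (h' : X.IsPath y l' z) : X.IsPath x (l ++ l') z := by
  induction l generalizing x with
  | nil => cases h; exact h'
  | cons e l ih => exact ⟨h.1, ih h.2⟩

theorem isPath_append_iff (X : CubeComplex.{u}) {x z : X.Vertex} {l l' : List X.Edge} :
    X.IsPath x (l ++ l') z ↔ ∃ y, X.IsPath x l y ∧ X.IsPath y l' z := by
  constructor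
  · intro h
    induction l generalizing x with
    | nil => exact ⟨x, rfl, h⟩
    | cons e l ih =>
      obtain ⟨y, h1, h2⟩ := ih h.2
      exact ⟨y, ⟨h.1, h1⟩, h2⟩
  · rintro ⟨y, h1, h2⟩
    exact X.isPath_append h1 h2

/-- The edge path along the first, then the second direction of a square. -/
def sqFst (X : CubeComplex.{u}) (s : X.Cube 2) : List X.Edge :=
  [X.restr (FaceMap.edge 0 0) s, X.restr (FaceMap.edge ![1, 0] 1) s]

/-- The edge path along the second, then the first direction of a square. -/
def sqSnd (X : CubeComplex.{u}) (s : X.Cube 2) : List X.Edge :=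
  [X.restr (FaceMap.edge 0 1) s, X.restr (FaceMap.edge ![0, 1] 0) s]

/-- Elementary homotopies of edge paths: deletion of a backtracking, and pushing across a
square. -/
inductive Step (X : CubeComplex.{u}) : List X.Edge → List X.Edge → Prop
  | back (l l' : List X.Edge) (e : X.Edge) : Step X (l ++ ([e, X.rev e] ++ l')) (l ++ l')
  | square (l l' : List X.Edge) (s : X.Cube 2) :
      Step X (l ++ (X.sqFst s ++ l')) (l ++ (X.sqSnd s ++ l'))

/-- Edge paths from `x` to `y`. -/
def Path (X : CubeComplex.{u}) (x y : X.Vertex) : Type u := {l : List X.Edge // X.IsPath x l y}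

/-- Homotopy classes of edge paths from `x` to `y`, relative to the end points. -/
def PathClass (X : CubeComplex.{u}) (x y : X.Vertex) : Type u :=
  Quot (fun p q : X.Path x y => X.Step p.1 q.1)

/-- The class of an edge path. -/
def cls (X : CubeComplex.{u}) {x y : X.Vertex} (l : List X.Edge) (h : X.IsPath x l y) :
    X.PathClass x y := Quot.mk _ ⟨l, h⟩

/-- Concatenation of path classes. -/
def PathClass.comp {X : CubeComplex.{u}} {x y z : X.Vertex} (p : X.PathClass x y)
    (q : X.PathClass y z) : X.PathClass x z :=
  Quot.map₂ (fun a b => (⟨a.1 ++ b.1, X.isPath_append a.2 b.2⟩ : X.Path x z))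
    (by
      rintro ⟨a, ha⟩ ⟨b, hb⟩ ⟨c, hc⟩ h
      dsimp only at h ⊢
      cases h with
      | back l l' e =>
        have := Step.back (X := X) (a ++ l) l' e
        simpa only [List.append_assoc] using this
      | square l l' s =>
        have := Step.square (X := X) (a ++ l) l' s
        simpa only [List.append_assoc] using this)
    (by
      rintro ⟨a, ha⟩ ⟨b, hb⟩ ⟨c, hc⟩ h
      dsimp only at h ⊢
      cases h with
      | back l l' e =>
        have := Step.back (X := X) l (l' ++ c) e
        simpa only [List.append_assoc] using this
      | square l l' s =>
        have := Step.square (X := X) l (l' ++ c) s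
        simpa only [List.append_assoc] using this)
    p q

/-- The fundamental groupoid of a cube complex: objects are the vertices, morphisms the homotopy
classes of edge paths, and `p ≫ q` is first `p`, then `q`. -/
def Grpd (X : CubeComplex.{u}) : Type u := X.Vertex

instance grpdCategory (X : CubeComplex.{u}) : Category.{u} X.Grpd where
  Hom x y := X.PathClass x y
  id _ := X.cls [] rfl
  comp p q := PathClass.comp p q
  id_comp := by
    rintro x y ⟨p⟩
    rfl
  comp_id := by
    rintro x y ⟨p, hp⟩
    exact congrArg (Quot.mk _) (Subtype.ext (List.append_nil p))
  assoc := by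
    rintro w x y z ⟨p, hp⟩ ⟨q, hq⟩ ⟨r, hr⟩
    exact congrArg (Quot.mk _) (Subtype.ext (List.append_assoc p q r))

/-- The lists `l` and `l'` are homotopic edge paths from `x` to `y`. -/
def Homotopic (X : CubeComplex.{u}) (x y : X.Vertex) (l l' : List X.Edge) : Prop :=
  ∃ (h : X.IsPath x l y) (h' : X.IsPath x l' y), X.cls l h = X.cls l' h'

theorem Homotopic.context {X : CubeComplex.{u}} {w x y z : X.Vertex} {l l' a b : List X.Edge}
    (h : X.Homotopic x y l l') (ha : X.IsPath w a x) (hb : X.IsPath y b z) :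
    X.Homotopic w z (a ++ (l ++ b)) (a ++ (l' ++ b)) := by
  obtain ⟨h1, h2, h3⟩ := h
  refine ⟨X.isPath_append ha (X.isPath_append h1 hb), X.isPath_append ha (X.isPath_append h2 hb),
    ?_⟩
  exact congrArg (fun t => (X.cls a ha).comp (PathClass.comp t (X.cls b hb))) h3

theorem homotopic_refl (X : CubeComplex.{u}) {x y : X.Vertex} {l : List X.Edge}
    (h : X.IsPath x l y) : X.Homotopic x y l l := ⟨h, h, rfl⟩

/-- A cellular map `X → Y` on the level of edge paths: an edge goes to an edge path, and
backtrackings and boundaries of squares go to null-homotopic loops. -/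
structure CellMap (X Y : CubeComplex.{u}) where
  onV : X.Vertex → Y.Vertex
  onE : X.Edge → List Y.Edge
  isPath : ∀ e, Y.IsPath (onV (X.src e)) (onE e) (onV (X.tgt e))
  back : ∀ e, Y.Homotopic (onV (X.src e)) (onV (X.src e)) (onE e ++ onE (X.rev e)) []
  square : ∀ s : X.Cube 2, Y.Homotopic (onV (X.restr (FaceMap.vertex 0) s))
    (onV (X.restr (FaceMap.vertex 1) s)) ((X.sqFst s).flatMap onE) ((X.sqSnd s).flatMap onE)

theorem CellMap.isPath_flatMap {X Y : CubeComplex.{u}} (F : CellMap X Y) {x y : X.Vertex}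
    {l : List X.Edge} (h : X.IsPath x l y) :
    Y.IsPath (F.onV x) (l.flatMap F.onE) (F.onV y) := by
  induction l generalizing x with
  | nil => cases h; rfl
  | cons e l ih =>
    rw [List.flatMap_cons, ← h.1]
    exact Y.isPath_append (F.isPath e) (ih h.2)

theorem src_edge (X : CubeComplex.{u}) {n : ℕ} (c : Fin n → ZMod 2) (j : Fin n) (C : X.Cube n) :
    X.src (X.restr (FaceMap.edge c j) C) = X.restr (FaceMap.vertex c) C := by
  unfold src
  rw [X.restr_comp]
  congr 1
  apply FaceMap.ext
  · funext i
    change c i + Function.extend (FaceMap.edge c j).axis (0 : Fin 1 → ZMod 2) 0 i = c i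
    by_cases h : ∃ k, (FaceMap.edge c j).axis k = i
    · obtain ⟨k, rfl⟩ := h
      rw [(FaceMap.edge c j).axis.injective.extend_apply]
      exact add_zero _
    · rw [Function.extend_apply' _ _ _ h]
      exact add_zero _
  · ext i; exact i.elim0

theorem tgt_edge (X : CubeComplex.{u}) {n : ℕ} (c : Fin n → ZMod 2) (j : Fin n) (C : X.Cube n) :
    X.tgt (X.restr (FaceMap.edge c j) C) =
      X.restr (FaceMap.vertex (Function.update c j (c j + 1))) C := by
  unfold tgt
  rw [X.restr_comp]
  congr 1
  apply FaceMap.ext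
  · funext i
    change c i + Function.extend (FaceMap.edge c j).axis (1 : Fin 1 → ZMod 2) 0 i =
      Function.update c j (c j + 1) i
    by_cases h : ∃ k, (FaceMap.edge c j).axis k = i
    · obtain ⟨k, rfl⟩ := h
      rw [(FaceMap.edge c j).axis.injective.extend_apply]
      change c j + 1 = Function.update c j (c j + 1) j
      rw [Function.update_self]
    · rw [Function.extend_apply' _ _ _ h, Function.update_of_ne]
      · exact add_zero _
      · rintro rfl; exact h ⟨0, rfl⟩
  · ext i; exact i.elim0

theorem src_rev (X : CubeComplex.{u}) (e : X.Edge) : X.src (X.rev e) = X.tgt e :=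
  X.src_edge 1 0 e

theorem tgt_rev (X : CubeComplex.{u}) (e : X.Edge) : X.tgt (X.rev e) = X.src e := by
  refine (X.tgt_edge 1 0 e).trans ?_
  unfold src
  congr 2
  funext i
  rw [Subsingleton.elim i 0]
  simp only [Function.update_self]
  decide

theorem isPath_sqFst (X : CubeComplex.{u}) (s : X.Cube 2) :
    X.IsPath (X.restr (FaceMap.vertex 0) s) (X.sqFst s) (X.restr (FaceMap.vertex 1) s) := by
  refine ⟨X.src_edge _ _ _, ?_, ?_⟩
  · rw [X.src_edge, X.tgt_edge]
    congr 2; decide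
  · change X.tgt _ = _
    rw [X.tgt_edge]
    congr 2; decide

theorem isPath_sqSnd (X : CubeComplex.{u}) (s : X.Cube 2) :
    X.IsPath (X.restr (FaceMap.vertex 0) s) (X.sqSnd s) (X.restr (FaceMap.vertex 1) s) := by
  refine ⟨X.src_edge _ _ _, ?_, ?_⟩
  · rw [X.src_edge, X.tgt_edge]
    congr 2; decide
  · change X.tgt _ = _
    rw [X.tgt_edge]
    congr 2; decide

theorem IsPath.unique {X : CubeComplex.{u}} {x y z : X.Vertex} {l : List X.Edge}
    (h : X.IsPath x l y) (h' : X.IsPath x l z) : y = z := by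
  induction l generalizing x with
  | nil => cases h; exact h'
  | cons e l ih => exact ih h.2 h'.2

theorem homotopic_square (X : CubeComplex.{u}) (s : X.Cube 2) :
    X.Homotopic (X.restr (FaceMap.vertex 0) s) (X.restr (FaceMap.vertex 1) s)
      (X.sqFst s) (X.sqSnd s) :=
  ⟨X.isPath_sqFst s, X.isPath_sqSnd s, Quot.sound (by
    have := Step.square (X := X) [] [] s
    simpa using this)⟩

theorem isPath_edge (X : CubeComplex.{u}) (e : X.Edge) : X.IsPath (X.src e) [e] (X.tgt e) :=
  ⟨rfl, rfl⟩

theorem homotopic_back (X : CubeComplex.{u}) (e : X.Edge) :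
    X.Homotopic (X.src e) (X.src e) [e, X.rev e] [] :=
  ⟨⟨rfl, X.src_rev e, X.tgt_rev e⟩, rfl, Quot.sound (by
    have := Step.back (X := X) [] [] e
    simpa using this)⟩

/-- The functor induced by a cellular map on fundamental groupoids. -/
def CellMap.functor {X Y : CubeComplex.{u}} (F : CellMap X Y) : X.Grpd ⥤ Y.Grpd where
  obj x := F.onV x
  map {x y} p := Quot.lift
    (fun p : X.Path x y => Y.cls (p.1.flatMap F.onE) (F.isPath_flatMap p.2))
    (by
      rintro ⟨a, ha⟩ ⟨b, hb⟩ h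
      dsimp only at h ⊢
      suffices H : Y.Homotopic (F.onV x) (F.onV y) (a.flatMap F.onE) (b.flatMap F.onE) by
        obtain ⟨_, _, h3⟩ := H
        exact h3
      cases h with
      | back l l' e =>
        obtain ⟨z, h1, h2, h3, h4⟩ := X.isPath_append_iff.1 ha
        rw [X.tgt_rev] at h4
        subst h2
        simp only [List.flatMap_append]
        have := (F.back e).context (F.isPath_flatMap h1) (F.isPath_flatMap h4)
        simpa using this
      | square l l' s =>
        obtain ⟨z, h1, h2⟩ := X.isPath_append_iff.1 ha
        obtain ⟨w, h2, h3⟩ := X.isPath_append_iff.1 h2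
        simp only [List.flatMap_append]
        have hz : z = X.restr (FaceMap.vertex 0) s := h2.1.symm.trans (X.src_edge _ _ _)
        subst hz
        have hw : w = X.restr (FaceMap.vertex 1) s := h2.unique (X.isPath_sqFst s)
        subst hw
        exact (F.square s).context (F.isPath_flatMap h1) (F.isPath_flatMap h3))
    p
  map_id _ := rfl
  map_comp := by
    rintro x y z ⟨p, hp⟩ ⟨q, hq⟩
    exact congrArg (Quot.mk _) (Subtype.ext List.flatMap_append)

/-! #### Collapsing along hyperplanes -/

/-- No edge of the cube `C` is dual to a hyperplane in `H`. -/
def Avoids (X : CubeComplex.{u}) (H : Set X.Hyperplane) {n : ℕ} (C : X.Cube n) : Prop :=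
  ∀ φ : FaceMap 1 n, X.hyp (X.restr φ C) ∉ H

/-- `C` and `C'` are opposite faces of a cube whose edges joining them are dual to a hyperplane
in `H`. -/
def Opposite (X : CubeComplex.{u}) (H : Set X.Hyperplane) {n : ℕ}
    (C C' : {C : X.Cube n // X.Avoids H C}) : Prop :=
  ∃ D : X.Cube (n + 1), (∀ c, X.hyp (X.restr (FaceMap.edge c 0) D) ∈ H) ∧
    X.restr (FaceMap.face 0) D = C.1 ∧ X.restr (FaceMap.face 1) D = C'.1

/-- The collapse `X_H`: every cube is collapsed to the intersection of its midplanes lying in the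
hyperplanes in `H`. Thus a cube of `X_H` is represented by a cube of `X` with no edge dual to `H`,
and opposite faces of a cube across a midplane in `H` are identified. -/
def collapse (X : CubeComplex.{u}) (H : Set X.Hyperplane) : CubeComplex.{u} where
  Cube n := Quot (X.Opposite H (n := n))
  restr {m n} φ := Quot.map
    (fun C => ⟨X.restr φ C.1, fun ψ => by rw [X.restr_comp]; exact C.2 _⟩)
    (by
      rintro ⟨C, hC⟩ ⟨C', hC'⟩ ⟨D, hD, h0, h1⟩
      dsimp only at h0 h1
      refine ⟨X.restr φ.suspend D, fun c => ?_, ?_, ?_⟩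
      · rw [X.restr_comp, faceMap_one_eq (FaceMap.comp _ _)]
        exact hD _
      · dsimp only
        rw [X.restr_comp, FaceMap.suspend_comp_face, ← X.restr_comp, h0]
      · dsimp only
        rw [X.restr_comp, FaceMap.suspend_comp_face, ← X.restr_comp, h1])
  restr_id := by
    rintro n ⟨C⟩
    exact congrArg (Quot.mk _) (Subtype.ext (X.restr_id _))
  restr_comp := by
    rintro l m n φ ψ ⟨C⟩
    exact congrArg (Quot.mk _) (Subtype.ext (X.restr_comp _ _ _))

theorem avoids_vertex (X : CubeComplex.{u}) (H : Set X.Hyperplane) (x : X.Vertex) :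
    X.Avoids H x := fun φ => (φ.axis 0).elim0

/-- The image of a vertex in the collapse. -/
def collapseVertex (X : CubeComplex.{u}) (H : Set X.Hyperplane) (x : X.Vertex) :
    (X.collapse H).Vertex := Quot.mk _ ⟨x, X.avoids_vertex H x⟩

theorem avoids_edge (X : CubeComplex.{u}) (H : Set X.Hyperplane) (e : X.Edge)
    (h : X.hyp e ∉ H) : X.Avoids H e := by
  intro φ
  rw [faceMap_one_eq φ, Subsingleton.elim (φ.axis 0) 0, X.hyp_eq e _ 0 0]
  rwa [X.edge_zero]

open Classical in
/-- The image of an edge in the collapse: a trivial path if the edge is dual to a hyperplane in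
`H`, and an edge otherwise. -/
def collapseEdge (X : CubeComplex.{u}) (H : Set X.Hyperplane) (e : X.Edge) :
    List (X.collapse H).Edge :=
  if h : X.hyp e ∈ H then [] else [Quot.mk _ ⟨e, X.avoids_edge H e h⟩]

theorem collapseVertex_eq (X : CubeComplex.{u}) (H : Set X.Hyperplane) (e : X.Edge)
    (h : X.hyp e ∈ H) : X.collapseVertex H (X.src e) = X.collapseVertex H (X.tgt e) := by
  refine Quot.sound ⟨e, fun c => ?_, ?_, ?_⟩
  · rw [X.hyp_eq e _ 0 0]
    rwa [X.edge_zero]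
  · change X.restr _ e = X.restr _ e
    congr 1
    apply FaceMap.ext
    · funext j; rw [Fin.subsingleton_one.elim j 0]; rfl
    · ext i; exact i.elim0
  · change X.restr _ e = X.restr _ e
    congr 1
    apply FaceMap.ext
    · funext j; rw [Fin.subsingleton_one.elim j 0]; rfl
    · ext i; exact i.elim0

theorem isPath_collapseEdge (X : CubeComplex.{u}) (H : Set X.Hyperplane) (e : X.Edge) :
    (X.collapse H).IsPath (X.collapseVertex H (X.src e)) (X.collapseEdge H e)
      (X.collapseVertex H (X.tgt e)) := by
  unfold collapseEdge
  split_ifs with h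
  · exact X.collapseVertex_eq H e h
  · exact ⟨rfl, rfl⟩

theorem collapseEdge_face (X : CubeComplex.{u}) (H : Set X.Hyperplane) (D : X.Cube 2)
    (h : X.hyp (X.restr (FaceMap.edge 0 0) D) ∈ H) :
    X.collapseEdge H (X.restr (FaceMap.edge 0 1) D) =
      X.collapseEdge H (X.restr (FaceMap.edge ![1, 0] 1) D) := by
  have h1 := X.hyp_eq D 0 ![1, 0] 1
  unfold collapseEdge
  by_cases h2 : X.hyp (X.restr (FaceMap.edge 0 1) D) ∈ H
  · rw [dif_pos h2, dif_pos (h1 ▸ h2)]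
  · rw [dif_neg h2, dif_neg (h1 ▸ h2)]
    congr 1
    refine Quot.sound ⟨D, fun c => by rwa [X.hyp_eq D c 0 0], ?_, ?_⟩
    · change X.restr _ D = X.restr _ D
      congr 1
      apply FaceMap.ext
      · funext j; fin_cases j <;> rfl
      · ext i; rw [Subsingleton.elim i 0]; rfl
    · change X.restr _ D = X.restr _ D
      congr 1
      apply FaceMap.ext
      · funext j; fin_cases j <;> rfl
      · ext i; rw [Subsingleton.elim i 0]; rfl

/-- The exchange of the two coordinates of a square. -/
def _root_.OutSpace.FaceMap.swap : FaceMap 2 2 := ⟨0, (Equiv.swap 0 1).toEmbedding⟩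

theorem restr_swap_edge (X : CubeComplex.{u}) (D : X.Cube 2) (a b : ZMod 2) (j : Fin 2) :
    X.restr (FaceMap.edge ![a, b] j) (X.restr FaceMap.swap D) =
      X.restr (FaceMap.edge ![b, a] (Equiv.swap 0 1 j)) D := by
  rw [X.restr_comp]
  congr 1
  apply FaceMap.ext
  · funext i
    have h : ∀ k, Function.extend FaceMap.swap.axis (![a, b] : Fin 2 → ZMod 2) 0
        (FaceMap.swap.axis k) = (![a, b] : Fin 2 → ZMod 2) k :=
      fun k => FaceMap.swap.axis.injective.extend_apply _ _ k
    change (0 : ZMod 2) + Function.extend FaceMap.swap.axis (![a, b] : Fin 2 → ZMod 2) 0 i =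
      (![b, a] : Fin 2 → ZMod 2) i
    rw [zero_add]
    fin_cases i
    · exact h 1
    · exact h 0
  · rfl

theorem collapseEdge_face' (X : CubeComplex.{u}) (H : Set X.Hyperplane) (D : X.Cube 2)
    (h : X.hyp (X.restr (FaceMap.edge 0 1) D) ∈ H) :
    X.collapseEdge H (X.restr (FaceMap.edge 0 0) D) =
      X.collapseEdge H (X.restr (FaceMap.edge ![0, 1] 0) D) := by
  have h0 : (![0, 0] : Fin 2 → ZMod 2) = 0 := by decide
  have e0 := X.restr_swap_edge D 0 0 0
  have e1 := X.restr_swap_edge D 0 0 1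
  have e2 := X.restr_swap_edge D 1 0 1
  rw [h0] at e0 e1
  rw [Equiv.swap_apply_left] at e0
  rw [Equiv.swap_apply_right] at e1 e2
  have := X.collapseEdge_face H (X.restr FaceMap.swap D) (by rw [e0]; exact h)
  rwa [e1, e2] at this

/-- The collapsing map `X → X_H`. -/
def collapseMap (X : CubeComplex.{u}) (H : Set X.Hyperplane) : CellMap X (X.collapse H) where
  onV := X.collapseVertex H
  onE := X.collapseEdge H
  isPath := X.isPath_collapseEdge H
  back e := by
    by_cases h : X.hyp e ∈ H
    · have h' : X.hyp (X.rev e) ∈ H := by rwa [X.hyp_rev]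
      have h1 : X.collapseEdge H e = [] := dif_pos h
      have h2 : X.collapseEdge H (X.rev e) = [] := dif_pos h'
      rw [h1, h2]
      exact homotopic_refl _ rfl
    · have h' : X.hyp (X.rev e) ∉ H := by rwa [X.hyp_rev]
      have h1 : X.collapseEdge H e = [Quot.mk _ ⟨e, X.avoids_edge H e h⟩] := dif_neg h
      have h2 : X.collapseEdge H (X.rev e) = [Quot.mk _ ⟨X.rev e, X.avoids_edge H _ h'⟩] :=
        dif_neg h'
      rw [h1, h2]
      exact (X.collapse H).homotopic_back (Quot.mk _ ⟨e, X.avoids_edge H e h⟩)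
  square s := by
    have pf : (X.collapse H).IsPath (X.collapseVertex H (X.restr (FaceMap.vertex 0) s))
        ((X.sqFst s).flatMap (X.collapseEdge H))
        (X.collapseVertex H (X.restr (FaceMap.vertex 1) s)) := by
      have h := X.isPath_sqFst s
      have e1 := X.isPath_collapseEdge H (X.restr (FaceMap.edge 0 0) s)
      have e2 := X.isPath_collapseEdge H (X.restr (FaceMap.edge ![1, 0] 1) s)
      rw [h.1] at e1
      rw [h.2.1, show X.tgt (X.restr (FaceMap.edge ![1, 0] 1) s) = _ from h.2.2] at e2
      simpa [sqFst] using (X.collapse H).isPath_append e1 e2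
    by_cases h0 : X.hyp (X.restr (FaceMap.edge 0 0) s) ∈ H
    · have k := X.collapseEdge_face H s h0
      have h0' : X.hyp (X.restr (FaceMap.edge ![0, 1] 0) s) ∈ H := by rwa [X.hyp_eq s _ 0 0]
      have h1 : X.collapseEdge H (X.restr (FaceMap.edge 0 0) s) = [] := dif_pos h0
      have h2 : X.collapseEdge H (X.restr (FaceMap.edge ![0, 1] 0) s) = [] := dif_pos h0'
      have : (X.sqFst s).flatMap (X.collapseEdge H) = (X.sqSnd s).flatMap (X.collapseEdge H) := by
        simp [sqFst, sqSnd, h1, h2, k]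
      rw [← this]
      exact homotopic_refl _ pf
    by_cases h1 : X.hyp (X.restr (FaceMap.edge 0 1) s) ∈ H
    · have k := X.collapseEdge_face' H s h1
      have h1' : X.hyp (X.restr (FaceMap.edge ![1, 0] 1) s) ∈ H := by rwa [X.hyp_eq s _ 0 1]
      have g1 : X.collapseEdge H (X.restr (FaceMap.edge 0 1) s) = [] := dif_pos h1
      have g2 : X.collapseEdge H (X.restr (FaceMap.edge ![1, 0] 1) s) = [] := dif_pos h1'
      have : (X.sqFst s).flatMap (X.collapseEdge H) = (X.sqSnd s).flatMap (X.collapseEdge H) := by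
        simp [sqFst, sqSnd, g1, g2, k]
      rw [← this]
      exact homotopic_refl _ pf
    · have hs : X.Avoids H s := by
        intro φ
        rw [faceMap_one_eq φ, X.hyp_eq s _ 0]
        generalize φ.axis 0 = j
        fin_cases j
        · exact h0
        · exact h1
      have hA : ∀ c j, X.collapseEdge H (X.restr (FaceMap.edge c j) s) =
          [(X.collapse H).restr (FaceMap.edge c j) (Quot.mk _ ⟨s, hs⟩)] :=
        fun c j => dif_neg (hs _)
      have := (X.collapse H).homotopic_square (Quot.mk _ ⟨s, hs⟩)
      simp only [sqFst, sqSnd] at this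
      simp only [sqFst, sqSnd, List.flatMap_cons, List.flatMap_nil, hA, List.append_nil,
        List.cons_append, List.nil_append]
      exact this

/-- The collapsing map on fundamental groupoids. -/
def collapseFunctor (X : CubeComplex.{u}) (H : Set X.Hyperplane) :
    X.Grpd ⥤ (X.collapse H).Grpd := (X.collapseMap H).functor

theorem Iso.onPath {X Y : CubeComplex.{u}} (h : X.Iso Y) (e : X.Edge) :
    Y.src (h.equiv 1 e) = h.equiv 0 (X.src e) ∧ Y.tgt (h.equiv 1 e) = h.equiv 0 (X.tgt e) :=
  ⟨(h.comm _ _).symm, (h.comm _ _).symm⟩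

/-- An isomorphism as a cellular map. -/
def Iso.cellMap {X Y : CubeComplex.{u}} (h : X.Iso Y) : CellMap X Y where
  onV := h.equiv 0
  onE e := [h.equiv 1 e]
  isPath e := ⟨(h.onPath e).1, (h.onPath e).2⟩
  back e := by
    have := Y.homotopic_back (h.equiv 1 e)
    rw [(h.onPath e).1] at this
    rw [rev, h.comm]
    exact this
  square s := by
    have := Y.homotopic_square (h.equiv 2 s)
    rw [h.comm, h.comm]
    simp only [sqFst, sqSnd, ← h.comm] at this
    simpa [sqFst, sqSnd, h.comm] using this

/-- The functor on fundamental groupoids induced by an isomorphism. -/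
def Iso.functor {X Y : CubeComplex.{u}} (h : X.Iso Y) : X.Grpd ⥤ Y.Grpd := h.cellMap.functor

end CubeComplex

/-! ### Salvetti complexes and their blow-ups -/

/-- The letter `x` or its inverse. -/
def Letter.twist {V : Type u} (a : ZMod 2) (x : Letter V) : Letter V :=
  if a = 0 then x else x.inv

theorem Letter.inv_inv {V : Type u} (x : Letter V) : x.inv.inv = x := by
  simp [Letter.inv]

theorem Letter.twist_twist {V : Type u} (a b : ZMod 2) (x : Letter V) :
    (x.twist a).twist b = x.twist (a + b) := by
  have key : ∀ a : ZMod 2, a = 0 ∨ a = 1 := by decide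
  rcases key a with rfl | rfl <;> rcases key b with rfl | rfl <;>
    simp [Letter.twist, Letter.inv_inv, show (1 : ZMod 2) + 1 = 0 from by decide]

theorem Letter.twist_fst {V : Type u} (a : ZMod 2) (x : Letter V) : (x.twist a).1 = x.1 := by
  unfold Letter.twist; split_ifs <;> rfl

/-- The Salvetti complex `𝕊`: it has one vertex, and a parametrized `n`-cube is given by the `n`
oriented edges at its origin, which are labelled by letters with pairwise commuting, distinct
underlying vertices. -/
def salvetti {V : Type u} (Γ : SimpleGraph V) : CubeComplex.{u} where
  Cube n := {ℓ : Fin n → Letter V // ∀ i j, i ≠ j → Γ.Adj (ℓ i).1 (ℓ j).1}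
  restr φ ℓ := ⟨fun i => (ℓ.1 (φ.axis i)).twist (φ.corner (φ.axis i)), fun i j h => by
    rw [Letter.twist_fst, Letter.twist_fst]
    exact ℓ.2 _ _ (φ.axis.injective.ne h)⟩
  restr_id := by
    rintro n ⟨ℓ, hℓ⟩
    rfl
  restr_comp := by
    rintro l m n φ ψ ⟨ℓ, hℓ⟩
    apply Subtype.ext
    funext i
    change ((ℓ _).twist _).twist _ = (ℓ (φ.axis (ψ.axis i))).twist (φ.corner (φ.axis (ψ.axis i)) +
      Function.extend φ.axis ψ.corner 0 (φ.axis (ψ.axis i)))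
    rw [Letter.twist_twist, φ.axis.injective.extend_apply]

section Blowup

variable {V : Type u} {Γ : SimpleGraph V} {ι : Type}

/-- A region: a choice of a side of every partition (`0` for `P`, `1` for `P^*`), such that the
chosen sides of any two non-commuting partitions intersect. -/
def IsRegion (P : ι → WhiteheadPartition Γ) (x : ι → ZMod 2) : Prop :=
  ∀ i j, i ≠ j → (P i).Commute (P j) ∨ ((P i).sideAt (x i) ∩ (P j).sideAt (x j)).Nonempty

/-- The subset `I(R)` of `V^±` belonging to a region. -/
def regionSet (P : ι → WhiteheadPartition Γ) (x : ι → ZMod 2) : Set (Letter V) :=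
  {v | ∀ i, v ∈ (P i).sideAt (x i) ∨ v.1 ∈ (P i).link}

/-- The labels of oriented edges of the blow-up: `inl v` is the label of an edge `e_v` that is
traversed positively or negatively according to the sign of the letter, `inr i` is the label of an
edge `e_{𝐏_i}`, in any direction. -/
abbrev BLabel (V : Type u) (ι : Type) : Type u := Letter V ⊕ ι

/-- The label of the same edge, possibly with the opposite orientation. -/
def BLabel.twist (a : ZMod 2) : BLabel V ι → BLabel V ι
  | Sum.inl v => Sum.inl (v.twist a)
  | Sum.inr i => Sum.inr i

theorem BLabel.twist_twist (a b : ZMod 2) (y : BLabel V ι) :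
    BLabel.twist b (BLabel.twist a y) = BLabel.twist (a + b) y := by
  cases y with
  | inl v => exact congrArg Sum.inl (v.twist_twist a b)
  | inr i => rfl

theorem BLabel.twist_zero (y : BLabel V ι) : BLabel.twist 0 y = y := by
  cases y <;> rfl

/-- Commuting labels. -/
def CommutingLabels (P : ι → WhiteheadPartition Γ) : BLabel V ι → BLabel V ι → Prop
  | Sum.inl v, Sum.inl w => Γ.Adj v.1 w.1
  | Sum.inl v, Sum.inr i => v.1 ∈ (P i).link
  | Sum.inr i, Sum.inl v => v.1 ∈ (P i).link
  | Sum.inr i, Sum.inr j => i ≠ j ∧ (P i).Commute (P j)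

theorem commutingLabels_twist (P : ι → WhiteheadPartition Γ) (a b : ZMod 2) (y z : BLabel V ι) :
    CommutingLabels P (BLabel.twist a y) (BLabel.twist b z) ↔ CommutingLabels P y z := by
  cases y <;> cases z <;> simp [CommutingLabels, BLabel.twist, Letter.twist_fst]

open Classical in
/-- The partitions whose side is switched along an edge with the given label, as a vector in
`{0,1}^ι`. -/
def switch (P : ι → WhiteheadPartition Γ) : BLabel V ι → ι → ZMod 2
  | Sum.inl v => fun i => if v.1 ∈ (P i).single then 1 else 0
  | Sum.inr j => fun i => if i = j then 1 else 0

theorem switch_twist (P : ι → WhiteheadPartition Γ) (a : ZMod 2) (y : BLabel V ι) :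
    switch P (BLabel.twist a y) = switch P y := by
  have key : ∀ a : ZMod 2, a = 0 ∨ a = 1 := by decide
  cases y <;> rcases key a with rfl | rfl <;> rfl

/-- Whether an oriented edge with label `y` can start at the region `x`: an edge `e_v` is oriented
from the region containing `v⁻¹` to the region containing `v`. An edge `e_{𝐏_i}` only requires
both of its ends to be regions. -/
def Departs (P : ι → WhiteheadPartition Γ) (x : ι → ZMod 2) : BLabel V ι → Prop
  | Sum.inl v => v.inv ∈ regionSet P x
  | Sum.inr _ => True

/-- The vertex `c` of the cube with origin `x` and edge labels `ℓ`. -/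
def cubeVertex (P : ι → WhiteheadPartition Γ) {n : ℕ} (x : ι → ZMod 2) (ℓ : Fin n → BLabel V ι)
    (c : Fin n → ZMod 2) : ι → ZMod 2 := x + ∑ j, c j • switch P (ℓ j)

/-- A parametrized `n`-cube of the blow-up: its origin and the labels of the `n` oriented edges
at the origin. The labels commute pairwise, all vertices of the cube are regions, and all edges of
the cube are present. -/
@[ext] structure BlowupCube (P : ι → WhiteheadPartition Γ) (n : ℕ) where
  origin : ι → ZMod 2
  label : Fin n → BLabel V ι
  commuting : ∀ i j, i ≠ j → CommutingLabels P (label i) (label j)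
  region : ∀ c : Fin n → ZMod 2, IsRegion P (cubeVertex P origin label c)
  departs : ∀ (c : Fin n → ZMod 2) (j : Fin n),
    Departs P (cubeVertex P origin label c) (BLabel.twist (c j) (label j))

theorem cubeVertex_restr (P : ι → WhiteheadPartition Γ) {m n : ℕ} (φ : FaceMap m n)
    (x : ι → ZMod 2) (ℓ : Fin n → BLabel V ι) (c : Fin m → ZMod 2) :
    cubeVertex P (cubeVertex P x ℓ φ.corner)
      (fun i => BLabel.twist (φ.corner (φ.axis i)) (ℓ (φ.axis i))) c =
    cubeVertex P x ℓ (fun j => φ.corner j + Function.extend φ.axis c 0 j) := by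
  unfold cubeVertex
  simp only [switch_twist, add_smul, Finset.sum_add_distrib, add_assoc]
  congr 2
  have h1 : ∑ j ∈ Finset.univ.map φ.axis, Function.extend φ.axis c 0 j • switch P (ℓ j) =
      ∑ i, c i • switch P (ℓ (φ.axis i)) := by
    rw [Finset.sum_map]
    refine Finset.sum_congr rfl fun i _ => ?_
    rw [φ.axis.injective.extend_apply]
  rw [← h1]
  refine Finset.sum_subset (Finset.subset_univ _) fun j _ hj => ?_
  rw [Function.extend_apply']
  · exact zero_smul _ _
  · rintro ⟨i, rfl⟩
    exact hj (Finset.mem_map_of_mem _ (Finset.mem_univ i))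

/-- The blow-up `𝕊^𝒫`. -/
def blowup (P : ι → WhiteheadPartition Γ) : CubeComplex.{u} where
  Cube n := BlowupCube P n
  restr φ C :=
    { origin := cubeVertex P C.origin C.label φ.corner
      label := fun i => BLabel.twist (φ.corner (φ.axis i)) (C.label (φ.axis i))
      region := fun c => by
        rw [cubeVertex_restr]
        exact C.region _
      commuting := fun i j h => by
        rw [commutingLabels_twist]
        exact C.commuting _ _ (φ.axis.injective.ne h)
      departs := fun c i => by
        rw [cubeVertex_restr, BLabel.twist_twist]
        have := C.departs (fun j => φ.corner j + Function.extend φ.axis c 0 j) (φ.axis i)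
        rwa [φ.axis.injective.extend_apply] at this }
  restr_id := by
    rintro n C
    apply BlowupCube.ext
    · change C.origin + ∑ j, (0 : Fin n → ZMod 2) j • _ = _
      simp
    · funext i
      exact BLabel.twist_zero _
  restr_comp := by
    rintro l m n φ ψ C
    apply BlowupCube.ext
    · exact cubeVertex_restr P φ _ _ _
    · funext i
      change BLabel.twist _ (BLabel.twist _ _) = BLabel.twist (φ.corner (φ.axis (ψ.axis i)) +
        Function.extend φ.axis ψ.corner 0 (φ.axis (ψ.axis i))) _
      rw [BLabel.twist_twist, φ.axis.injective.extend_apply]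
      rfl

/-- The underlying unoriented label: `e_v` or `e_{𝐏_i}`. -/
def unoriented : BLabel V ι → V ⊕ ι
  | Sum.inl v => Sum.inl v.1
  | Sum.inr i => Sum.inr i

/-- The label of an edge of the blow-up. -/
def edgeLabel (P : ι → WhiteheadPartition Γ) (e : (blowup P).Edge) : V ⊕ ι :=
  unoriented (BlowupCube.label e 0)

/-- The labels of the edges of the blow-up that are dual to hyperplanes in `H`. -/
def dualLabels (P : ι → WhiteheadPartition Γ) (H : Set (blowup P).Hyperplane) : Set (V ⊕ ι) :=
  {a | ∃ e, edgeLabel P e = a ∧ (blowup P).hyp e ∈ H}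

/-- The hyperplanes dual to the edges labelled `e_{𝐏_i}`, for `i` in `J`. -/
def partitionHyperplanes (P : ι → WhiteheadPartition Γ) (J : Set ι) :
    Set (blowup P).Hyperplane :=
  {h | ∃ e, ∃ i ∈ J, edgeLabel P e = Sum.inr i ∧ (blowup P).hyp e = h}

/-- The word in `V^±` read along an edge of the blow-up by the canonical collapse. -/
def labelWord (Γ : SimpleGraph V) : BLabel V ι → List (salvetti Γ).Edge
  | Sum.inl v => [⟨fun _ => v, fun i j h => absurd (Subsingleton.elim i j) h⟩]
  | Sum.inr _ => []

/-- The vertex of the Salvetti complex. -/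
def salvettiPt (Γ : SimpleGraph V) : (salvetti Γ).Vertex := ⟨Fin.elim0, fun i => i.elim0⟩

theorem salvetti_vertex_eq (x y : (salvetti Γ).Vertex) : x = y :=
  Subtype.ext (funext fun i => i.elim0)

theorem isPath_salvetti (x y : (salvetti Γ).Vertex) (l : List (salvetti Γ).Edge) :
    (salvetti Γ).IsPath x l y := by
  induction l generalizing x with
  | nil => exact salvetti_vertex_eq _ _
  | cons e l ih => exact ⟨salvetti_vertex_eq _ _, ih _⟩

theorem homotopic_salvetti (x y x' y' : (salvetti Γ).Vertex) {l l' : List (salvetti Γ).Edge}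
    (h : (salvetti Γ).Homotopic x y l l') : (salvetti Γ).Homotopic x' y' l l' := by
  obtain rfl := salvetti_vertex_eq x x'
  obtain rfl := salvetti_vertex_eq y y'
  exact h

/-- The canonical collapse `c_𝒫 : 𝕊^𝒫 → 𝕊`, which collapses all edges `e_{𝐏_i}` and sends the
edges `e_v` to the edge `e_v`. -/
def canonicalMap (P : ι → WhiteheadPartition Γ) :
    CubeComplex.CellMap (blowup P) (salvetti Γ) where
  onV _ := salvettiPt Γ
  onE e := labelWord Γ (BlowupCube.label e 0)
  isPath e := isPath_salvetti _ _ _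
  back e := by
    change (salvetti Γ).Homotopic _ _ (labelWord Γ (BlowupCube.label e 0) ++
      labelWord Γ (BLabel.twist 1 (BlowupCube.label e 0))) []
    generalize BlowupCube.label e 0 = y
    cases y with
    | inl v =>
      exact homotopic_salvetti _ _ _ _ ((salvetti Γ).homotopic_back
        ⟨fun _ => v, fun i j h => absurd (Subsingleton.elim i j) h⟩)
    | inr i => exact CubeComplex.homotopic_refl _ rfl
  square s := by
    have hc : CommutingLabels P (BlowupCube.label s 0) (BlowupCube.label s 1) :=
      BlowupCube.commuting s 0 1 (by decide)
    have e1 : ∀ (c : Fin 2 → ZMod 2) (j : Fin 2), BlowupCube.label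
        ((blowup P).restr (FaceMap.edge c j) s) 0 = BLabel.twist (c j) (BlowupCube.label s j) :=
      fun c j => rfl
    simp only [CubeComplex.sqFst, CubeComplex.sqSnd, List.flatMap_cons, List.flatMap_nil, e1]
    change (salvetti Γ).Homotopic _ _
      (labelWord Γ (BLabel.twist 0 (BlowupCube.label s 0)) ++
        (labelWord Γ (BLabel.twist 0 (BlowupCube.label s 1)) ++ []))
      (labelWord Γ (BLabel.twist 0 (BlowupCube.label s 1)) ++
        (labelWord Γ (BLabel.twist 0 (BlowupCube.label s 0)) ++ []))
    simp only [BLabel.twist_zero]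
    generalize BlowupCube.label s 0 = y at hc
    generalize BlowupCube.label s 1 = z at hc
    cases y with
    | inr i => cases z <;> exact CubeComplex.homotopic_refl _ (isPath_salvetti _ _ _)
    | inl v =>
      cases z with
      | inr i => exact CubeComplex.homotopic_refl _ (isPath_salvetti _ _ _)
      | inl w =>
        have hvw : Γ.Adj v.1 w.1 := hc
        have hsq : ∀ i j : Fin 2, i ≠ j → Γ.Adj ((![v, w] : Fin 2 → Letter V) i).1
            ((![v, w] : Fin 2 → Letter V) j).1 := by
          intro i j h
          fin_cases i <;> fin_cases j
          · exact absurd rfl h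
          · exact hvw
          · exact hvw.symm
          · exact absurd rfl h
        have := homotopic_salvetti _ _ (salvettiPt Γ) (salvettiPt Γ)
          ((salvetti Γ).homotopic_square ⟨![v, w], hsq⟩)
        exact this

/-- The canonical collapse on fundamental groupoids. -/
def canonicalFunctor (P : ι → WhiteheadPartition Γ) :
    (blowup P).Grpd ⥤ (salvetti Γ).Grpd := (canonicalMap P).functor

/-! ### Tree-like sets of hyperplanes -/

/-- A set `T` of oriented edges is a maximal tree in the 1-skeleton: it is closed under reversal,
contains no loops and no multiple edges, and the graph formed by all vertices and the edges
in `T` is a tree. -/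
structure IsMaximalTree (X : CubeComplex.{u}) (T : Set X.Edge) : Prop where
  rev_mem : ∀ e ∈ T, X.rev e ∈ T
  no_loop : ∀ e ∈ T, X.src e ≠ X.tgt e
  no_multiple : ∀ e ∈ T, ∀ e' ∈ T, X.src e = X.src e' → X.tgt e = X.tgt e' → e = e'
  isTree : (SimpleGraph.fromRel fun x y : X.Vertex =>
    ∃ e ∈ T, X.src e = x ∧ X.tgt e = y).IsTree

/-- The partitions in `P` whose link is `L`. -/
def linkClass (P : ι → WhiteheadPartition Γ) (L : Set V) :
    {j : ι // (P j).link = L} → WhiteheadPartition Γ := fun j => P j.1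

/-- The labels of the edges of the base graph for the partitions with link `L`: all `e_𝐏` for
partitions `𝐏` with link `L`, and all `e_v` with `lk(v) = L`. -/
def baseLabels (P : ι → WhiteheadPartition Γ) (L : Set V) : Set (V ⊕ ι) :=
  {a | (∃ v, a = Sum.inl v ∧ lk Γ v = L) ∨ ∃ i, a = Sum.inr i ∧ (P i).link = L}

/-- The edges of `𝕊^{𝒫_L}`, for the subcollection `𝒫_L` of all partitions with link `L`, whose
label belongs to a set of labels of edges of `𝕊^𝒫`. -/
def classEdges (P : ι → WhiteheadPartition Γ) (L : Set V) (A : Set (V ⊕ ι)) :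
    Set (blowup (linkClass P L)).Edge :=
  {e | Sum.map id Subtype.val (edgeLabel (linkClass P L) e) ∈ A}

/-- Tree-like sets of hyperplanes in `𝕊^𝒫`: every hyperplane in `H` is the lift of a hyperplane
dual to an edge of one of the base graphs `𝔤_L ⊆ 𝕊^{𝒫_L}`, where `L` runs over the links of the
partitions in `𝒫`, and for every such `L` the edges of `𝔤_L` dual to these hyperplanes form a
maximal tree. -/
def IsTreeLike (P : ι → WhiteheadPartition Γ) (H : Set (blowup P).Hyperplane) : Prop :=
  (∀ a ∈ dualLabels P H, ∃ i, a ∈ baseLabels P (P i).link) ∧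
    ∀ i, IsMaximalTree (blowup (linkClass P (P i).link))
      (classEdges P (P i).link (dualLabels P H ∩ baseLabels P (P i).link))

end Blowup

/-! ### Markings -/

open Classical in
/-- The composition `G ∘ F⁻¹` for an equivalence of categories `F` (and a constant functor if `F` is
not an equivalence). -/
def compInv {C D E : Type u} [Category.{u} C] [Category.{u} D] [Category.{u} E] [Nonempty E]
    (F : C ⥤ D) (G : C ⥤ E) : D ⥤ E :=
  if _h : F.IsEquivalence then F.inv ⋙ G else (Functor.const D).obj (Classical.arbitrary E)

section Marking

variable {V : Type u} {Γ : SimpleGraph V}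

instance salvettiNonempty : Nonempty (salvetti Γ).Grpd := ⟨salvettiPt Γ⟩

theorem gen_inv (v : Letter V) : gen Γ v.inv = (gen Γ v)⁻¹ := by
  obtain ⟨v, b⟩ := v
  cases b <;> simp [gen, Letter.inv]

theorem gen_comm {v w : Letter V} (h : Γ.Adj v.1 w.1) :
    gen Γ v * gen Γ w = gen Γ w * gen Γ v := by
  have key : Commute (PresentedGroup.of v.1 : RAAG Γ) (PresentedGroup.of w.1) := by
    have : (PresentedGroup.mk (raagRels Γ) (FreeGroup.of v.1 * FreeGroup.of w.1 *
        (FreeGroup.of v.1)⁻¹ * (FreeGroup.of w.1)⁻¹)) = 1 :=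
      PresentedGroup.one_of_mem ⟨v.1, w.1, h, rfl⟩
    simp only [map_mul, map_inv] at this
    rw [mul_inv_eq_one, mul_inv_eq_iff_eq_mul] at this
    exact this
  unfold gen
  split_ifs
  · exact key
  · exact key.inv_right
  · exact key.inv_left
  · exact key.inv_left.inv_right

/-- The element of `A_Γ` represented by an edge path in the Salvetti complex; this identifies the
fundamental group of the Salvetti complex with `A_Γ`. -/
def pathElement {x y : (salvetti Γ).Grpd} (p : x ⟶ y) : RAAG Γ :=
  Quot.lift (fun p : (salvetti Γ).Path x y => (p.1.map fun e => gen Γ (e.1 0)).prod)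
    (by
      rintro ⟨a, ha⟩ ⟨b, hb⟩ h
      dsimp only at h ⊢
      cases h with
      | back l l' e =>
        have h1 : (((salvetti Γ).rev e).1 0) = (e.1 0).inv := rfl
        simp [h1, gen_inv]
      | square l l' s =>
        have h1 := gen_comm (s.2 0 1 (by decide))
        have e1 : ∀ (c : Fin 2 → ZMod 2) (j : Fin 2), ((salvetti Γ).restr (FaceMap.edge c j) s).1 0
            = (s.1 j).twist (c j) := fun c j => rfl
        simp only [CubeComplex.sqFst, CubeComplex.sqSnd, List.map_append, List.map_cons,
          List.map_nil, List.prod_append, List.prod_cons, List.prod_nil, mul_one, e1]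
        congr 2) p

/-- A map `𝕊 → 𝕊` (up to homotopy) induces the automorphism `f` of `A_Γ`, up to an inner
automorphism. -/
def Induces (F : (salvetti Γ).Grpd ⥤ (salvetti Γ).Grpd) (f : MulAut (RAAG Γ)) : Prop :=
  ∃ g : RAAG Γ, ∀ (x y : (salvetti Γ).Grpd) (p : x ⟶ y),
    pathElement (F.map p) = g * f (pathElement p) * g⁻¹

/-- A cube complex `X` with a map `X → 𝕊`. All cube complexes considered here are locally CAT(0),
hence aspherical, so a map `X → 𝕊` up to homotopy is given by a functor on fundamental groupoids
up to natural isomorphism, and it is a homotopy equivalence if and only if the functor is an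
equivalence of categories. -/
structure MarkedComplex (Γ : SimpleGraph V) where
  X : CubeComplex.{u}
  marking : X.Grpd ⥤ (salvetti Γ).Grpd

namespace MarkedComplex

/-- Equivalence of marked complexes: an isomorphism of cube complexes that commutes with the
markings up to homotopy. -/
def Equivalent (σ τ : MarkedComplex Γ) : Prop :=
  ∃ h : σ.X.Iso τ.X, Nonempty (h.functor ⋙ τ.marking ≅ σ.marking)

/-- The marked complex `σ_H = (X_H, α ∘ c⁻¹)`, where `σ = (X, α)` and `c : X → X_H` is the
collapse. -/
def collapse (σ : MarkedComplex Γ) (H : Set σ.X.Hyperplane) : MarkedComplex Γ :=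
  ⟨σ.X.collapse H, compInv (σ.X.collapseFunctor H) σ.marking⟩

/-- The marked Salvetti complex `(𝕊, α)`. -/
def salvetti (α : (OutSpace.salvetti Γ).Grpd ⥤ (OutSpace.salvetti Γ).Grpd) : MarkedComplex Γ :=
  ⟨OutSpace.salvetti Γ, α⟩

/-- The blow-up `σ^𝒫 = (𝕊^𝒫, α ∘ c_𝒫)` of `σ = (𝕊, α)`. -/
def blowup (α : (OutSpace.salvetti Γ).Grpd ⥤ (OutSpace.salvetti Γ).Grpd) {ι : Type}
    (P : ι → WhiteheadPartition Γ) : MarkedComplex Γ :=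
  ⟨OutSpace.blowup P, canonicalFunctor P ⋙ α⟩

end MarkedComplex

/-- `(𝕊, α)` is a rose: `α` is a homotopy equivalence that induces an element of `Out_ℓ`. -/
def IsRose (α : (salvetti Γ).Grpd ⥤ (salvetti Γ).Grpd) : Prop :=
  α.IsEquivalence ∧ ∃ f, Induces α f ∧ outClass f ∈ OutL Γ

/-- `(𝕊, β)` is connected to `σ = (𝕊, α)` by a Whitehead move: for a Whitehead pair `(P, m)` with
Whitehead automorphism `f`, realized by `F : 𝕊 → 𝕊`, it is equivalent to `(𝕊, α ∘ F)`. -/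
def IsWhiteheadMove (α β : (salvetti Γ).Grpd ⥤ (salvetti Γ).Grpd) : Prop :=
  ∃ (P : Set (Letter V)) (m : Letter V) (f : MulAut (RAAG Γ))
    (F : (salvetti Γ).Grpd ⥤ (salvetti Γ).Grpd),
    IsWhiteheadPair Γ P m ∧ IsWhiteheadAut Γ P m f ∧ Induces F f ∧
      (MarkedComplex.salvetti β).Equivalent (MarkedComplex.salvetti (F ⋙ α))

/-- The set of hyperplanes `{H_1, …, H_i, K_{i+1}, …, K_k}`, where `H_1, …, H_k` is an ordering of
the elements of `H`, and `K_j` is dual to the edges labelled by the `j`-th partition in an ordering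
of `P`. -/
def mixedHyperplanes {k : ℕ} (P : Fin k → WhiteheadPartition Γ) {H : Set (blowup P).Hyperplane}
    (η : Fin k ≃ H) (π : Equiv.Perm (Fin k)) (i : Fin (k + 1)) : Set (blowup P).Hyperplane :=
  {h | ∃ j : Fin k, j.castSucc < i ∧ h = η j} ∪
    partitionHyperplanes P {a | ∃ j : Fin k, i ≤ j.castSucc ∧ a = π j}

end Marking

end OutSpace

end

/-! ### Signs, letters and adjacency -/

noncomputable section

namespace OutSpace

/-! Compatible partitions behave like walls. Every label, a vertex or a partition, has a
representative vertex `rep` (for a partition, a base), and labels commute iff their representatives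
are adjacent. Two distinct compatible partitions that do not commute have exactly one pair of
disjoint sides. Hence an edge with a given label determines the sides of all partitions that do not
commute with the label (`Fits.determined`), every region can be projected to an end of such an edge
(`IsProj`), and pairwise commuting edges at a region always span a cube. It follows that hyperplanes
are the same as labels (`hypLabel_injective`), so a tree-like set is a set `A` of labels that gives,
for each link `L` of a partition, a spanning tree of a finite multigraph, the base graph.

Canonical collapse. Shortest paths of partition edges between two regions are unique up to homotopy
(`Geo.unique`). Closing up an edge `e_v` with such geodesics gives a loop that depends only on `v`;
these loops satisfy the relations of `A_Γ` and invert the map induced by the canonical collapse.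

Collapse along `A`. A coordinate matches the labels outside `A` with the vertices of `Γ`, preserving
links. Reading its letters turns a cube avoiding `A` into a cube of the Salvetti complex, and every
cube of the latter occurs. Cubes with the same letters become equal in the collapse because they are
joined by slides across edges with labels in `A` (`reflTransGen_slide`): the flip of a partition
with link `L` is replaced by a path in the spanning tree for `L`, and the only corrections needed
along the way are flips of partitions with strictly larger link, which allows induction. So the
collapse is the Salvetti complex.

Factorization. Start with the set of all partition labels and replace them by elements of `A` one at
a time, partitions with maximal link first. Removing a partition `a` cuts the tree for `L` into two
parts, and the tree of `A` supplies a label `b` crossing the same cut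
(`IsSpanningTree.exists_exchange`). Let `D` be the vertices of the blow-up over one part, and `m`
the letter read along `b` when entering `D`. The letters outside `L` that are read along edges
ending in `D` are the side of a Whitehead pair with base `m`, and its automorphism, corrected by
powers of `m` at the vertices in `D`, turns the old reading of edge paths into the new one
(`IsCut.isTwist`). Treating maximal links first ensures that no other collapsed edge crosses the
cut. If the set of letters is only `{m}`, or if `b = a`, the change is an inversion, which up to
conjugation is the Whitehead automorphism of the largest possible side.

Whitehead automorphisms lie in `Out_ℓ`: each is an inversion followed by a shear `v ↦ w ^ p * v * w
^ q`, and shears are products of transvections and partial conjugations (`mem_shearGroup`). The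
composed twists give automorphisms `f i` comparing the collapses with the canonical one; since
Whitehead automorphisms are involutions, the markings `α ∘ (f i)⁻¹` form a chain of Whitehead moves.
Another identification of the collapse with the Salvetti complex differs by a graph automorphism and
inversions. -/

theorem ZMod.two_cases (a : ZMod 2) : a = 0 ∨ a = 1 := by
  revert a; decide

theorem ZMod.two_add_self (a : ZMod 2) : a + a = 0 := by
  revert a; decide

theorem ZMod.two_add_one_add_one (a : ZMod 2) : a + 1 + 1 = a := by
  revert a; decide

theorem ZMod.two_add_one_ne (a : ZMod 2) : a + 1 ≠ a := by
  revert a; decide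

theorem ZMod.two_eq_add_one {a b : ZMod 2} (h : a ≠ b) : a = b + 1 := by
  revert a b; decide

theorem Letter.inv_ne {V : Type u} (x : Letter V) : x.inv ≠ x := by
  intro h
  have := congrArg Prod.snd h
  simp [Letter.inv] at this

theorem Letter.eq_or_eq_inv {V : Type u} {x y : Letter V} (h : x.1 = y.1) :
    x = y ∨ x = y.inv := by
  obtain ⟨v, a⟩ := x
  obtain ⟨w, b⟩ := y
  obtain rfl : v = w := h
  cases a <;> cases b <;> simp [Letter.inv]

@[simp] theorem Letter.twist_zero {V : Type u} (x : Letter V) : x.twist 0 = x := rfl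

@[simp] theorem Letter.twist_one {V : Type u} (x : Letter V) : x.twist 1 = x.inv := rfl

theorem VLE.refl {V : Type u} (Γ : SimpleGraph V) (v : V) : VLE Γ v v :=
  fun _ h => Set.mem_insert_of_mem _ h

theorem lk_subset_of_VLE {V : Type u} {Γ : SimpleGraph V} {v w : V} (h : VLE Γ v w)
    (hvw : ¬ Γ.Adj v w) : lk Γ v ⊆ lk Γ w := by
  intro x hx
  rcases h hx with rfl | h
  · exact absurd hx hvw
  · exact h

/-- The symmetric difference of the conditions of a Whitehead pair: adjacency is constant on the
two sides, away from the link. -/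
theorem IsWhiteheadPair.mem_of_adj {V : Type u} {Γ : SimpleGraph V} {P : Set (Letter V)}
    {m : Letter V} (h : IsWhiteheadPair Γ P m) {v w : Letter V} (hw : w ∈ P)
    (hvw : Γ.Adj v.1 w.1) (hv : v.1 ∉ lk Γ m.1) : v ∈ P := by
  have hwm : ¬ Γ.Adj w.1 m.1 := h.not_adj w hw
  have hvm : v.1 ≠ m.1 := fun e => hwm (e ▸ hvw.symm)
  -- If both signs of `w` lie in `P`, the component condition carries over to `v`. If only one does,
  -- `lk w ⊆ lk m`, which would put `v` in the link of `m`.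
  by_cases hwi : w.inv ∈ P
  · have hwm' : w.1 ≠ m.1 := by
      intro e
      rcases Letter.eq_or_eq_inv e with rfl | rfl
      · exact h.inv_notMem hwi
      · exact h.inv_notMem hw
    have h1 : w.1 ∈ (st Γ m.1)ᶜ := by
      rintro (e | e)
      · exact hwm' e
      · exact hwm (SimpleGraph.Adj.symm e)
    have h2 : v.1 ∈ (st Γ m.1)ᶜ := by
      rintro (e | e)
      · exact hvm e
      · exact hv e
    refine h.component w hw hwi v ⟨h1, h2, ?_⟩
    apply SimpleGraph.Adj.reachable
    exact hvw.symm
  · exact absurd (lk_subset_of_VLE (h.le_of_single w hw hwi) hwm hvw.symm) hv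

/-! ### Sides, links and disjointness of Whitehead partitions -/

namespace WhiteheadPartition

variable {V : Type u} {Γ : SimpleGraph V}

/-- A base of a Whitehead partition. -/
def base (P : WhiteheadPartition Γ) : Letter V := P.isPair.choose

theorem isPair_base (P : WhiteheadPartition Γ) : IsWhiteheadPair Γ P.side P.base :=
  P.isPair.choose_spec

/-- Each base occurs with only one sign in the side and is not adjacent to the other base, so the
relation `≤` gives an inclusion of links both ways. -/
theorem lk_eq_of_isPair {P : Set (Letter V)} {m n : Letter V} (hm : IsWhiteheadPair Γ P m)
    (hn : IsWhiteheadPair Γ P n) : lk Γ m.1 = lk Γ n.1 :=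
  (lk_subset_of_VLE (hn.le_of_single m hm.mem hm.inv_notMem) (hn.not_adj m hm.mem)).antisymm
    (lk_subset_of_VLE (hm.le_of_single n hn.mem hn.inv_notMem) (hm.not_adj n hn.mem))

theorem link_eq (P : WhiteheadPartition Γ) : P.link = lk Γ P.base.1 := by
  ext v
  constructor
  · rintro ⟨m, hm, hv⟩
    rwa [lk_eq_of_isPair P.isPair_base hm]
  · intro hv
    exact ⟨_, P.isPair_base, hv⟩

theorem mem_link_iff (P : WhiteheadPartition Γ) (v : V) : v ∈ P.link ↔ Γ.Adj P.base.1 v := by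
  rw [link_eq]; rfl

/-- The base, as an element of a given side. -/
def baseAt (P : WhiteheadPartition Γ) (a : ZMod 2) : Letter V := P.base.twist a

theorem baseAt_fst (P : WhiteheadPartition Γ) (a : ZMod 2) : (P.baseAt a).1 = P.base.1 :=
  Letter.twist_fst _ _

theorem base_notMem_link (P : WhiteheadPartition Γ) : P.base.1 ∉ P.link := by
  rw [mem_link_iff]; exact Γ.loopless.irrefl _

theorem baseAt_mem (P : WhiteheadPartition Γ) (a : ZMod 2) : P.baseAt a ∈ P.sideAt a := by
  rcases ZMod.two_cases a with rfl | rfl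
  · exact P.isPair_base.mem
  · exact ⟨P.isPair_base.inv_notMem, P.base_notMem_link⟩

theorem notMem_link {P : WhiteheadPartition Γ} {a : ZMod 2} {x : Letter V}
    (h : x ∈ P.sideAt a) : x.1 ∉ P.link := by
  rcases ZMod.two_cases a with rfl | rfl
  · rw [mem_link_iff]
    exact fun e => P.isPair_base.not_adj x h e.symm
  · exact h.2

theorem side_unique {P : WhiteheadPartition Γ} {a b : ZMod 2} {x : Letter V}
    (h : x ∈ P.sideAt a) (h' : x ∈ P.sideAt b) : a = b := by
  rcases ZMod.two_cases a with rfl | rfl <;> rcases ZMod.two_cases b with rfl | rfl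
  · rfl
  · exact absurd h h'.1
  · exact absurd h' h.1
  · rfl

theorem exists_mem_sideAt (P : WhiteheadPartition Γ) {x : Letter V} (h : x.1 ∉ P.link) :
    ∃ a, x ∈ P.sideAt a := by
  by_cases hx : x ∈ P.side
  · exact ⟨0, hx⟩
  · exact ⟨1, hx, h⟩

theorem mem_sideAt_or (P : WhiteheadPartition Γ) (a : ZMod 2) {x : Letter V}
    (h : x.1 ∉ P.link) : x ∈ P.sideAt a ∨ x ∈ P.sideAt (a + 1) := by
  obtain ⟨b, hb⟩ := P.exists_mem_sideAt h
  by_cases e : b = a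
  · exact Or.inl (e ▸ hb)
  · exact Or.inr (ZMod.two_eq_add_one e ▸ hb)

/-- For the side `P` this is the corresponding property of a Whitehead pair; for the other side
exchange the roles of `v` and `w`. -/
theorem mem_of_adj {P : WhiteheadPartition Γ} {a : ZMod 2} {v w : Letter V}
    (hw : w ∈ P.sideAt a) (hvw : Γ.Adj v.1 w.1) (hv : v.1 ∉ P.link) : v ∈ P.sideAt a := by
  have key := P.isPair_base
  rcases ZMod.two_cases a with rfl | rfl
  · exact key.mem_of_adj hw hvw (P.link_eq ▸ hv)
  · refine ⟨fun h => hw.1 ?_, hv⟩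
    exact key.mem_of_adj h hvw.symm (P.link_eq ▸ hw.2)

theorem mem_single_iff (P : WhiteheadPartition Γ) (v : Letter V) :
    v.1 ∈ P.single ↔ ∃ a, v ∈ P.sideAt a ∧ v.inv ∈ P.sideAt (a + 1) := by
  have h11 : (1 + 1 : ZMod 2) = 0 := by decide
  obtain ⟨v, b⟩ := v
  constructor
  · rintro (⟨h, h'⟩ | ⟨h, h'⟩)
    · cases b
      · exact ⟨1, h', by rw [h11]; exact h⟩
      · exact ⟨0, h, h'⟩
    · cases b
      · exact ⟨0, h', h⟩
      · exact ⟨1, h, by rw [h11]; exact h'⟩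
  · rintro ⟨a, h, h'⟩
    rcases ZMod.two_cases a with rfl | rfl
    · cases b
      · exact Or.inr ⟨h', h⟩
      · exact Or.inl ⟨h, h'⟩
    · rw [h11] at h'
      cases b
      · exact Or.inl ⟨h', h⟩
      · exact Or.inr ⟨h, h'⟩

theorem notMem_link_of_single {P : WhiteheadPartition Γ} {v : V} (h : v ∈ P.single) :
    v ∉ P.link := by
  obtain ⟨a, h, -⟩ := (P.mem_single_iff (v, true)).1 h
  exact notMem_link h

/-- A neighbour of `v` outside the link would be on the side of `v` and also on the side of `v⁻¹`,
and these are different. -/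
theorem lk_subset_of_single {P : WhiteheadPartition Γ} {v : V} (h : v ∈ P.single) :
    lk Γ v ⊆ P.link := by
  obtain ⟨a, h1, h2⟩ := (P.mem_single_iff (v, true)).1 h
  intro w hw
  by_contra hl
  have e1 := mem_of_adj (v := (w, true)) h1 (SimpleGraph.Adj.symm hw) hl
  have e2 := mem_of_adj (v := (w, true)) h2 (SimpleGraph.Adj.symm hw) hl
  exact ZMod.two_add_one_ne a (side_unique e2 e1)

/-- All elements of `max` have the same link as the base, so commutation can be tested on one choice
of bases. -/
theorem commute_iff (P Q : WhiteheadPartition Γ) :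
    P.Commute Q ↔ Γ.Adj P.base.1 Q.base.1 := by
  have hbase : ∀ R : WhiteheadPartition Γ, R.base ∈ R.max := fun R =>
    ⟨R.isPair_base.mem, R.isPair_base.inv_notMem, _, R.isPair_base, VLE.refl _ _, VLE.refl _ _⟩
  have hlk : ∀ R : WhiteheadPartition Γ, ∀ x ∈ R.max, lk Γ x.1 = lk Γ R.base.1 := by
    rintro R x ⟨hx, -, m, hm, h1, h2⟩
    have hxm := hm.not_adj x hx
    rw [← lk_eq_of_isPair hm R.isPair_base]
    exact (lk_subset_of_VLE h1 hxm).antisymm (lk_subset_of_VLE h2 fun e => hxm e.symm)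
  constructor
  · intro h
    exact h _ (hbase P) _ (hbase Q)
  · intro h m hm n hn
    have h1 : Q.base.1 ∈ lk Γ m.1 := by rw [hlk P m hm]; exact h
    have h2 : m.1 ∈ lk Γ n.1 := by rw [hlk Q n hn]; exact SimpleGraph.Adj.symm h1
    exact SimpleGraph.Adj.symm h2

theorem commute_iff_mem_link (P Q : WhiteheadPartition Γ) :
    P.Commute Q ↔ Q.base.1 ∈ P.link := by
  rw [commute_iff, mem_link_iff]

theorem commute_comm {P Q : WhiteheadPartition Γ} : P.Commute Q ↔ Q.Commute P := by
  rw [commute_iff, commute_iff, Γ.adj_comm]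

/-- An element of the first side lying in the link of `Q` would be adjacent to the base of `Q` and
so pull it into that side, against disjointness. Hence the element lies in some side of `Q`, and
only one is left. -/
theorem subset_of_disjoint {P Q : WhiteheadPartition Γ} {a b : ZMod 2}
    (h : P.sideAt a ∩ Q.sideAt b = ∅) (hc : ¬ P.Commute Q) :
    P.sideAt a ⊆ Q.sideAt (b + 1) := by
  intro x hx
  have hne : ∀ y, y ∈ P.sideAt a → y ∉ Q.sideAt b := fun y h1 h2 => by
    have : y ∈ P.sideAt a ∩ Q.sideAt b := ⟨h1, h2⟩
    simp [h] at this
  by_cases hl : x.1 ∈ Q.link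
  · exfalso
    have hxq : Γ.Adj (Q.baseAt b).1 x.1 := by
      rw [baseAt_fst]; exact (Q.mem_link_iff _).1 hl
    by_cases hp : (Q.baseAt b).1 ∈ P.link
    · rw [baseAt_fst] at hp
      exact hc ((commute_iff_mem_link P Q).2 hp)
    · exact hne _ (mem_of_adj hx hxq hp) (Q.baseAt_mem b)
  · exact (Q.mem_sideAt_or b hl).resolve_left (hne x hx)

/-- A side of one partition that is not in the other side of a second partition meets the first
side, if it contains a vertex from the link. -/
theorem inter_nonempty_of_mem_link {P Q : WhiteheadPartition Γ} {a b : ZMod 2} {x : Letter V}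
    (hc : ¬ P.Commute Q) (hx : x ∈ P.sideAt a) (hl : x.1 ∈ Q.link) :
    (P.sideAt a ∩ Q.sideAt b).Nonempty := by
  rw [Set.nonempty_iff_ne_empty]
  intro h
  exact notMem_link (subset_of_disjoint h hc hx) hl

/-- `Q` separates the base of `P` from its inverse, because the common side contains only one of
them. -/
theorem link_subset_of_sideAt_eq {P Q : WhiteheadPartition Γ} {a b : ZMod 2}
    (h : P.sideAt a = Q.sideAt b) : P.link ⊆ Q.link := by
  have h1 : P.baseAt a ∈ Q.sideAt b := h ▸ P.baseAt_mem a
  have h2 : P.baseAt (a + 1) ∉ Q.sideAt b := by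
    rw [← h]
    exact fun h' => ZMod.two_add_one_ne a (side_unique (P.baseAt_mem _) h')
  have h3 : P.base.1 ∈ Q.single := by
    rw [← P.baseAt_fst a, mem_single_iff]
    refine ⟨b, h1, ?_⟩
    have : (P.baseAt a).inv = P.baseAt (a + 1) := by
      rw [baseAt, baseAt, ← Letter.twist_one, Letter.twist_twist]
    rw [this]
    refine (Q.mem_sideAt_or b ?_).resolve_left h2
    have := notMem_link h1
    rwa [baseAt_fst] at this ⊢
  rw [P.link_eq]
  exact lk_subset_of_single h3

theorem sideAt_add_one (P : WhiteheadPartition Γ) (a : ZMod 2) :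
    P.sideAt (a + 1) = {x | x ∉ P.sideAt a ∧ x.1 ∉ P.link} := by
  ext x
  constructor
  · intro h
    exact ⟨fun h' => ZMod.two_add_one_ne a (side_unique h h'), notMem_link h⟩
  · rintro ⟨h, h'⟩
    exact (P.mem_sideAt_or a h').resolve_left h

theorem samePartition_of_sideAt_eq {P Q : WhiteheadPartition Γ} {a b : ZMod 2}
    (h : P.sideAt a = Q.sideAt b) : P.SamePartition Q := by
  have hl : P.link = Q.link := (link_subset_of_sideAt_eq h).antisymm (link_subset_of_sideAt_eq h.symm)
  have h' : P.sideAt (a + 1) = Q.sideAt (b + 1) := by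
    rw [sideAt_add_one, sideAt_add_one, h, hl]
  have h11 : (1 + 1 : ZMod 2) = 0 := by decide
  rcases ZMod.two_cases a with rfl | rfl <;> rcases ZMod.two_cases b with rfl | rfl
  · exact Or.inl h
  · exact Or.inr h
  · rw [h11] at h'
    exact Or.inr h'
  · rw [h11] at h'
    exact Or.inl h'

theorem exists_disjoint {P Q : WhiteheadPartition Γ} (h : P.Compatible Q)
    (hc : ¬ P.Commute Q) : ∃ a b, P.sideAt a ∩ Q.sideAt b = ∅ :=
  h.resolve_left hc

/-- Two disjoint sides are unique. -/
theorem disjoint_unique {P Q : WhiteheadPartition Γ} (hs : ¬ P.SamePartition Q)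
    (hc : ¬ P.Commute Q) {a b a' b' : ZMod 2} (h : P.sideAt a ∩ Q.sideAt b = ∅)
    (h' : P.sideAt a' ∩ Q.sideAt b' = ∅) : a = a' ∧ b = b' := by
  have s := subset_of_disjoint h hc
  have s' := subset_of_disjoint h' hc
  have t := subset_of_disjoint (by rwa [Set.inter_comm] at h) (fun e => hc (commute_comm.1 e))
  have t' := subset_of_disjoint (by rwa [Set.inter_comm] at h') (fun e => hc (commute_comm.1 e))
  by_cases ha : a = a'
  · subst ha
    exact ⟨rfl, add_right_cancel (side_unique (s (P.baseAt_mem a)) (s' (P.baseAt_mem a)))⟩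
  · exfalso
    obtain rfl := ZMod.two_eq_add_one ha
    by_cases hb : b = b'
    · subst hb
      have := side_unique (t (Q.baseAt_mem b)) (t' (Q.baseAt_mem b))
      exact ha (add_right_cancel this)
    -- If both opposite pairs of sides are disjoint, a side of each partition contains a side of the
    -- other, so the two sides are equal.
    · obtain rfl := ZMod.two_eq_add_one hb
      rw [ZMod.two_add_one_add_one] at s t
      exact hs (samePartition_of_sideAt_eq (s.antisymm t'))

end WhiteheadPartition

/-! ### Regions, edges at a region, and the sides an edge forces -/

section Regions

variable {V : Type u} {Γ : SimpleGraph V} {ι : Type} {P : ι → WhiteheadPartition Γ}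

open WhiteheadPartition

/-- The vertex whose link is the link of a label. -/
def rep (P : ι → WhiteheadPartition Γ) : V ⊕ ι → V
  | Sum.inl v => v
  | Sum.inr i => (P i).base.1

/-- Reduces all commutation of labels to adjacency in `Γ`; the clause `i ≠ j` is automatic because
no vertex is adjacent to itself. -/
theorem commutingLabels_iff (y z : BLabel V ι) : CommutingLabels P y z ↔
    Γ.Adj (rep P (unoriented y)) (rep P (unoriented z)) := by
  cases y with
  | inl v =>
    cases z with
    | inl w => rfl
    | inr i => exact ((P i).mem_link_iff v.1).trans (Γ.adj_comm _ _)
  | inr i =>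
    cases z with
    | inl w => exact (P i).mem_link_iff w.1
    | inr j =>
      refine Iff.trans ?_ ((P i).commute_iff (P j))
      refine ⟨fun h => h.2, fun h => ⟨?_, h⟩⟩
      rintro rfl
      exact Γ.loopless.irrefl _ (((P i).commute_iff (P i)).1 h)

theorem commutingLabels_comm {y z : BLabel V ι} (h : CommutingLabels P y z) :
    CommutingLabels P z y := by
  rw [commutingLabels_iff] at h ⊢
  exact h.symm

theorem rep_mem_link {y : BLabel V ι} {i : ι} (h : CommutingLabels P y (Sum.inr i)) :
    rep P (unoriented y) ∈ (P i).link := by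
  rw [commutingLabels_iff] at h
  exact ((P i).mem_link_iff _).2 h.symm

theorem not_commute_self (i : ι) : ¬ (P i).Commute (P i) := by
  rw [commute_iff]
  exact Γ.loopless.irrefl _

theorem switch_inl_of_mem {v : Letter V} {i : ι} (h : v.1 ∈ (P i).single) :
    switch P (Sum.inl v) i = 1 := if_pos h

theorem switch_inl_of_notMem {v : Letter V} {i : ι} (h : v.1 ∉ (P i).single) :
    switch P (Sum.inl v) i = 0 := if_neg h

theorem switch_inr_self (i : ι) : switch P (Sum.inr i) i = 1 := if_pos rfl

theorem switch_inr_of_ne {i j : ι} (h : i ≠ j) : switch P (Sum.inr j) i = 0 := if_neg h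

/-- A label that switches the `i`-th partition has its link inside the link of that partition, so
whatever commutes with the label commutes with `e_{𝐏_i}`. -/
theorem commutingLabels_of_switch {y z : BLabel V ι} (h : CommutingLabels P y z) {i : ι}
    (hi : switch P z i ≠ 0) : CommutingLabels P y (Sum.inr i) := by
  cases z with
  | inl w =>
    have hw : w.1 ∈ (P i).single := by
      by_contra hw
      exact hi (switch_inl_of_notMem hw)
    rw [commutingLabels_iff] at h ⊢
    have := lk_subset_of_single hw h.symm
    exact (((P i).mem_link_iff _).1 this).symm
  | inr j =>
    have : i = j := by
      by_contra e
      exact hi (switch_inr_of_ne e)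
    rwa [this]

theorem switch_eq_zero {y : BLabel V ι} {i : ι} (h : CommutingLabels P y (Sum.inr i)) :
    switch P y i = 0 := by
  cases y with
  | inl v => exact switch_inl_of_notMem fun hs => notMem_link_of_single hs h
  | inr j => exact switch_inr_of_ne (Ne.symm h.1)

/-- An oriented edge with label `y` starts at the region `x`. -/
structure Fits (P : ι → WhiteheadPartition Γ) (x : ι → ZMod 2) (y : BLabel V ι) : Prop where
  region : IsRegion P x
  region' : IsRegion P (x + switch P y)
  departs : Departs P x y

theorem add_switch_switch (x : ι → ZMod 2) (y : BLabel V ι) :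
    x + switch P y + switch P y = x := by
  funext i
  simp [add_assoc, ZMod.two_add_self]

theorem mem_regionSet_add_switch {x : ι → ZMod 2} {v : Letter V} (h : v.inv ∈ regionSet P x) :
    v ∈ regionSet P (x + switch P (Sum.inl v)) := by
  intro i
  by_cases hl : v.1 ∈ (P i).link
  · exact Or.inr hl
  · have h1 := (h i).resolve_right hl
    left
    rw [Pi.add_apply]
    by_cases hs : v.1 ∈ (P i).single
    · rw [switch_inl_of_mem hs]
      obtain ⟨a, h2, h3⟩ := ((P i).mem_single_iff v).1 hs
      rw [side_unique h1 h3, ZMod.two_add_one_add_one]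
      exact h2
    · rw [switch_inl_of_notMem hs, add_zero]
      refine ((P i).mem_sideAt_or (x i) hl).resolve_right fun h2 => hs ?_
      refine ((P i).mem_single_iff v).2 ⟨_, h2, ?_⟩
      rwa [ZMod.two_add_one_add_one]

/-- Beyond the edge, the letter `v` lies in every chosen side apart from those of partitions with
`v` in the link, so it witnesses the intersections. If `v` is in the link of just one of two
non-commuting partitions they still meet; if it is in both links, neither side has changed. -/
theorem isRegion_add_switch {x : ι → ZMod 2} (hx : IsRegion P x) {v : Letter V}
    (h : v.inv ∈ regionSet P x) : IsRegion P (x + switch P (Sum.inl v)) := by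
  have hv := mem_regionSet_add_switch h
  have hsw : ∀ i, v.1 ∈ (P i).link → (x + switch P (Sum.inl v)) i = x i := by
    intro i hi
    rw [Pi.add_apply, switch_inl_of_notMem fun hs => notMem_link_of_single hs hi, add_zero]
  intro i j hij
  by_cases hc : (P i).Commute (P j)
  · exact Or.inl hc
  right
  rcases hv i with hi | hi
  · rcases hv j with hj | hj
    · exact ⟨v, hi, hj⟩
    · exact inter_nonempty_of_mem_link hc hi hj
  · rcases hv j with hj | hj
    · rw [Set.inter_comm]
      exact inter_nonempty_of_mem_link (fun e => hc (commute_comm.1 e)) hj hi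
    · rw [hsw i hi, hsw j hj]
      exact (hx i j hij).resolve_left hc

theorem fits_inl_iff {x : ι → ZMod 2} {v : Letter V} :
    Fits P x (Sum.inl v) ↔ IsRegion P x ∧ v.inv ∈ regionSet P x :=
  ⟨fun h => ⟨h.region, h.departs⟩, fun h => ⟨h.1, isRegion_add_switch h.1 h.2, h.2⟩⟩

theorem fits_inr_iff {x : ι → ZMod 2} {i : ι} :
    Fits P x (Sum.inr i) ↔ IsRegion P x ∧ IsRegion P (x + switch P (Sum.inr i)) :=
  ⟨fun h => ⟨h.region, h.region'⟩, fun h => ⟨h.1, h.2, trivial⟩⟩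

theorem Fits.twist {x : ι → ZMod 2} {y : BLabel V ι} (h : Fits P x y) :
    Fits P (x + switch P y) (BLabel.twist 1 y) := by
  cases y with
  | inl v =>
    refine fits_inl_iff.2 ⟨h.region', ?_⟩
    change v.inv.inv ∈ _
    rw [Letter.inv_inv]
    exact mem_regionSet_add_switch h.departs
  | inr i =>
    refine fits_inr_iff.2 ⟨h.region', ?_⟩
    rw [add_switch_switch]
    exact h.region

theorem Fits.move_inl {x : ι → ZMod 2} {v : Letter V} {z : BLabel V ι}
    (hy : Fits P x (Sum.inl v)) (hz : Fits P x z) (h : CommutingLabels P (Sum.inl v) z) :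
    Fits P (x + switch P z) (Sum.inl v) := by
  refine fits_inl_iff.2 ⟨hz.region', fun i => ?_⟩
  by_cases hi : switch P z i = 0
  · rw [Pi.add_apply, hi, add_zero]
    exact hy.departs i
  · exact Or.inr (commutingLabels_of_switch h hi)

/-- The flag condition in dimension two: two commuting edges at a region span a square, and this
provides the edge opposite to the first one. -/
theorem Fits.move {x : ι → ZMod 2} {y z : BLabel V ι}
    (hy : Fits P x y) (hz : Fits P x z) (h : CommutingLabels P y z) :
    Fits P (x + switch P z) y := by
  cases y with
  | inl v => exact hy.move_inl hz h
  | inr j =>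
    cases z with
    | inl w =>
      refine fits_inr_iff.2 ⟨hz.region', ?_⟩
      rw [add_right_comm]
      exact (hz.move_inl hy (commutingLabels_comm h)).region'
    | inr l =>
      refine fits_inr_iff.2 ⟨hz.region', fun a b hab => ?_⟩
      -- A pair avoiding `j` or avoiding `l` sees only one of the two switches and is covered by the
      -- region at the end of that edge. The only other pair is `{j, l}`, which commutes.
      by_cases hj : a ≠ j ∧ b ≠ j
      · simp only [Pi.add_apply, switch_inr_of_ne hj.1, switch_inr_of_ne hj.2, add_zero]
        exact hz.region' a b hab
      by_cases hl : a ≠ l ∧ b ≠ l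
      · simp only [Pi.add_apply, switch_inr_of_ne hl.1, switch_inr_of_ne hl.2, add_zero]
        exact hy.region' a b hab
      left
      have hc : (P j).Commute (P l) := h.2
      have hc' := commute_comm.1 hc
      rw [not_and_or, not_not, not_not] at hj hl
      rcases hj with rfl | rfl <;> rcases hl with rfl | rfl
      · exact absurd hc (not_commute_self _)
      · exact hc
      · exact hc'
      · exact absurd hc (not_commute_self _)

theorem cubeVertex_zero {n : ℕ} (x : ι → ZMod 2) (ℓ : Fin n → BLabel V ι) :
    cubeVertex P x ℓ 0 = x := by
  simp [cubeVertex]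

theorem cubeVertex_single {n : ℕ} (x : ι → ZMod 2) (ℓ : Fin n → BLabel V ι) (j : Fin n) :
    cubeVertex P x ℓ (Pi.single j 1) = x + switch P (ℓ j) := by
  unfold cubeVertex
  rw [Finset.sum_eq_single j]
  · simp
  · intro i _ hi; simp [hi]
  · intro h; exact absurd (Finset.mem_univ _) h

/-- Induction on the support of `c`: each further coordinate crosses one edge, while `Fits.move`
preserves the edges in the other directions. Thus a cube is just a region with pairwise commuting
edges at it. -/
theorem fits_cubeVertex {n : ℕ} {x : ι → ZMod 2} {ℓ : Fin n → BLabel V ι}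
    (hc : ∀ i j, i ≠ j → CommutingLabels P (ℓ i) (ℓ j)) (hx : IsRegion P x)
    (h : ∀ j, Fits P x (ℓ j)) (S : Finset (Fin n)) :
    ∀ c : Fin n → ZMod 2, (∀ j ∉ S, c j = 0) → IsRegion P (cubeVertex P x ℓ c) ∧
      ∀ j, Fits P (cubeVertex P x ℓ c) (BLabel.twist (c j) (ℓ j)) := by
  induction S using Finset.induction_on with
  | empty =>
    intro c h0
    obtain rfl : c = 0 := funext fun j => h0 j (Finset.notMem_empty _)
    rw [cubeVertex_zero]
    exact ⟨hx, fun j => by simpa [BLabel.twist_zero] using h j⟩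
  | insert k S hk ih =>
    intro c h0
    rcases ZMod.two_cases (c k) with hck | hck
    · refine ih c fun j hj => ?_
      by_cases e : j = k
      · rw [e, hck]
      · exact h0 j (by simp [e, hj])
    · have hc0 : c = Function.update c k 0 + Pi.single k 1 := by
        funext j
        by_cases e : j = k
        · subst e; simp [hck]
        · simp [e]
      have hv : cubeVertex P x ℓ c =
          cubeVertex P x ℓ (Function.update c k 0) + switch P (ℓ k) := by
        conv_lhs => rw [hc0]
        have := cubeVertex_single (P := P) (cubeVertex P x ℓ (Function.update c k 0)) ℓ k
        rw [← this]
        simp only [cubeVertex, Pi.add_apply, add_smul, Finset.sum_add_distrib, add_assoc]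
      obtain ⟨h1, h2⟩ := ih (Function.update c k 0) fun j hj => by
        by_cases e : j = k
        · subst e; simp
        · rw [Function.update_of_ne e]
          exact h0 j (by simp [e, hj])
      have hk2 := h2 k
      rw [Function.update_self, BLabel.twist_zero] at hk2
      rw [hv]
      refine ⟨hk2.region', fun j => ?_⟩
      by_cases e : j = k
      · subst e
        rw [hck]
        exact hk2.twist
      · have hj2 := h2 j
        rw [Function.update_of_ne e] at hj2
        refine hj2.move hk2 ?_
        have := hc j k e
        rwa [← commutingLabels_twist P (c j) 0, BLabel.twist_zero] at this

/-- The cube with a given origin and given labels. -/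
def mkCube {n : ℕ} (x : ι → ZMod 2) (ℓ : Fin n → BLabel V ι)
    (hc : ∀ i j, i ≠ j → CommutingLabels P (ℓ i) (ℓ j)) (hx : IsRegion P x)
    (h : ∀ j, Fits P x (ℓ j)) : BlowupCube P n where
  origin := x
  label := ℓ
  commuting := hc
  region c := (fits_cubeVertex hc hx h Finset.univ c (by simp)).1
  departs c j := ((fits_cubeVertex hc hx h Finset.univ c (by simp)).2 j).departs

theorem BlowupCube.isRegion {n : ℕ} (C : BlowupCube P n) : IsRegion P C.origin := by
  have := C.region 0
  rwa [cubeVertex_zero] at this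

theorem BlowupCube.fits {n : ℕ} (C : BlowupCube P n) (j : Fin n) :
    Fits P C.origin (C.label j) where
  region := C.isRegion
  region' := by
    have := C.region (Pi.single j 1)
    rwa [cubeVertex_single] at this
  departs := by
    have := C.departs 0 j
    rwa [cubeVertex_zero, Pi.zero_apply, BLabel.twist_zero] at this

/-- The side of the `i`-th partition at a region is forced by the departure of an edge with
label `y`. -/
def Forces (P : ι → WhiteheadPartition Γ) (y : BLabel V ι) (i : ι) (b : ZMod 2) : Prop :=
  match y with
  | Sum.inl v => v.inv ∈ (P i).sideAt b
  | Sum.inr j => ∃ a, (P j).sideAt a ∩ (P i).sideAt (b + 1) = ∅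

theorem exists_forces (hP : IsCompatibleCollection P) {y : BLabel V ι} {i : ι}
    (h : ¬ CommutingLabels P y (Sum.inr i)) (hy : y ≠ Sum.inr i) : ∃ b, Forces P y i b := by
  cases y with
  | inl v => exact (P i).exists_mem_sideAt (x := v.inv) h
  | inr j =>
    have hij : j ≠ i := fun e => hy (congrArg Sum.inr e)
    obtain ⟨a, b, hab⟩ := exists_disjoint (hP j i hij).2 fun hc => h ⟨hij, hc⟩
    exact ⟨b + 1, a, by rwa [ZMod.two_add_one_add_one]⟩

theorem Forces.unique (hP : IsCompatibleCollection P) {y : BLabel V ι} {i : ι}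
    (h : ¬ CommutingLabels P y (Sum.inr i)) (hy : y ≠ Sum.inr i) {b b' : ZMod 2}
    (hb : Forces P y i b) (hb' : Forces P y i b') : b = b' := by
  cases y with
  | inl v => exact side_unique hb hb'
  | inr j =>
    have hij : j ≠ i := fun e => hy (congrArg Sum.inr e)
    obtain ⟨a, ha⟩ := hb
    obtain ⟨a', ha'⟩ := hb'
    exact add_right_cancel (disjoint_unique (hP j i hij).1 (fun hc => h ⟨hij, hc⟩) ha ha').2

/-- Provides a witness over the representative of the label, so that adjacency arguments can be
applied to a forced side. -/
theorem Forces.exists_mem {y : BLabel V ι} {i : ι} (h : ¬ CommutingLabels P y (Sum.inr i))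
    (hy : y ≠ Sum.inr i) {b : ZMod 2} (hb : Forces P y i b) :
    ∃ u : Letter V, u.1 = rep P (unoriented y) ∧ u ∈ (P i).sideAt b := by
  cases y with
  | inl v => exact ⟨v.inv, rfl, hb⟩
  | inr j =>
    have hij : j ≠ i := fun e => hy (congrArg Sum.inr e)
    obtain ⟨a, ha⟩ := hb
    have := subset_of_disjoint ha (fun hc => h ⟨hij, hc⟩) ((P j).baseAt_mem a)
    rw [ZMod.two_add_one_add_one] at this
    exact ⟨_, baseAt_fst _ _, this⟩

/-- For a partition edge, both sides of `P j` meet the chosen side of `P i`, so the chosen side is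
not the one that occurs in the disjoint pair. -/
theorem Fits.forces (hP : IsCompatibleCollection P) {x : ι → ZMod 2} {y : BLabel V ι}
    (hf : Fits P x y) {i : ι} (h : ¬ CommutingLabels P y (Sum.inr i)) (hy : y ≠ Sum.inr i) :
    Forces P y i (x i) := by
  cases y with
  | inl v => exact (hf.departs i).resolve_right h
  | inr j =>
    have hij : j ≠ i := fun e => hy (congrArg Sum.inr e)
    have hc : ¬ (P j).Commute (P i) := fun hc => h ⟨hij, hc⟩
    obtain ⟨a, b, hab⟩ := exists_disjoint (hP j i hij).2 hc
    have h1 := (hf.region j i hij).resolve_left hc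
    have h2 := (hf.region' j i hij).resolve_left hc
    rw [Pi.add_apply, Pi.add_apply, switch_inr_self, switch_inr_of_ne hij.symm, add_zero] at h2
    by_cases hb : b = x i
    · exfalso
      subst hb
      by_cases ha : a = x j
      · subst ha
        exact h1.ne_empty hab
      · rw [ZMod.two_eq_add_one ha] at hab
        exact h2.ne_empty hab
    · rw [ZMod.two_eq_add_one hb] at hab
      exact ⟨a, hab⟩

/-- Both regions take the forced side, and it is unique. This is the rigidity behind the description
of hyperplanes and of the base graphs: copies of an edge differ only in the commuting partitions and
in its own. -/
theorem Fits.determined (hP : IsCompatibleCollection P) {x x' : ι → ZMod 2} {y : BLabel V ι}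
    (hf : Fits P x y) (hf' : Fits P x' y) {i : ι} (h : ¬ CommutingLabels P y (Sum.inr i))
    (hy : y ≠ Sum.inr i) : x i = x' i :=
  (hf.forces hP h hy).unique hP h hy (hf'.forces hP h hy)

/-- `x'` is obtained from `x` by passing to the sides that are forced by an edge with label `y`. -/
structure IsProj (P : ι → WhiteheadPartition Γ) (y : BLabel V ι) (x x' : ι → ZMod 2) : Prop where
  commuting : ∀ i, CommutingLabels P y (Sum.inr i) → x' i = x i
  self : ∀ i, y = Sum.inr i → x' i = x i
  forces : ∀ i, ¬ CommutingLabels P y (Sum.inr i) → y ≠ Sum.inr i → Forces P y i (x' i)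

open Classical in
theorem exists_isProj (hP : IsCompatibleCollection P) (y : BLabel V ι) (x : ι → ZMod 2) :
    ∃ x', IsProj P y x x' := by
  refine ⟨fun i => if h : ¬ CommutingLabels P y (Sum.inr i) ∧ y ≠ Sum.inr i then
    (exists_forces hP h.1 h.2).choose else x i, fun i hi => ?_, fun i hi => ?_, fun i h1 h2 => ?_⟩
  · exact dif_neg fun h => h.1 hi
  · exact dif_neg fun h => h.2 hi
  · rw [dif_pos ⟨h1, h2⟩]
    exact (exists_forces hP h1 h2).choose_spec

/-- Sides forced by a letter share the inverse of that letter. Sides forced by a partition contain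
sides of it; if they contain the same one they share its base, and otherwise disjointness would make
two of the partitions equal. -/
theorem Forces.inter_nonempty (hP : IsCompatibleCollection P) {y : BLabel V ι} {i l : ι}
    (hi : ¬ CommutingLabels P y (Sum.inr i)) (hyi : y ≠ Sum.inr i)
    (hl : ¬ CommutingLabels P y (Sum.inr l)) (hyl : y ≠ Sum.inr l) {b c : ZMod 2}
    (hb : Forces P y i b) (hc : Forces P y l c) (hcom : ¬ (P i).Commute (P l)) :
    ((P i).sideAt b ∩ (P l).sideAt c).Nonempty := by
  cases y with
  | inl v => exact ⟨v.inv, hb, hc⟩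
  | inr j =>
    have hij : j ≠ i := fun e => hyi (congrArg Sum.inr e)
    have hlj : j ≠ l := fun e => hyl (congrArg Sum.inr e)
    have ci : ¬ (P j).Commute (P i) := fun h => hi ⟨hij, h⟩
    have cl : ¬ (P j).Commute (P l) := fun h => hl ⟨hlj, h⟩
    obtain ⟨a, ha⟩ := hb
    obtain ⟨a', ha'⟩ := hc
    have s := subset_of_disjoint ha ci
    have s' := subset_of_disjoint ha' cl
    rw [ZMod.two_add_one_add_one] at s s'
    by_cases e : a = a'
    · subst e
      exact ⟨_, s ((P j).baseAt_mem a), s' ((P j).baseAt_mem a)⟩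
    · rw [Set.nonempty_iff_ne_empty]
      intro h0
      obtain rfl := ZMod.two_eq_add_one e
      have t := subset_of_disjoint (by rwa [Set.inter_comm] at h0)
        (fun e => hcom (commute_comm.1 e))
      have t' := subset_of_disjoint (by rwa [Set.inter_comm] at ha)
        (fun e => ci (commute_comm.1 e))
      rw [ZMod.two_add_one_add_one] at t'
      -- The inclusions close up: the side `a'` of `P j` lies in the side `c` of `P l`, this in the
      -- side `b + 1` of `P i`, and this again in the side `a'` of `P j`.
      exact (hP j i hij).1 (samePartition_of_sideAt_eq ((s'.trans t).antisymm t'))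

/-- A forced side meets every side it has to meet: another forced side, either side of the partition
that labels the edge, and the sides of a commuting partition, whose link contains the representative
of the label. So only pairs of commuting partitions must be checked. -/
theorem isRegion_of_forces (hP : IsCompatibleCollection P) {y : BLabel V ι} {x' : ι → ZMod 2}
    (h : ∀ i l, i ≠ l → CommutingLabels P y (Sum.inr i) → CommutingLabels P y (Sum.inr l) →
      (P i).Commute (P l) ∨ ((P i).sideAt (x' i) ∩ (P l).sideAt (x' l)).Nonempty)
    (hf : ∀ i, ¬ CommutingLabels P y (Sum.inr i) → y ≠ Sum.inr i → Forces P y i (x' i)) :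
    IsRegion P x' := by
  -- one of the two partitions is forced
  have key : ∀ i l, i ≠ l → ¬ CommutingLabels P y (Sum.inr l) → y ≠ Sum.inr l →
      ¬ (P i).Commute (P l) → ((P i).sideAt (x' i) ∩ (P l).sideAt (x' l)).Nonempty := by
    intro i l hil hl hyl hcom
    by_cases hi : CommutingLabels P y (Sum.inr i)
    · obtain ⟨u, hu, hu'⟩ := (hf l hl hyl).exists_mem hl hyl
      rw [Set.inter_comm]
      refine inter_nonempty_of_mem_link (fun e => hcom (commute_comm.1 e)) hu' ?_
      rw [hu]
      exact rep_mem_link hi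
    · by_cases hyi : y = Sum.inr i
      · subst hyi
        rw [Set.nonempty_iff_ne_empty]
        intro h0
        obtain ⟨a, ha⟩ := hf l hl hyl
        -- The definition of forcing already provides a disjoint pair with the opposite side of `P
        -- l`, and there is only one disjoint pair.
        exact ZMod.two_add_one_ne _ (disjoint_unique (hP i l hil).1 hcom ha h0).2
      · exact Forces.inter_nonempty hP hi hyi hl hyl (hf i hi hyi) (hf l hl hyl) hcom
  intro i l hil
  by_cases hcom : (P i).Commute (P l)
  · exact Or.inl hcom
  by_cases hi : CommutingLabels P y (Sum.inr i)
  · by_cases hl : CommutingLabels P y (Sum.inr l)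
    · exact h i l hil hi hl
    · right
      refine key i l hil hl ?_ hcom
      rintro rfl
      exact hcom (commute_comm.1 hi.2)
  · by_cases hyi : y = Sum.inr i
    · right
      subst hyi
      refine key i l hil (fun e => hcom e.2) (fun e => hil (Sum.inr_injective e)) hcom
    · right
      rw [Set.inter_comm]
      exact key l i hil.symm hi hyi fun e => hcom (commute_comm.1 e)

theorem IsProj.fits (hP : IsCompatibleCollection P) {y : BLabel V ι} {x x' : ι → ZMod 2}
    (h : IsProj P y x x') (hx : IsRegion P x) : Fits P x' y := by
  have h1 : IsRegion P x' := by
    refine isRegion_of_forces hP (fun i l hil hi hl => ?_) h.forces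
    rw [h.commuting i hi, h.commuting l hl]
    exact hx i l hil
  cases y with
  | inl v =>
    refine fits_inl_iff.2 ⟨h1, fun i => ?_⟩
    by_cases hi : CommutingLabels P (Sum.inl v) (Sum.inr i)
    · exact Or.inr hi
    · exact Or.inl (h.forces i hi (by simp))
  | inr j =>
    refine fits_inr_iff.2 ⟨h1, ?_⟩
    have hs : ∀ i, (Sum.inr j : BLabel V ι) ≠ Sum.inr i →
        (x' + switch P (Sum.inr j)) i = x' i := by
      intro i hi
      rw [Pi.add_apply, switch_inr_of_ne, add_zero]
      rintro rfl
      exact hi rfl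
    -- The criterion does not depend on the chosen side of `P j`, so it applies to the other end of
    -- the edge as well.
    refine isRegion_of_forces (y := Sum.inr j) hP (fun i l hil hi hl => ?_) fun i hi hyi => ?_
    · rw [hs i fun e => hi.1 (Sum.inr_injective e), hs l fun e => hl.1 (Sum.inr_injective e)]
      exact h1 i l hil
    · rw [hs i hyi]
      exact h.forces i hi hyi

/-- A forced side contains a letter over the representative of `y`; a letter adjacent to it lies in
the same side unless it is in the link. For a partition edge, project both of its ends. -/
theorem IsProj.fits_of_commuting (hP : IsCompatibleCollection P) {y z : BLabel V ι}
    {x x' : ι → ZMod 2} (h : IsProj P y x x') (hz : Fits P x z) (hc : CommutingLabels P z y) :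
    Fits P x' z := by
  have h1 : IsRegion P x' := (h.fits hP hz.region).region
  have hadj := (commutingLabels_iff z y).1 hc
  cases z with
  | inl w =>
    refine fits_inl_iff.2 ⟨h1, fun i => ?_⟩
    by_cases hl : w.1 ∈ (P i).link
    · exact Or.inr hl
    left
    by_cases hi : CommutingLabels P y (Sum.inr i)
    · rw [h.commuting i hi]
      exact (hz.departs i).resolve_right hl
    · by_cases hyi : y = Sum.inr i
      · subst hyi
        exact absurd hc hl
      · obtain ⟨u, hu, hu'⟩ := (h.forces i hi hyi).exists_mem hi hyi
        refine mem_of_adj hu' ?_ hl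
        rw [hu]
        exact hadj
  | inr l =>
    refine fits_inr_iff.2 ⟨h1, ?_⟩
    refine (IsProj.fits hP (y := y) (x := x + switch P (Sum.inr l)) ?_ hz.region').region
    have hl := commutingLabels_comm hc
    refine ⟨fun i hi => ?_, fun i hi => ?_, fun i hi hyi => ?_⟩
    · rw [Pi.add_apply, Pi.add_apply, h.commuting i hi]
    · rw [Pi.add_apply, Pi.add_apply, h.self i hi]
    · rw [Pi.add_apply, switch_inr_of_ne, add_zero]
      · exact h.forces i hi hyi
      · rintro rfl
        exact hi hl

/-- Project to the labels one after the other; the edges obtained before survive because the labels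
commute. -/
theorem exists_fits (hP : IsCompatibleCollection P) {n : ℕ} {ℓ : Fin n → BLabel V ι}
    (hc : ∀ i j, i ≠ j → CommutingLabels P (ℓ i) (ℓ j)) {x : ι → ZMod 2} (hx : IsRegion P x)
    (S : Finset (Fin n)) : ∃ x', IsRegion P x' ∧ ∀ j ∈ S, Fits P x' (ℓ j) := by
  induction S using Finset.induction_on with
  | empty => exact ⟨x, hx, by simp⟩
  | insert k S hk ih =>
    obtain ⟨x', h1, h2⟩ := ih
    obtain ⟨x'', h3⟩ := exists_isProj hP (ℓ k) x'
    have h4 := h3.fits hP h1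
    refine ⟨x'', h4.region, fun j hj => ?_⟩
    rcases Finset.mem_insert.1 hj with rfl | hj'
    · exact h4
    · refine h3.fits_of_commuting hP (h2 j hj') (hc j k ?_)
      rintro rfl
      exact hk hj'

open Classical in
-- Partitions are added one at a time. If both sides of a new one are blocked, its two sides contain
-- chosen sides of two old partitions. If these do not commute, their chosen sides meet, which is
-- impossible; if they commute, their bases are adjacent and therefore on the same side of the new
-- partition.
theorem exists_isRegion [Finite ι] (P : ι → WhiteheadPartition Γ) : ∃ x, IsRegion P x := by
  have key : ∀ S : Finset ι, ∃ x : ι → ZMod 2, ∀ i ∈ S, ∀ j ∈ S, i ≠ j →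
      (P i).Commute (P j) ∨ ((P i).sideAt (x i) ∩ (P j).sideAt (x j)).Nonempty := by
    intro S
    induction S using Finset.induction_on with
    | empty => exact ⟨0, by simp⟩
    | insert k S hk ih =>
      obtain ⟨x, hx⟩ := ih
      suffices h : ∃ a, ∀ j ∈ S, (P k).Commute (P j) ∨
          ((P k).sideAt a ∩ (P j).sideAt (x j)).Nonempty by
        obtain ⟨a, ha⟩ := h
        refine ⟨Function.update x k a, fun i hi j hj hij => ?_⟩
        rcases Finset.mem_insert.1 hi with rfl | hi' <;>
          rcases Finset.mem_insert.1 hj with rfl | hj'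
        · exact absurd rfl hij
        · rw [Function.update_self, Function.update_of_ne hij.symm]
          exact ha j hj'
        · rw [Function.update_self, Function.update_of_ne hij, commute_comm, Set.inter_comm]
          exact ha i hi'
        · rw [Function.update_of_ne (by rintro rfl; exact hk hi'),
            Function.update_of_ne (by rintro rfl; exact hk hj')]
          exact hx i hi' j hj' hij
      by_contra hcon
      push Not at hcon
      obtain ⟨j, hj, hcj, hj0⟩ := hcon 0
      obtain ⟨l, hl, hcl, hl0⟩ := hcon 1
      have s := subset_of_disjoint (by rwa [Set.inter_comm] at hj0)
        (fun e => hcj (commute_comm.1 e))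
      have s' := subset_of_disjoint (by rwa [Set.inter_comm] at hl0)
        (fun e => hcl (commute_comm.1 e))
      have hd : ∀ u, u ∈ (P j).sideAt (x j) → u ∉ (P l).sideAt (x l) := fun u h h' =>
        absurd (side_unique (s h) (s' h')) (by decide)
      have hjl : j ≠ l := by
        rintro rfl
        exact hd _ ((P j).baseAt_mem _) ((P j).baseAt_mem _)
      rcases hx j hj l hl hjl with hc | ⟨u, h, h'⟩
      · have h1 := s ((P j).baseAt_mem _)
        have h2 := s' ((P l).baseAt_mem _)
        have h3 := mem_of_adj (v := (P l).baseAt (x l)) h1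
          (by rw [baseAt_fst, baseAt_fst]; exact ((commute_iff _ _).1 hc).symm) (notMem_link h2)
        exact absurd (side_unique h2 h3) (by decide)
      · exact hd u h h'
  have := Fintype.ofFinite ι
  obtain ⟨x, hx⟩ := key Finset.univ
  exact ⟨x, fun i j hij => hx i (Finset.mem_univ _) j (Finset.mem_univ _) hij⟩

/-- Between two regions there is a partition whose side can be switched. -/
theorem exists_flip [Finite ι] (hP : IsCompatibleCollection P) {x y : ι → ZMod 2}
    (hx : IsRegion P x) (hy : IsRegion P y) (hxy : x ≠ y) :
    ∃ i, x i ≠ y i ∧ Fits P x (Sum.inr i) := by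
  obtain ⟨i₀, hi₀⟩ := Function.ne_iff.1 hxy
  -- Among the partitions separating `x` from `y`, take one whose side at `x` is minimal. An
  -- obstruction to switching it would be a partition whose side at `x` lies inside: if it does not
  -- separate, the region `y` gives a contradiction, and if it does, minimality makes the sides
  -- equal.
  obtain ⟨i, hi, hmin⟩ := Set.Finite.exists_minimalFor (fun i => (P i).sideAt (x i))
    {i | x i ≠ y i} (Set.toFinite _) ⟨i₀, hi₀⟩
  refine ⟨i, hi, fits_inr_iff.2 ⟨hx, ?_⟩⟩
  have key : ∀ j, i ≠ j → ¬ (P i).Commute (P j) →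
      ((P i).sideAt (x i + 1) ∩ (P j).sideAt (x j)).Nonempty := by
    intro j hij hc
    rw [Set.nonempty_iff_ne_empty]
    intro h0
    have s := subset_of_disjoint (by rwa [Set.inter_comm] at h0)
      (fun e => hc (commute_comm.1 e))
    rw [ZMod.two_add_one_add_one] at s
    by_cases hj : x j = y j
    · have := (hy i j hij).resolve_left hc
      rw [← hj, ZMod.two_eq_add_one (Ne.symm hi), h0] at this
      exact Set.not_nonempty_empty this
    · exact (hP i j hij).1 (samePartition_of_sideAt_eq ((hmin hj s).antisymm s))
  intro a b hab
  by_cases hc : (P a).Commute (P b)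
  · exact Or.inl hc
  right
  simp only [Pi.add_apply]
  by_cases ha : a = i
  · subst ha
    rw [switch_inr_self, switch_inr_of_ne hab.symm, add_zero]
    exact key b hab hc
  · by_cases hb : b = i
    · subst hb
      rw [switch_inr_self, switch_inr_of_ne hab, add_zero, Set.inter_comm]
      exact key a hab.symm fun e => hc (commute_comm.1 e)
    · rw [switch_inr_of_ne ha, switch_inr_of_ne hb, add_zero, add_zero]
      exact (hx a b hab).resolve_left hc

end Regions

/-! ### Hyperplanes correspond to labels -/

theorem CubeComplex.hyp_face_eq (X : CubeComplex.{u}) (D : X.Cube 2) :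
    X.hyp (X.restr (FaceMap.face 0) D) = X.hyp (X.restr (FaceMap.face 1) D) := by
  rw [faceMap_one_eq (FaceMap.face 0), faceMap_one_eq (FaceMap.face 1)]
  exact X.hyp_eq D _ _ _

section Hyperplanes

variable {V : Type u} {Γ : SimpleGraph V} {ι : Type} {P : ι → WhiteheadPartition Γ}

open WhiteheadPartition

/-- Induction on the number of separating partitions. Only these are crossed, and they commute with
all labels in `Y`, so the edges labelled by `Y` are carried along at every stage. -/
theorem reflTransGen_flip [Finite ι] (hP : IsCompatibleCollection P) (Y : Set (BLabel V ι))
    {R : (ι → ZMod 2) → (ι → ZMod 2) → Prop} {x y : ι → ZMod 2} (hx : IsRegion P x)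
    (hY : ∀ z ∈ Y, Fits P x z) (hy : IsRegion P y)
    (hD : ∀ i, x i ≠ y i → ∀ z ∈ Y, CommutingLabels P z (Sum.inr i))
    (h : ∀ w i, x i ≠ y i → IsRegion P w → (∀ z ∈ Y, Fits P w z) → Fits P w (Sum.inr i) →
      R w (w + switch P (Sum.inr i))) : Relation.ReflTransGen R x y := by
  obtain ⟨n, hn⟩ : ∃ n, n = Set.ncard {i | x i ≠ y i} := ⟨_, rfl⟩
  induction n using Nat.strong_induction_on generalizing x with
  | _ n ih =>
    by_cases hxy : x = y
    · subst hxy; rfl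
    obtain ⟨i, hi, hf⟩ := exists_flip hP hx hy hxy
    have hsub : ∀ j, (x + switch P (Sum.inr i)) j ≠ y j → x j ≠ y j ∧ j ≠ i := by
      intro j hj
      by_cases e : j = i
      · subst e
        exfalso
        rw [Pi.add_apply, switch_inr_self, ZMod.two_eq_add_one hi] at hj
        exact hj (ZMod.two_add_one_add_one _)
      · rw [Pi.add_apply, switch_inr_of_ne e, add_zero] at hj
        exact ⟨hj, e⟩
    refine Relation.ReflTransGen.head (h x i hi hx hY hf) (ih _ ?_ hf.region'
      (fun z hz => (hY z hz).move hf (hD i hi z hz)) (fun j hj => hD j (hsub j hj).1)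
      (fun w j hj => h w j (hsub j hj).1) rfl)
    rw [hn]
    refine Set.ncard_lt_ncard ⟨fun j hj => (hsub j hj).1, fun hs => ?_⟩ (Set.toFinite _)
    exact (hsub i (hs hi)).2 rfl

/-- The cube with one more direction. -/
def BlowupCube.suspend {n : ℕ} (C : BlowupCube P n) (y : BLabel V ι)
    (hc : ∀ j, CommutingLabels P (C.label j) y) (hf : Fits P C.origin y) : (blowup P).Cube (n + 1) :=
  mkCube C.origin (Fin.cons y C.label)
    (by
      intro i j
      refine Fin.cases ?_ (fun i => ?_) i <;> refine Fin.cases ?_ (fun j => ?_) j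
      · intro h; exact absurd rfl h
      · intro _; exact commutingLabels_comm (hc j)
      · intro _; exact hc i
      · intro h
        exact C.commuting i j fun e => h (congrArg _ e))
    C.isRegion
    (by
      intro j
      refine Fin.cases ?_ (fun j => ?_) j
      · exact hf
      · exact C.fits j)

theorem BlowupCube.face_suspend_zero {n : ℕ} (C : BlowupCube P n) (y : BLabel V ι)
    (hc : ∀ j, CommutingLabels P (C.label j) y) (hf : Fits P C.origin y) :
    (blowup P).restr (FaceMap.face 0) (C.suspend y hc hf) = C := by
  apply BlowupCube.ext
  · change cubeVertex P C.origin (Fin.cons y C.label) (Fin.cons 0 0) = _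
    have : (Fin.cons 0 0 : Fin (n + 1) → ZMod 2) = 0 := by
      funext j; refine Fin.cases rfl (fun _ => rfl) j
    rw [this, cubeVertex_zero]
  · funext j
    exact BLabel.twist_zero _

theorem BlowupCube.origin_face_suspend_one {n : ℕ} (C : BlowupCube P n) (y : BLabel V ι)
    (hc : ∀ j, CommutingLabels P (C.label j) y) (hf : Fits P C.origin y) :
    BlowupCube.origin ((blowup P).restr (FaceMap.face 1) (C.suspend y hc hf)) =
      C.origin + switch P y := by
  change cubeVertex P C.origin (Fin.cons y C.label) (Fin.cons 1 0) = _
  have : (Fin.cons 1 0 : Fin (n + 1) → ZMod 2) = Pi.single 0 1 := by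
    funext j; refine Fin.cases rfl (fun _ => rfl) j
  rw [this, cubeVertex_single]
  rfl

theorem BlowupCube.label_face_suspend_one {n : ℕ} (C : BlowupCube P n) (y : BLabel V ι)
    (hc : ∀ j, CommutingLabels P (C.label j) y) (hf : Fits P C.origin y) :
    BlowupCube.label ((blowup P).restr (FaceMap.face 1) (C.suspend y hc hf)) = C.label := by
  funext j
  exact BLabel.twist_zero _

/-- The edge with a given label departing from a region. -/
def edgeAt (x : ι → ZMod 2) (y : BLabel V ι) (h : Fits P x y) : (blowup P).Edge :=
  mkCube x (fun _ => y) (fun i j h => absurd (Subsingleton.elim i j) h) h.region fun _ => h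

/-- The vertex given by a region. -/
def vertexAt (x : ι → ZMod 2) (h : IsRegion P x) : (blowup P).Vertex :=
  mkCube x Fin.elim0 (fun i => i.elim0) h fun i => i.elim0

theorem vertex_ext {x y : (blowup P).Vertex}
    (h : BlowupCube.origin x = BlowupCube.origin y) : x = y :=
  BlowupCube.ext h (funext fun i => i.elim0)

theorem edge_ext {e e' : (blowup P).Edge} (h : BlowupCube.origin e = BlowupCube.origin e')
    (h' : BlowupCube.label e 0 = BlowupCube.label e' 0) : e = e' :=
  BlowupCube.ext h (funext fun i => by rw [Subsingleton.elim i 0]; exact h')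

theorem origin_src (e : (blowup P).Edge) :
    BlowupCube.origin ((blowup P).src e) = BlowupCube.origin e :=
  cubeVertex_zero _ _

theorem cubeVertex_one (x : ι → ZMod 2) (ℓ : Fin 1 → BLabel V ι) :
    cubeVertex P x ℓ 1 = x + switch P (ℓ 0) := by
  simp [cubeVertex]

theorem origin_tgt (e : (blowup P).Edge) : BlowupCube.origin ((blowup P).tgt e) =
    BlowupCube.origin e + switch P (BlowupCube.label e 0) :=
  cubeVertex_one _ _

theorem origin_rev (e : (blowup P).Edge) : BlowupCube.origin ((blowup P).rev e) =
    BlowupCube.origin e + switch P (BlowupCube.label e 0) :=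
  cubeVertex_one _ _

theorem label_rev (e : (blowup P).Edge) : BlowupCube.label ((blowup P).rev e) 0 =
    BLabel.twist 1 (BlowupCube.label e 0) := rfl

theorem unoriented_twist (a : ZMod 2) (y : BLabel V ι) :
    unoriented (BLabel.twist a y) = unoriented y := by
  cases y with
  | inl v => exact congrArg Sum.inl (Letter.twist_fst a v)
  | inr i => rfl

theorem edgeLabel_restr {n : ℕ} (C : (blowup P).Cube n) (φ : FaceMap 1 n) :
    edgeLabel P ((blowup P).restr φ C) = unoriented (BlowupCube.label C (φ.axis 0)) :=
  unoriented_twist _ _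

theorem edgeLabel_rev (e : (blowup P).Edge) : edgeLabel P ((blowup P).rev e) = edgeLabel P e :=
  unoriented_twist _ _

/-- The common label of the edges dual to a hyperplane. -/
def hypLabel (P : ι → WhiteheadPartition Γ) : (blowup P).Hyperplane → V ⊕ ι :=
  Quot.lift (edgeLabel P) (by
    rintro _ _ ⟨C, c, d, j⟩
    rw [edgeLabel_restr, edgeLabel_restr]
    rfl)

theorem hypLabel_hyp (e : (blowup P).Edge) : hypLabel P ((blowup P).hyp e) = edgeLabel P e := rfl

/-- A function of the edges with a given oriented label that does not change across squares whose
other edges are labelled by partitions is constant. -/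
theorem eq_of_fits [Finite ι] (hP : IsCompatibleCollection P) {y : BLabel V ι} {α : Type*}
    (F : ∀ w, Fits P w y → α)
    (hF : ∀ w i (h : Fits P w y) (hi : Fits P w (Sum.inr i))
      (hc : CommutingLabels P y (Sum.inr i)),
      F w h = F (w + switch P (Sum.inr i)) (h.move hi hc))
    {w w' : ι → ZMod 2} (h : Fits P w y) (h' : Fits P w' y)
    (hi : ∀ i, y = Sum.inr i → w i = w' i) : F w h = F w' h' := by
  have hcom : ∀ i, w i ≠ w' i → CommutingLabels P y (Sum.inr i) := by
    intro i hwi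
    by_contra hc
    by_cases hzi : y = Sum.inr i
    · exact hwi (hi i hzi)
    · exact hwi (h.determined hP h' hc hzi)
  have key := reflTransGen_flip (R := fun u u' => ∃ (h : Fits P u y) (h' : Fits P u' y),
    F u h = F u' h') hP {y} h.region (by rintro z rfl; exact h) h'.region
    (by rintro i hxi z rfl; exact hcom i hxi)
    (fun u i hwi hu hz hui => ⟨hz y rfl, (hz y rfl).move hui (hcom i hwi), hF u i (hz y rfl) hui (hcom i hwi)⟩)
  suffices ∀ u, Relation.ReflTransGen _ w u → ∃ hu : Fits P u y, F w h = F u hu from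
    (this w' key).choose_spec
  intro u hu
  induction hu with
  | refl => exact ⟨h, rfl⟩
  | tail _ hs ih =>
    obtain ⟨_, ih⟩ := ih
    obtain ⟨_, h2, h3⟩ := hs
    exact ⟨h2, ih.trans h3⟩

theorem edgeAt_eq {e : (blowup P).Edge} {y : BLabel V ι} (hy : BlowupCube.label e 0 = y)
    (h : Fits P (BlowupCube.origin e) y) : edgeAt (BlowupCube.origin e) y h = e :=
  edge_ext rfl hy.symm

/-- Edges with the same oriented label are joined by a chain of squares whose other sides are
partition edges, and each square makes its opposite edges parallel. -/
theorem hyp_eq_of_fits [Finite ι] (hP : IsCompatibleCollection P) {e e' : (blowup P).Edge}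
    (h : BlowupCube.label e 0 = BlowupCube.label e' 0)
    (hi : ∀ i, BlowupCube.label e 0 = Sum.inr i →
      BlowupCube.origin e i = BlowupCube.origin e' i) :
    (blowup P).hyp e = (blowup P).hyp e' := by
  have hf' := BlowupCube.fits e' 0
  rw [← h] at hf'
  rw [← edgeAt_eq rfl (BlowupCube.fits e 0), ← edgeAt_eq h.symm hf']
  refine eq_of_fits hP (fun w hw => (blowup P).hyp (edgeAt w _ hw)) ?_ _ _ hi
  intro w i hw hwi hc
  have key := (blowup P).hyp_face_eq
    (BlowupCube.suspend (edgeAt w _ hw) (Sum.inr i) (fun _ => hc) hwi)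
  refine (congrArg _ (BlowupCube.face_suspend_zero (edgeAt w _ hw) _ (fun _ => hc)
    hwi)).symm.trans (key.trans (congrArg _ (BlowupCube.ext ?_ ?_)))
  · exact BlowupCube.origin_face_suspend_one (edgeAt w _ hw) _ (fun _ => hc) hwi
  · exact BlowupCube.label_face_suspend_one (edgeAt w _ hw) _ (fun _ => hc) hwi

/-- After reversing one of the edges if necessary, their oriented labels agree, and so does the
starting side in the case of a partition label. Hence every set of hyperplanes is the preimage of a
set of labels. -/
theorem hypLabel_injective [Finite ι] (hP : IsCompatibleCollection P) :
    Function.Injective (hypLabel P) := by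
  rintro ⟨e⟩ ⟨e'⟩ h
  change (blowup P).hyp e = (blowup P).hyp e'
  replace h : unoriented (BlowupCube.label e 0) = unoriented (BlowupCube.label e' 0) := h
  cases hy : BlowupCube.label e 0 with
  | inl v =>
    cases hy' : BlowupCube.label e' 0 with
    | inr i => rw [hy, hy'] at h; cases h
    | inl w =>
      rw [hy, hy'] at h
      rcases Letter.eq_or_eq_inv (Sum.inl_injective h) with rfl | rfl
      · exact hyp_eq_of_fits hP (hy.trans hy'.symm) fun i hi => by rw [hy] at hi; cases hi
      · rw [← (blowup P).hyp_rev e']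
        refine hyp_eq_of_fits hP ?_ fun i hi => by rw [hy] at hi; cases hi
        rw [label_rev, hy, hy']
        rfl
  | inr i =>
    cases hy' : BlowupCube.label e' 0 with
    | inl v => rw [hy, hy'] at h; cases h
    | inr j =>
      rw [hy, hy'] at h
      obtain rfl : i = j := Sum.inr_injective h
      by_cases ho : BlowupCube.origin e i = BlowupCube.origin e' i
      · refine hyp_eq_of_fits hP (hy.trans hy'.symm) fun l hl => ?_
        rw [hy] at hl
        cases hl
        exact ho
      · rw [← (blowup P).hyp_rev e']
        refine hyp_eq_of_fits hP ?_ fun l hl => ?_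
        · rw [label_rev, hy, hy']; rfl
        · rw [hy] at hl
          cases hl
          rw [origin_rev, hy', Pi.add_apply, switch_inr_self]
          exact ZMod.two_eq_add_one ho

theorem exists_fits_label [Finite ι] (hP : IsCompatibleCollection P) (y : BLabel V ι) :
    ∃ x, Fits P x y := by
  obtain ⟨x, hx⟩ := exists_isRegion P
  obtain ⟨x', hx'⟩ := exists_isProj hP y x
  exact ⟨x', hx'.fits hP hx⟩

theorem hypLabel_surjective [Finite ι] (hP : IsCompatibleCollection P) :
    Function.Surjective (hypLabel P) := by
  rintro (v | i)
  · obtain ⟨x, hx⟩ := exists_fits_label hP (Sum.inl (v, true))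
    exact ⟨(blowup P).hyp (edgeAt x _ hx), rfl⟩
  · obtain ⟨x, hx⟩ := exists_fits_label hP (Sum.inr i)
    exact ⟨(blowup P).hyp (edgeAt x _ hx), rfl⟩

theorem dualLabels_eq_image (H : Set (blowup P).Hyperplane) :
    dualLabels P H = hypLabel P '' H := by
  ext a
  constructor
  · rintro ⟨e, rfl, he⟩
    exact ⟨_, he, rfl⟩
  · rintro ⟨⟨e⟩, he, rfl⟩
    exact ⟨e, rfl, he⟩

theorem mem_iff_hypLabel_mem [Finite ι] (hP : IsCompatibleCollection P)
    {H : Set (blowup P).Hyperplane} {h : (blowup P).Hyperplane} :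
    h ∈ H ↔ hypLabel P h ∈ dualLabels P H := by
  rw [dualLabels_eq_image, (hypLabel_injective hP).mem_set_image]

theorem dualLabels_preimage [Finite ι] (hP : IsCompatibleCollection P) (A : Set (V ⊕ ι)) :
    dualLabels P (hypLabel P ⁻¹' A) = A := by
  rw [dualLabels_eq_image, Set.image_preimage_eq _ (hypLabel_surjective hP)]

theorem partitionHyperplanes_eq (J : Set ι) :
    partitionHyperplanes P J = hypLabel P ⁻¹' (Sum.inr '' J) := by
  ext h
  constructor
  · rintro ⟨e, i, hi, h1, rfl⟩
    exact ⟨i, hi, h1.symm⟩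
  · obtain ⟨e⟩ := h
    rintro ⟨i, hi, h1⟩
    exact ⟨e, i, hi, h1.symm, rfl⟩

end Hyperplanes

/-! ### Automorphisms of right-angled Artin groups in `Out_ℓ` -/

section Automorphisms

variable {V : Type u} {Γ : SimpleGraph V}

/-- The homomorphism from a right-angled Artin group given by its values on the generators. -/
def RAAG.lift {G : Type*} [Group G] (F : V → G)
    (hF : ∀ v w, Γ.Adj v w → F v * F w = F w * F v) : RAAG Γ →* G :=
  PresentedGroup.toGroup (f := F) (by
    rintro _ ⟨v, w, h, rfl⟩
    simp only [map_mul, map_inv, FreeGroup.lift_apply_of]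
    rw [hF v w h]
    group)

@[simp] theorem RAAG.lift_of {G : Type*} [Group G] (F : V → G)
    (hF : ∀ v w, Γ.Adj v w → F v * F w = F w * F v) (v : V) :
    RAAG.lift (Γ := Γ) F hF (PresentedGroup.of v) = F v :=
  PresentedGroup.toGroup.of _

theorem gen_true (v : V) : gen Γ (v, true) = PresentedGroup.of v := rfl

theorem gen_false (v : V) : gen Γ (v, false) = (PresentedGroup.of v)⁻¹ := rfl

theorem RAAG.lift_gen {G : Type*} [Group G] (F : Letter V → G)
    (hF : ∀ v w : Letter V, Γ.Adj v.1 w.1 → F v * F w = F w * F v)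
    (hi : ∀ v : Letter V, F v.inv = (F v)⁻¹) (v : Letter V) :
    RAAG.lift (Γ := Γ) (fun v => F (v, true)) (fun v w => hF (v, true) (w, true)) (gen Γ v) =
      F v := by
  obtain ⟨v, b⟩ := v
  cases b
  · rw [gen_false, map_inv, RAAG.lift_of, ← hi]
    rfl
  · rw [gen_true, RAAG.lift_of]

theorem RAAG.of_comm {v w : V} (h : Γ.Adj v w) : (PresentedGroup.of v : RAAG Γ) *
    PresentedGroup.of w = PresentedGroup.of w * PresentedGroup.of v :=
  gen_comm (v := (v, true)) (w := (w, true)) h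

theorem RAAG.hom_ext_of {G : Type*} [Group G] {f g : RAAG Γ →* G}
    (h : ∀ v, f (PresentedGroup.of v) = g (PresentedGroup.of v)) : f = g :=
  PresentedGroup.ext h

theorem mulAut_ext_of {f g : MulAut (RAAG Γ)}
    (h : ∀ v, f (PresentedGroup.of v) = g (PresentedGroup.of v)) : f = g := by
  ext x
  exact DFunLike.congr_fun (RAAG.hom_ext_of (f := f.toMonoidHom) (g := g.toMonoidHom) h) x

theorem mulAut_ext_gen {f g : MulAut (RAAG Γ)}
    (h : ∀ v, f (gen Γ v) = g (gen Γ v)) : f = g :=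
  mulAut_ext_of fun v => h (v, true)

/-- The automorphism given by its values and the values of its inverse on the generators. -/
def RAAG.aut (F G : V → RAAG Γ) (hF : ∀ v w, Γ.Adj v w → F v * F w = F w * F v)
    (hG : ∀ v w, Γ.Adj v w → G v * G w = G w * G v)
    (hFG : ∀ v, RAAG.lift F hF (G v) = PresentedGroup.of v)
    (hGF : ∀ v, RAAG.lift G hG (F v) = PresentedGroup.of v) : MulAut (RAAG Γ) :=
  MonoidHom.toMulEquiv (RAAG.lift F hF) (RAAG.lift G hG)
    (RAAG.hom_ext_of fun v => by rw [MonoidHom.comp_apply, RAAG.lift_of, hGF]; rfl)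
    (RAAG.hom_ext_of fun v => by rw [MonoidHom.comp_apply, RAAG.lift_of, hFG]; rfl)

@[simp] theorem RAAG.aut_of (F G : V → RAAG Γ) (hF : ∀ v w, Γ.Adj v w → F v * F w = F w * F v)
    (hG : ∀ v w, Γ.Adj v w → G v * G w = G w * G v)
    (hFG : ∀ v, RAAG.lift F hF (G v) = PresentedGroup.of v)
    (hGF : ∀ v, RAAG.lift G hG (F v) = PresentedGroup.of v) (v : V) :
    RAAG.aut F G hF hG hFG hGF (PresentedGroup.of v) = F v :=
  RAAG.lift_of F hF v

open Classical in
/-- The inversion of a generator. -/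
def inversion (Γ : SimpleGraph V) (a : V) : MulAut (RAAG Γ) :=
  have h : ∀ v w, Γ.Adj v w →
      (if v = a then (PresentedGroup.of v : RAAG Γ)⁻¹ else PresentedGroup.of v) *
        (if w = a then (PresentedGroup.of w : RAAG Γ)⁻¹ else PresentedGroup.of w) =
      (if w = a then (PresentedGroup.of w : RAAG Γ)⁻¹ else PresentedGroup.of w) *
        (if v = a then (PresentedGroup.of v : RAAG Γ)⁻¹ else PresentedGroup.of v) := by
    intro v w hvw
    have := gen_comm (v := (v, !decide (v = a))) (w := (w, !decide (w = a))) hvw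
    by_cases hv : v = a <;> by_cases hw : w = a <;> simp_all [gen]
  have h' : ∀ v, RAAG.lift _ h
      (if v = a then (PresentedGroup.of v : RAAG Γ)⁻¹ else PresentedGroup.of v) =
        PresentedGroup.of v := by
    intro v
    by_cases hv : v = a <;> simp [hv]
  RAAG.aut _ _ h h h' h'

open Classical in
theorem inversion_of (a v : V) : inversion Γ a (PresentedGroup.of v) =
    if v = a then (PresentedGroup.of v)⁻¹ else PresentedGroup.of v := by
  unfold inversion
  rw [RAAG.aut_of]

theorem inversion_of_self (a : V) : inversion Γ a (PresentedGroup.of a) =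
    (PresentedGroup.of a)⁻¹ := by
  rw [inversion_of, if_pos rfl]

theorem inversion_of_ne {a v : V} (h : v ≠ a) : inversion Γ a (PresentedGroup.of v) =
    PresentedGroup.of v := by
  rw [inversion_of, if_neg h]

theorem inversion_gen_self {m : Letter V} : inversion Γ m.1 (gen Γ m) = (gen Γ m)⁻¹ := by
  obtain ⟨a, b⟩ := m
  cases b <;> simp [gen_false, gen_true, inversion_of_self]

theorem inversion_gen_of_ne {a : V} {v : Letter V} (h : v.1 ≠ a) :
    inversion Γ a (gen Γ v) = gen Γ v := by
  obtain ⟨v, b⟩ := v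
  cases b <;> simp [gen_false, gen_true, inversion_of_ne h]

/-- The automorphisms whose outer class is in `Out_ℓ`. -/
def AutL (Γ : SimpleGraph V) : Subgroup (MulAut (RAAG Γ)) :=
  (OutL Γ).comap (QuotientGroup.mk' (Inn (RAAG Γ)))

theorem mem_AutL {f : MulAut (RAAG Γ)} : f ∈ AutL Γ ↔ outClass f ∈ OutL Γ := Iff.rfl

theorem mem_AutL_of_generator {f : MulAut (RAAG Γ)} (h : IsGraphAut Γ f ∨ IsInversion Γ f ∨
    IsPartialConjugation Γ f ∨ IsNonadjacentTransvection Γ f) : f ∈ AutL Γ :=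
  Subgroup.subset_closure ⟨f, h, rfl⟩

theorem inversion_mem (a : V) : inversion Γ a ∈ AutL Γ :=
  mem_AutL_of_generator (Or.inr (Or.inl ⟨a, inversion_of_self a, fun _ h => inversion_of_ne h⟩))

open Classical in
-- Induction on the set of inverted generators, composing with one inversion at a time.
theorem mem_AutL_of_signs (S : Finset V) : ∀ f : MulAut (RAAG Γ),
    (∀ v, f (PresentedGroup.of v) =
      if v ∈ S then (PresentedGroup.of v)⁻¹ else PresentedGroup.of v) → f ∈ AutL Γ := by
  induction S using Finset.induction_on with
  | empty =>
    intro f hf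
    obtain rfl : f = 1 := mulAut_ext_of fun v => by simp [hf v]
    exact one_mem _
  | insert a S ha ih =>
    intro f hf
    have h1 : f * inversion Γ a ∈ AutL Γ := by
      refine ih _ fun v => ?_
      rw [MulAut.mul_apply, inversion_of]
      by_cases hv : v = a
      · subst hv
        simp [ha, hf]
      · simp [hv, hf]
    have h2 := mul_mem h1 (inv_mem (inversion_mem a))
    rwa [mul_inv_cancel_right] at h2

/-! #### Shears -/

/-- The condition on the exponents of a shear `v ↦ w ^ (a v) * v * w ^ (b v)`. -/
structure ShearCond (Γ : SimpleGraph V) (w : V) (p : V → ℤ × ℤ) : Prop where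
  star : ∀ v ∈ st Γ w, p v = 0
  adj : ∀ u v, Γ.Adj u v → u ∉ st Γ w → v ∉ st Γ w → p u = p v ∧ (p u).2 = -(p u).1

theorem ShearCond.zero (w : V) : ShearCond Γ w 0 := ⟨fun _ _ => rfl, fun _ _ _ _ _ => ⟨rfl, rfl⟩⟩

theorem ShearCond.add {w : V} {p q : V → ℤ × ℤ} (hp : ShearCond Γ w p) (hq : ShearCond Γ w q) :
    ShearCond Γ w (p + q) where
  star v hv := by rw [Pi.add_apply, hp.star v hv, hq.star v hv, add_zero]
  adj u v h hu hv := by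
    have h1 := hp.adj u v h hu hv
    have h2 := hq.adj u v h hu hv
    refine ⟨by rw [Pi.add_apply, Pi.add_apply, h1.1, h2.1], ?_⟩
    rw [Pi.add_apply, Prod.snd_add, Prod.fst_add, h1.2, h2.2]
    ring

theorem ShearCond.neg {w : V} {p : V → ℤ × ℤ} (hp : ShearCond Γ w p) :
    ShearCond Γ w (-p) where
  star v hv := by rw [Pi.neg_apply, hp.star v hv, neg_zero]
  adj u v h hu hv := by
    have h1 := hp.adj u v h hu hv
    refine ⟨by rw [Pi.neg_apply, Pi.neg_apply, h1.1], ?_⟩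
    rw [Pi.neg_apply, Prod.snd_neg, Prod.fst_neg, h1.2]

/-- The image of a generator under a shear. -/
def shearFun (Γ : SimpleGraph V) (w : V) (p : V → ℤ × ℤ) (v : V) : RAAG Γ :=
  PresentedGroup.of w ^ (p v).1 * PresentedGroup.of v * PresentedGroup.of w ^ (p v).2

theorem shearFun_of_eq_zero {w : V} {p : V → ℤ × ℤ} {v : V} (h : p v = 0) :
    shearFun Γ w p v = PresentedGroup.of v := by
  simp [shearFun, h]

/-- A vertex in the star of `w` is fixed and commutes with `w`. Two adjacent vertices outside the
star are conjugated by the same power of `w`. -/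
theorem shearFun_comm {w : V} {p : V → ℤ × ℤ} (hp : ShearCond Γ w p) {u v : V}
    (h : Γ.Adj u v) : shearFun Γ w p u * shearFun Γ w p v =
      shearFun Γ w p v * shearFun Γ w p u := by
  have key : ∀ u v, Γ.Adj u v → v ∈ st Γ w →
      _root_.Commute (shearFun Γ w p u) (shearFun Γ w p v) := by
    intro u v h hv
    rw [shearFun_of_eq_zero (hp.star v hv)]
    have hw : _root_.Commute (PresentedGroup.of w : RAAG Γ) (PresentedGroup.of v) := by
      rcases hv with rfl | hv
      · exact _root_.Commute.refl _
      · exact RAAG.of_comm hv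
    have hu : _root_.Commute (PresentedGroup.of u : RAAG Γ) (PresentedGroup.of v) :=
      RAAG.of_comm h
    exact ((hw.zpow_left _).mul_left hu).mul_left (hw.zpow_left _)
  by_cases hv : v ∈ st Γ w
  · exact key u v h hv
  by_cases hu : u ∈ st Γ w
  · exact (key v u h.symm hu).symm
  obtain ⟨h1, h2⟩ := hp.adj u v h hu hv
  have := RAAG.of_comm (Γ := Γ) h
  simp only [shearFun, ← h1, h2]
  have e : ∀ a x y : RAAG Γ, a * x * a⁻¹ * (a * y * a⁻¹) = a * (x * y) * a⁻¹ := by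
    intro a x y; group
  rw [zpow_neg, e, e, this]

/-- A shear fixes `w`, so composing shears with the same `w` adds exponents. This makes the shears
in `Out_ℓ` an additive group of exponents. -/
theorem shearFun_lift {w : V} {p : V → ℤ × ℤ} (hp : ShearCond Γ w p) (q : V → ℤ × ℤ)
    (v : V) : RAAG.lift (shearFun Γ w p) (fun _ _ h => shearFun_comm hp h) (shearFun Γ w q v) =
      shearFun Γ w (p + q) v := by
  have hw : RAAG.lift (shearFun Γ w p) (fun _ _ h => shearFun_comm hp h)
      (PresentedGroup.of w) = PresentedGroup.of w := by
    rw [RAAG.lift_of, shearFun_of_eq_zero (hp.star w (Set.mem_insert _ _))]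
  conv_lhs => rw [shearFun]
  rw [map_mul, map_mul, map_zpow, map_zpow, hw, RAAG.lift_of]
  simp only [shearFun, Pi.add_apply, Prod.fst_add, Prod.snd_add, zpow_add]
  rw [(Commute.refl (PresentedGroup.of w : RAAG Γ)).zpow_zpow (p v).1 (q v).1]
  group

/-- The automorphism `v ↦ w ^ (a v) * v * w ^ (b v)`. -/
def shear {w : V} {p : V → ℤ × ℤ} (hp : ShearCond Γ w p) : MulAut (RAAG Γ) :=
  RAAG.aut (shearFun Γ w p) (shearFun Γ w (-p)) (fun _ _ h => shearFun_comm hp h)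
    (fun _ _ h => shearFun_comm hp.neg h)
    (fun v => by rw [shearFun_lift hp, shearFun_of_eq_zero]; simp)
    (fun v => by rw [shearFun_lift hp.neg, shearFun_of_eq_zero]; simp)

theorem shear_of {w : V} {p : V → ℤ × ℤ} (hp : ShearCond Γ w p) (v : V) :
    shear hp (PresentedGroup.of v) = shearFun Γ w p v :=
  RAAG.aut_of _ _ _ _ _ _ v

theorem shear_add {w : V} {p q : V → ℤ × ℤ} (hp : ShearCond Γ w p) (hq : ShearCond Γ w q) :
    shear (hp.add hq) = shear hp * shear hq := by
  refine mulAut_ext_of fun v => ?_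
  rw [MulAut.mul_apply, shear_of, shear_of]
  exact (shearFun_lift hp q v).symm

theorem shear_base {w : V} {p : V → ℤ × ℤ} (hp : ShearCond Γ w p) :
    shear hp (PresentedGroup.of w) = PresentedGroup.of w := by
  rw [shear_of, shearFun_of_eq_zero (hp.star w (Set.mem_insert _ _))]

/-- The exponents of the shears in `Out_ℓ`. -/
def shearGroup (Γ : SimpleGraph V) (w : V) : AddSubgroup (V → ℤ × ℤ) where
  carrier := {p | ∃ h : ShearCond Γ w p, shear h ∈ AutL Γ}
  zero_mem' := by
    refine ⟨ShearCond.zero w, ?_⟩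
    obtain h : shear (ShearCond.zero (Γ := Γ) w) = 1 := mulAut_ext_of fun v => by
      rw [shear_of, shearFun_of_eq_zero (Pi.zero_apply v)]; rfl
    rw [h]
    exact one_mem _
  add_mem' := by
    rintro p q ⟨hp, hp'⟩ ⟨hq, hq'⟩
    exact ⟨hp.add hq, by rw [shear_add hp hq]; exact mul_mem hp' hq'⟩
  neg_mem' := by
    rintro p ⟨hp, hp'⟩
    refine ⟨hp.neg, ?_⟩
    have h : shear hp * shear hp.neg = 1 := by
      rw [← shear_add]
      refine mulAut_ext_of fun v => ?_
      rw [shear_of, shearFun_of_eq_zero (by simp)]; rfl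
    rw [eq_inv_of_mul_eq_one_right h]
    exact inv_mem hp'

theorem ShearCond.single [DecidableEq V] {v w : V} (h : VLE Γ v w) (hv : v ∉ st Γ w) (a : ℤ × ℤ) :
    ShearCond Γ w (Pi.single v a) where
  star x hx := Pi.single_eq_of_ne (by rintro rfl; exact hv hx) _
  adj x y hxy hx hy := by
    rw [Pi.single_eq_of_ne (by rintro rfl; exact hy (h hxy)),
      Pi.single_eq_of_ne (by rintro rfl; exact hx (h hxy.symm))]
    exact ⟨rfl, rfl⟩

/-- The transvection has exponents `(0, 1)`; conjugating it by the inversion of `v` gives the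
multiplication on the left, with exponents `(-1, 0)`. These two generate. -/
theorem single_mem_shearGroup [DecidableEq V] {v w : V} (h : VLE Γ v w) (hv : v ∉ st Γ w)
    (a : ℤ × ℤ) : Pi.single v a ∈ shearGroup Γ w := by
  have hvw : v ≠ w := fun e => hv (e ▸ Set.mem_insert _ _)
  have hadj : ¬ Γ.Adj v w := fun e => hv (Set.mem_insert_of_mem _ e.symm)
  have hc := fun a => ShearCond.single (Γ := Γ) h hv a
  have h2 : shear (hc (0, 1)) ∈ AutL Γ := by
    refine mem_AutL_of_generator (Or.inr (Or.inr (Or.inr ⟨v, w, hvw, hadj, h, ?_, ?_⟩)))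
    · simp [shear_of, shearFun]
    · intro x hx
      rw [shear_of, shearFun_of_eq_zero (Pi.single_eq_of_ne hx _)]
  have h1 : shear (hc (-1, 0)) ∈ AutL Γ := by
    have : shear (hc (-1, 0)) = inversion Γ v * shear (hc (0, 1)) * inversion Γ v := by
      refine mulAut_ext_of fun x => ?_
      rw [MulAut.mul_apply, MulAut.mul_apply]
      by_cases hx : x = v
      · subst hx
        simp [inversion_of_self, inversion_of_ne hvw.symm, shear_of, shearFun]
      · rw [inversion_of_ne hx, shear_of, shear_of,
          shearFun_of_eq_zero (Pi.single_eq_of_ne hx _),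
          shearFun_of_eq_zero (Pi.single_eq_of_ne hx _), inversion_of_ne hx]
    rw [this]
    exact mul_mem (mul_mem (inversion_mem _) h2) (inversion_mem _)
  have e : (Pi.single v a : V → ℤ × ℤ) =
      (-a.1) • Pi.single v (-1, 0) + a.2 • Pi.single v (0, 1) := by
    rw [← Pi.single_smul, ← Pi.single_smul, ← Pi.single_add]
    congr 1
    ext <;> simp
  rw [e]
  exact add_mem (zsmul_mem (show _ ∈ shearGroup Γ w from ⟨_, h1⟩) _)
    (zsmul_mem (show _ ∈ shearGroup Γ w from ⟨_, h2⟩) _)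

theorem SameComponent.refl {w c : V} (h : c ∉ st Γ w) : SameComponent Γ w c c :=
  ⟨h, h, SimpleGraph.Reachable.refl _⟩

theorem SameComponent.adj {w c u v : V} (h : SameComponent Γ w c u) (huv : Γ.Adj u v)
    (hv : v ∉ st Γ w) : SameComponent Γ w c v := by
  obtain ⟨h1, h2, h3⟩ := h
  refine ⟨h1, hv, h3.trans (SimpleGraph.Adj.reachable ?_)⟩
  exact huv

theorem SameComponent.induction {w c : V} {Q : V → Prop} (hc : Q c)
    (h : ∀ u v, u ∉ st Γ w → v ∉ st Γ w → Γ.Adj u v → Q u → Q v) {x : V}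
    (hx : SameComponent Γ w c x) : Q x := by
  obtain ⟨h1, h2, ⟨W⟩⟩ := hx
  have key : ∀ a b : ↑((st Γ w)ᶜ), (Γ.induce (st Γ w)ᶜ).Walk a b → Q a.1 → Q b.1 := by
    intro a b W
    induction W with
    | nil => exact fun h => h
    | @cons a b _ hab _ ih => exact fun ha => ih (h _ _ a.2 b.2 hab ha)
  exact key _ _ W hc

open Classical in
/-- The exponents of a partial conjugation. -/
def componentExp (Γ : SimpleGraph V) (w c : V) : V → ℤ × ℤ :=
  fun x => if SameComponent Γ w c x then (1, -1) else 0

theorem componentExp_mem {w c : V} (hc : c ∉ st Γ w) : componentExp Γ w c ∈ shearGroup Γ w := by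
  have h : ShearCond Γ w (componentExp Γ w c) := by
    refine ⟨fun v hv => if_neg fun h => h.2.1 hv, fun u v huv hu hv => ?_⟩
    by_cases h : SameComponent Γ w c u
    · have h' := h.adj huv hv
      simp [componentExp, h, h']
    · have h' : ¬ SameComponent Γ w c v := fun h' => h (h'.adj huv.symm hu)
      simp [componentExp, h, h']
  refine ⟨h, mem_AutL_of_generator (Or.inr (Or.inr (Or.inl ⟨w, c, hc, fun x hx => ?_,
    fun x hx => ?_⟩)))⟩
  · rw [shear_of]
    simp [shearFun, componentExp, hx]
  · have h0 : componentExp Γ w c x = 0 := if_neg hx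
    rw [shear_of, shearFun_of_eq_zero h0]

/-- Induction on the support of `p`. If `v ≤ w`, the exponents at `v` alone can be removed by
transvections. Otherwise `v` has a neighbour outside the star of `w`, so its exponents are opposite
to each other and constant on its component, and a power of a partial conjugation removes them on
the whole component. -/
theorem mem_shearGroup [Finite V] {w : V} {p : V → ℤ × ℤ} (hp : ShearCond Γ w p) :
    p ∈ shearGroup Γ w := by
  classical
  obtain ⟨n, hn⟩ : ∃ n, n = Set.ncard {v | p v ≠ 0} := ⟨_, rfl⟩
  induction n using Nat.strong_induction_on generalizing p with
  | _ n ih =>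
    by_cases h0 : ∃ v, p v ≠ 0
    swap
    · push Not at h0
      rw [show p = 0 from funext h0]
      exact zero_mem _
    obtain ⟨v, hv⟩ := h0
    have hvs : v ∉ st Γ w := fun h => hv (hp.star v h)
    -- Subtracting such a `q` kills the exponents at `v` and creates no new ones, so the support
    -- shrinks.
    suffices h : ∃ q ∈ shearGroup Γ w, q v = p v ∧ ∀ x, q x = p x ∨ q x = 0 by
      obtain ⟨q, hq, hqv, hqx⟩ := h
      obtain ⟨hq', -⟩ := id hq
      have hlt : Set.ncard {x | (p + -q) x ≠ 0} < n := by
        rw [hn]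
        refine Set.ncard_lt_ncard ⟨fun x hx => ?_, fun hs => ?_⟩ (Set.toFinite _)
        · intro (h : p x = 0)
          rcases hqx x with e | e <;> simp [h, e] at hx
        · exact hs hv (by simp [hqv])
      have := add_mem (ih _ hlt (hp.add hq'.neg) rfl) hq
      rwa [neg_add_cancel_right] at this
    by_cases hle : VLE Γ v w
    · refine ⟨Pi.single v (p v), single_mem_shearGroup hle hvs _, Pi.single_eq_same _ _,
        fun x => ?_⟩
      by_cases hx : x = v
      · subst hx; simp
      · right; exact Pi.single_eq_of_ne hx _
    · obtain ⟨u, hu, hus⟩ := Set.not_subset.1 hle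
      have hv2 : (p v).2 = -(p v).1 := (hp.adj v u hu hvs hus).2
      have hpv : p v = ((p v).1, -(p v).1) := Prod.ext rfl hv2
      have hval : ∀ x, SameComponent Γ w v x → p x = p v := by
        intro x hx
        refine SameComponent.induction (Q := fun x => p x = p v) rfl ?_ hx
        intro a b ha hb hab e
        rw [← e, (hp.adj a b hab ha hb).1]
      refine ⟨(p v).1 • componentExp Γ w v, zsmul_mem (componentExp_mem hvs) _, ?_, fun x => ?_⟩
      · rw [Pi.smul_apply, componentExp, if_pos (SameComponent.refl hvs), hpv]
        simp
      · by_cases hx : SameComponent Γ w v x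
        · left
          rw [Pi.smul_apply, componentExp, if_pos hx, hval x hx, hpv]
          simp
        · right
          rw [Pi.smul_apply, componentExp, if_neg hx, smul_zero]

theorem shear_mem [Finite V] {w : V} {p : V → ℤ × ℤ} (hp : ShearCond Γ w p) :
    shear hp ∈ AutL Γ := (mem_shearGroup hp).2

/-! #### Whitehead automorphisms -/

open Classical in
/-- The indicator function of a set, with values in the integers. -/
def ind {α : Type*} (P : Set α) (x : α) : ℤ := if x ∈ P then 1 else 0

theorem ind_of_mem {α : Type*} {P : Set α} {x : α} (h : x ∈ P) : ind P x = 1 := if_pos h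

theorem ind_of_notMem {α : Type*} {P : Set α} {x : α} (h : x ∉ P) : ind P x = 0 := if_neg h

/-- The values of the Whitehead automorphism, written uniformly. -/
structure WhiteheadValues (P : Set (Letter V)) (m : Letter V) (f : MulAut (RAAG Γ)) : Prop where
  base : f (gen Γ m) = (gen Γ m)⁻¹
  other : ∀ v : Letter V, v.1 ≠ m.1 →
    f (gen Γ v) = gen Γ m ^ ind P v.inv * gen Γ v * gen Γ m ^ (-ind P v)

theorem WhiteheadValues.isWhiteheadAut {P : Set (Letter V)} {m : Letter V} {f : MulAut (RAAG Γ)}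
    (h : WhiteheadValues P m f) : IsWhiteheadAut Γ P m f where
  base := h.base
  left v hv h1 h2 := by rw [h.other v hv, ind_of_mem h1, ind_of_notMem h2]; simp
  right v hv h1 h2 := by rw [h.other v hv, ind_of_notMem h1, ind_of_mem h2]; simp
  both v hv h1 h2 := by rw [h.other v hv, ind_of_mem h1, ind_of_mem h2]; simp
  neither v hv h1 h2 := by rw [h.other v hv, ind_of_notMem h1, ind_of_notMem h2]; simp

/-- The base is inverted, so the second application produces the opposite powers of it and
everything cancels. -/
theorem WhiteheadValues.mul_self {P : Set (Letter V)} {m : Letter V} {f : MulAut (RAAG Γ)}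
    (h : WhiteheadValues P m f) : f * f = 1 := by
  refine mulAut_ext_gen fun v => ?_
  rw [MulAut.mul_apply, MulAut.one_apply]
  have hm : f (f (gen Γ m)) = gen Γ m := by rw [h.base, map_inv, h.base, inv_inv]
  by_cases hv : v.1 = m.1
  · rcases Letter.eq_or_eq_inv hv with rfl | rfl
    · exact hm
    · rw [gen_inv, map_inv, map_inv, hm]
  · rw [h.other v hv, map_mul, map_mul, map_zpow, map_zpow, h.base, h.other v hv]
    group

/-- Inverting the base first and shearing afterwards gives the prescribed values. The shear
condition holds since adjacent vertices outside the star of the base lie in `P` simultaneously, for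
all choices of signs. -/
theorem exists_whiteheadAut [Finite V] {P : Set (Letter V)} {m : Letter V}
    (h : IsWhiteheadPair Γ P m) :
    ∃ f : MulAut (RAAG Γ), f ∈ AutL Γ ∧ WhiteheadValues P m f := by
  classical
  obtain ⟨w, s⟩ := m
  have hlink : ∀ v : Letter V, v.1 ∈ lk Γ w → v ∉ P := fun v hv hvP =>
    h.not_adj v hvP (SimpleGraph.Adj.symm hv)
  -- The sign of the letter `m`: it converts powers of `m` into powers of the positive generator
  -- `w`.
  let ε : ℤ := if s then 1 else -1
  have hgen : ∀ n : ℤ, gen Γ (w, s) ^ n = PresentedGroup.of w ^ (ε * n) := by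
    intro n
    cases s <;> simp [gen, ε]
  let p : V → ℤ × ℤ := fun v => if v = w then 0 else (ε * ind P (v, false), -(ε * ind P (v, true)))
  have hp : ShearCond Γ w p := by
    refine ⟨fun v hv => ?_, fun u v huv hu hv => ?_⟩
    · by_cases hvw : v = w
      · exact if_pos hvw
      · have hvl := hv.resolve_left hvw
        simp only [p]
        rw [if_neg hvw, ind_of_notMem (hlink _ hvl), ind_of_notMem (hlink _ hvl)]
        simp
    · have hul : u ∉ lk Γ w := fun e => hu (Set.mem_insert_of_mem _ e)
      have hvl : v ∉ lk Γ w := fun e => hv (Set.mem_insert_of_mem _ e)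
      have huw : u ≠ w := fun e => hu (e ▸ Set.mem_insert _ _)
      have hvw : v ≠ w := fun e => hv (e ▸ Set.mem_insert _ _)
      have key : ∀ a b : Letter V, a.1 = u → b.1 = v → (a ∈ P ↔ b ∈ P) := by
        rintro ⟨_, a⟩ ⟨_, b⟩ rfl rfl
        exact ⟨fun e => h.mem_of_adj e huv.symm hvl, fun e => h.mem_of_adj e huv hul⟩
      have e1 : ∀ a b, ind P (u, a) = ind P (v, b) := by
        intro a b
        unfold ind
        exact if_congr (key _ _ rfl rfl) rfl rfl
      simp only [p, if_neg huw, if_neg hvw]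
      have e2 : ind P (v, false) = ind P (v, true) := (e1 true false).symm.trans (e1 true true)
      rw [e1 false true, e1 true true, e2]
      exact ⟨rfl, rfl⟩
  refine ⟨shear hp * inversion Γ w, mul_mem (shear_mem hp) (inversion_mem w), ?_, ?_⟩
  · rw [MulAut.mul_apply, show inversion Γ w (gen Γ (w, s)) = _ from
      inversion_gen_self (m := (w, s)), map_inv]
    congr 1
    have := shear_base hp
    cases s
    · rw [gen_false, map_inv, this]
    · exact this
  · rintro ⟨v, b⟩ (hv : v ≠ w)
    have hof : shear hp (PresentedGroup.of v) = PresentedGroup.of w ^ (ε * ind P (v, false)) *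
        PresentedGroup.of v * PresentedGroup.of w ^ (-(ε * ind P (v, true))) := by
      rw [shear_of, shearFun]
      simp only [p, if_neg hv]
    rw [MulAut.mul_apply, inversion_gen_of_ne hv, hgen, hgen, mul_neg]
    cases b
    · rw [gen_false, map_inv, hof]
      simp only [Letter.inv, Bool.not_false]
      group
    · exact hof

/-- The side of the partition separating a letter from everything outside its link. -/
def fullSide (Γ : SimpleGraph V) (m : Letter V) : Set (Letter V) :=
  {x | x.1 ∉ lk Γ m.1 ∧ x ≠ m.inv}

theorem isWhiteheadPair_fullSide {m u : Letter V} (hu : u.1 ∉ st Γ m.1) :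
    IsWhiteheadPair Γ (fullSide Γ m) m where
  mem := ⟨Γ.loopless.irrefl _, fun e => Letter.inv_ne m e.symm⟩
  inv_notMem h := h.2 rfl
  two_le := by
    refine ⟨m, ⟨Γ.loopless.irrefl _, fun e => Letter.inv_ne m e.symm⟩, u, ⟨fun h => hu ?_, ?_⟩, ?_⟩
    · exact Set.mem_insert_of_mem _ h
    · rintro rfl
      exact hu (Set.mem_insert _ _)
    · rintro rfl
      exact hu (Set.mem_insert _ _)
  not_adj x hx h := hx.1 h.symm
  le_of_single x hx hxi := by
    have : x.inv = m.inv := by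
      by_contra e
      exact hxi ⟨hx.1, e⟩
    have : x.inv.1 = m.inv.1 := by rw [this]
    change x.1 = m.1 at this
    rw [this]
    exact VLE.refl _ _
  component v _ _ w hw := by
    obtain ⟨-, h, -⟩ := hw
    exact ⟨fun e => h (Set.mem_insert_of_mem _ e), fun e => h (e ▸ Set.mem_insert _ _)⟩

/-- Generators in the link commute with `m`, so conjugating all others is the same as conjugating
everything. This exhibits the inversion of `m` as a Whitehead automorphism up to an inner one. -/
theorem WhiteheadValues.fullSide_apply {m : Letter V} {f : MulAut (RAAG Γ)}
    (h : WhiteheadValues (fullSide Γ m) m f) (g : RAAG Γ) :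
    f g = gen Γ m * inversion Γ m.1 g * (gen Γ m)⁻¹ := by
  suffices h' : f = MulAut.conj (gen Γ m) * inversion Γ m.1 by rw [h']; rfl
  refine mulAut_ext_gen fun v => ?_
  rw [MulAut.mul_apply, MulAut.conj_apply]
  by_cases hv : v.1 = m.1
  · rcases Letter.eq_or_eq_inv hv with rfl | rfl
    · rw [h.base, inversion_gen_self]; group
    · rw [gen_inv, map_inv, h.base, map_inv, inversion_gen_self]; group
  · rw [h.other v hv, inversion_gen_of_ne hv]
    by_cases hl : v.1 ∈ lk Γ m.1
    · rw [ind_of_notMem fun e => e.1 hl, ind_of_notMem fun e => e.1 hl, gen_comm hl]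
      group
    · have h1 : v ∈ fullSide Γ m := ⟨hl, by rintro rfl; exact hv rfl⟩
      have h2 : v.inv ∈ fullSide Γ m := ⟨hl, fun e => hv (congrArg Prod.fst e :)⟩
      rw [ind_of_mem h1, ind_of_mem h2]
      group

end Automorphisms

/-! ### Morphisms of the fundamental groupoid -/

namespace CubeComplex

theorem rev_rev (X : CubeComplex.{u}) (e : X.Edge) : X.rev (X.rev e) = e := by
  conv_rhs => rw [← X.edge_zero e]
  unfold rev
  rw [X.restr_comp]
  congr 1
  apply FaceMap.ext
  · funext i
    have h := (FaceMap.edge (1 : Fin 1 → ZMod 2) 0).axis.injective.extend_apply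
      (1 : Fin 1 → ZMod 2) 0 i
    change 1 + Function.extend (FaceMap.edge 1 0).axis (1 : Fin 1 → ZMod 2) 0 i = 0
    rw [show (FaceMap.edge (1 : Fin 1 → ZMod 2) 0).axis i = i from Subsingleton.elim _ _] at h
    rw [h]
    change (1 + 1 : ZMod 2) = 0
    decide
  · rfl

theorem Homotopic.cls_eq {X : CubeComplex.{u}} {x y : X.Vertex} {l l' : List X.Edge}
    (h : X.Homotopic x y l l') (h1 : X.IsPath x l y) (h2 : X.IsPath x l' y) :
    X.cls l h1 = X.cls l' h2 := h.choose_spec.choose_spec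

/-- The morphism of the fundamental groupoid given by an edge path. -/
def hom (X : CubeComplex.{u}) {x y : X.Grpd} (l : List X.Edge) (h : X.IsPath x l y) : x ⟶ y :=
  X.cls l h

theorem hom_append (X : CubeComplex.{u}) {x y z : X.Grpd} {l l' : List X.Edge}
    (h : X.IsPath x l y) (h' : X.IsPath y l' z) :
    X.hom (l ++ l') (X.isPath_append h h') = X.hom l h ≫ X.hom l' h' := rfl

theorem hom_cons (X : CubeComplex.{u}) {x y : X.Grpd} {e : X.Edge} {l : List X.Edge}
    (h : X.IsPath x (e :: l) y) :
    X.hom (e :: l) h = X.hom (x := x) (y := X.tgt e) [e] ⟨h.1, rfl⟩ ≫ X.hom l h.2 := rfl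

theorem exists_hom (X : CubeComplex.{u}) {x y : X.Grpd} (p : x ⟶ y) :
    ∃ l, ∃ h : X.IsPath x l y, p = X.hom l h := by
  obtain ⟨l, h⟩ := p
  exact ⟨l, h, rfl⟩

theorem hom_edge_rev (X : CubeComplex.{u}) {x y : X.Grpd} {e : X.Edge} (h : X.IsPath x [e] y)
    (h' : X.IsPath y [X.rev e] x) : X.hom [e] h ≫ X.hom [X.rev e] h' = 𝟙 x := by
  obtain ⟨rfl, -⟩ := h
  exact (X.homotopic_back e).cls_eq _ _

theorem isPath_rev (X : CubeComplex.{u}) {x y : X.Vertex} {e : X.Edge} (h : X.IsPath x [e] y) :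
    X.IsPath y [X.rev e] x :=
  ⟨(X.src_rev e).trans h.2, (X.tgt_rev e).trans h.1⟩

theorem hom_rev_edge (X : CubeComplex.{u}) {x y : X.Grpd} {e : X.Edge} (h : X.IsPath x [e] y)
    (h' : X.IsPath y [X.rev e] x) : X.hom [X.rev e] h' ≫ X.hom [e] h = 𝟙 y := by
  have := X.hom_edge_rev h' (X.isPath_rev h')
  simpa only [X.rev_rev] using this

/-- The isomorphism given by an edge. -/
def edgeIso (X : CubeComplex.{u}) {x y : X.Grpd} (e : X.Edge) (h : X.IsPath x [e] y) : x ≅ y where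
  hom := X.hom [e] h
  inv := X.hom [X.rev e] (X.isPath_rev h)
  hom_inv_id := X.hom_edge_rev _ _
  inv_hom_id := X.hom_rev_edge _ _

instance isIso_hom (X : CubeComplex.{u}) {x y : X.Grpd} (p : x ⟶ y) : IsIso p := by
  obtain ⟨l, h, rfl⟩ := X.exists_hom p
  induction l generalizing x with
  | nil =>
    obtain rfl : x = y := h
    exact (inferInstance : IsIso (𝟙 x))
  | cons e l ih =>
    rw [hom_cons]
    have h1 : X.IsPath x [e] (X.tgt e) := ⟨h.1, rfl⟩
    have : IsIso (X.hom [e] h1) := (X.edgeIso e h1).isIso_hom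
    have := ih (x := X.tgt e) h.2
    exact IsIso.comp_isIso

theorem map_hom_eq {X Y : CubeComplex.{u}} (F : CellMap X Y) {x y : X.Grpd} {l : List X.Edge}
    (h : X.IsPath x l y) :
    F.functor.map (X.hom l h) = Y.hom (l.flatMap F.onE) (F.isPath_flatMap h) := rfl

end CubeComplex

/-! ### The fundamental groupoid of the Salvetti complex and its self-maps -/

section PathElements

variable {V : Type u} {Γ : SimpleGraph V}

theorem salvetti_grpd_eq (x y : (salvetti Γ).Grpd) : x = y := salvetti_vertex_eq x y

/-- The vertex of the Salvetti complex as an object of the fundamental groupoid. -/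
def salvettiObj (Γ : SimpleGraph V) : (salvetti Γ).Grpd := salvettiPt Γ

theorem pathElement_hom {x y : (salvetti Γ).Grpd} (l : List (salvetti Γ).Edge)
    (h : (salvetti Γ).IsPath x l y) :
    pathElement ((salvetti Γ).hom l h) = (l.map fun e => gen Γ (e.1 0)).prod := rfl

theorem pathElement_id (x : (salvetti Γ).Grpd) : pathElement (𝟙 x) = 1 := rfl

theorem pathElement_comp {x y z : (salvetti Γ).Grpd} (p : x ⟶ y) (q : y ⟶ z) :
    pathElement (p ≫ q) = pathElement p * pathElement q := by
  obtain ⟨l, h, rfl⟩ := (salvetti Γ).exists_hom p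
  obtain ⟨l', h', rfl⟩ := (salvetti Γ).exists_hom q
  rw [← CubeComplex.hom_append, pathElement_hom, pathElement_hom, pathElement_hom, List.map_append,
    List.prod_append]

theorem pathElement_inv {x y : (salvetti Γ).Grpd} (p : x ⟶ y) :
    pathElement (CategoryTheory.inv p) = (pathElement p)⁻¹ := by
  rw [eq_inv_iff_mul_eq_one, ← pathElement_comp, IsIso.inv_hom_id, pathElement_id]

/-- The loop of the Salvetti complex given by a letter. -/
def letterEdge (Γ : SimpleGraph V) (v : Letter V) : (salvetti Γ).Edge :=
  ⟨fun _ => v, fun i j h => absurd (Subsingleton.elim i j) h⟩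

theorem letterEdge_eq (e : (salvetti Γ).Edge) : letterEdge Γ (e.1 0) = e :=
  Subtype.ext (funext fun i => by rw [Subsingleton.elim i 0]; rfl)

/-- The action of a right-angled Artin group on an object of a category by automorphisms. -/
def loopHom {C : Type*} [Category* C] {x : C} (γ : V → (x ≅ x))
    (hγ : ∀ v w, Γ.Adj v w → (γ v).hom ≫ (γ w).hom = (γ w).hom ≫ (γ v).hom) :
    RAAG Γ →* (Aut x)ᵐᵒᵖ :=
  -- Multiplication in `Aut x` composes in the order opposite to concatenation of paths, hence the
  -- opposite group.
  RAAG.lift (fun v => MulOpposite.op (γ v)) (by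
    intro v w h
    apply MulOpposite.unop_injective
    apply Iso.ext
    exact hγ v w h)

theorem loopHom_mul {C : Type*} [Category* C] {x : C} (γ : V → (x ≅ x))
    (hγ : ∀ v w, Γ.Adj v w → (γ v).hom ≫ (γ w).hom = (γ w).hom ≫ (γ v).hom) (a b : RAAG Γ) :
    (loopHom γ hγ (a * b)).unop.hom =
      (loopHom γ hγ a).unop.hom ≫ (loopHom γ hγ b).unop.hom := by
  rw [map_mul]; rfl

theorem loopHom_one {C : Type*} [Category* C] {x : C} (γ : V → (x ≅ x))
    (hγ : ∀ v w, Γ.Adj v w → (γ v).hom ≫ (γ w).hom = (γ w).hom ≫ (γ v).hom) :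
    (loopHom γ hγ (1 : RAAG Γ)).unop.hom = 𝟙 x := by
  rw [map_one]; rfl

theorem loopHom_gen {C : Type*} [Category* C] {x : C} (γ : V → (x ≅ x))
    (hγ : ∀ v w, Γ.Adj v w → (γ v).hom ≫ (γ w).hom = (γ w).hom ≫ (γ v).hom) (v : Letter V) :
    (loopHom γ hγ (gen Γ v)).unop.hom = if v.2 then (γ v.1).hom else (γ v.1).inv := by
  obtain ⟨v, b⟩ := v
  cases b
  · rw [gen_false, map_inv, loopHom, RAAG.lift_of]; rfl
  · rw [gen_true, loopHom, RAAG.lift_of]; rfl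

/-- The automorphism given by a loop of the Salvetti complex. -/
def salvettiIso (Γ : SimpleGraph V) (x : (salvetti Γ).Grpd) (v : V) : x ≅ x :=
  (salvetti Γ).edgeIso (letterEdge Γ (v, true)) (isPath_salvetti _ _ _)

theorem salvettiIso_comm (x : (salvetti Γ).Grpd) (v w : V) (h : Γ.Adj v w) :
    (salvettiIso Γ x v).hom ≫ (salvettiIso Γ x w).hom =
      (salvettiIso Γ x w).hom ≫ (salvettiIso Γ x v).hom := by
  have hsq : ∀ i j : Fin 2, i ≠ j → Γ.Adj ((![(v, true), (w, true)] : Fin 2 → Letter V) i).1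
      ((![(v, true), (w, true)] : Fin 2 → Letter V) j).1 := by
    intro i j hij
    fin_cases i <;> fin_cases j
    · exact absurd rfl hij
    · exact h
    · exact h.symm
    · exact absurd rfl hij
  exact (homotopic_salvetti _ _ x x ((salvetti Γ).homotopic_square ⟨_, hsq⟩)).cls_eq _ _

/-- The action of `A_Γ` on the vertex of the Salvetti complex. -/
def salvettiLoop (Γ : SimpleGraph V) (x : (salvetti Γ).Grpd) : RAAG Γ →* (Aut x)ᵐᵒᵖ :=
  loopHom (salvettiIso Γ x) (salvettiIso_comm x)

theorem salvettiLoop_gen (x : (salvetti Γ).Grpd) (v : Letter V) :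
    (salvettiLoop Γ x (gen Γ v)).unop.hom =
      (salvetti Γ).hom [letterEdge Γ v] (isPath_salvetti _ _ _) := by
  rw [salvettiLoop, loopHom_gen]
  obtain ⟨v, b⟩ := v
  cases b <;> rfl

theorem salvettiLoop_pathElement {x : (salvetti Γ).Grpd} (p : x ⟶ x) :
    (salvettiLoop Γ x (pathElement p)).unop.hom = p := by
  obtain ⟨l, h, rfl⟩ := (salvetti Γ).exists_hom p
  rw [pathElement_hom]
  induction l with
  | nil => exact loopHom_one _ _
  | cons e l ih =>
    rw [List.map_cons, List.prod_cons, salvettiLoop, loopHom_mul]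
    have h1 := ih (isPath_salvetti _ _ _)
    have h2 := salvettiLoop_gen x (e.1 0)
    rw [salvettiLoop] at h1 h2
    rw [h1, h2]
    simp only [letterEdge_eq]
    rfl

theorem pathElement_salvettiLoop (x : (salvetti Γ).Grpd) (g : RAAG Γ) :
    pathElement (salvettiLoop Γ x g).unop.hom = g := by
  let f : RAAG Γ →* RAAG Γ :=
    { toFun := fun g => pathElement (salvettiLoop Γ x g).unop.hom
      map_one' := by rw [map_one]; rfl
      map_mul' := fun a b => by
        rw [salvettiLoop, loopHom_mul, pathElement_comp] }
  have : f = MonoidHom.id _ := RAAG.hom_ext_of fun v => by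
    change pathElement (salvettiLoop Γ x (gen Γ (v, true))).unop.hom = _
    rw [salvettiLoop_gen, pathElement_hom, List.map_singleton, List.prod_singleton]
    rfl
  exact DFunLike.congr_fun this g

/-- The loops of the generators satisfy the commutation relations by the squares, so they define a
homomorphism from `A_Γ` to the loops at the vertex. It inverts the reading of paths. -/
theorem pathElement_bijective (x y : (salvetti Γ).Grpd) :
    Function.Bijective (pathElement : (x ⟶ y) → RAAG Γ) := by
  obtain rfl := salvetti_grpd_eq x y
  exact ⟨Function.LeftInverse.injective (g := fun g => (salvettiLoop Γ x g).unop.hom)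
    salvettiLoop_pathElement, Function.RightInverse.surjective
    (g := fun g => (salvettiLoop Γ x g).unop.hom) (pathElement_salvettiLoop x)⟩

/-- The morphism of the fundamental groupoid of the Salvetti complex that represents an element. -/
def elementHom (x y : (salvetti Γ).Grpd) (g : RAAG Γ) : x ⟶ y :=
  ((pathElement_bijective x y).2 g).choose

@[simp] theorem pathElement_elementHom (x y : (salvetti Γ).Grpd) (g : RAAG Γ) :
    pathElement (elementHom x y g) = g := ((pathElement_bijective x y).2 g).choose_spec

theorem pathElement_injective {x y : (salvetti Γ).Grpd} {p q : x ⟶ y}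
    (h : pathElement p = pathElement q) : p = q := (pathElement_bijective x y).1 h

/-- Functors to the fundamental groupoid of the Salvetti complex are isomorphic if they are
conjugate. -/
theorem nonempty_iso_of_conj {C : Type*} [Category* C] (F G : C ⥤ (salvetti Γ).Grpd)
    (g : C → RAAG Γ)
    (h : ∀ {x y : C} (p : x ⟶ y),
      pathElement (F.map p) * g y = g x * pathElement (G.map p)) : Nonempty (F ≅ G) :=
  ⟨NatIso.ofComponents (fun x => asIso (elementHom _ _ (g x))) fun p => by
    apply pathElement_injective
    rw [pathElement_comp, pathElement_comp, asIso_hom, asIso_hom, pathElement_elementHom,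
      pathElement_elementHom, h]⟩

theorem exists_conj_of_iso {C : Type*} [Category* C] {F G : C ⥤ (salvetti Γ).Grpd}
    (e : F ≅ G) : ∃ g : C → RAAG Γ, ∀ {x y : C} (p : x ⟶ y),
      pathElement (F.map p) * g y = g x * pathElement (G.map p) :=
  ⟨fun x => pathElement (e.hom.app x), fun p => by
    rw [← pathElement_comp, ← pathElement_comp, e.hom.naturality]⟩

theorem isEquivalence_of_bijective {C : Type*} [Category* C] [Nonempty C]
    (F : C ⥤ (salvetti Γ).Grpd)
    (h : ∀ x y : C, Function.Bijective fun p : x ⟶ y => pathElement (F.map p)) :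
    F.IsEquivalence where
  faithful := ⟨fun {_ _} _ _ e => (h _ _).1 (congrArg pathElement e)⟩
  full := ⟨fun {x y} p => by
    obtain ⟨q, hq⟩ := (h x y).2 (pathElement p)
    exact ⟨q, pathElement_injective hq⟩⟩
  essSurj := ⟨fun y => by
    obtain ⟨x⟩ := ‹Nonempty C›
    exact ⟨x, ⟨eqToIso (salvetti_grpd_eq _ _)⟩⟩⟩

/-- The self-map of the Salvetti complex that induces a given automorphism. -/
def realize (f : MulAut (RAAG Γ)) : (salvetti Γ).Grpd ⥤ (salvetti Γ).Grpd where
  obj x := x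
  map {x y} p := elementHom x y (f (pathElement p))
  map_id x := by
    apply pathElement_injective
    rw [pathElement_elementHom, pathElement_id, map_one]
  map_comp p q := by
    apply pathElement_injective
    rw [pathElement_elementHom, pathElement_comp, pathElement_comp, pathElement_elementHom,
      pathElement_elementHom, map_mul]

@[simp] theorem pathElement_realize (f : MulAut (RAAG Γ)) {x y : (salvetti Γ).Grpd} (p : x ⟶ y) :
    pathElement ((realize f).map p) = f (pathElement p) := pathElement_elementHom _ _ _

instance isEquivalence_realize (f : MulAut (RAAG Γ)) : (realize f).IsEquivalence :=
  isEquivalence_of_bijective _ fun x y => by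
    simp only [pathElement_realize]
    exact f.bijective.comp (pathElement_bijective x y)

theorem induces_realize (f : MulAut (RAAG Γ)) : Induces (realize f) f :=
  ⟨1, fun x y p => by simp⟩

theorem realize_comp (f g : MulAut (RAAG Γ)) :
    Nonempty (realize f ⋙ realize g ≅ realize (g * f)) :=
  nonempty_iso_of_conj _ _ (fun _ => 1) fun p => by
    simp

theorem realize_one : Nonempty (realize (1 : MulAut (RAAG Γ)) ≅ 𝟭 _) :=
  nonempty_iso_of_conj _ _ (fun _ => 1) fun p => by simp

/-- Self-maps up to natural isomorphism are automorphisms up to inner ones, so statements on induced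
automorphisms become isomorphisms of functors. -/
theorem induces_iff {F : (salvetti Γ).Grpd ⥤ (salvetti Γ).Grpd} {f : MulAut (RAAG Γ)} :
    Induces F f ↔ Nonempty (F ≅ realize f) := by
  constructor
  · rintro ⟨g, hg⟩
    exact nonempty_iso_of_conj _ _ (fun _ => g) fun p => by
      rw [hg, pathElement_realize, inv_mul_cancel_right]
  · rintro ⟨e⟩
    obtain ⟨g, hg⟩ := exists_conj_of_iso e
    -- There is only one vertex, so the family of conjugating elements is constant.
    refine ⟨g (salvettiObj Γ), fun x y p => ?_⟩
    have := hg p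
    rw [pathElement_realize, congrArg g (salvetti_grpd_eq x (salvettiObj Γ)),
      congrArg g (salvetti_grpd_eq y (salvettiObj Γ))] at this
    exact eq_mul_inv_of_mul_eq this

theorem outClass_eq_iff {f g : MulAut (RAAG Γ)} :
    outClass f = outClass g ↔ ∃ a : RAAG Γ, ∀ x, f x = a * g x * a⁻¹ := by
  unfold outClass
  rw [eq_comm, QuotientGroup.mk'_apply, QuotientGroup.mk'_apply, QuotientGroup.eq]
  constructor
  · rintro ⟨a, ha⟩
    refine ⟨g a, fun x => ?_⟩
    have : f = g * MulAut.conj a := by rw [ha]; group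
    rw [this, MulAut.mul_apply, MulAut.conj_apply]
    simp
  · rintro ⟨a, ha⟩
    refine ⟨g⁻¹ a, ?_⟩
    ext x
    rw [MulAut.mul_apply, MulAut.conj_apply, ha]
    simp

theorem Induces.iff_outClass {F : (salvetti Γ).Grpd ⥤ (salvetti Γ).Grpd} {f : MulAut (RAAG Γ)}
    (h : Induces F f) (g : MulAut (RAAG Γ)) : Induces F g ↔ outClass g = outClass f := by
  obtain ⟨a, ha⟩ := h
  rw [outClass_eq_iff]
  constructor
  · rintro ⟨b, hb⟩
    refine ⟨b⁻¹ * a, fun x => ?_⟩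
    have h1 := ha _ _ (elementHom (salvettiObj Γ) (salvettiObj Γ) x)
    have h3 := hb _ _ (elementHom (salvettiObj Γ) (salvettiObj Γ) x)
    rw [h1, pathElement_elementHom] at h3
    have h2 : g x = b⁻¹ * (b * g x * b⁻¹) * b := by group
    rw [h2, ← h3]
    group
  · rintro ⟨b, hb⟩
    refine ⟨a * b⁻¹, fun x y p => ?_⟩
    rw [ha, hb]
    group

end PathElements

/-! ### The canonical collapse is a homotopy equivalence -/

section Canonical

variable {V : Type u} {Γ : SimpleGraph V} {ι : Type} {P : ι → WhiteheadPartition Γ}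

open WhiteheadPartition

/-- The region of an object of the fundamental groupoid of the blow-up. -/
def region (x : (blowup P).Grpd) : ι → ZMod 2 := BlowupCube.origin (V := V) (n := 0) x

theorem isRegion_region (x : (blowup P).Grpd) : IsRegion P (region x) :=
  BlowupCube.isRegion (n := 0) x

/-- The object of the fundamental groupoid given by a region. -/
def objAt (x : ι → ZMod 2) (h : IsRegion P x) : (blowup P).Grpd := vertexAt x h

@[simp] theorem region_objAt (x : ι → ZMod 2) (h : IsRegion P x) : region (objAt x h) = x := rfl

theorem region_ext {x y : (blowup P).Grpd} (h : region x = region y) : x = y := vertex_ext h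

theorem isPath_singleton_iff {x y : (blowup P).Grpd} {e : (blowup P).Edge} :
    (blowup P).IsPath x [e] y ↔ BlowupCube.origin e = region x ∧
      region x + switch P (BlowupCube.label e 0) = region y := by
  constructor
  · rintro ⟨h1, h2⟩
    have h3 : BlowupCube.origin e = region x := by rw [← origin_src e, h1]; rfl
    refine ⟨h3, ?_⟩
    rw [← h3, ← origin_tgt e, show (blowup P).tgt e = y from h2]
    rfl
  · rintro ⟨h1, h2⟩
    refine ⟨vertex_ext ?_, vertex_ext ?_⟩
    · rw [origin_src]; exact h1
    · rw [origin_tgt, h1]; exact h2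

theorem isPath_edgeAt {x y : (blowup P).Grpd} {l : BLabel V ι} (h : Fits P (region x) l)
    (hy : region x + switch P l = region y) : (blowup P).IsPath x [edgeAt (region x) l h] y :=
  isPath_singleton_iff.2 ⟨rfl, hy⟩

theorem isPath_objAt {x : ι → ZMod 2} {l : BLabel V ι} (h : Fits P x l) :
    (blowup P).IsPath (objAt x h.region) [edgeAt x l h] (objAt (x + switch P l) h.region') :=
  isPath_singleton_iff.2 ⟨rfl, rfl⟩

theorem fits_of_isPath {x y : (blowup P).Grpd} {e : (blowup P).Edge}
    (h : (blowup P).IsPath x [e] y) : Fits P (region x) (BlowupCube.label e 0) := by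
  rw [← (isPath_singleton_iff.1 h).1]
  exact BlowupCube.fits e 0

/-- Opposite sides of a square. -/
theorem hom_square {a b c d : (blowup P).Grpd} {e f f' e' : (blowup P).Edge}
    (he : (blowup P).IsPath a [e] b) (hf' : (blowup P).IsPath b [f'] d)
    (hf : (blowup P).IsPath a [f] c) (he' : (blowup P).IsPath c [e'] d)
    (hl : BlowupCube.label e 0 = BlowupCube.label e' 0)
    (hl' : BlowupCube.label f 0 = BlowupCube.label f' 0)
    (hc : CommutingLabels P (BlowupCube.label e 0) (BlowupCube.label f 0)) :
    (blowup P).hom [e] he ≫ (blowup P).hom [f'] hf' =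
      (blowup P).hom [f] hf ≫ (blowup P).hom [e'] he' := by
  obtain ⟨h1, h2⟩ := isPath_singleton_iff.1 he
  obtain ⟨h3, h4⟩ := isPath_singleton_iff.1 hf'
  obtain ⟨h5, h6⟩ := isPath_singleton_iff.1 hf
  obtain ⟨h7, h8⟩ := isPath_singleton_iff.1 he'
  have hfe := fits_of_isPath he
  have hff := fits_of_isPath hf
  let s : (blowup P).Cube 2 := mkCube (region a) ![BlowupCube.label e 0, BlowupCube.label f 0]
    (by
      intro i j hij
      fin_cases i <;> fin_cases j
      · exact absurd rfl hij
      · exact hc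
      · exact commutingLabels_comm hc
      · exact absurd rfl hij)
    (isRegion_region a)
    (by
      intro j
      fin_cases j
      · exact hfe
      · exact hff)
  have hv : ∀ c j, BlowupCube.origin ((blowup P).restr (FaceMap.edge c j) s) =
      cubeVertex P (region a) ![BlowupCube.label e 0, BlowupCube.label f 0] c := fun _ _ => rfl
  have e1 : (blowup P).restr (FaceMap.edge 0 0) s = e := by
    refine edge_ext ?_ (BLabel.twist_zero _)
    rw [hv, cubeVertex_zero, h1]
  have e2 : (blowup P).restr (FaceMap.edge ![1, 0] 1) s = f' := by
    refine edge_ext ?_ ((BLabel.twist_zero _).trans hl')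
    rw [hv, h3, ← h2]
    have : (![1, 0] : Fin 2 → ZMod 2) = Pi.single 0 1 := by decide
    rw [this, cubeVertex_single]
    rfl
  have e3 : (blowup P).restr (FaceMap.edge 0 1) s = f := by
    refine edge_ext ?_ (BLabel.twist_zero _)
    rw [hv, cubeVertex_zero, h5]
  have e4 : (blowup P).restr (FaceMap.edge ![0, 1] 0) s = e' := by
    refine edge_ext ?_ ((BLabel.twist_zero _).trans hl)
    rw [hv, h7, ← h6]
    have : (![0, 1] : Fin 2 → ZMod 2) = Pi.single 1 1 := by decide
    rw [this, cubeVertex_single]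
    rfl
  have key := (blowup P).homotopic_square s
  obtain ⟨k1, k2, k3⟩ := key
  simp only [CubeComplex.sqFst, CubeComplex.sqSnd, e1, e2, e3, e4] at k1 k2 k3
  have ha : (blowup P).restr (FaceMap.vertex 0) s = a := k1.1.symm.trans he.1
  have hd : (blowup P).restr (FaceMap.vertex 1) s = d := k1.2.2.symm.trans hf'.2
  generalize (blowup P).restr (FaceMap.vertex 0) s = a' at *
  generalize (blowup P).restr (FaceMap.vertex 1) s = d' at *
  subst ha hd
  exact k3

/-- The number of partitions separating two regions. -/
def regionDist (x y : ι → ZMod 2) : ℕ := Set.ncard {i | x i ≠ y i}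

theorem regionDist_add_switch [Finite ι] {x₀ x : ι → ZMod 2} {i : ι} (h : x i = x₀ i) :
    regionDist x₀ (x + switch P (Sum.inr i)) = regionDist x₀ x + 1 := by
  have : {j | x₀ j ≠ (x + switch P (Sum.inr i)) j} = insert i {j | x₀ j ≠ x j} := by
    ext j
    by_cases hj : j = i
    · subst hj
      simp only [Set.mem_ofPred_eq, Pi.add_apply, switch_inr_self, h, Set.mem_insert_iff,
        true_or, iff_true]
      exact (ZMod.two_add_one_ne _).symm
    · simp [hj, switch_inr_of_ne hj]
  unfold regionDist
  rw [this, Set.ncard_insert_of_notMem _ (Set.toFinite _)]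
  intro hi
  exact hi h.symm

/-- Classes of geodesic paths of edges labelled by partitions. -/
def Geo (x₀ : (blowup P).Grpd) : ℕ → ∀ x : (blowup P).Grpd, (x₀ ⟶ x) → Prop
  | 0, x, p => ∃ h : x₀ = x, p = eqToHom h
  | n + 1, x, p => ∃ (y : (blowup P).Grpd) (q : x₀ ⟶ y) (i : ι) (e : (blowup P).Edge)
      (h : (blowup P).IsPath y [e] x), Geo x₀ n y q ∧ BlowupCube.label e 0 = Sum.inr i ∧
      region y i = region x₀ i ∧ p = q ≫ (blowup P).hom [e] h

theorem Geo.dist [Finite ι] {x₀ : (blowup P).Grpd} {n : ℕ} {x : (blowup P).Grpd} {p : x₀ ⟶ x}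
    (h : Geo x₀ n x p) : regionDist (region x₀) (region x) = n := by
  induction n generalizing x with
  | zero =>
    obtain ⟨rfl, -⟩ := h
    simp [regionDist]
  | succ n ih =>
    obtain ⟨y, q, i, e, he, hq, hl, hi, -⟩ := h
    rw [← (isPath_singleton_iff.1 he).2, hl, regionDist_add_switch hi, ih hq]

theorem exists_geo [Finite ι] (hP : IsCompatibleCollection P) (x₀ : (blowup P).Grpd) (n : ℕ) :
    ∀ x : (blowup P).Grpd, regionDist (region x₀) (region x) = n → ∃ p, Geo x₀ n x p := by
  induction n with
  | zero =>
    intro x hx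
    have : x₀ = x := by
      apply region_ext
      funext i
      by_contra hi
      have h0 := (Set.ncard_eq_zero (Set.toFinite _)).1 hx
      exact (h0 ▸ hi : i ∈ (∅ : Set ι))
    exact ⟨eqToHom this, this, rfl⟩
  | succ n ih =>
    intro x hx
    have hne : region x ≠ region x₀ := by
      intro h
      simp [regionDist, h] at hx
    obtain ⟨i, hi, hf⟩ := exists_flip hP (isRegion_region x) (isRegion_region x₀) hne
    let y : (blowup P).Grpd := objAt _ hf.region'
    have hyi : region y i = region x₀ i := by
      rw [region_objAt, Pi.add_apply, switch_inr_self, ZMod.two_eq_add_one hi,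
        ZMod.two_add_one_add_one]
    have hyx : region y + switch P (Sum.inr i) = region x := add_switch_switch _ _
    have hd := regionDist_add_switch (P := P) hyi
    rw [hyx, hx] at hd
    obtain ⟨q, hq⟩ := ih y (Nat.succ_injective hd).symm
    have hfy : Fits P (region y) (Sum.inr i) := hf.twist
    exact ⟨_, y, q, i, _, isPath_edgeAt hfy hyx, hq, rfl, hyi, rfl⟩

/-- All four combinations of sides are realized: at `x`, beyond each of the two edges, and at `x₀`,
which is opposite in both partitions. For non-commuting partitions one combination is empty. -/
theorem commute_of_flips (hP : IsCompatibleCollection P) {x₀ x : ι → ZMod 2} {i j : ι}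
    (hij : i ≠ j) (h₀ : IsRegion P x₀) (hi : Fits P x (Sum.inr i)) (hj : Fits P x (Sum.inr j))
    (hxi : x i ≠ x₀ i) (hxj : x j ≠ x₀ j) : (P i).Commute (P j) := by
  by_contra hc
  obtain ⟨a, b, hab⟩ := exists_disjoint (hP i j hij).2 hc
  have h1 := (hi.region i j hij).resolve_left hc
  have h2 := (hi.region' i j hij).resolve_left hc
  have h3 := (hj.region' i j hij).resolve_left hc
  have h4 := (h₀ i j hij).resolve_left hc
  simp only [Pi.add_apply, switch_inr_self, switch_inr_of_ne hij, switch_inr_of_ne hij.symm,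
    add_zero] at h2 h3
  rw [ZMod.two_eq_add_one hxi.symm, ZMod.two_eq_add_one hxj.symm] at h4
  by_cases ha : a = x i <;> by_cases hb : b = x j
  · subst ha hb; exact h1.ne_empty hab
  · rw [ZMod.two_eq_add_one hb] at hab; subst ha; exact h3.ne_empty hab
  · rw [ZMod.two_eq_add_one ha] at hab; subst hb; exact h2.ne_empty hab
  · rw [ZMod.two_eq_add_one ha, ZMod.two_eq_add_one hb] at hab; exact h4.ne_empty hab

/-- Induction on the length. Two different last steps belong to commuting partitions and bound a
square at `x`. Its opposite vertex is one step closer to `x₀` than their starting points, so by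
induction both paths may be taken through it, and they differ by this square. -/
theorem Geo.unique [Finite ι] (hP : IsCompatibleCollection P) {x₀ : (blowup P).Grpd} {n : ℕ} :
    ∀ {x : (blowup P).Grpd} {p q : x₀ ⟶ x}, Geo x₀ n x p → Geo x₀ n x q → p = q := by
  induction n with
  | zero =>
    rintro x _ _ ⟨_, rfl⟩ ⟨_, rfl⟩
    rfl
  | succ n ih =>
    rintro x _ _ ⟨y, p, i, e, he, hp, hei, hyi, rfl⟩ ⟨z, q, j, f, hf, hq, hfj, hzj, rfl⟩
    obtain ⟨e1, e2⟩ := isPath_singleton_iff.1 he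
    obtain ⟨f1, f2⟩ := isPath_singleton_iff.1 hf
    have hfe := fits_of_isPath he
    have hff := fits_of_isPath hf
    rw [hei] at e2 hfe
    rw [hfj] at f2 hff
    have hye : region y = region x + switch P (Sum.inr i) := by rw [← e2, add_switch_switch]
    have hzf : region z = region x + switch P (Sum.inr j) := by rw [← f2, add_switch_switch]
    by_cases hij : i = j
    · subst hij
      obtain rfl : y = z := region_ext (hye.trans hzf.symm)
      obtain rfl : e = f := edge_ext (e1.trans f1.symm) (hei.trans hfj.symm)
      rw [ih hp hq]
    · have hxi : Fits P (region x) (Sum.inr i) := by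
        have := hfe.twist; rwa [e2] at this
      have hxj : Fits P (region x) (Sum.inr j) := by
        have := hff.twist; rwa [f2] at this
      have n1 : region x i ≠ region x₀ i := by
        rw [← e2, Pi.add_apply, switch_inr_self, hyi]
        exact ZMod.two_add_one_ne _
      have n2 : region x j ≠ region x₀ j := by
        rw [← f2, Pi.add_apply, switch_inr_self, hzj]
        exact ZMod.two_add_one_ne _
      have hc := commute_of_flips hP hij (isRegion_region x₀) hxi hxj n1 n2
      have hcl : CommutingLabels P (Sum.inr i) (Sum.inr j) := ⟨hij, hc⟩
      -- the opposite vertex of the square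
      have hyj : Fits P (region y) (Sum.inr j) := by
        rw [hye]; exact hxj.move hxi (commutingLabels_comm hcl)
      let w : (blowup P).Grpd := objAt _ hyj.region'
      have hwy : region w + switch P (Sum.inr j) = region y := add_switch_switch _ _
      have hwz : region w + switch P (Sum.inr i) = region z := by
        rw [hzf, region_objAt, hye, add_right_comm, add_switch_switch]
      have hwj : Fits P (region w) (Sum.inr j) := hyj.twist
      have hwi : Fits P (region w) (Sum.inr i) := by
        have : Fits P (region z) (Sum.inr i) := by
          rw [hzf]; exact hxi.move hxj hcl
        have := this.twist
        rwa [← hwz, add_switch_switch] at this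
      have wi : region w i = region x₀ i := by
        rw [← hyi, ← hwy, Pi.add_apply, switch_inr_of_ne hij, add_zero]
      have wj : region w j = region x₀ j := by
        rw [← hzj, ← hwz, Pi.add_apply, switch_inr_of_ne (Ne.symm hij), add_zero]
      have hd := regionDist_add_switch (P := P) wj
      rw [hwy, hp.dist] at hd
      obtain ⟨r, hr⟩ := exists_geo hP x₀ _ w rfl
      have g1 : Geo x₀ n y (r ≫ (blowup P).hom _ (isPath_edgeAt hwj hwy)) := by
        rw [hd]
        exact ⟨w, r, j, _, _, hr, rfl, wj, rfl⟩
      have g2 : Geo x₀ n z (r ≫ (blowup P).hom _ (isPath_edgeAt hwi hwz)) := by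
        rw [hd]
        exact ⟨w, r, i, _, _, hr, rfl, wi, rfl⟩
      rw [ih hp g1, ih hq g2, Category.assoc, Category.assoc]
      congr 1
      exact hom_square _ _ _ _ hfj.symm hei.symm (commutingLabels_comm hcl)

/-- The class of the geodesic paths to a region. -/
def geodesic [Finite ι] (hP : IsCompatibleCollection P) (x₀ x : (blowup P).Grpd) : x₀ ⟶ x :=
  (exists_geo hP x₀ _ x rfl).choose

theorem geo_geodesic [Finite ι] (hP : IsCompatibleCollection P) (x₀ x : (blowup P).Grpd) :
    Geo x₀ (regionDist (region x₀) (region x)) x (geodesic hP x₀ x) :=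
  (exists_geo hP x₀ _ x rfl).choose_spec

/-- Either the edge or its reverse leads away from `x₀` and extends a geodesic to a geodesic. So
partition edges become trivial when closed up with geodesics. -/
theorem geodesic_edge [Finite ι] (hP : IsCompatibleCollection P) (x₀ : (blowup P).Grpd)
    {x y : (blowup P).Grpd} {e : (blowup P).Edge} (h : (blowup P).IsPath x [e] y) {i : ι}
    (hi : BlowupCube.label e 0 = Sum.inr i) :
    geodesic hP x₀ x ≫ (blowup P).hom [e] h = geodesic hP x₀ y := by
  have key : ∀ {x y : (blowup P).Grpd} {e : (blowup P).Edge} (h : (blowup P).IsPath x [e] y),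
      BlowupCube.label e 0 = Sum.inr i → region x i = region x₀ i →
      geodesic hP x₀ x ≫ (blowup P).hom [e] h = geodesic hP x₀ y := by
    intro x y e h hi hx
    have hd := regionDist_add_switch (P := P) hx
    have h2 := (isPath_singleton_iff.1 h).2
    rw [hi] at h2
    rw [h2] at hd
    refine Geo.unique hP (n := regionDist (region x₀) (region y)) ?_ (geo_geodesic hP x₀ y)
    rw [hd]
    exact ⟨x, _, i, e, h, geo_geodesic hP x₀ x, hi, hx, rfl⟩
  by_cases hx : region x i = region x₀ i
  · exact key h hi hx
  · have h' := (blowup P).isPath_rev h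
    have hl : BlowupCube.label ((blowup P).rev e) 0 = Sum.inr i := by rw [label_rev, hi]; rfl
    have hy : region y i = region x₀ i := by
      rw [← (isPath_singleton_iff.1 h).2, hi, Pi.add_apply, switch_inr_self,
        ZMod.two_eq_add_one hx, ZMod.two_add_one_add_one]
    have := key h' hl hy
    rw [← this, Category.assoc, CubeComplex.hom_rev_edge, Category.comp_id]

/-- The element of `A_Γ` read along an edge with a given label by the canonical collapse. -/
def labelElement (Γ : SimpleGraph V) : BLabel V ι → RAAG Γ
  | Sum.inl v => gen Γ v
  | Sum.inr _ => 1

/-- The element of `A_Γ` read along an edge path of the blow-up. -/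
theorem pathElement_canonical {x y : (blowup P).Grpd} (l : List (blowup P).Edge)
    (h : (blowup P).IsPath x l y) :
    pathElement ((canonicalFunctor P).map ((blowup P).hom l h)) =
      (l.map fun e => labelElement Γ (BlowupCube.label e 0)).prod := by
  change ((l.flatMap (canonicalMap P).onE).map fun e => gen Γ (e.1 0)).prod = _
  clear h
  induction l with
  | nil => rfl
  | cons e l ih =>
    have he : ((labelWord Γ (BlowupCube.label e 0)).map fun e => gen Γ (e.1 0)).prod =
        labelElement Γ (BlowupCube.label e 0) := by
      cases BlowupCube.label e 0 with
      | inl v => exact List.prod_singleton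
      | inr i => rfl
    rw [List.flatMap_cons, List.map_append, List.prod_append, ih]
    exact (congrArg (· * _) he).trans List.prod_cons.symm

theorem pathElement_canonical_edge {x y : (blowup P).Grpd} (e : (blowup P).Edge)
    (h : (blowup P).IsPath x [e] y) :
    pathElement ((canonicalFunctor P).map ((blowup P).hom [e] h)) =
      labelElement Γ (BlowupCube.label e 0) :=
  (pathElement_canonical [e] h).trans List.prod_singleton

theorem Geo.pathElement_eq_one {x₀ : (blowup P).Grpd} {n : ℕ} : ∀ {x : (blowup P).Grpd}
    {p : x₀ ⟶ x}, Geo x₀ n x p → pathElement ((canonicalFunctor P).map p) = 1 := by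
  induction n with
  | zero =>
    rintro x _ ⟨rfl, rfl⟩
    rw [eqToHom_refl, CategoryTheory.Functor.map_id, pathElement_id]
  | succ n ih =>
    rintro x _ ⟨y, q, i, e, he, hq, hei, -, rfl⟩
    rw [Functor.map_comp, pathElement_comp, ih hq, pathElement_canonical_edge, one_mul, hei]
    rfl

/-- The loop obtained by closing up an edge with geodesics. -/
def edgeLoop [Finite ι] (hP : IsCompatibleCollection P) (x₀ : (blowup P).Grpd)
    {x y : (blowup P).Grpd} (e : (blowup P).Edge) (h : (blowup P).IsPath x [e] y) : x₀ ≅ x₀ :=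
  asIso (geodesic hP x₀ x) ≪≫ (blowup P).edgeIso e h ≪≫ (asIso (geodesic hP x₀ y)).symm

theorem edgeLoop_hom [Finite ι] (hP : IsCompatibleCollection P) (x₀ : (blowup P).Grpd)
    {x y : (blowup P).Grpd} (e : (blowup P).Edge) (h : (blowup P).IsPath x [e] y) :
    (edgeLoop hP x₀ e h).hom =
      geodesic hP x₀ x ≫ (blowup P).hom [e] h ≫ CategoryTheory.inv (geodesic hP x₀ y) := rfl

theorem edgeLoop_inv [Finite ι] (hP : IsCompatibleCollection P) (x₀ : (blowup P).Grpd)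
    {x y : (blowup P).Grpd} (e : (blowup P).Edge) (h : (blowup P).IsPath x [e] y) :
    (edgeLoop hP x₀ e h).inv = (edgeLoop hP x₀ _ ((blowup P).isPath_rev h)).hom :=
  Category.assoc _ _ _

/-- Neighbouring copies of the edge are opposite sides of a square, and the other two sides, being
partition edges, are absorbed by the geodesics. -/
theorem edgeLoop_eq [Finite ι] (hP : IsCompatibleCollection P) (x₀ : (blowup P).Grpd)
    {x y x' y' : (blowup P).Grpd} {e e' : (blowup P).Edge} (h : (blowup P).IsPath x [e] y)
    (h' : (blowup P).IsPath x' [e'] y') {v : Letter V}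
    (hv : BlowupCube.label e 0 = Sum.inl v) (hv' : BlowupCube.label e' 0 = Sum.inl v) :
    (edgeLoop hP x₀ e h).hom = (edgeLoop hP x₀ e' h').hom := by
  let F : ∀ w, Fits P w (Sum.inl v) → (x₀ ⟶ x₀) := fun w hw =>
    (edgeLoop hP x₀ (edgeAt w _ hw) (isPath_objAt hw)).hom
  have key : ∀ {x y : (blowup P).Grpd} {e : (blowup P).Edge} (h : (blowup P).IsPath x [e] y)
      (hv : BlowupCube.label e 0 = Sum.inl v),
      (edgeLoop hP x₀ e h).hom = F (region x) (hv ▸ fits_of_isPath h) := by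
    intro x y e h hv
    obtain ⟨h1, h2⟩ := isPath_singleton_iff.1 h
    have hw : Fits P (region x) (Sum.inl v) := hv ▸ fits_of_isPath h
    rw [hv] at h2
    have hx : objAt _ hw.region = x := region_ext rfl
    have hy : objAt _ hw.region' = y := region_ext h2
    have he : edgeAt (region x) _ hw = e := edge_ext h1.symm hv.symm
    clear h2 h1
    have gen : ∀ {a b : (blowup P).Grpd} {f : (blowup P).Edge} (h' : (blowup P).IsPath a [f] b),
        a = x → b = y → f = e → (edgeLoop hP x₀ e h).hom = (edgeLoop hP x₀ f h').hom := by
      rintro a b f h' rfl rfl rfl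
      rfl
    exact gen (isPath_objAt hw) hx hy he
  rw [key h hv, key h' hv']
  refine eq_of_fits hP F ?_ _ _ fun i hi => by cases hi
  intro w i hw hwi hc
  have hw' : Fits P (w + switch P (Sum.inl v)) (Sum.inr i) :=
    hwi.move hw (commutingLabels_comm hc)
  have hm := hw.move hwi hc
  have p1 : (blowup P).IsPath (objAt w hw.region) [edgeAt w _ hwi] (objAt _ hm.region) :=
    isPath_edgeAt hwi rfl
  have p2 : (blowup P).IsPath (objAt _ hw.region') [edgeAt _ _ hw'] (objAt _ hm.region') :=
    isPath_edgeAt hw' (add_right_comm _ _ _)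
  change (edgeLoop hP x₀ _ (isPath_objAt hw)).hom = (edgeLoop hP x₀ _ (isPath_objAt hm)).hom
  rw [edgeLoop_hom, edgeLoop_hom, ← geodesic_edge hP x₀ p1 (i := i) rfl,
    ← geodesic_edge hP x₀ p2 (i := i) rfl, IsIso.inv_comp, Category.assoc]
  congr 1
  simp only [← Category.assoc]
  refine congrArg (· ≫ CategoryTheory.inv (geodesic hP x₀ (objAt _ hw.region'))) ?_
  rw [IsIso.eq_comp_inv]
  exact hom_square _ _ _ _ rfl rfl hc

theorem exists_edge [Finite ι] (hP : IsCompatibleCollection P) (y : BLabel V ι) :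
    ∃ e : (blowup P).Edge, BlowupCube.label e 0 = y := by
  obtain ⟨x, hx⟩ := exists_fits_label hP y
  exact ⟨edgeAt x y hx, rfl⟩

/-- The loop of the blow-up given by a generator. -/
def generatorLoop [Finite ι] (hP : IsCompatibleCollection P) (x₀ : (blowup P).Grpd) (v : V) :
    x₀ ≅ x₀ :=
  edgeLoop hP x₀ (exists_edge hP (Sum.inl (v, true))).choose
    ((blowup P).isPath_edge _)

theorem generatorLoop_eq [Finite ι] (hP : IsCompatibleCollection P) (x₀ : (blowup P).Grpd) {v : V}
    {x y : (blowup P).Grpd} {e : (blowup P).Edge} (h : (blowup P).IsPath x [e] y)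
    (hv : BlowupCube.label e 0 = Sum.inl (v, true)) :
    (generatorLoop hP x₀ v).hom = (edgeLoop hP x₀ e h).hom :=
  edgeLoop_eq hP x₀ _ _ (exists_edge hP (Sum.inl (v, true))).choose_spec hv

theorem generatorLoop_inv_eq [Finite ι] (hP : IsCompatibleCollection P) (x₀ : (blowup P).Grpd)
    {v : V} {x y : (blowup P).Grpd} {e : (blowup P).Edge} (h : (blowup P).IsPath x [e] y)
    (hv : BlowupCube.label e 0 = Sum.inl (v, false)) :
    (generatorLoop hP x₀ v).inv = (edgeLoop hP x₀ e h).hom := by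
  have hr : BlowupCube.label ((blowup P).rev e) 0 = Sum.inl (v, true) := by
    rw [label_rev, hv]; rfl
  have h1 := generatorLoop_eq hP x₀ ((blowup P).isPath_rev h) hr
  have h2 := Iso.ext h1
  rw [h2, edgeLoop_inv]
  congr 2
  exact (blowup P).rev_rev e

/-- There is a region from which edges for both generators depart; the square they span gives the
relation. -/
theorem generatorLoop_comm [Finite ι] (hP : IsCompatibleCollection P) (x₀ : (blowup P).Grpd)
    (v w : V) (hvw : Γ.Adj v w) : (generatorLoop hP x₀ v).hom ≫ (generatorLoop hP x₀ w).hom =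
      (generatorLoop hP x₀ w).hom ≫ (generatorLoop hP x₀ v).hom := by
  obtain ⟨x, hx⟩ := exists_fits_label hP (Sum.inl (v, true))
  obtain ⟨x', hx'⟩ := exists_isProj hP (Sum.inl (w, true)) x
  have hc : CommutingLabels P (Sum.inl (v, true)) (Sum.inl (w, true)) := hvw
  have hv := hx'.fits_of_commuting hP hx hc
  have hw := hx'.fits hP hx.region
  have hv' := hv.move hw hc
  have hw' := hw.move hv (commutingLabels_comm hc)
  have p1 : (blowup P).IsPath (objAt x' hv.region) [edgeAt _ _ hv] (objAt _ hv.region') :=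
    isPath_edgeAt hv rfl
  have p2 : (blowup P).IsPath (objAt _ hv.region') [edgeAt _ _ hw'] (objAt _ hw'.region') :=
    isPath_edgeAt hw' rfl
  have p3 : (blowup P).IsPath (objAt x' hv.region) [edgeAt _ _ hw] (objAt _ hw.region') :=
    isPath_edgeAt hw rfl
  have p4 : (blowup P).IsPath (objAt _ hw.region') [edgeAt _ _ hv'] (objAt _ hw'.region') :=
    isPath_edgeAt hv' (add_right_comm _ _ _)
  have e1 := generatorLoop_eq hP x₀ p1 rfl
  have e2 := generatorLoop_eq hP x₀ p2 rfl
  have e3 := generatorLoop_eq hP x₀ p3 rfl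
  have e4 := generatorLoop_eq hP x₀ p4 rfl
  calc (generatorLoop hP x₀ v).hom ≫ (generatorLoop hP x₀ w).hom = geodesic hP x₀ _ ≫
        ((blowup P).hom _ p1 ≫ (blowup P).hom _ p2) ≫ CategoryTheory.inv (geodesic hP x₀ _) := by
        rw [e1, e2, edgeLoop_hom, edgeLoop_hom]
        simp only [Category.assoc, IsIso.inv_hom_id_assoc]
    _ = geodesic hP x₀ _ ≫
        ((blowup P).hom _ p3 ≫ (blowup P).hom _ p4) ≫ CategoryTheory.inv (geodesic hP x₀ _) := by
        rw [hom_square p1 p2 p3 p4 rfl rfl hc]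
    _ = _ := by
        rw [e3, e4, edgeLoop_hom, edgeLoop_hom]
        simp only [Category.assoc, IsIso.inv_hom_id_assoc]

/-- The action of `A_Γ` on the vertices of the blow-up. -/
def blowupLoop [Finite ι] (hP : IsCompatibleCollection P) (x₀ : (blowup P).Grpd) :
    RAAG Γ →* (Aut x₀)ᵐᵒᵖ :=
  loopHom (generatorLoop hP x₀) (generatorLoop_comm hP x₀)

/-- Each edge of a path is closed up by geodesics from `x₀`; in the product, consecutive geodesics
cancel and only the outer two remain. -/
theorem blowupLoop_canonical [Finite ι] (hP : IsCompatibleCollection P) (x₀ : (blowup P).Grpd)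
    {x y : (blowup P).Grpd} (p : x ⟶ y) :
    (blowupLoop hP x₀ (pathElement ((canonicalFunctor P).map p))).unop.hom =
      geodesic hP x₀ x ≫ p ≫ CategoryTheory.inv (geodesic hP x₀ y) := by
  obtain ⟨l, h, rfl⟩ := (blowup P).exists_hom p
  induction l generalizing x with
  | nil =>
    obtain rfl : x = y := h
    refine (congrArg (fun g => (blowupLoop hP x₀ g).unop.hom)
      (pathElement_canonical (x := x) (y := x) [] rfl)).trans ((loopHom_one _ _).trans ?_)
    have h1 : geodesic hP x₀ x ≫ 𝟙 x ≫ CategoryTheory.inv (geodesic hP x₀ x) = 𝟙 x₀ := by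
      rw [Category.id_comp, IsIso.hom_inv_id]
    exact h1.symm
  | cons e l ih =>
    obtain ⟨z, h1, h2⟩ : ∃ z : (blowup P).Grpd, (blowup P).IsPath x [e] z ∧
        (blowup P).IsPath z l y := ⟨(blowup P).tgt e, ⟨h.1, rfl⟩, h.2⟩
    have ih := ih h2
    have he : (blowupLoop hP x₀ (pathElement ((canonicalFunctor P).map
        ((blowup P).hom [e] h1)))).unop.hom = (edgeLoop hP x₀ e h1).hom := by
      rw [pathElement_canonical_edge]
      cases hl : BlowupCube.label e 0 with
      | inl v =>
        obtain ⟨v, b⟩ := v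
        refine (loopHom_gen _ _ _).trans ?_
        cases b
        · exact generatorLoop_inv_eq hP x₀ h1 hl
        · exact generatorLoop_eq hP x₀ h1 hl
      | inr i =>
        refine (loopHom_one _ _).trans ?_
        rw [edgeLoop_hom, ← geodesic_edge hP x₀ h1 hl, ← Category.assoc, IsIso.hom_inv_id]
    rw [show (blowup P).hom (e :: l) h = (blowup P).hom [e] h1 ≫ (blowup P).hom l h2 from rfl,
      Functor.map_comp, pathElement_comp]
    refine (loopHom_mul _ _ _ _).trans ?_
    change (blowupLoop hP x₀ _).unop.hom ≫ (blowupLoop hP x₀ _).unop.hom = _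
    rw [he, ih, edgeLoop_hom]
    simp only [Category.assoc, IsIso.inv_hom_id_assoc]

theorem canonical_blowupLoop [Finite ι] (hP : IsCompatibleCollection P) (x₀ : (blowup P).Grpd)
    (g : RAAG Γ) : pathElement ((canonicalFunctor P).map (blowupLoop hP x₀ g).unop.hom) = g := by
  let f : RAAG Γ →* RAAG Γ :=
    { toFun := fun g => pathElement ((canonicalFunctor P).map (blowupLoop hP x₀ g).unop.hom)
      map_one' := by
        rw [blowupLoop, loopHom_one, CategoryTheory.Functor.map_id, pathElement_id]
      map_mul' := fun a b => by
        rw [blowupLoop, loopHom_mul, Functor.map_comp, pathElement_comp] }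
  have : f = MonoidHom.id _ := RAAG.hom_ext_of fun v => by
    change pathElement ((canonicalFunctor P).map
      (blowupLoop hP x₀ (gen Γ (v, true))).unop.hom) = _
    rw [blowupLoop, loopHom_gen, if_pos rfl]
    obtain ⟨e, he⟩ := exists_edge hP (Sum.inl (v, true))
    obtain ⟨x, y, h⟩ : ∃ x y : (blowup P).Grpd, (blowup P).IsPath x [e] y :=
      ⟨_, _, (blowup P).isPath_edge e⟩
    rw [generatorLoop_eq hP x₀ h he, edgeLoop_hom, Functor.map_comp,
      Functor.map_comp, pathElement_comp, pathElement_comp, Functor.map_inv, pathElement_inv,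
      (geo_geodesic hP x₀ _).pathElement_eq_one, (geo_geodesic hP x₀ _).pathElement_eq_one,
      pathElement_canonical_edge, he]
    simp [labelElement, gen]
  exact DFunLike.congr_fun this g

theorem canonical_bijective [Finite ι] (hP : IsCompatibleCollection P) (x y : (blowup P).Grpd) :
    Function.Bijective fun p : x ⟶ y => pathElement ((canonicalFunctor P).map p) := by
  constructor
  · intro p q h
    have h1 := blowupLoop_canonical hP x p
    rw [show pathElement ((canonicalFunctor P).map p) = _ from h, blowupLoop_canonical] at h1
    exact ((cancel_mono _).1 ((cancel_epi _).1 h1)).symm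
  · intro g
    refine ⟨CategoryTheory.inv (geodesic hP x x) ≫ (blowupLoop hP x g).unop.hom ≫
      geodesic hP x y, ?_⟩
    simp only [Functor.map_comp, pathElement_comp, Functor.map_inv, pathElement_inv,
      (geo_geodesic hP x _).pathElement_eq_one, canonical_blowupLoop]
    simp

theorem nonempty_blowup [Finite ι] (P : ι → WhiteheadPartition Γ) : Nonempty (blowup P).Grpd := by
  obtain ⟨x, hx⟩ := exists_isRegion P
  exact ⟨objAt x hx⟩

theorem isEquivalence_canonical [Finite ι] (hP : IsCompatibleCollection P) :
    (canonicalFunctor P).IsEquivalence :=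
  have := nonempty_blowup P
  isEquivalence_of_bijective _ (canonical_bijective hP)

end Canonical

/-! ### Spanning trees of finite multigraphs -/

section Trees

variable {U E : Type*} {ends : E → Sym2 U} {B : Set E}

/-- The edges in `B` form a spanning tree of the multigraph with vertex set `U`, edge set `E` and
end points `ends`. -/
structure IsSpanningTree (ends : E → Sym2 U) (B : Set E) : Prop where
  injOn : Set.InjOn ends B
  not_isDiag : ∀ c ∈ B, ¬ (ends c).IsDiag
  isTree : (SimpleGraph.fromEdgeSet (ends '' B)).IsTree

theorem IsSpanningTree.edgeSet (h : IsSpanningTree ends B) :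
    (SimpleGraph.fromEdgeSet (ends '' B)).edgeSet = ends '' B := by
  rw [SimpleGraph.edgeSet_fromEdgeSet, sdiff_eq_left, Set.disjoint_left]
  rintro _ ⟨c, hc, rfl⟩ h'
  exact h.not_isDiag c hc h'

/-- A connected simple graph has at least one edge less than it has vertices. With exactly that many
labels, none can be lost in passing to the simple graph, so there are no loops or multiple edges. -/
theorem isSpanningTree_iff [Finite U] [Finite E] : IsSpanningTree ends B ↔
    (SimpleGraph.fromEdgeSet (ends '' B)).Connected ∧ B.ncard + 1 = Nat.card U := by
  constructor
  · intro h
    refine ⟨h.isTree.1, ?_⟩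
    rw [← (SimpleGraph.isTree_iff_connected_and_card.1 h.isTree).2, h.edgeSet,
      Nat.card_coe_set_eq, h.injOn.ncard_image]
  · rintro ⟨hc, hn⟩
    have h1 := hc.card_vert_le_card_edgeSet_add_one
    rw [Nat.card_coe_set_eq, SimpleGraph.edgeSet_fromEdgeSet, ← hn] at h1
    have h2 : (ends '' B \ Sym2.diagSet).ncard ≤ (ends '' B).ncard :=
      Set.ncard_le_ncard Set.sdiff_subset (Set.toFinite _)
    have h3 : (ends '' B).ncard ≤ B.ncard := Set.ncard_image_le (Set.toFinite _)
    have h4 : ends '' B \ Sym2.diagSet = ends '' B :=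
      Set.eq_of_subset_of_ncard_le Set.sdiff_subset (by omega) (Set.toFinite _)
    refine ⟨Set.injOn_of_ncard_image_eq (by omega) (Set.toFinite _), fun c hc h => ?_,
      SimpleGraph.isTree_iff_connected_and_card.2 ⟨hc, ?_⟩⟩
    · have : ends c ∈ ends '' B \ Sym2.diagSet := by rw [h4]; exact ⟨c, hc, rfl⟩
      exact this.2 h
    · rw [Nat.card_coe_set_eq, SimpleGraph.edgeSet_fromEdgeSet, h4, ← hn]
      omega

/-- The exchange of an edge of a spanning tree for an edge of a second spanning tree, together with
the cut which separates the end points of both edges. -/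
theorem IsSpanningTree.exists_exchange [Finite U] [Finite E] {B' : Set E}
    (h : IsSpanningTree ends B) (h' : IsSpanningTree ends B') {a : E} (ha : a ∈ B) :
    ∃ b ∈ B', ∃ C : Set U, b ∉ B \ {a} ∧ IsSpanningTree ends (insert b (B \ {a})) ∧
      (∀ c ∈ B \ {a}, ∀ u v, ends c = s(u, v) → (u ∈ C ↔ v ∈ C)) ∧
      (∀ u v, ends a = s(u, v) → ¬ (u ∈ C ↔ v ∈ C)) ∧
      ∀ u v, ends b = s(u, v) → ¬ (u ∈ C ↔ v ∈ C) := by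
  obtain ⟨hc, hn⟩ := isSpanningTree_iff.1 h
  obtain ⟨hc', hn'⟩ := isSpanningTree_iff.1 h'
  obtain ⟨o, t, hot⟩ : ∃ o t, ends a = s(o, t) := by
    induction hx : ends a using Sym2.ind with
    | _ x y => exact ⟨x, y, rfl⟩
  set G := SimpleGraph.fromEdgeSet (ends '' (B \ {a})) with hG
  -- The cut is the component of one end of `a` in the tree without `a`.
  let C : Set U := {u | G.Reachable o u}
  have hn1 : (B \ {a}).ncard + 1 = B.ncard := Set.ncard_sdiff_singleton_add_one ha (Set.toFinite _)
  have hadj : ∀ u v, u ≠ v → ∀ c ∈ B \ {a}, ends c = s(u, v) → G.Adj u v := by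
    intro u v huv c hc h
    rw [hG, SimpleGraph.fromEdgeSet_adj]
    exact ⟨⟨c, hc, h⟩, huv⟩
  have hcut : ∀ c ∈ B \ {a}, ∀ u v, ends c = s(u, v) → (u ∈ C ↔ v ∈ C) := by
    intro c hc u v huv
    by_cases he : u = v
    · rw [he]
    have := hadj u v he c hc huv
    exact ⟨fun hu => SimpleGraph.Reachable.trans hu this.reachable,
      fun hv => SimpleGraph.Reachable.trans hv this.symm.reachable⟩
  have hstep : ∀ u v, (SimpleGraph.fromEdgeSet (ends '' B)).Adj u v →
      G.Adj u v ∨ s(u, v) = s(o, t) := by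
    intro u v huv
    rw [SimpleGraph.fromEdgeSet_adj] at huv
    obtain ⟨⟨c, hc, hcu⟩, hne⟩ := huv
    by_cases hca : c = a
    · right; rw [← hcu, hca, hot]
    · left; exact hadj u v hne c ⟨hc, hca⟩ hcu
  have hreach : ∀ u, G.Reachable o u ∨ G.Reachable t u := by
    have key : ∀ {u v} (_ : (SimpleGraph.fromEdgeSet (ends '' B)).Walk u v), v = o →
        G.Reachable o u ∨ G.Reachable t u := by
      intro u v w
      induction w with
      | nil => rintro rfl; exact Or.inl SimpleGraph.Reachable.rfl
      | cons hadj _ ih =>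
        intro hv
        rcases hstep _ _ hadj with h1 | h1
        · exact (ih hv).imp (·.trans h1.symm.reachable) (·.trans h1.symm.reachable)
        · rw [Sym2.eq_iff] at h1
          rcases h1 with ⟨rfl, -⟩ | ⟨rfl, -⟩
          · exact Or.inl SimpleGraph.Reachable.rfl
          · exact Or.inr SimpleGraph.Reachable.rfl
    exact fun u => (hc.preconnected u o).elim fun w => key w rfl
  -- Otherwise the tree would remain connected without `a`, with too few edges.
  have ht : t ∉ C := by
    intro ht
    have : G.Connected := by
      have : Nonempty U := ⟨o⟩
      refine ⟨fun u v => ?_⟩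
      have key : ∀ u, G.Reachable o u := fun u => (hreach u).elim id fun h => ht.trans h
      exact (key u).symm.trans (key v)
    have h1 := this.card_vert_le_card_edgeSet_add_one
    rw [Nat.card_coe_set_eq, hG, SimpleGraph.edgeSet_fromEdgeSet] at h1
    have h2 : (ends '' (B \ {a}) \ Sym2.diagSet).ncard ≤ (ends '' (B \ {a})).ncard :=
      Set.ncard_le_ncard Set.sdiff_subset (Set.toFinite _)
    have h3 : (ends '' (B \ {a})).ncard ≤ (B \ {a}).ncard := Set.ncard_image_le (Set.toFinite _)
    omega
  have ho : o ∈ C := SimpleGraph.Reachable.rfl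
  -- The second tree connects the ends of `a`, so one of its edges crosses the cut. This edge may be
  -- `a` itself.
  obtain ⟨w⟩ := hc'.preconnected o t
  obtain ⟨d, -, hd1, hd2⟩ := w.exists_boundary_dart C ho ht
  have hd := d.adj
  rw [SimpleGraph.fromEdgeSet_adj] at hd
  obtain ⟨⟨b, hb, hbd⟩, hne⟩ := hd
  have hbn : b ∉ B \ {a} := fun hb => hd2 ((hcut b hb _ _ hbd).1 hd1)
  have hsep : ∀ c u v p q, ends c = s(p, q) → p ∈ C → q ∉ C → ends c = s(u, v) →
      ¬ (u ∈ C ↔ v ∈ C) := by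
    intro c u v p q h1 hp hq h2
    rw [h1, Sym2.eq_iff] at h2
    rcases h2 with ⟨rfl, rfl⟩ | ⟨rfl, rfl⟩
    · exact fun h => hq (h.1 hp)
    · exact fun h => hq (h.2 hp)
  refine ⟨b, hb, C, hbn, isSpanningTree_iff.2 ⟨?_, ?_⟩, hcut,
    fun u v => hsep a u v o t hot ho ht, fun u v => hsep b u v _ _ hbd hd1 hd2⟩
  · have hle : G ≤ SimpleGraph.fromEdgeSet (ends '' insert b (B \ {a})) :=
      SimpleGraph.fromEdgeSet_mono (Set.image_mono (Set.subset_insert _ _))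
    have hbr : (SimpleGraph.fromEdgeSet (ends '' insert b (B \ {a}))).Reachable d.fst d.snd := by
      apply SimpleGraph.Adj.reachable
      rw [SimpleGraph.fromEdgeSet_adj]
      exact ⟨⟨b, Set.mem_insert _ _, hbd⟩, hne⟩
    have hdt : G.Reachable t d.snd := (hreach d.snd).resolve_left hd2
    have hto := ((SimpleGraph.Reachable.mono hle hd1).trans hbr).trans (hdt.mono hle).symm
    have key : ∀ u, (SimpleGraph.fromEdgeSet (ends '' insert b (B \ {a}))).Reachable o u :=
      fun u => (hreach u).elim (·.mono hle) fun h => hto.trans (h.mono hle)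
    have : Nonempty U := ⟨o⟩
    exact ⟨fun u v => (key u).symm.trans (key v)⟩
  · rw [Set.ncard_insert_of_notMem hbn (Set.toFinite _)]
    omega

/-- A path with both ends in `F` stays in `F`, if the complement of `F` can be entered only through
one vertex. -/
theorem _root_.SimpleGraph.Walk.IsPath.support_subset {G : SimpleGraph U} {F F' : Set U}
    (hF : (F ∩ F').Subsingleton) (hadj : ∀ u v, G.Adj u v → (u ∈ F ∧ v ∈ F) ∨ (u ∈ F' ∧ v ∈ F'))
    {x y : U} {w : G.Walk x y} (hw : w.IsPath) (hx : x ∈ F) (hy : y ∈ F) :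
    ∀ u ∈ w.support, u ∈ F := by
  induction w with
  | nil =>
    intro u hu
    rw [SimpleGraph.Walk.support_nil, List.mem_singleton] at hu
    exact hu ▸ hx
  | @cons x z y h w ih =>
    rw [SimpleGraph.Walk.cons_isPath_iff] at hw
    intro u hu
    rw [SimpleGraph.Walk.support_cons, List.mem_cons] at hu
    rcases hu with rfl | hu
    · exact hx
    by_cases hz : z ∈ F
    · exact ih hw.1 hz hy u hu
    exfalso
    -- A path leaving `F` does so from a vertex of `F ∩ F'` and must re-enter through such a vertex;
    -- as there is just one, it would be visited twice.
    have hx' : x ∈ F' := ((hadj x z h).resolve_left fun h => hz h.2).1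
    obtain ⟨d, hd, hd1, hd2⟩ := w.exists_boundary_dart Fᶜ hz (fun h => h hy)
    have hd2 : d.snd ∈ F := not_not.1 hd2
    have hd' : d.snd ∈ F' := ((hadj _ _ d.adj).resolve_left fun h => hd1 h.1).2
    apply hw.2
    rw [hF ⟨hx, hx'⟩ ⟨hd2, hd'⟩]
    exact w.dart_snd_mem_support_of_mem_darts hd

end Trees

/-! ### The base graph of a link as a multigraph on labels -/

section LinkClass

variable {V : Type u} {Γ : SimpleGraph V} {ι : Type} {P : ι → WhiteheadPartition Γ} {L : Set V}

open WhiteheadPartition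

theorem IsCompatibleCollection.linkClass (hP : IsCompatibleCollection P) (L : Set V) :
    IsCompatibleCollection (linkClass P L) :=
  fun i j h => hP i.1 j.1 fun h' => h (Subtype.ext h')

/-- The restriction of a region to the partitions with link `L`. -/
def restrict (P : ι → WhiteheadPartition Γ) (L : Set V) (x : ι → ZMod 2) :
    {j : ι // (P j).link = L} → ZMod 2 := fun j => x j.1

theorem IsRegion.restrict {x : ι → ZMod 2} (h : IsRegion P x) (L : Set V) :
    IsRegion (linkClass P L) (restrict P L x) :=
  fun i j hij => h i.1 j.1 fun h' => hij (Subtype.ext h')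

/-- The label of the blow-up given by a label of the blow-up for the partitions with link `L`. -/
def liftLabel (y : BLabel V {j : ι // (P j).link = L}) : BLabel V ι := Sum.map id Subtype.val y

theorem unoriented_liftLabel (y : BLabel V {j : ι // (P j).link = L}) :
    unoriented (liftLabel y) = Sum.map id Subtype.val (unoriented y) := by
  cases y <;> rfl

theorem switch_liftLabel (y : BLabel V {j : ι // (P j).link = L})
    (j : {j : ι // (P j).link = L}) : switch P (liftLabel y) j.1 = switch (linkClass P L) y j := by
  cases y with
  | inl v => rfl
  | inr i =>
    by_cases h : j = i
    · subst h
      exact (switch_inr_self _).trans (switch_inr_self _).symm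
    · exact (switch_inr_of_ne fun h' => h (Subtype.ext h')).trans (switch_inr_of_ne h).symm

theorem restrict_add_switch (x : ι → ZMod 2) (y : BLabel V {j : ι // (P j).link = L}) :
    restrict P L (x + switch P (liftLabel y)) =
      restrict P L x + switch (linkClass P L) y := by
  funext j
  exact congrArg (x j.1 + ·) (switch_liftLabel y j)

theorem rep_liftLabel (y : BLabel V {j : ι // (P j).link = L}) :
    rep P (unoriented (liftLabel y)) = rep (linkClass P L) (unoriented y) := by
  cases y <;> rfl

theorem Fits.restrict {x : ι → ZMod 2} {y : BLabel V {j : ι // (P j).link = L}}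
    (h : Fits P x (liftLabel y)) : Fits (linkClass P L) (restrict P L x) y where
  region := h.region.restrict L
  region' := by
    rw [← restrict_add_switch]
    exact h.region'.restrict L
  departs := by
    have := h.departs
    cases y with
    | inl v => exact fun j => this j.1
    | inr i => trivial

theorem mem_baseLabels_iff (a : V ⊕ ι) : a ∈ baseLabels P L ↔ lk Γ (rep P a) = L := by
  cases a with
  | inl v => simp [baseLabels, rep]
  | inr i => simp [baseLabels, rep, link_eq]

/-- Base labels for `L` have link `L`, and no vertex lies in its own link. Consequently no partition
with link `L` can be moved freely along such an edge, and the base graph has a single edge for every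
label. -/
theorem not_commutingLabels_of_mem {y : BLabel V {j : ι // (P j).link = L}}
    (hy : unoriented (liftLabel y) ∈ baseLabels P L) (j : {j : ι // (P j).link = L}) :
    ¬ CommutingLabels (linkClass P L) y (Sum.inr j) := by
  intro h
  have h1 := rep_mem_link h
  rw [← rep_liftLabel] at h1
  have h2 : rep P (unoriented (liftLabel y)) ∈ lk Γ (rep P (unoriented (liftLabel y))) := by
    rw [(mem_baseLabels_iff _).1 hy]
    have h3 : (P j.1).link = L := j.2
    exact h3.le h1
  exact Γ.loopless.irrefl _ h2

theorem map_edgeLabel (e : (blowup (linkClass P L)).Edge) :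
    Sum.map id Subtype.val (edgeLabel (linkClass P L) e) =
      unoriented (liftLabel (BlowupCube.label e 0)) := (unoriented_liftLabel _).symm

theorem exists_liftLabel {c : V ⊕ ι} (hc : c ∈ baseLabels P L) :
    ∃ y : BLabel V {j : ι // (P j).link = L}, unoriented (liftLabel y) = c := by
  rcases hc with ⟨v, rfl, -⟩ | ⟨i, rfl, hi⟩
  · exact ⟨Sum.inl (v, true), rfl⟩
  · exact ⟨Sum.inr ⟨i, hi⟩, rfl⟩

theorem exists_edge_of_mem [Finite ι] (hP : IsCompatibleCollection P) {c : V ⊕ ι}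
    (hc : c ∈ baseLabels P L) : ∃ e : (blowup (linkClass P L)).Edge,
      Sum.map id Subtype.val (edgeLabel (linkClass P L) e) = c := by
  obtain ⟨y, rfl⟩ := exists_liftLabel hc
  obtain ⟨e, he⟩ := exists_edge (hP.linkClass L) y
  exact ⟨e, by rw [map_edgeLabel, he]⟩

/-- In the base graph, there is just one edge with a given label. -/
theorem edge_eq_or_eq_rev (hP : IsCompatibleCollection P)
    {e e' : (blowup (linkClass P L)).Edge}
    (h : Sum.map id Subtype.val (edgeLabel (linkClass P L) e) ∈ baseLabels P L)
    (h' : edgeLabel (linkClass P L) e = edgeLabel (linkClass P L) e') :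
    e = e' ∨ e = (blowup (linkClass P L)).rev e' := by
  have key : ∀ {e e' : (blowup (linkClass P L)).Edge},
      Sum.map id Subtype.val (edgeLabel (linkClass P L) e) ∈ baseLabels P L →
      BlowupCube.label e 0 = BlowupCube.label e' 0 →
      (∀ i, BlowupCube.label e 0 = Sum.inr i →
        BlowupCube.origin e i = BlowupCube.origin e' i) → e = e' := by
    intro e e' h h1 h2
    refine edge_ext (funext fun i => ?_) h1
    by_cases hi : BlowupCube.label e 0 = Sum.inr i
    · exact h2 i hi
    · have hf := BlowupCube.fits e' 0
      rw [← h1] at hf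
      rw [map_edgeLabel] at h
      exact (BlowupCube.fits e 0).determined (hP.linkClass L) hf
        (not_commutingLabels_of_mem h i) hi
  unfold edgeLabel at h'
  cases hy : BlowupCube.label e 0 with
  | inl v =>
    cases hz : BlowupCube.label e' 0 with
    | inr i => rw [hy, hz] at h'; cases h'
    | inl w =>
      rw [hy, hz] at h'
      rcases Letter.eq_or_eq_inv (Sum.inl.inj h' : v.1 = w.1) with rfl | rfl
      · exact Or.inl (key h (hy.trans hz.symm) fun i hi => by rw [hy] at hi; cases hi)
      · refine Or.inr (key h ?_ fun i hi => by rw [hy] at hi; cases hi)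
        rw [label_rev, hy, hz]
        rfl
  | inr i =>
    cases hz : BlowupCube.label e' 0 with
    | inl v => rw [hy, hz] at h'; cases h'
    | inr j =>
      rw [hy, hz] at h'
      obtain rfl : i = j := Sum.inr.inj h'
      by_cases hi : BlowupCube.origin e i = BlowupCube.origin e' i
      · refine Or.inl (key h (hy.trans hz.symm) fun j hj => ?_)
        rw [hy] at hj
        cases hj
        exact hi
      · refine Or.inr (key h ?_ fun j hj => ?_)
        · rw [label_rev, hy, hz]
          rfl
        · rw [hy] at hj
          cases hj
          rw [origin_rev, hz, Pi.add_apply, switch_inr_self]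
          exact ZMod.two_eq_add_one hi

open Classical in
/-- The end points of the edge of the base graph with a given label. -/
def classEnds [Finite ι] (P : ι → WhiteheadPartition Γ) (L : Set V) (c : V ⊕ ι) :
    Sym2 (blowup (linkClass P L)).Vertex :=
  if h : ∃ e : (blowup (linkClass P L)).Edge,
      Sum.map id Subtype.val (edgeLabel (linkClass P L) e) = c then
    s((blowup (linkClass P L)).src h.choose, (blowup (linkClass P L)).tgt h.choose)
  -- The value for labels without an edge in this blow-up; base labels of a compatible collection
  -- always have one.
  else Sym2.diag (vertexAt _ (exists_isRegion (linkClass P L)).choose_spec)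

theorem map_val_injective :
    Function.Injective (Sum.map id Subtype.val : V ⊕ {j : ι // (P j).link = L} → V ⊕ ι) :=
  Function.injective_id.sumMap Subtype.val_injective

theorem classEnds_eq [Finite ι] (hP : IsCompatibleCollection P)
    {e : (blowup (linkClass P L)).Edge}
    (h : Sum.map id Subtype.val (edgeLabel (linkClass P L) e) ∈ baseLabels P L) :
    classEnds P L (Sum.map id Subtype.val (edgeLabel (linkClass P L) e)) =
      s((blowup (linkClass P L)).src e, (blowup (linkClass P L)).tgt e) := by
  have hex : ∃ e' : (blowup (linkClass P L)).Edge,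
    Sum.map id Subtype.val (edgeLabel (linkClass P L) e') =
      Sum.map id Subtype.val (edgeLabel (linkClass P L) e) := ⟨e, rfl⟩
  unfold classEnds
  rw [dif_pos hex]
  rcases edge_eq_or_eq_rev hP h (map_val_injective hex.choose_spec).symm with h1 | h1
  · rw [← h1]
  · have h2 := congrArg (blowup (linkClass P L)).src h1
    have h3 := congrArg (blowup (linkClass P L)).tgt h1
    rw [CubeComplex.src_rev] at h2
    rw [CubeComplex.tgt_rev] at h3
    rw [h2, h3, Sym2.eq_swap]

theorem exists_edge_of_classEnds [Finite ι] (hP : IsCompatibleCollection P) {c : V ⊕ ι}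
    (hc : c ∈ baseLabels P L) {u v : (blowup (linkClass P L)).Vertex}
    (h : classEnds P L c = s(u, v)) : ∃ e : (blowup (linkClass P L)).Edge,
      Sum.map id Subtype.val (edgeLabel (linkClass P L) e) = c ∧
      (blowup (linkClass P L)).src e = u ∧ (blowup (linkClass P L)).tgt e = v := by
  obtain ⟨e, rfl⟩ := exists_edge_of_mem hP hc
  rw [classEnds_eq hP hc, Sym2.eq_iff] at h
  rcases h with ⟨h1, h2⟩ | ⟨h1, h2⟩
  · exact ⟨e, rfl, h1, h2⟩
  · exact ⟨(blowup (linkClass P L)).rev e, by rw [edgeLabel_rev],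
      by rw [CubeComplex.src_rev, h2], by rw [CubeComplex.tgt_rev, h1]⟩

/-- Each base label has one edge up to orientation, so the conditions on oriented edges translate
into conditions on labels: no multiple edges means injectivity of the end points, no loops means
that they are off the diagonal. -/
theorem isMaximalTree_iff [Finite ι] (hP : IsCompatibleCollection P) (A : Set (V ⊕ ι)) :
    IsMaximalTree (blowup (linkClass P L)) (classEdges P L (A ∩ baseLabels P L)) ↔
      IsSpanningTree (classEnds P L) (A ∩ baseLabels P L) := by
  have hG : (SimpleGraph.fromRel fun x y : (blowup (linkClass P L)).Vertex =>
      ∃ e ∈ classEdges P L (A ∩ baseLabels P L), (blowup (linkClass P L)).src e = x ∧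
        (blowup (linkClass P L)).tgt e = y) =
      SimpleGraph.fromEdgeSet (classEnds P L '' (A ∩ baseLabels P L)) := by
    ext x y
    rw [SimpleGraph.fromRel_adj, SimpleGraph.fromEdgeSet_adj, and_comm]
    refine and_congr_left fun hxy => ⟨?_, ?_⟩
    · rintro (⟨e, he, rfl, rfl⟩ | ⟨e, he, rfl, rfl⟩)
      · exact ⟨_, he, classEnds_eq hP he.2⟩
      · exact ⟨_, he, (classEnds_eq hP he.2).trans Sym2.eq_swap⟩
    · rintro ⟨c, hc, h⟩
      obtain ⟨e, rfl, h1, h2⟩ := exists_edge_of_classEnds hP hc.2 h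
      exact Or.inl ⟨e, hc, h1, h2⟩
  constructor
  · intro h
    refine ⟨?_, ?_, hG ▸ h.isTree⟩
    · intro c hc d hd hcd
      obtain ⟨e, rfl⟩ := exists_edge_of_mem hP hc.2
      rw [classEnds_eq hP hc.2] at hcd
      obtain ⟨e', rfl, h1, h2⟩ := exists_edge_of_classEnds hP hd.2 hcd.symm
      rw [h.no_multiple e hc e' hd h1.symm h2.symm]
    · intro c hc
      obtain ⟨e, rfl⟩ := exists_edge_of_mem hP hc.2
      rw [classEnds_eq hP hc.2]
      exact h.no_loop e hc
  · intro h
    have hl : ∀ e ∈ classEdges P L (A ∩ baseLabels P L),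
        (blowup (linkClass P L)).src e ≠ (blowup (linkClass P L)).tgt e := by
      intro e he heq
      apply h.not_isDiag _ he
      rw [classEnds_eq hP he.2]
      exact heq
    refine ⟨?_, hl, ?_, hG ▸ h.isTree⟩
    · intro e he
      have h1 : Sum.map id Subtype.val (edgeLabel (linkClass P L) e) ∈ A ∩ baseLabels P L := he
      rw [← edgeLabel_rev] at h1
      exact h1
    · intro e he e' he' h1 h2
      have h3 := h.injOn he he' (by rw [classEnds_eq hP he.2, classEnds_eq hP he'.2, h1, h2])
      refine (edge_eq_or_eq_rev hP he.2 (map_val_injective h3)).resolve_right ?_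
      rintro rfl
      rw [CubeComplex.src_rev] at h1
      exact hl e' he' h1.symm

/-- Sets of labels that are dual to tree-like sets of hyperplanes. -/
def TreeLabels [Finite ι] (P : ι → WhiteheadPartition Γ) (A : Set (V ⊕ ι)) : Prop :=
  (∀ a ∈ A, ∃ i, a ∈ baseLabels P (P i).link) ∧
    ∀ i, IsSpanningTree (classEnds P (P i).link) (A ∩ baseLabels P (P i).link)

theorem isTreeLike_iff [Finite ι] (hP : IsCompatibleCollection P)
    (H : Set (blowup P).Hyperplane) : IsTreeLike P H ↔ TreeLabels P (dualLabels P H) :=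
  and_congr_right fun _ => forall_congr' fun _ => isMaximalTree_iff hP _

instance finite_vertex [Finite ι] : Finite (blowup P).Vertex :=
  Finite.of_injective (fun x : (blowup P).Vertex => (BlowupCube.origin x : ι → ZMod 2))
    fun _ _ h => vertex_ext h

/-- The edges labelled by the partitions form a spanning tree of the base graph. -/
theorem isSpanningTree_inr [Finite ι] (hP : IsCompatibleCollection P) (L : Set V) :
    IsSpanningTree (classEnds P L) (Set.range Sum.inr ∩ baseLabels P L) := by
  have hdata : ∀ c ∈ Set.range Sum.inr ∩ baseLabels P L, ∀ u v, classEnds P L c = s(u, v) →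
      ∃ i : {j : ι // (P j).link = L}, c = Sum.inr i.1 ∧
        BlowupCube.origin v = BlowupCube.origin u + switch (linkClass P L) (Sum.inr i) := by
    rintro c ⟨⟨i, rfl⟩, hc⟩ u v huv
    obtain ⟨e, he, rfl, rfl⟩ := exists_edge_of_classEnds hP hc huv
    have hi : (P i).link = L := by
      rcases hc with ⟨v, h, -⟩ | ⟨j, h, hj⟩
      · cases h
      · cases h; exact hj
    refine ⟨⟨i, hi⟩, rfl, ?_⟩
    have : BlowupCube.label e 0 = Sum.inr ⟨i, hi⟩ := by
      have h1 : edgeLabel _ e = Sum.inr ⟨i, hi⟩ := map_val_injective he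
      unfold edgeLabel at h1
      cases hl : BlowupCube.label e 0 with
      | inl v => rw [hl] at h1; cases h1
      | inr j => rw [hl] at h1; cases h1; rfl
    rw [origin_tgt, origin_src, this]
  refine ⟨?_, ?_, ?_⟩
  · intro c hc d hd hcd
    induction hx : classEnds P L c using Sym2.ind with
    | _ u v =>
    obtain ⟨i, rfl, h1⟩ := hdata c hc u v hx
    obtain ⟨j, rfl, h2⟩ := hdata d hd u v (hcd.symm.trans hx)
    rw [h1] at h2
    by_contra hij
    have h3 := congrFun h2 i
    rw [Pi.add_apply, Pi.add_apply, switch_inr_self, switch_inr_of_ne (by rintro rfl; exact hij rfl),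
      add_zero] at h3
    exact ZMod.two_add_one_ne _ h3
  · intro c hc hd
    induction hx : classEnds P L c using Sym2.ind with
    | _ u v =>
    obtain ⟨i, rfl, h1⟩ := hdata c hc u v hx
    rw [hx] at hd
    obtain rfl : u = v := hd
    have h3 := congrFun h1 i
    rw [Pi.add_apply, switch_inr_self] at h3
    exact ZMod.two_add_one_ne _ h3.symm
  · refine ⟨?_, ?_⟩
    · obtain ⟨x, hx⟩ := exists_isRegion (linkClass P L)
      have : Nonempty (blowup (linkClass P L)).Vertex := ⟨vertexAt x hx⟩
      refine ⟨fun u v => ?_⟩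
      -- Connectedness: any two regions are joined by successive switches of single partitions.
      have key := reflTransGen_flip (P := linkClass P L) (hP.linkClass L) ∅
        (R := fun x y => ∃ (hx : IsRegion (linkClass P L) x) (hy : IsRegion (linkClass P L) y),
          (SimpleGraph.fromEdgeSet (classEnds P L '' (Set.range Sum.inr ∩ baseLabels P L))).Adj
            (vertexAt x hx) (vertexAt y hy))
        (BlowupCube.isRegion u) (fun z hz => hz.elim) (BlowupCube.isRegion v)
        (fun i _ z hz => hz.elim) ?_
      · suffices ∀ y, Relation.ReflTransGen _ (BlowupCube.origin u) y →
            ∃ hy : IsRegion (linkClass P L) y, (SimpleGraph.fromEdgeSet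
              (classEnds P L '' (Set.range Sum.inr ∩ baseLabels P L))).Reachable u
                (vertexAt y hy) by
          obtain ⟨hy, h⟩ := this _ key
          rwa [show vertexAt _ hy = v from vertex_ext rfl] at h
        intro y hy
        induction hy with
        | refl =>
          refine ⟨BlowupCube.isRegion u, ?_⟩
          rw [show vertexAt _ (BlowupCube.isRegion u) = u from vertex_ext rfl]
        | tail _ h ih =>
          obtain ⟨_, h1⟩ := ih
          obtain ⟨_, h2, h3⟩ := h
          exact ⟨h2, h1.trans h3.reachable⟩
      · intro w i _ hw _ hwi
        refine ⟨hw, hwi.region', ?_⟩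
        rw [SimpleGraph.fromEdgeSet_adj]
        refine ⟨⟨Sum.inr i.1, ⟨⟨_, rfl⟩, Or.inr ⟨_, rfl, i.2⟩⟩, ?_⟩, ?_⟩
        · have h1 := classEnds_eq (e := edgeAt _ _ hwi) hP (L := L) (Or.inr ⟨_, rfl, i.2⟩)
          have h2 : (blowup (linkClass P L)).src (edgeAt _ _ hwi) = vertexAt w hw :=
            vertex_ext (origin_src _)
          have h3 : (blowup (linkClass P L)).tgt (edgeAt _ _ hwi) = vertexAt _ hwi.region' :=
            vertex_ext (origin_tgt _)
          rw [h2, h3] at h1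
          exact h1
        · intro h
          have h3 : w i = (w + switch (linkClass P L) (Sum.inr i)) i :=
            congrFun (congrArg BlowupCube.origin h) i
          rw [Pi.add_apply, switch_inr_self] at h3
          exact ZMod.two_add_one_ne _ h3.symm
    -- Among the partition edges, only the one labelled by the `i`-th partition changes the `i`-th
    -- side, so it is a bridge.
    · rw [SimpleGraph.isAcyclic_iff_forall_isBridge]
      intro e he
      induction e using Sym2.ind with
      | _ u v =>
      rw [SimpleGraph.mem_edgeSet, SimpleGraph.fromEdgeSet_adj] at he
      obtain ⟨⟨c, hc, huv⟩, hne⟩ := he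
      obtain ⟨i, rfl, h1⟩ := hdata c hc u v huv
      rw [SimpleGraph.isBridge_iff]
      rintro ⟨w⟩
      have key : ∀ {a b} (_ : ((SimpleGraph.fromEdgeSet (classEnds P L ''
          (Set.range Sum.inr ∩ baseLabels P L))).deleteEdges {s(u, v)}).Walk a b),
          BlowupCube.origin a i = BlowupCube.origin b i := by
        intro a b w
        induction w with
        | nil => rfl
        | @cons a b _ h _ ih =>
          rw [SimpleGraph.deleteEdges_adj, SimpleGraph.fromEdgeSet_adj] at h
          obtain ⟨⟨⟨d, hd, hab⟩, -⟩, hn⟩ := h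
          obtain ⟨j, rfl, h2⟩ := hdata d hd a b hab
          rw [← ih, h2, Pi.add_apply, switch_inr_of_ne, add_zero]
          rintro rfl
          exact hn (hab.symm.trans huv)
      have h2 := key w
      rw [h1, Pi.add_apply, switch_inr_self] at h2
      exact ZMod.two_add_one_ne _ h2.symm

end LinkClass

/-! ### Slides across the edges of a tree-like set -/

section Connectivity

variable {V : Type u} {Γ : SimpleGraph V} {ι : Type} {P : ι → WhiteheadPartition Γ} {L : Set V}

open WhiteheadPartition

theorem commutingLabels_inr_iff {y : BLabel V ι} {i : ι} :
    CommutingLabels P y (Sum.inr i) ↔ rep P (unoriented y) ∈ (P i).link := by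
  rw [commutingLabels_iff, mem_link_iff, SimpleGraph.adj_comm]
  rfl

theorem commutingLabels_inr_iff' {y : BLabel V ι} {i : ι} :
    CommutingLabels P y (Sum.inr i) ↔ (P i).base.1 ∈ lk Γ (rep P (unoriented y)) :=
  commutingLabels_iff _ _

/-- If the link of the label is not inside the link of the partition, the partition does not
separate a letter from its inverse, so both orientations force the same side. -/
theorem Forces.twist {y : BLabel V ι} {i : ι} {b : ZMod 2} (h : Forces P y i b)
    (hl : ¬ lk Γ (rep P (unoriented y)) ⊆ (P i).link) : Forces P (BLabel.twist 1 y) i b := by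
  cases y with
  | inr j => exact h
  | inl v =>
    change (v.twist 1).inv ∈ (P i).sideAt b
    rw [Letter.twist_one, Letter.inv_inv]
    have h : v.inv ∈ (P i).sideAt b := h
    refine ((P i).mem_sideAt_or b (x := v)
      (notMem_link (x := v.inv) h)).resolve_right fun h' => hl ?_
    refine lk_subset_of_single ((mem_single_iff _ v).2 ⟨b + 1, h', ?_⟩)
    rwa [ZMod.two_add_one_add_one]

/-- The vertices of the base graph whose sides meet the given side of a further partition. -/
def meeting (P : ι → WhiteheadPartition Γ) (L : Set V) (j : ι) (b : ZMod 2) :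
    Set (blowup (linkClass P L)).Vertex :=
  {t | ∀ l, ((P l.1).sideAt (BlowupCube.origin t l) ∩ (P j).sideAt b).Nonempty}

/-- Each partition with link `L` has exactly one side that is disjoint from some side of `P j`. A
vertex meeting both sides of `P j` must take the other side every time. -/
theorem subsingleton_meeting (hP : IsCompatibleCollection P) {j : ι} (hj : (P j).base.1 ∉ L)
    (hl : ¬ L ⊆ (P j).link) (b : ZMod 2) :
    (meeting P L j b ∩ meeting P L j (b + 1)).Subsingleton := by
  intro t ht t' ht'
  refine vertex_ext (funext fun l => ?_)
  have hlj : l.1 ≠ j := by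
    rintro h
    have := l.2
    rw [h] at this
    exact hl this.ge
  have hc : ¬ (P l.1).Commute (P j) := by
    rw [commute_iff_mem_link, l.2]
    exact hj
  obtain ⟨a, c, hac⟩ := exists_disjoint (hP _ _ hlj).2 hc
  have key : ∀ t ∈ meeting P L j b ∩ meeting P L j (b + 1), BlowupCube.origin t l = a + 1 := by
    intro t ht
    apply ZMod.two_eq_add_one
    intro h
    by_cases hcb : c = b
    · subst hcb
      have := ht.1 l
      rw [h] at this
      exact this.ne_empty hac
    · rw [ZMod.two_eq_add_one hcb] at hac
      have := ht.2 l
      rw [h] at this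
      exact this.ne_empty hac
  rw [key t ht, key t' ht']

/-- For a letter, its inverse is a common element. For a partition, one of its sides is contained in
the forced side, and the region conditions at the two ends of the edge make the sides at `z` meet
that one. -/
theorem inter_nonempty_of_forces (hP : IsCompatibleCollection P) {j : ι}
    (hj : (P j).base.1 ∉ L) (hl : ¬ L ⊆ (P j).link) {b : ZMod 2}
    {y : BLabel V {j : ι // (P j).link = L}} (hy : unoriented (liftLabel y) ∈ baseLabels P L)
    {z : {j : ι // (P j).link = L} → ZMod 2} (hz : Fits (linkClass P L) z y)
    (hb : Forces P (liftLabel y) j b) (l : {j : ι // (P j).link = L}) :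
    ((P l.1).sideAt (z l) ∩ (P j).sideAt b).Nonempty := by
  have hc : ∀ l : {j : ι // (P j).link = L}, ¬ (P l.1).Commute (P j) := by
    intro l
    rw [commute_iff_mem_link, l.2]
    exact hj
  have hn := not_commutingLabels_of_mem hy
  cases y with
  | inl v => exact ⟨v.inv, (hz.departs l).resolve_right (hn l), hb⟩
  | inr i =>
    have hij : i.1 ≠ j := by
      intro h
      have := i.2
      rw [h] at this
      exact hl this.ge
    obtain ⟨a, ha⟩ := hb
    have hsub := subset_of_disjoint ha (hc i)
    rw [ZMod.two_add_one_add_one] at hsub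
    by_cases hli : l = i
    · subst hli
      by_cases hza : z l = a
      · rw [hza]
        exact ⟨_, baseAt_mem _ _, hsub (baseAt_mem _ _)⟩
      · rw [ZMod.two_eq_add_one hza, Set.nonempty_iff_ne_empty]
        intro h
        rw [← ZMod.two_add_one_add_one b] at h
        obtain h1 := disjoint_unique (hP _ _ hij).1 (hc l) ha h
        exact ZMod.two_add_one_ne _ h1.1.symm
    · have hcl : ¬ (P l.1).Commute (P i.1) := fun h => hn l ⟨Ne.symm hli, commute_comm.1 h⟩
      have h1 := (hz.region l i hli).resolve_left hcl
      have h2 := (hz.region' l i hli).resolve_left hcl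
      rw [Pi.add_apply, Pi.add_apply, switch_inr_self, switch_inr_of_ne hli, add_zero] at h2
      by_cases hza : z i = a
      · rw [hza] at h1
        exact h1.mono (Set.inter_subset_inter_right _ hsub)
      · rw [ZMod.two_eq_add_one hza, ZMod.two_add_one_add_one] at h2
        exact h2.mono (Set.inter_subset_inter_right _ hsub)

theorem switch_ne_zero {y : BLabel V ι} {i : ι} (h : switch P y i ≠ 0) :
    lk Γ (rep P (unoriented y)) ⊆ (P i).link := by
  cases y with
  | inl v => exact lk_subset_of_single (not_not.1 fun h' => h (switch_inl_of_notMem h'))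
  | inr j =>
    obtain rfl : i = j := not_not.1 fun h' => h (switch_inr_of_ne h')
    exact (link_eq _).ge

/-- On a path in a spanning tree of the base graph, the edges force the sides of further partitions
as do both ends. -/
theorem forces_of_isPath [Finite ι] (hP : IsCompatibleCollection P) {A : Set (V ⊕ ι)}
    (hA : IsSpanningTree (classEnds P L) (A ∩ baseLabels P L)) {x x' : ι → ZMod 2}
    (hx : IsRegion P x) (hx' : IsRegion P x')
    {w : (SimpleGraph.fromEdgeSet (classEnds P L '' (A ∩ baseLabels P L))).Walk
      (vertexAt _ (hx.restrict L)) (vertexAt _ (hx'.restrict L))} (hw : w.IsPath) {j : ι}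
    (hj : (P j).base.1 ∉ L) (hl : ¬ L ⊆ (P j).link) (hxj : x j = x' j)
    {e : (blowup (linkClass P L)).Edge}
    (he : Sum.map id Subtype.val (edgeLabel (linkClass P L) e) ∈ A ∩ baseLabels P L)
    (h1 : (blowup (linkClass P L)).src e ∈ w.support)
    (h2 : (blowup (linkClass P L)).tgt e ∈ w.support) {b : ZMod 2}
    (hb : Forces P (liftLabel (BlowupCube.label e 0)) j b) : b = x j := by
  have hends : ∀ {e : (blowup (linkClass P L)).Edge} {b : ZMod 2},
      Sum.map id Subtype.val (edgeLabel (linkClass P L) e) ∈ baseLabels P L →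
      Forces P (liftLabel (BlowupCube.label e 0)) j b →
      (blowup (linkClass P L)).src e ∈ meeting P L j b ∧
        (blowup (linkClass P L)).tgt e ∈ meeting P L j b := by
    intro e b he hb
    rw [map_edgeLabel] at he
    refine ⟨fun l => ?_, fun l => ?_⟩
    · rw [origin_src]
      exact inter_nonempty_of_forces hP hj hl he (BlowupCube.fits e 0) hb l
    · rw [origin_tgt]
      have hlk : ¬ lk Γ (rep P (unoriented (liftLabel (BlowupCube.label e 0)))) ⊆
          (P j).link := by
        have h1 := (mem_baseLabels_iff _).1 he
        exact fun h => hl (h1.ge.trans h)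
      have hb' := hb.twist hlk
      have he' : unoriented (liftLabel (BLabel.twist 1 (BlowupCube.label e 0))) ∈
          baseLabels P L := by
        rwa [unoriented_liftLabel, unoriented_twist, ← unoriented_liftLabel]
      refine inter_nonempty_of_forces hP hj hl he' (BlowupCube.fits e 0).twist ?_ l
      cases h : BlowupCube.label e 0 <;> rw [h] at hb' <;> exact hb'
  have hreg : ∀ {x : ι → ZMod 2} (hx : IsRegion P x),
      vertexAt _ (hx.restrict L) ∈ meeting P L j (x j) := by
    intro x hx l
    have hlj : l.1 ≠ j := by
      rintro h
      have := l.2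
      rw [h] at this
      exact hl this.ge
    refine (hx l.1 j hlj).resolve_left ?_
    rw [commute_iff_mem_link, l.2]
    exact hj
  -- Every edge of the base graph forces a side of `P j`, and both its ends meet that side. So the
  -- graph is covered by two parts with at most one common vertex, and a path with both ends in one
  -- part stays there.
  have hsupp := hw.support_subset (subsingleton_meeting hP hj hl (x j)) (by
    intro u v huv
    rw [SimpleGraph.fromEdgeSet_adj] at huv
    obtain ⟨⟨c, hc, hcu⟩, -⟩ := huv
    obtain ⟨e, rfl, rfl, rfl⟩ := exists_edge_of_classEnds hP hc.2 hcu
    have hlab := hc.2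
    rw [map_edgeLabel] at hlab
    have hlk := (mem_baseLabels_iff _).1 hlab
    obtain ⟨b, hb⟩ := exists_forces hP (y := liftLabel (BlowupCube.label e 0)) (i := j)
      (fun h => hj (hlk.le (commutingLabels_inr_iff'.1 h)))
      (fun h => hl (by rw [h] at hlk; exact hlk.ge.trans (link_eq _).ge))
    have := hends hc.2 hb
    by_cases hbx : b = x j
    · subst hbx; exact Or.inl this
    · rw [ZMod.two_eq_add_one hbx] at this; exact Or.inr this) (hreg hx)
    (by rw [hxj]; exact hreg hx')
  by_contra hbx
  -- An edge of the path that forces the opposite side would have both ends in the intersection of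
  -- the two parts, hence be a loop.
  have h3 := hends he.2 hb
  rw [ZMod.two_eq_add_one hbx] at h3
  have := subsingleton_meeting hP hj hl (x j) ⟨hsupp _ h1, h3.1⟩ ⟨hsupp _ h2, h3.2⟩
  apply hA.not_isDiag _ he
  rw [classEnds_eq hP he.2]
  exact this

/-- `x'` is the other end of an edge at `x` that has a label in `A` and spans a cube with the edges
labelled by `Y`. -/
def Slide (P : ι → WhiteheadPartition Γ) (A : Set (V ⊕ ι)) (Y : Set (BLabel V ι))
    (x x' : ι → ZMod 2) : Prop :=
  (∀ z ∈ Y, Fits P x z) ∧ ∃ c, unoriented c ∈ A ∧ (∀ z ∈ Y, CommutingLabels P z c) ∧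
    Fits P x c ∧ x' = x + switch P c

/-- Any two regions carrying the edges `Y` are joined by flips, so it suffices to realize single
flips by slides. -/
theorem reflTransGen_slide_of_flip [Finite ι] (hP : IsCompatibleCollection P) {A : Set (V ⊕ ι)}
    {Y : Set (BLabel V ι)} {S : Set ι}
    (h : ∀ i ∈ S, ∀ x, (∀ z ∈ Y, Fits P x z) → Fits P x (Sum.inr i) →
      Relation.ReflTransGen (Slide P A Y) x (x + switch P (Sum.inr i)))
    (hS : ∀ i ∈ S, ∀ z ∈ Y, CommutingLabels P z (Sum.inr i)) {x x' : ι → ZMod 2}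
    (hx : IsRegion P x) (hx' : IsRegion P x') (hY : ∀ z ∈ Y, Fits P x z)
    (hd : ∀ i, x i ≠ x' i → i ∈ S) : Relation.ReflTransGen (Slide P A Y) x x' := by
  have key := reflTransGen_flip (R := Relation.ReflTransGen (Slide P A Y)) hP Y hx hY hx'
    (fun i hi => hS i (hd i hi)) fun w i hi _ hw hwi => h i (hd i hi) w hw hwi
  clear hd hx'
  induction key with
  | refl => exact .refl
  | tail _ h ih => exact ih.trans h

/-- Induction on the size of the complement of the link `L` of the flipped partition. The spanning
tree for `L` contains a path between the images of both ends in the base graph, and its edges are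
lifted one by one. Before each lift the current region is projected to an edge with the next label;
this changes only partitions whose link is strictly larger than `L`, and those flips are slides by
induction. -/
theorem reflTransGen_slide_flip [Finite ι] [Finite V] (hP : IsCompatibleCollection P)
    {A : Set (V ⊕ ι)} (hA : TreeLabels P A) {Y : Set (BLabel V ι)} {i : ι}
    (hi : ∀ z ∈ Y, CommutingLabels P z (Sum.inr i)) {x : ι → ZMod 2}
    (hx : ∀ z ∈ Y, Fits P x z) (hxi : Fits P x (Sum.inr i)) :
    Relation.ReflTransGen (Slide P A Y) x (x + switch P (Sum.inr i)) := by
  obtain ⟨n, hn⟩ : ∃ n, n = ((P i).linkᶜ).ncard := ⟨_, rfl⟩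
  induction n using Nat.strong_induction_on generalizing i x with
  | _ n ih =>
    obtain ⟨L, hL⟩ : ∃ L, (P i).link = L := ⟨_, rfl⟩
    have hYL : ∀ z ∈ Y, rep P (unoriented z) ∈ L := by
      intro z hz
      rw [← hL]
      exact commutingLabels_inr_iff.1 (hi z hz)
    -- The induction hypothesis in the form used: changes in partitions with link strictly above `L`
    -- are free.
    have hbig : ∀ {x x' : ι → ZMod 2}, IsRegion P x → IsRegion P x' → (∀ z ∈ Y, Fits P x z) →
        (∀ j, x j ≠ x' j → L ⊂ (P j).link) → Relation.ReflTransGen (Slide P A Y) x x' := by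
      intro x x' hx hx' hY hd
      have hS : ∀ j ∈ {j | L ⊂ (P j).link}, ∀ z ∈ Y, CommutingLabels P z (Sum.inr j) :=
        fun j hj z hz => commutingLabels_inr_iff.2 ((show L ⊂ (P j).link from hj).1 (hYL z hz))
      refine reflTransGen_slide_of_flip hP (S := {j | L ⊂ (P j).link}) ?_ hS hx hx' hY hd
      intro j hj x hx hxj
      refine ih _ ?_ (hS j hj) hx hxj rfl
      rw [hn, hL]
      exact Set.ncard_lt_ncard (compl_lt_compl_iff_lt.2 hj) (Set.toFinite _)
    have htree : IsSpanningTree (classEnds P L) (A ∩ baseLabels P L) := hL ▸ hA.2 i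
    obtain ⟨w, hw⟩ := (htree.isTree.1.preconnected (vertexAt _ (hxi.region.restrict L))
      (vertexAt _ (hxi.region'.restrict L))).exists_isPath
    have hcoord : ∀ j, ¬ L ⊆ (P j).link → x j = (x + switch P (Sum.inr i)) j := by
      intro j hj
      rw [Pi.add_apply, switch_inr_of_ne, add_zero]
      rintro rfl
      exact hj hL.ge
    -- Lifting of a walk `q` that runs inside the support of `w`. The lifted region lies over the
    -- current vertex of `q` and agrees with `x` in all partitions whose link does not contain `L`.
    have key : ∀ {u v} (q : (SimpleGraph.fromEdgeSet
        (classEnds P L '' (A ∩ baseLabels P L))).Walk u v), (∀ t ∈ q.support, t ∈ w.support) →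
        ∀ y, IsRegion P y → (∀ z ∈ Y, Fits P y z) → restrict P L y = BlowupCube.origin u →
        (∀ j, ¬ L ⊆ (P j).link → y j = x j) → ∃ y', IsRegion P y' ∧ (∀ z ∈ Y, Fits P y' z) ∧
          restrict P L y' = BlowupCube.origin v ∧ (∀ j, ¬ L ⊆ (P j).link → y' j = x j) ∧
          Relation.ReflTransGen (Slide P A Y) y y' := by
      intro u v q
      induction q with
      | nil => exact fun _ y h1 h2 h3 h4 => ⟨y, h1, h2, h3, h4, .refl⟩
      | @cons u u' v huv q ihq =>
        intro hsub y hy hyY hyu hyx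
        have hu : u ∈ w.support := hsub u (by simp)
        have hu' : u' ∈ w.support := hsub u' (by simp)
        have huv' := huv
        rw [SimpleGraph.fromEdgeSet_adj] at huv'
        obtain ⟨⟨c, hc, hcu⟩, -⟩ := huv'
        obtain ⟨e, rfl, rfl, rfl⟩ := exists_edge_of_classEnds hP hc.2 hcu
        have hlab := hc.2
        rw [map_edgeLabel] at hlab
        have hlk := (mem_baseLabels_iff _).1 hlab
        have hfe := BlowupCube.fits e 0
        rw [origin_src] at hyu
        rw [← hyu] at hfe
        obtain ⟨y1, hy1⟩ := exists_isProj hP (liftLabel (BlowupCube.label e 0)) y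
        have hf1 := hy1.fits hP hy
        have hcomm : ∀ z ∈ Y, CommutingLabels P z (liftLabel (BlowupCube.label e 0)) := by
          intro z hz
          rw [commutingLabels_iff]
          exact SimpleGraph.Adj.symm (hlk.ge (hYL z hz))
        have hY1 : ∀ z ∈ Y, Fits P y1 z :=
          fun z hz => hy1.fits_of_commuting hP (hyY z hz) (hcomm z hz)
        -- If the link of `P j` does not contain `L`, the edges of the path force the side that `P
        -- j` has at both ends of the flip, which is the current side.
        have hdiff : ∀ j, y j ≠ y1 j → L ⊂ (P j).link := by
          intro j hj
          have hnc : ¬ CommutingLabels P (liftLabel (BlowupCube.label e 0)) (Sum.inr j) :=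
            fun h => hj (hy1.commuting j h).symm
          have hne : liftLabel (BlowupCube.label e 0) ≠ Sum.inr j :=
            fun h => hj (hy1.self j h).symm
          have hLj : L ⊆ (P j).link := by
            by_contra hLj
            refine hj ((hyx j hLj).trans ?_)
            exact (forces_of_isPath hP htree hxi.region hxi.region' hw
              (fun h => hnc (commutingLabels_inr_iff'.2 (hlk.ge h))) hLj (hcoord j hLj) hc hu hu'
              (hy1.forces j hnc hne)).symm
          -- If the link of `P j` is exactly `L`, its side is already determined by the vertex of
          -- the base graph.
          refine hLj.ssubset_of_ne fun hLj => hj ?_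
          exact hfe.determined (hP.linkClass L) hf1.restrict (i := ⟨j, hLj.symm⟩)
            (not_commutingLabels_of_mem hlab _) (fun h => hne (by rw [h]; rfl))
        obtain ⟨y', h1, h2, h3, h4, h5⟩ := ihq (fun t ht => hsub t (by simp [ht]))
          (y1 + switch P (liftLabel (BlowupCube.label e 0))) hf1.region'
          (fun z hz => (hY1 z hz).move hf1 (hcomm z hz)) (by
            rw [restrict_add_switch, origin_tgt, ← hyu]
            congr 1
            funext j
            by_contra hj
            exact (hdiff j.1 fun h => hj h.symm).ne j.2.symm)
          (fun j hj => by
            have e1 : switch P (liftLabel (BlowupCube.label e 0)) j = 0 :=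
              not_not.1 fun h => hj (hlk.ge.trans (switch_ne_zero h))
            have e2 : y1 j = y j := not_not.1 fun h => hj (hdiff j (Ne.symm h)).subset
            rw [Pi.add_apply, e1, add_zero, e2, hyx j hj])
        refine ⟨y', h1, h2, h3, h4, (hbig hy hf1.region hyY hdiff).trans (.head ?_ h5)⟩
        refine ⟨hY1, _, ?_, hcomm, hf1, rfl⟩
        rw [← map_edgeLabel]
        exact hc.1
    obtain ⟨y', h1, h2, h3, h4, h5⟩ := key w (fun _ h => h) x hxi.region hx rfl fun _ _ => rfl
    -- The lifted path ends over the right vertex of the base graph; what remains to be corrected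
    -- again concerns larger links only.
    refine h5.trans (hbig h1 hxi.region' h2 fun j hj => ?_)
    have hLj : L ⊆ (P j).link := not_not.1 fun hLj => hj ((h4 j hLj).trans (hcoord j hLj))
    exact hLj.ssubset_of_ne fun hLj => hj (congrFun h3 ⟨j, hLj.symm⟩)

/-- Slides along the edges with labels in a tree-like set connect the edges with a given label. -/
theorem reflTransGen_slide [Finite ι] [Finite V] (hP : IsCompatibleCollection P)
    {A : Set (V ⊕ ι)} (hA : TreeLabels P A) {Y : Set (BLabel V ι)} {x x' : ι → ZMod 2}
    (hx : IsRegion P x) (hx' : IsRegion P x') (hY : ∀ z ∈ Y, Fits P x z)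
    (hY' : ∀ z ∈ Y, Fits P x' z) (hi : ∀ i, Sum.inr i ∈ Y → x i = x' i) :
    Relation.ReflTransGen (Slide P A Y) x x' := by
  have hS : ∀ i ∈ {i | x i ≠ x' i}, ∀ z ∈ Y, CommutingLabels P z (Sum.inr i) := by
    intro i hxi z hz
    by_contra hc
    exact hxi ((hY z hz).determined hP (hY' z hz) hc fun h => hxi (hi i (h ▸ hz)))
  exact reflTransGen_slide_of_flip hP (fun i hi x hx hxi =>
    reflTransGen_slide_flip hP hA (hS i hi) hx hxi) hS hx hx' hY fun i hi => hi

end Connectivity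

/-! ### The collapse along a tree-like set is the Salvetti complex -/

section Coordinates

variable {V : Type u} {Γ : SimpleGraph V} {ι : Type} {P : ι → WhiteheadPartition Γ}
  {A : Set (V ⊕ ι)} {β : V ⊕ ι → Letter V}

open WhiteheadPartition

/-- The labels that are not in `A` correspond to the vertices of `Γ`, with the same links; for each
of them an orientation is chosen. -/
structure IsCoordinate (P : ι → WhiteheadPartition Γ) (A : Set (V ⊕ ι))
    (β : V ⊕ ι → Letter V) : Prop where
  injOn : Set.InjOn (fun c => (β c).1) Aᶜ
  surj : ∀ v, ∃ c ∉ A, (β c).1 = v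
  lk_eq : ∀ c ∉ A, lk Γ (β c).1 = lk Γ (rep P c)

/-- The orientation of an edge with label `y` at the region `x`. -/
def orientation (x : ι → ZMod 2) : BLabel V ι → ZMod 2
  | Sum.inl v => if v.2 then 0 else 1
  | Sum.inr i => x i

/-- The letter read along an edge with label `y` at the region `x`. -/
def letterAt (β : V ⊕ ι → Letter V) (x : ι → ZMod 2) (y : BLabel V ι) : Letter V :=
  (β (unoriented y)).twist (orientation x y)

theorem letterAt_fst (x : ι → ZMod 2) (y : BLabel V ι) :
    (letterAt β x y).1 = (β (unoriented y)).1 := Letter.twist_fst _ _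

theorem Letter.twist_inj {v : Letter V} {a b : ZMod 2} (h : v.twist a = v.twist b) : a = b := by
  rcases ZMod.two_cases a with rfl | rfl <;> rcases ZMod.two_cases b with rfl | rfl
  · rfl
  · rw [Letter.twist_zero, Letter.twist_one] at h
    exact absurd h.symm (Letter.inv_ne v)
  · rw [Letter.twist_zero, Letter.twist_one] at h
    exact absurd h (Letter.inv_ne v)
  · rfl

theorem orientation_twist {x x' : ι → ZMod 2} {y : BLabel V ι} {a : ZMod 2}
    (h : ∀ i, y = Sum.inr i → x' i = x i + a) :
    orientation x' (BLabel.twist a y) = orientation x y + a := by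
  cases y with
  | inr i => exact h i rfl
  | inl v =>
    obtain ⟨v, s⟩ := v
    rcases ZMod.two_cases a with rfl | rfl <;> cases s <;>
      simp [orientation, BLabel.twist, Letter.twist, Letter.inv,
        show (1 : ZMod 2) + 1 = 0 from by decide]

theorem letterAt_twist {x x' : ι → ZMod 2} {y : BLabel V ι} {a : ZMod 2}
    (h : ∀ i, y = Sum.inr i → x' i = x i + a) :
    letterAt β x' (BLabel.twist a y) = (letterAt β x y).twist a := by
  unfold letterAt
  rw [orientation_twist h, unoriented_twist, Letter.twist_twist]

theorem eq_of_orientation {x x' : ι → ZMod 2} {y y' : BLabel V ι}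
    (h : unoriented y = unoriented y') (h' : orientation x y = orientation x' y') :
    y = y' ∧ ∀ i, y = Sum.inr i → x i = x' i := by
  cases y with
  | inl v =>
    cases y' with
    | inr i => cases h
    | inl w =>
      refine ⟨?_, fun i hi => by cases hi⟩
      obtain ⟨v, s⟩ := v
      obtain ⟨w, t⟩ := w
      obtain rfl : v = w := Sum.inl.inj h
      cases s <;> cases t <;> first | rfl | (exact absurd h' (by simp [orientation]))
  | inr i =>
    cases y' with
    | inl v => cases h
    | inr j =>
      obtain rfl : i = j := Sum.inr.inj h
      refine ⟨rfl, fun k hk => ?_⟩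
      cases hk
      exact h'

theorem IsCoordinate.eq_of_letterAt (hβ : IsCoordinate P A β) {x x' : ι → ZMod 2}
    {y y' : BLabel V ι} (hy : unoriented y ∉ A) (hy' : unoriented y' ∉ A)
    (h : letterAt β x y = letterAt β x' y') : y = y' ∧ ∀ i, y = Sum.inr i → x i = x' i := by
  have h1 : unoriented y = unoriented y' := hβ.injOn hy hy' (by
    have := congrArg Prod.fst h
    rwa [letterAt_fst, letterAt_fst] at this)
  refine eq_of_orientation h1 ?_
  unfold letterAt at h
  rw [h1] at h
  exact Letter.twist_inj h

theorem IsCoordinate.adj_iff (hβ : IsCoordinate P A β) {c d : V ⊕ ι} (hc : c ∉ A) (hd : d ∉ A) :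
    Γ.Adj (β c).1 (β d).1 ↔ Γ.Adj (rep P c) (rep P d) := by
  have h1 : (β d).1 ∈ lk Γ (β c).1 ↔ (β d).1 ∈ lk Γ (rep P c) := by rw [hβ.lk_eq c hc]
  have h2 : rep P c ∈ lk Γ (β d).1 ↔ rep P c ∈ lk Γ (rep P d) := by rw [hβ.lk_eq d hd]
  exact h1.trans (Iff.trans ⟨.symm, .symm⟩ (h2.trans ⟨.symm, .symm⟩))

/-- Directions other than the `i`-th commute with the `i`-th label and do not switch its partition,
so moving the corner alters the letter only through its own coordinate. -/
theorem letterAt_restr {n m : ℕ} (C : BlowupCube P n) (φ : FaceMap m n) (i : Fin m) :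
    letterAt β (BlowupCube.origin ((blowup P).restr φ C))
      (BlowupCube.label ((blowup P).restr φ C) i) =
    (letterAt β C.origin (C.label (φ.axis i))).twist (φ.corner (φ.axis i)) := by
  refine letterAt_twist fun k hk => ?_
  change C.origin k + (∑ j, φ.corner j • switch P (C.label j)) k = _
  rw [Finset.sum_apply, Finset.sum_eq_single (φ.axis i)]
  · rw [hk, Pi.smul_apply, switch_inr_self, smul_eq_mul, mul_one]
  · intro j _ hj
    have := C.commuting j _ hj
    rw [hk] at this
    rw [Pi.smul_apply, switch_eq_zero this, smul_zero]
  · exact fun h => absurd (Finset.mem_univ _) h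

theorem avoids_iff {n : ℕ} (C : BlowupCube P n) :
    (blowup P).Avoids (hypLabel P ⁻¹' A) (n := n) C ↔ ∀ i, unoriented (C.label i) ∉ A := by
  have h1 : ∀ φ : FaceMap 1 n, (blowup P).hyp ((blowup P).restr φ C) ∈ hypLabel P ⁻¹' A ↔
      unoriented (C.label (φ.axis 0)) ∈ A := by
    intro φ
    exact iff_of_eq (congrArg (· ∈ A) (edgeLabel_restr (P := P) (n := n) C φ))
  constructor
  · intro h i
    exact fun h' => h (FaceMap.edge 0 i) ((h1 _).2 h')
  · intro h φ h'
    exact h _ ((h1 φ).1 h')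

/-- The cube of the Salvetti complex given by a cube of the blow-up. -/
def IsCoordinate.onCube (hβ : IsCoordinate P A β) {n : ℕ}
    (C : {C : (blowup P).Cube n // (blowup P).Avoids (hypLabel P ⁻¹' A) C}) :
    (salvetti Γ).Cube n :=
  ⟨fun i => letterAt β (BlowupCube.origin C.1) (BlowupCube.label C.1 i), fun i j h => by
    rw [letterAt_fst, letterAt_fst, hβ.adj_iff ((avoids_iff _).1 C.2 i) ((avoids_iff _).1 C.2 j)]
    exact (commutingLabels_iff _ _).1 (BlowupCube.commuting C.1 i j h)⟩

theorem IsCoordinate.onCube_eq_of_opposite (hβ : IsCoordinate P A β) {n : ℕ}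
    {C C' : {C : (blowup P).Cube n // (blowup P).Avoids (hypLabel P ⁻¹' A) C}}
    (h : (blowup P).Opposite _ C C') : hβ.onCube C = hβ.onCube C' := by
  obtain ⟨D, -, h0, h1⟩ := h
  refine Subtype.ext (funext fun i => ?_)
  change letterAt β (BlowupCube.origin C.1) (BlowupCube.label C.1 i) =
    letterAt β (BlowupCube.origin C'.1) (BlowupCube.label C'.1 i)
  have e0 := letterAt_restr (β := β) D (FaceMap.face 0) i
  have e1 := letterAt_restr (β := β) D (FaceMap.face 1) i
  rw [h0] at e0
  rw [h1] at e1
  exact e0.trans e1.symm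

theorem IsCoordinate.onCube_restr (hβ : IsCoordinate P A β) {m n : ℕ} (φ : FaceMap m n)
    (C : {C : (blowup P).Cube n // (blowup P).Avoids (hypLabel P ⁻¹' A) C})
    (h : (blowup P).Avoids (hypLabel P ⁻¹' A) ((blowup P).restr φ C.1)) :
    hβ.onCube ⟨(blowup P).restr φ C.1, h⟩ = (salvetti Γ).restr φ (hβ.onCube C) :=
  Subtype.ext (funext fun i => letterAt_restr C.1 φ i)

/-- Equal letters give equal labels and equal sides of the partitions among these labels. The
origins are then joined by slides that carry all the edges along, and every slide is a cube of one
dimension higher whose opposite faces are identified. -/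
theorem IsCoordinate.mk_eq_of_onCube_eq [Finite ι] [Finite V] (hβ : IsCoordinate P A β)
    (hP : IsCompatibleCollection P) (hA : TreeLabels P A) {n : ℕ}
    {C C' : {C : (blowup P).Cube n // (blowup P).Avoids (hypLabel P ⁻¹' A) C}}
    (h : hβ.onCube C = hβ.onCube C') :
    Quot.mk ((blowup P).Opposite (hypLabel P ⁻¹' A)) C =
      Quot.mk ((blowup P).Opposite (hypLabel P ⁻¹' A)) C' := by
  have h1 := fun i => hβ.eq_of_letterAt ((avoids_iff _).1 C.2 i) ((avoids_iff _).1 C'.2 i)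
    (congrFun (congrArg Subtype.val h) i)
  have hlab : BlowupCube.label C.1 = BlowupCube.label C'.1 := funext fun i => (h1 i).1
  have key := reflTransGen_slide hP hA (Y := Set.range (BlowupCube.label C.1))
    (BlowupCube.isRegion C.1) (BlowupCube.isRegion C'.1) (by
      rintro _ ⟨i, rfl⟩
      exact BlowupCube.fits C.1 i) (by
      rintro _ ⟨i, rfl⟩
      rw [hlab]
      exact BlowupCube.fits C'.1 i) (by
      rintro i ⟨j, hj⟩
      exact (h1 j).2 i hj)
  have : ∀ x', Relation.ReflTransGen (Slide P A (Set.range (BlowupCube.label C.1)))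
      (BlowupCube.origin C.1) x' →
      ∀ C' : {C : (blowup P).Cube n // (blowup P).Avoids (hypLabel P ⁻¹' A) C},
      BlowupCube.label C.1 = BlowupCube.label C'.1 → BlowupCube.origin C'.1 = x' →
      Quot.mk ((blowup P).Opposite (hypLabel P ⁻¹' A)) C =
        Quot.mk ((blowup P).Opposite (hypLabel P ⁻¹' A)) C' := by
    clear key h1 h hlab C'
    intro x' hx'
    induction hx' with
    | refl =>
      intro C' hl ho
      congr 1
      exact Subtype.ext (BlowupCube.ext ho.symm hl)
    | @tail x x' hx hs ih =>
      intro C' hl ho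
      obtain ⟨hf, c, hcA, hc, hxc, rfl⟩ := hs
      let C₁ : BlowupCube P n := mkCube x (BlowupCube.label C.1) (BlowupCube.commuting C.1)
        hxc.region fun j => hf _ ⟨j, rfl⟩
      have hC₁ : (blowup P).Avoids (hypLabel P ⁻¹' A) (n := n) C₁ :=
        (avoids_iff C₁).2 ((avoids_iff C.1).1 C.2)
      refine (ih ⟨C₁, hC₁⟩ rfl rfl).trans (Quot.sound ?_)
      refine ⟨BlowupCube.suspend C₁ c (fun j => hc _ ⟨j, rfl⟩) hxc, fun a => ?_,
        BlowupCube.face_suspend_zero _ _ _ _, ?_⟩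
      · rw [Set.mem_preimage, hypLabel_hyp, edgeLabel_restr]
        exact hcA
      · refine BlowupCube.ext ?_ ?_
        · exact (BlowupCube.origin_face_suspend_one _ _ _ _).trans ho.symm
        · exact (BlowupCube.label_face_suspend_one _ _ _ _).trans hl
  exact this _ key C' hlab rfl

theorem exists_unoriented (c : V ⊕ ι) : ∃ y : BLabel V ι, unoriented y = c := by
  cases c with
  | inl v => exact ⟨Sum.inl (v, true), rfl⟩
  | inr i => exact ⟨Sum.inr i, rfl⟩

theorem Letter.exists_twist {v w : Letter V} (h : v.1 = w.1) : ∃ a, w.twist a = v := by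
  rcases Letter.eq_or_eq_inv h with rfl | rfl
  · exact ⟨0, Letter.twist_zero _⟩
  · exact ⟨1, Letter.twist_one _⟩

/-- The labels matching the letters commute because links are preserved, so all of them depart from
some common region. The cube found has the right letters up to sign. -/
theorem IsCoordinate.onCube_surjective [Finite ι] (hβ : IsCoordinate P A β)
    (hP : IsCompatibleCollection P) (n : ℕ) : Function.Surjective (hβ.onCube (n := n)) := by
  intro D
  choose c hcA hc using fun i => hβ.surj (D.1 i).1
  choose y hy using fun i => exists_unoriented (c i)
  have hcom : ∀ i j, i ≠ j → CommutingLabels P (y i) (y j) := by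
    intro i j hij
    rw [commutingLabels_iff, hy, hy, ← hβ.adj_iff (hcA i) (hcA j), hc, hc]
    exact D.2 i j hij
  obtain ⟨x₀, hx₀⟩ := exists_isRegion P
  obtain ⟨x, hx, hf⟩ := exists_fits hP hcom hx₀ Finset.univ
  let C : BlowupCube P n := mkCube x y hcom hx fun j => hf j (Finset.mem_univ j)
  have hC : (blowup P).Avoids (hypLabel P ⁻¹' A) (n := n) C :=
    (avoids_iff C).2 fun i => by
      rw [show C.label i = y i from rfl, hy]
      exact hcA i
  choose a ha using fun i => Letter.exists_twist (v := D.1 i) (w := letterAt β x (y i))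
    (by rw [letterAt_fst, hy, hc])
  -- Moving the origin to the corner `a` corrects the signs.
  let φ : FaceMap n n := ⟨a, Function.Embedding.refl _⟩
  have hφ : (blowup P).Avoids (hypLabel P ⁻¹' A) ((blowup P).restr φ C) := by
    intro ψ
    have := (blowup P).restr_comp φ ψ (C : (blowup P).Cube n)
    exact (congrArg (fun e => (blowup P).hyp e ∉ hypLabel P ⁻¹' A) this).mpr (hC _)
  refine ⟨⟨(blowup P).restr φ C, hφ⟩, ?_⟩
  rw [hβ.onCube_restr φ ⟨C, hC⟩ hφ]
  exact Subtype.ext (funext fun i => ha i)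

/-- The isomorphism between the collapse of the blow-up and the Salvetti complex. -/
def IsCoordinate.iso [Finite ι] [Finite V] (hβ : IsCoordinate P A β)
    (hP : IsCompatibleCollection P) (hA : TreeLabels P A) :
    ((blowup P).collapse (hypLabel P ⁻¹' A)).Iso (salvetti Γ) where
  equiv n := Equiv.ofBijective
    (Quot.lift (hβ.onCube (n := n)) fun _ _ h => hβ.onCube_eq_of_opposite h)
    ⟨by
      rintro ⟨C⟩ ⟨C'⟩ h
      exact hβ.mk_eq_of_onCube_eq hP hA h, fun D => by
      obtain ⟨C, hC⟩ := hβ.onCube_surjective hP n D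
      exact ⟨Quot.mk _ C, hC⟩⟩
  comm φ C := by
    obtain ⟨C⟩ := C
    exact hβ.onCube_restr φ C _

open Classical in
/-- The element of `A_Γ` read along an edge of the blow-up. -/
def readEdge (A : Set (V ⊕ ι)) (β : V ⊕ ι → Letter V) (e : (blowup P).Edge) : RAAG Γ :=
  if edgeLabel P e ∈ A then 1
  else gen Γ (letterAt β (BlowupCube.origin e) (BlowupCube.label e 0))

/-- The collapse, followed by the isomorphism with the Salvetti complex, on fundamental
groupoids. -/
def IsCoordinate.functor [Finite ι] [Finite V] (hβ : IsCoordinate P A β)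
    (hP : IsCompatibleCollection P) (hA : TreeLabels P A) :
    (blowup P).Grpd ⥤ (salvetti Γ).Grpd :=
  (blowup P).collapseFunctor (hypLabel P ⁻¹' A) ⋙ (hβ.iso hP hA).functor

theorem IsCoordinate.pathElement_functor [Finite ι] [Finite V] (hβ : IsCoordinate P A β)
    (hP : IsCompatibleCollection P) (hA : TreeLabels P A) {x y : (blowup P).Grpd}
    (l : List (blowup P).Edge) (h : (blowup P).IsPath x l y) :
    pathElement ((hβ.functor hP hA).map ((blowup P).hom l h)) =
      (l.map (readEdge A β)).prod := by
  change (((l.flatMap ((blowup P).collapseEdge _)).flatMap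
    fun e => [(hβ.iso hP hA).equiv 1 e]).map fun e => gen Γ (e.1 0)).prod = _
  clear h
  induction l with
  | nil => rfl
  | cons e l ih =>
    have he : (((((blowup P).collapseEdge (hypLabel P ⁻¹' A)) e).flatMap
        fun e => [(hβ.iso hP hA).equiv 1 e]).map fun e => gen Γ (e.1 0)).prod =
        readEdge A β e := by
      unfold CubeComplex.collapseEdge readEdge
      by_cases h : edgeLabel P e ∈ A
      · rw [dif_pos (show (blowup P).hyp e ∈ hypLabel P ⁻¹' A from h), if_pos h]
        rfl
      · rw [dif_neg (show (blowup P).hyp e ∉ hypLabel P ⁻¹' A from h), if_neg h]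
        exact List.prod_singleton
    rw [List.flatMap_cons, List.flatMap_append, List.map_append, List.prod_append, ih]
    exact (congrArg (· * _) he).trans List.prod_cons.symm

end Coordinates

/-! ### Functors induced by isomorphisms of cube complexes -/

namespace CubeComplex

variable {X Y Z : CubeComplex.{u}}

/-- The inverse of an isomorphism. -/
def Iso.symm (h : X.Iso Y) : Y.Iso X where
  equiv n := (h.equiv n).symm
  comm φ C := by
    rw [Equiv.symm_apply_eq, h.comm, Equiv.apply_symm_apply]

/-- The composition of isomorphisms. -/
def Iso.trans (h : X.Iso Y) (h' : Y.Iso Z) : X.Iso Z where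
  equiv n := (h.equiv n).trans (h'.equiv n)
  comm φ C := by
    simp only [Equiv.trans_apply, h.comm, h'.comm]

/-- The identity isomorphism. -/
def Iso.refl (X : CubeComplex.{u}) : X.Iso X := ⟨fun _ => Equiv.refl _, fun _ _ => rfl⟩

theorem CellMap.homotopic (F : CellMap X Y) {x y : X.Vertex} {l l' : List X.Edge}
    (h : X.Homotopic x y l l') :
    Y.Homotopic (F.onV x) (F.onV y) (l.flatMap F.onE) (l'.flatMap F.onE) := by
  obtain ⟨h1, h2, h3⟩ := h
  exact ⟨F.isPath_flatMap h1, F.isPath_flatMap h2,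
    congrArg (F.functor.map (X := (x : X.Grpd)) (Y := (y : X.Grpd))) h3⟩

theorem Iso.isPath (h : X.Iso Y) {x y : X.Vertex} {l : List X.Edge} (hl : X.IsPath x l y) :
    Y.IsPath (h.equiv 0 x) (l.map (h.equiv 1)) (h.equiv 0 y) := by
  have := h.cellMap.isPath_flatMap hl
  rw [show l.flatMap h.cellMap.onE = l.map (h.equiv 1) from List.map_eq_flatMap.symm] at this
  exact this

theorem Iso.map_cls (h : X.Iso Y) {x y : X.Grpd} {l : List X.Edge} (hl : X.IsPath x l y) :
    h.functor.map (X.hom l hl) = Y.hom (l.map (h.equiv 1)) (h.isPath hl) := by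
  refine (map_hom_eq h.cellMap hl).trans ?_
  congr 1
  exact List.map_eq_flatMap.symm

theorem Iso.homotopic (h : X.Iso Y) {x y : X.Vertex} {l l' : List X.Edge}
    (hl : X.Homotopic x y l l') :
    Y.Homotopic (h.equiv 0 x) (h.equiv 0 y) (l.map (h.equiv 1)) (l'.map (h.equiv 1)) := by
  have := h.cellMap.homotopic hl
  rwa [List.map_eq_flatMap, List.map_eq_flatMap]

theorem Iso.map_symm_map (h : X.Iso Y) (l : List X.Edge) :
    (l.map (h.equiv 1)).map (h.symm.equiv 1) = l := by
  rw [List.map_map]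
  exact (List.map_congr_left fun e _ => (h.equiv 1).symm_apply_apply e).trans (List.map_id l)

theorem Iso.homotopic_iff (h : X.Iso Y) {x y : X.Vertex} {l l' : List X.Edge} :
    Y.Homotopic (h.equiv 0 x) (h.equiv 0 y) (l.map (h.equiv 1)) (l'.map (h.equiv 1)) ↔
      X.Homotopic x y l l' := by
  refine ⟨fun hl => ?_, h.homotopic⟩
  have := h.symm.homotopic hl
  rw [h.map_symm_map, h.map_symm_map] at this
  rwa [show h.symm.equiv 0 (h.equiv 0 x) = x from (h.equiv 0).symm_apply_apply x,
    show h.symm.equiv 0 (h.equiv 0 y) = y from (h.equiv 0).symm_apply_apply y] at this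

instance Iso.isEquivalence (h : X.Iso Y) : h.functor.IsEquivalence where
  faithful := ⟨by
    intro x y p q hpq
    obtain ⟨l, hl, rfl⟩ := X.exists_hom p
    obtain ⟨l', hl', rfl⟩ := X.exists_hom q
    rw [h.map_cls, h.map_cls] at hpq
    exact (h.homotopic_iff.1 ⟨h.isPath hl, h.isPath hl', hpq⟩).cls_eq _ _⟩
  full := ⟨by
    intro x y q
    obtain ⟨l, hl, rfl⟩ := Y.exists_hom q
    have hl' := h.symm.isPath hl
    rw [show h.symm.equiv 0 (h.functor.obj x) = x from (h.equiv 0).symm_apply_apply x,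
      show h.symm.equiv 0 (h.functor.obj y) = y from (h.equiv 0).symm_apply_apply y] at hl'
    refine ⟨X.hom _ hl', (h.map_cls hl').trans ?_⟩
    congr 1
    exact h.symm.map_symm_map l⟩
  essSurj := ⟨fun y => ⟨(h.equiv 0).symm y,
    ⟨eqToIso ((h.equiv 0).apply_symm_apply y)⟩⟩⟩

end CubeComplex

/-! ### Exchanging two labels across a cut is a Whitehead automorphism -/

section Exchange

variable {V : Type u} {Γ : SimpleGraph V} {ι : Type} {P : ι → WhiteheadPartition Γ}
  {A A' : Set (V ⊕ ι)} {β β' : V ⊕ ι → Letter V} {L : Set V} {a b : V ⊕ ι}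
  {D : Set (blowup P).Vertex} {m : Letter V}

open WhiteheadPartition

/-- The letter read along an edge. -/
def edgeLetter (β : V ⊕ ι → Letter V) (e : (blowup P).Edge) : Letter V :=
  letterAt β (BlowupCube.origin e) (BlowupCube.label e 0)

theorem edgeLetter_fst (e : (blowup P).Edge) : (edgeLetter β e).1 = (β (edgeLabel P e)).1 :=
  letterAt_fst _ _

theorem edgeLetter_rev (e : (blowup P).Edge) :
    edgeLetter β ((blowup P).rev e) = (edgeLetter β e).inv := by
  unfold edgeLetter
  rw [label_rev, letterAt_twist (x := BlowupCube.origin e), Letter.twist_one]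
  intro i hi
  rw [origin_rev, hi, Pi.add_apply, switch_inr_self]

theorem readEdge_of_mem {e : (blowup P).Edge} (h : edgeLabel P e ∈ A) :
    readEdge A β e = (1 : RAAG Γ) := if_pos h

theorem readEdge_of_notMem {e : (blowup P).Edge} (h : edgeLabel P e ∉ A) :
    readEdge A β e = gen Γ (edgeLetter β e) := if_neg h

theorem IsCoordinate.letter_mem_iff (hβ : IsCoordinate P A β) {c : V ⊕ ι} (hc : c ∉ A)
    {u : V} (hu : lk Γ u = L) : (β c).1 ∈ L ↔ rep P c ∈ L := by
  have h1 : u ∈ lk Γ (β c).1 ↔ u ∈ lk Γ (rep P c) := by rw [hβ.lk_eq c hc]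
  rw [← hu]
  exact Iff.trans ⟨.symm, .symm⟩ (h1.trans ⟨.symm, .symm⟩)

/-- The set `D` of vertices is the preimage of one side of a cut of the base graph for `L`, which
does not separate the ends of edges with labels in `A`, other than `a`, and separates the ends of
edges labelled `a` and `b`. -/
structure IsCut (P : ι → WhiteheadPartition Γ) (A : Set (V ⊕ ι)) (L : Set V) (a b : V ⊕ ι)
    (D : Set (blowup P).Vertex) : Prop where
  mem : a ∈ A
  notMem : b ∉ A
  lk_left : lk Γ (rep P a) = L
  lk_right : lk Γ (rep P b) = L
  same : ∀ e, edgeLabel P e ∈ A → edgeLabel P e ≠ a →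
    ((blowup P).src e ∈ D ↔ (blowup P).tgt e ∈ D)
  separates : ∀ e, edgeLabel P e = a ∨ edgeLabel P e = b →
    ¬ ((blowup P).src e ∈ D ↔ (blowup P).tgt e ∈ D)
  congr : ∀ x y : (blowup P).Vertex, (∀ l, (P l).link = L →
    BlowupCube.origin x l = BlowupCube.origin y l) → (x ∈ D ↔ y ∈ D)

/-- The label commutes with no partition with link `L`, so edges with the same letter agree in the
sides of all these partitions, and `D` depends on nothing else. -/
theorem IsCut.ends_iff (hP : IsCompatibleCollection P) (h : IsCut P A L a b D)
    {e e' : (blowup P).Edge} (hl : edgeLabel P e = edgeLabel P e')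
    (hr : rep P (edgeLabel P e) ∉ L) (hee : edgeLetter β e = edgeLetter β e') :
    ((blowup P).src e ∈ D ↔ (blowup P).src e' ∈ D) ∧
      ((blowup P).tgt e ∈ D ↔ (blowup P).tgt e' ∈ D) := by
  have h1 : orientation (BlowupCube.origin e) (BlowupCube.label e 0) =
      orientation (BlowupCube.origin e') (BlowupCube.label e' 0) := by
    unfold edgeLetter letterAt at hee
    rw [show unoriented (BlowupCube.label e 0) = unoriented (BlowupCube.label e' 0) from hl] at hee
    exact Letter.twist_inj hee
  obtain ⟨h2, h3⟩ := eq_of_orientation hl h1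
  have hf := BlowupCube.fits e 0
  have hf' := BlowupCube.fits e' 0
  rw [← h2] at hf'
  have h4 : ∀ l, (P l).link = L → BlowupCube.origin e l = BlowupCube.origin e' l := by
    intro l hlL
    by_cases hyl : BlowupCube.label e 0 = Sum.inr l
    · exact h3 l hyl
    · refine hf.determined hP hf' (fun hc => hr ?_) hyl
      rw [← hlL]
      exact commutingLabels_inr_iff.1 hc
  refine ⟨h.congr _ _ fun l hlL => ?_, h.congr _ _ fun l hlL => ?_⟩
  · rw [origin_src, origin_src, h4 l hlL]
  · rw [origin_tgt, origin_tgt, Pi.add_apply, Pi.add_apply, h4 l hlL, h2]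

/-- The letters that are read along edges which end in `D`. -/
def sideLetters (A : Set (V ⊕ ι)) (β : V ⊕ ι → Letter V) (L : Set V) (D : Set (blowup P).Vertex) :
    Set (Letter V) :=
  {v | v.1 ∉ L ∧ ∃ e, edgeLabel P e ∉ A ∧ edgeLetter β e = v ∧ (blowup P).tgt e ∈ D}

/-- Membership does not depend on the edge along which a letter is read; for the inverse letter read
the edge backwards. -/
theorem IsCut.mem_sideLetters_iff (hP : IsCompatibleCollection P) (h : IsCut P A L a b D)
    (hβ : IsCoordinate P A β) {e : (blowup P).Edge} (he : edgeLabel P e ∉ A)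
    (hr : (edgeLetter β e).1 ∉ L) :
    (edgeLetter β e ∈ sideLetters A β L D ↔ (blowup P).tgt e ∈ D) ∧
      ((edgeLetter β e).inv ∈ sideLetters A β L D ↔ (blowup P).src e ∈ D) := by
  have key : ∀ {e : (blowup P).Edge}, edgeLabel P e ∉ A → (edgeLetter β e).1 ∉ L →
      (edgeLetter β e ∈ sideLetters A β L D ↔ (blowup P).tgt e ∈ D) := by
    intro e he hr
    refine ⟨?_, fun ht => ⟨hr, e, he, rfl, ht⟩⟩
    rintro ⟨-, e', he', hee, ht⟩
    have hl : edgeLabel P e' = edgeLabel P e := hβ.injOn he' he (by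
      have := congrArg Prod.fst hee
      rwa [edgeLetter_fst, edgeLetter_fst] at this)
    refine (h.ends_iff hP hl ?_ hee).2.1 ht
    rwa [← hβ.letter_mem_iff he' h.lk_left, ← edgeLetter_fst, hee]
  refine ⟨key he hr, ?_⟩
  rw [← edgeLetter_rev, key (by rwa [edgeLabel_rev]) (by rwa [edgeLetter_rev]),
    CubeComplex.tgt_rev]

theorem IsCut.rep_notMem (h : IsCut P A L a b D) : rep P a ∉ L ∧ rep P b ∉ L := by
  constructor
  · rw [← h.lk_left]; exact Γ.loopless.irrefl _
  · rw [← h.lk_right]; exact Γ.loopless.irrefl _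

/-- Every label has an edge that ends in `D`, if it is separated by the cut. -/
theorem IsCut.exists_edge [Finite ι] (hP : IsCompatibleCollection P) (h : IsCut P A L a b D)
    {c : V ⊕ ι} (hc : c = a ∨ c = b) :
    ∃ e, edgeLabel P e = c ∧ (blowup P).src e ∉ D ∧ (blowup P).tgt e ∈ D := by
  obtain ⟨y, hy⟩ := exists_unoriented c
  obtain ⟨e, he⟩ := OutSpace.exists_edge hP y
  have hec : edgeLabel P e = c := by rw [← hy, ← he]; rfl
  have hs := h.separates e (by rw [hec]; exact hc)
  by_cases ht : (blowup P).tgt e ∈ D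
  · exact ⟨e, hec, fun h' => hs ⟨fun _ => ht, fun _ => h'⟩, ht⟩
  · refine ⟨(blowup P).rev e, by rw [edgeLabel_rev, hec], by rwa [CubeComplex.src_rev], ?_⟩
    rw [CubeComplex.tgt_rev]
    by_contra h'
    exact hs ⟨fun h => absurd h h', fun h => absurd h ht⟩

/-- All edges labelled `a` or `b` cross the cut, and the letter records in which direction. -/
theorem IsCut.ends_of_letter (hP : IsCompatibleCollection P) (h : IsCut P A L a b D)
    {c : V ⊕ ι} (hc : c = a ∨ c = b) {e₀ e : (blowup P).Edge} (he₀ : edgeLabel P e₀ = c)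
    (hs : (blowup P).src e₀ ∉ D) (ht : (blowup P).tgt e₀ ∈ D) (he : edgeLabel P e = c) :
    (edgeLetter β e = edgeLetter β e₀ ∧ (blowup P).src e ∉ D ∧ (blowup P).tgt e ∈ D) ∨
    (edgeLetter β e = (edgeLetter β e₀).inv ∧ (blowup P).src e ∈ D ∧ (blowup P).tgt e ∉ D) := by
  have hr : rep P (edgeLabel P e) ∉ L := by
    rw [he]
    rcases hc with rfl | rfl
    · exact h.rep_notMem.1
    · exact h.rep_notMem.2
  have hfst : (edgeLetter β e).1 = (edgeLetter β e₀).1 := by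
    rw [edgeLetter_fst, edgeLetter_fst, he, he₀]
  rcases Letter.eq_or_eq_inv hfst with h1 | h1
  · have h2 := h.ends_iff hP (he.trans he₀.symm) hr h1
    exact Or.inl ⟨h1, fun h' => hs (h2.1.1 h'), h2.2.2 ht⟩
  · have h2 := h.ends_iff hP (β := β) (e := (blowup P).rev e) (e' := e₀)
      (by rw [edgeLabel_rev, he, he₀]) (by rwa [edgeLabel_rev])
      (by rw [edgeLetter_rev, h1, Letter.inv_inv])
    rw [CubeComplex.src_rev, CubeComplex.tgt_rev] at h2
    exact Or.inr ⟨h1, h2.2.2 ht, fun h' => hs (h2.1.1 h')⟩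

/-- The elements read along edges for two coordinates differ by conjugation and an automorphism. -/
def IsTwist (w : MulAut (RAAG Γ)) (g : (blowup P).Vertex → RAAG Γ) (A : Set (V ⊕ ι))
    (β : V ⊕ ι → Letter V) (A' : Set (V ⊕ ι)) (β' : V ⊕ ι → Letter V) : Prop :=
  ∀ e, readEdge A' β' e =
    g ((blowup P).src e) * w (readEdge A β e) * (g ((blowup P).tgt e))⁻¹

open Classical in
/-- The coordinate after the exchange of `a` and `b`. -/
def exchangeCoordinate (β : V ⊕ ι → Letter V) (a : V ⊕ ι) (m : Letter V) (e : (blowup P).Edge) :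
    V ⊕ ι → Letter V :=
  -- The twist is chosen so that the edge `e`, if labelled `a`, reads exactly `m`.
  Function.update β a (m.twist (orientation (BlowupCube.origin e) (BlowupCube.label e 0)))

theorem exchangeCoordinate_of_ne {e : (blowup P).Edge} {c : V ⊕ ι} (h : c ≠ a) :
    exchangeCoordinate β a m e c = β c := by
  classical exact Function.update_of_ne h _ _

theorem exchangeCoordinate_fst (e : (blowup P).Edge) :
    (exchangeCoordinate β a m e a).1 = m.1 := by
  classical
  unfold exchangeCoordinate
  rw [Function.update_self, Letter.twist_fst]

theorem edgeLetter_exchangeCoordinate {e : (blowup P).Edge} (h : edgeLabel P e = a) :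
    edgeLetter (exchangeCoordinate β a m e) e = m := by
  classical
  unfold edgeLetter letterAt exchangeCoordinate
  rw [show unoriented (BlowupCube.label e 0) = a from h, Function.update_self,
    Letter.twist_twist, ZMod.two_add_self, Letter.twist_zero]

theorem edgeLetter_exchangeCoordinate_of_ne {e e' : (blowup P).Edge} (h : edgeLabel P e' ≠ a) :
    edgeLetter (exchangeCoordinate β a m e) e' = edgeLetter β e' := by
  exact congrArg (Letter.twist _) (exchangeCoordinate_of_ne h)

/-- The label `a` takes over the vertex of `b`; this preserves links because both labels have link
`L`. -/
theorem IsCut.isCoordinate (h : IsCut P A L a b D) (hβ : IsCoordinate P A β) {m : Letter V}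
    (hm : m.1 = (β b).1) (e : (blowup P).Edge) :
    IsCoordinate P (insert b (A \ {a})) (exchangeCoordinate β a m e) := by
  have hmem : ∀ c, c ∉ insert b (A \ {a}) ↔ c ≠ b ∧ (c = a ∨ c ∉ A) := by
    intro c
    rw [Set.mem_insert_iff, Set.mem_sdiff, Set.mem_singleton_iff, not_or, not_and_not_right]
    refine and_congr_right fun _ => ?_
    tauto
  have hab : a ≠ b := fun hab => h.notMem (hab ▸ h.mem)
  have hfst : ∀ c ∉ A, c ≠ b → (β c).1 ≠ m.1 := fun c hc hcb hcm =>
    hcb (hβ.injOn hc h.notMem (hcm.trans hm))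
  refine ⟨?_, ?_, ?_⟩
  · intro c hc d hd hcd
    rw [Set.mem_compl_iff, hmem] at hc hd
    change (exchangeCoordinate β a m e c).1 = (exchangeCoordinate β a m e d).1 at hcd
    by_cases hca : c = a <;> by_cases hda : d = a
    · rw [hca, hda]
    · subst hca
      rw [exchangeCoordinate_fst, exchangeCoordinate_of_ne hda] at hcd
      exact absurd hcd.symm (hfst d (hd.2.resolve_left hda) hd.1)
    · subst hda
      rw [exchangeCoordinate_fst, exchangeCoordinate_of_ne hca] at hcd
      exact absurd hcd (hfst c (hc.2.resolve_left hca) hc.1)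
    · rw [exchangeCoordinate_of_ne hca, exchangeCoordinate_of_ne hda] at hcd
      exact hβ.injOn (hc.2.resolve_left hca) (hd.2.resolve_left hda) hcd
  · intro v
    obtain ⟨c, hc, rfl⟩ := hβ.surj v
    by_cases hcb : c = b
    · subst hcb
      exact ⟨a, (hmem a).2 ⟨hab, Or.inl rfl⟩, by rw [exchangeCoordinate_fst, hm]⟩
    · have hca : c ≠ a := by
        rintro rfl
        exact hc h.mem
      exact ⟨c, (hmem c).2 ⟨hcb, Or.inr hc⟩, by rw [exchangeCoordinate_of_ne hca]⟩
  · intro c hc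
    rw [hmem] at hc
    by_cases hca : c = a
    · subst hca
      rw [exchangeCoordinate_fst, hm, hβ.lk_eq b h.notMem, h.lk_left, h.lk_right]
    · rw [exchangeCoordinate_of_ne hca, hβ.lk_eq c (hc.2.resolve_left hca)]

theorem IsCut.lk_letter (h : IsCut P A L a b D) (hβ : IsCoordinate P A β) {m : Letter V}
    (hm : m.1 = (β b).1) : lk Γ m.1 = L := by
  rw [hm, hβ.lk_eq b h.notMem, h.lk_right]

/-- The correction is `m⁻¹` at the vertices in `D` and trivial elsewhere. An edge ending in `D`
therefore gains a factor `m` on the right, one starting there a factor `m⁻¹` on the left, which is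
the opposite of what the Whitehead automorphism does to its letter. -/
theorem IsCut.isTwist (hP : IsCompatibleCollection P) (h : IsCut P A L a b D)
    (hβ : IsCoordinate P A β) {ea eb : (blowup P).Edge} (hea : edgeLabel P ea = a)
    (hsa : (blowup P).src ea ∉ D) (hta : (blowup P).tgt ea ∈ D) (heb : edgeLabel P eb = b)
    (hsb : (blowup P).src eb ∉ D) (htb : (blowup P).tgt eb ∈ D) {f : MulAut (RAAG Γ)}
    (hf : WhiteheadValues (sideLetters A β L D) (edgeLetter β eb) f) :
    IsTwist f (fun x => gen Γ (edgeLetter β eb) ^ (-ind D x)) A β (insert b (A \ {a}))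
      (exchangeCoordinate β a (edgeLetter β eb) ea) := by
  have hab : a ≠ b := fun hab => h.notMem (hab ▸ h.mem)
  have hm : (edgeLetter β eb).1 = (β b).1 := by rw [edgeLetter_fst, heb]
  intro e
  beta_reduce
  -- Entering `D` along `b` reads `m`; the automorphism inverts it and the correction cancels it, as
  -- needed for a label that is now collapsed.
  by_cases hb : edgeLabel P e = b
  · rw [readEdge_of_mem (by rw [hb]; exact Set.mem_insert _ _),
      readEdge_of_notMem (by rw [hb]; exact h.notMem)]
    rcases h.ends_of_letter hP (β := β) (Or.inr rfl) heb hsb htb hb with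
      ⟨h1, h2, h3⟩ | ⟨h1, h2, h3⟩
    · rw [h1, hf.base, ind_of_notMem h2, ind_of_mem h3]
      simp
    · rw [h1, gen_inv, map_inv, hf.base, ind_of_mem h2, ind_of_notMem h3]
      simp
  -- The label `a` used to be collapsed, so only the correction remains, and it supplies the new
  -- letter `m`.
  by_cases ha : edgeLabel P e = a
  · rw [readEdge_of_notMem (by
      rw [ha, Set.mem_insert_iff, not_or]
      exact ⟨hab, fun h' => h'.2 rfl⟩), readEdge_of_mem (by rw [ha]; exact h.mem)]
    rcases h.ends_of_letter hP (β := exchangeCoordinate β a (edgeLetter β eb) ea) (Or.inl rfl)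
      hea hsa hta ha with ⟨h1, h2, h3⟩ | ⟨h1, h2, h3⟩
    · rw [h1, edgeLetter_exchangeCoordinate hea, ind_of_notMem h2, ind_of_mem h3]
      simp
    · rw [h1, edgeLetter_exchangeCoordinate hea, ind_of_mem h2, ind_of_notMem h3, gen_inv]
      simp
  by_cases hA : edgeLabel P e ∈ A
  · rw [readEdge_of_mem
      (show edgeLabel P e ∈ insert b (A \ {a}) from Set.mem_insert_of_mem _ ⟨hA, ha⟩), readEdge_of_mem hA]
    have : ind D ((blowup P).src e) = ind D ((blowup P).tgt e) := by
      have := h.same e hA ha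
      by_cases ht : (blowup P).tgt e ∈ D
      · rw [ind_of_mem ht, ind_of_mem (this.2 ht)]
      · rw [ind_of_notMem ht, ind_of_notMem (mt this.1 ht)]
    rw [this]
    simp
  · rw [readEdge_of_notMem (by
      rw [Set.mem_insert_iff, not_or]
      exact ⟨hb, fun h' => hA h'.1⟩), readEdge_of_notMem hA,
      edgeLetter_exchangeCoordinate_of_ne ha]
    have hne : (edgeLetter β e).1 ≠ (edgeLetter β eb).1 := by
      rw [hm, edgeLetter_fst]
      exact fun h' => hb (hβ.injOn hA h.notMem h')
    rw [hf.other _ hne]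
    -- A letter in `L` commutes with `m`, and its edge switches no partition with link `L`, so both
    -- ends are on the same side of the cut and the corrections cancel.
    by_cases hL : (edgeLetter β e).1 ∈ L
    · have hi₁ : ind (sideLetters A β L D) (edgeLetter β e) = 0 :=
        ind_of_notMem fun h' => h'.1 hL
      have hi₂ : ind (sideLetters A β L D) (edgeLetter β e).inv = 0 :=
        ind_of_notMem fun h' => h'.1 hL
      have hr : rep P (edgeLabel P e) ∈ L := by
        rwa [← hβ.letter_mem_iff hA h.lk_left, ← edgeLetter_fst]
      have hsame : (blowup P).src e ∈ D ↔ (blowup P).tgt e ∈ D := by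
        refine h.congr _ _ fun l hl => ?_
        rw [origin_src, origin_tgt, Pi.add_apply, switch_eq_zero, add_zero]
        rw [commutingLabels_inr_iff, hl]
        exact hr
      have hcomm : Commute (gen Γ (edgeLetter β eb)) (gen Γ (edgeLetter β e)) :=
        gen_comm ((h.lk_letter hβ hm).ge hL)
      have hi : ind D ((blowup P).src e) = ind D ((blowup P).tgt e) := by
        by_cases ht : (blowup P).tgt e ∈ D
        · rw [ind_of_mem ht, ind_of_mem (hsame.2 ht)]
        · rw [ind_of_notMem ht, ind_of_notMem (mt hsame.1 ht)]
      rw [hi₁, hi₂, hi, neg_zero, zpow_zero, one_mul, mul_one, (hcomm.zpow_left _).eq, mul_inv_cancel_right]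
    · have hW := h.mem_sideLetters_iff hP hβ hA hL
      have h1 : ind (sideLetters A β L D) (edgeLetter β e) = ind D ((blowup P).tgt e) := by
        by_cases ht : (blowup P).tgt e ∈ D
        · rw [ind_of_mem ht, ind_of_mem (hW.1.2 ht)]
        · rw [ind_of_notMem ht, ind_of_notMem (mt hW.1.1 ht)]
      have h2 : ind (sideLetters A β L D) (edgeLetter β e).inv = ind D ((blowup P).src e) := by
        by_cases ht : (blowup P).src e ∈ D
        · rw [ind_of_mem ht, ind_of_mem (hW.2.2 ht)]
        · rw [ind_of_notMem ht, ind_of_notMem (mt hW.2.1 ht)]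
      rw [h1, h2]
      group

/-- Some square reads `v` and `w`. Both of its edges with letter `v` have their ends in `D`, so all
four vertices are in `D`, including the ends of an edge with letter `w`. -/
theorem IsCut.mem_sideLetters_of_adj [Finite ι] (hP : IsCompatibleCollection P)
    (h : IsCut P A L a b D) (hβ : IsCoordinate P A β) {v w : Letter V}
    (hv : v ∈ sideLetters A β L D) (hv' : v.inv ∈ sideLetters A β L D) (hvw : Γ.Adj v.1 w.1)
    (hw : w.1 ∉ L) : w ∈ sideLetters A β L D ∧ w.inv ∈ sideLetters A β L D := by
  have hsq : ∀ i j : Fin 2, i ≠ j → Γ.Adj ((![v, w] : Fin 2 → Letter V) i).1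
      ((![v, w] : Fin 2 → Letter V) j).1 := by
    intro i j h
    fin_cases i <;> fin_cases j
    · exact absurd rfl h
    · exact hvw
    · exact hvw.symm
    · exact absurd rfl h
  obtain ⟨⟨C, hC⟩, hCs⟩ := hβ.onCube_surjective hP 2 ⟨![v, w], hsq⟩
  have h0 : letterAt β (BlowupCube.origin C) (BlowupCube.label C 0) = v :=
    congrFun (congrArg Subtype.val hCs) 0
  have h1 : letterAt β (BlowupCube.origin C) (BlowupCube.label C 1) = w :=
    congrFun (congrArg Subtype.val hCs) 1
  have hlab : ∀ c j, edgeLabel P ((blowup P).restr (FaceMap.edge c j) C) ∉ A := by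
    intro c j
    exact hC _
  have hlet : ∀ (c : Fin 2 → ZMod 2) (j : Fin 2),
      edgeLetter β ((blowup P).restr (FaceMap.edge c j) C) =
      (letterAt β (BlowupCube.origin C) (BlowupCube.label C j)).twist (c j) :=
    fun c j => letterAt_restr C (FaceMap.edge c j) 0
  have hv0 : ∀ c : Fin 2 → ZMod 2, c 0 = 0 →
      (blowup P).src ((blowup P).restr (FaceMap.edge c 0) C) ∈ D ∧
      (blowup P).tgt ((blowup P).restr (FaceMap.edge c 0) C) ∈ D := by
    intro c hc
    have hl := hlet c 0
    rw [h0, hc, Letter.twist_zero] at hl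
    have := h.mem_sideLetters_iff hP hβ (hlab c 0) (by rw [hl]; exact hv.1)
    rw [hl] at this
    exact ⟨this.2.1 hv', this.1.1 hv⟩
  have hl := hlet 0 1
  rw [h1, Pi.zero_apply, Letter.twist_zero] at hl
  have hw' := h.mem_sideLetters_iff hP hβ (hlab 0 1) (by rw [hl]; exact hw)
  rw [hl] at hw'
  have s1 := (hv0 0 rfl).1
  have s2 := (hv0 ![0, 1] rfl).1
  rw [CubeComplex.src_edge] at s1 s2
  rw [CubeComplex.src_edge, CubeComplex.tgt_edge,
    show Function.update (0 : Fin 2 → ZMod 2) 1 ((0 : Fin 2 → ZMod 2) 1 + 1) = ![0, 1] by decide]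
    at hw'
  exact ⟨hw'.1.2 s2, hw'.2.2 s1⟩

/-- A letter contained with one sign only is read along an edge crossing the cut. Such an edge
switches a partition with link `L`, so its link lies in `L`, the link of the base. The component
condition follows by propagating along adjacent vertices outside the star of the base. -/
theorem IsCut.isWhiteheadPair [Finite ι] (hP : IsCompatibleCollection P)
    (h : IsCut P A L a b D) (hβ : IsCoordinate P A β) {eb : (blowup P).Edge}
    (heb : edgeLabel P eb = b) (hsb : (blowup P).src eb ∉ D) (htb : (blowup P).tgt eb ∈ D)
    (hW : (sideLetters A β L D).Nontrivial) :
    IsWhiteheadPair Γ (sideLetters A β L D) (edgeLetter β eb) := by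
  have hm : (edgeLetter β eb).1 = (β b).1 := by rw [edgeLetter_fst, heb]
  have hlk := h.lk_letter hβ hm
  have hmL : (edgeLetter β eb).1 ∉ L := by rw [← hlk]; exact Γ.loopless.irrefl _
  have heA : edgeLabel P eb ∉ A := by rw [heb]; exact h.notMem
  have hmW := h.mem_sideLetters_iff hP hβ heA hmL
  refine ⟨hmW.1.2 htb, fun h' => hsb (hmW.2.1 h'), hW, fun x hx hadj => ?_, ?_, ?_⟩
  · exact hx.1 (hlk.le hadj.symm)
  · rintro x ⟨hxL, e, heA, rfl, ht⟩ hx'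
    have hxW := h.mem_sideLetters_iff hP hβ heA hxL
    have hs : (blowup P).src e ∉ D := fun hs => hx' (hxW.2.2 hs)
    have hex : ∃ l, (P l).link = L ∧ switch P (BlowupCube.label e 0) l ≠ 0 := by
      by_contra hne
      push Not at hne
      refine hs ((h.congr _ _ fun l hl => ?_).2 ht)
      rw [origin_src, origin_tgt, Pi.add_apply, hne l hl, add_zero]
    obtain ⟨l, hl, hsw⟩ := hex
    have h1 := switch_ne_zero hsw
    rw [hl] at h1
    intro u hu
    refine Set.mem_insert_of_mem _ (hlk.ge (h1 ?_))
    rw [edgeLetter_fst, hβ.lk_eq _ heA] at hu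
    exact hu
  · intro v hv hv' w hvw
    have hst : ∀ u : V, u ∉ st Γ (edgeLetter β eb).1 → u ∉ L := fun u hu huL =>
      hu (Set.mem_insert_of_mem _ (hlk.ge huL))
    have key : ∀ s, ((w.1, s) : Letter V) ∈ sideLetters A β L D := by
      refine SameComponent.induction
        (Q := fun u => ∀ s, ((u, s) : Letter V) ∈ sideLetters A β L D) ?_ ?_ hvw
      · intro s
        rcases Letter.eq_or_eq_inv (x := ((v.1, s) : Letter V)) (y := v) rfl with h1 | h1
        · rw [h1]; exact hv
        · rw [h1]; exact hv'
      · intro u u' hu hu' huu hQ s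
        exact (h.mem_sideLetters_of_adj hP hβ (v := (u, true)) (w := (u', s)) (hQ _) (hQ _) huu
          (hst u' hu')).1
    exact key w.2

/-- The coordinates differ by a Whitehead automorphism. -/
def IsStep (P : ι → WhiteheadPartition Γ) (A : Set (V ⊕ ι)) (β : V ⊕ ι → Letter V)
    (A' : Set (V ⊕ ι)) (β' : V ⊕ ι → Letter V) : Prop :=
  ∃ (W : Set (Letter V)) (m : Letter V) (w : MulAut (RAAG Γ)) (g : (blowup P).Vertex → RAAG Γ),
    IsWhiteheadPair Γ W m ∧ w ∈ AutL Γ ∧ WhiteheadValues W m w ∧ IsTwist w g A β A' β'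

/-- The Whitehead automorphism of the full side is the inversion followed by conjugation with `m`,
and the conjugation is absorbed into the corrections at the vertices. -/
theorem IsTwist.isStep_of_inversion [Finite V] {g : (blowup P).Vertex → RAAG Γ} {u : V}
    (hu : u ∉ st Γ m.1) (h : IsTwist (inversion Γ m.1) g A β A' β') : IsStep P A β A' β' := by
  have hW := isWhiteheadPair_fullSide (m := m) (u := (u, true)) hu
  obtain ⟨w, hw, hv⟩ := exists_whiteheadAut hW
  refine ⟨_, m, w, fun x => g x * (gen Γ m)⁻¹, hW, hw, hv, fun e => ?_⟩
  rw [h e, hv.fullSide_apply]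
  group

/-- A one-element set is not the side of a Whitehead pair, but the formula for the values makes
sense and describes the inversion. -/
theorem whiteheadValues_singleton (m : Letter V) :
    WhiteheadValues {m} m (inversion Γ m.1) where
  base := inversion_gen_self
  other v hv := by
    have h1 : v ∉ ({m} : Set (Letter V)) := fun h => hv (congrArg Prod.fst h)
    have h2 : v.inv ∉ ({m} : Set (Letter V)) := fun h =>
      hv (show v.inv.1 = m.1 from congrArg Prod.fst (Set.mem_singleton_iff.1 h))
    rw [inversion_gen_of_ne hv, ind_of_notMem h1, ind_of_notMem h2]
    simp

/-- The side of a Whitehead pair contains letters over two different vertices outside the link, so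
it is not exhausted by the star of one vertex. -/
theorem exists_notMem_st {Q : WhiteheadPartition Γ} {v : V} (h : Q.link = lk Γ v) :
    ∃ u, u ∉ st Γ v := by
  obtain ⟨x, hx, hxm⟩ := Q.isPair_base.two_le.exists_ne Q.base
  have hx0 : x.1 ∉ Q.link := notMem_link (a := 0) hx
  have hne : x.1 ≠ Q.base.1 := by
    intro h'
    rcases Letter.eq_or_eq_inv h' with h1 | h1
    · exact hxm h1
    · exact Q.isPair_base.inv_notMem (h1 ▸ hx)
  by_contra hall
  push Not at hall
  rw [h] at hx0
  have h1 := (hall x.1).resolve_right hx0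
  have h2 := (hall Q.base.1).resolve_right (by rw [← h]; exact Q.base_notMem_link)
  exact hne (h1.trans h2.symm)

theorem IsCut.exists_step [Finite ι] [Finite V] (hP : IsCompatibleCollection P)
    (h : IsCut P A L a b D) (hβ : IsCoordinate P A β) {i : ι} (hi : (P i).link = L) :
    ∃ β', IsCoordinate P (insert b (A \ {a})) β' ∧ IsStep P A β (insert b (A \ {a})) β' := by
  obtain ⟨ea, hea, hsa, hta⟩ := h.exists_edge hP (Or.inl rfl)
  obtain ⟨eb, heb, hsb, htb⟩ := h.exists_edge hP (Or.inr rfl)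
  have hm : (edgeLetter β eb).1 = (β b).1 := by rw [edgeLetter_fst, heb]
  refine ⟨_, h.isCoordinate hβ hm ea, ?_⟩
  by_cases hW : (sideLetters A β L D).Nontrivial
  · have hp := h.isWhiteheadPair hP hβ heb hsb htb hW
    obtain ⟨w, hw, hv⟩ := exists_whiteheadAut hp
    exact ⟨_, _, w, _, hp, hw, hv, h.isTwist hP hβ hea hsa hta heb hsb htb hv⟩
  -- In the degenerate case only `m` is read on entering `D`, so the change of coordinate is the
  -- inversion of `m`. The full side of `m` replaces the missing Whitehead pair.
  · have hlk := h.lk_letter hβ hm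
    have hmem : edgeLetter β eb ∈ sideLetters A β L D :=
      ⟨by rw [← hlk]; exact Γ.loopless.irrefl _, eb, by rw [heb]; exact h.notMem, rfl, htb⟩
    have hW : sideLetters A β L D = {edgeLetter β eb} :=
      (Set.not_nontrivial_iff.1 hW).eq_singleton_of_mem hmem
    obtain ⟨u, hu⟩ := exists_notMem_st (hi.trans hlk.symm)
    exact (h.isTwist hP hβ hea hsa hta heb hsb htb
      (hW ▸ whiteheadValues_singleton _)).isStep_of_inversion hu

open Classical in
/-- The change of the orientation of one label. -/
theorem IsCoordinate.exists_step_self [Finite V] (hβ : IsCoordinate P A β) (i : ι) :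
    ∃ β', IsCoordinate P A β' ∧ IsStep P A β A β' := by
  -- The reversed label is one that reads the base of `P i`: the existence of `P i` provides a
  -- vertex outside the star of that base, hence a full side that is part of a Whitehead pair.
  obtain ⟨c, hc, hcb⟩ := hβ.surj (P i).base.1
  obtain ⟨u, hu⟩ := exists_notMem_st (Q := P i) (v := (β c).1) (by rw [hcb, link_eq])
  let β' := Function.update β c (β c).inv
  have hself : β' c = (β c).inv := Function.update_self _ _ _
  have hne : ∀ d, d ≠ c → β' d = β d := fun d hd => Function.update_of_ne hd _ _
  have hfst : ∀ d, (β' d).1 = (β d).1 := by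
    intro d
    by_cases hd : d = c
    · rw [hd, hself]; rfl
    · rw [hne d hd]
  refine ⟨β', ⟨?_, ?_, ?_⟩, IsTwist.isStep_of_inversion (g := fun _ => 1) hu fun e => ?_⟩
  · intro d hd d' hd' h
    refine hβ.injOn hd hd' ?_
    change (β d).1 = (β d').1
    rw [← hfst d, ← hfst d']
    exact h
  · intro v
    obtain ⟨d, hd, h⟩ := hβ.surj v
    exact ⟨d, hd, (hfst d).trans h⟩
  · intro d hd
    rw [hfst, hβ.lk_eq d hd]
  · rw [one_mul, inv_one, mul_one]
    by_cases he : edgeLabel P e ∈ A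
    · rw [readEdge_of_mem he, readEdge_of_mem he, map_one]
    · rw [readEdge_of_notMem he, readEdge_of_notMem he]
      by_cases hec : edgeLabel P e = c
      · have h1 : (edgeLetter β e).1 = (β c).1 := by rw [edgeLetter_fst, hec]
        have h2 : edgeLetter β' e = (edgeLetter β e).inv := by
          unfold edgeLetter letterAt
          rw [show unoriented (BlowupCube.label e 0) = c from hec, hself]
          rw [← Letter.twist_one, ← Letter.twist_one, Letter.twist_twist, Letter.twist_twist,
            add_comm]
        rw [h2, gen_inv, ← h1, inversion_gen_self]
      · have h2 : edgeLetter β' e = edgeLetter β e := congrArg (Letter.twist _) (hne _ hec)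
        rw [h2, inversion_gen_of_ne]
        rw [edgeLetter_fst]
        exact fun h' => hec (hβ.injOn he hc h')

end Exchange

/-! ### From cuts of base graphs to exchanges of labels -/

section ExchangeStep

variable {V : Type u} {Γ : SimpleGraph V} {ι : Type} {P : ι → WhiteheadPartition Γ}
  {A A' : Set (V ⊕ ι)} {β β' : V ⊕ ι → Letter V} {L : Set V} {a b : V ⊕ ι}

open WhiteheadPartition

/-- The vertex of the blow-up for the partitions with link `L` under a vertex of the blow-up. -/
def restrictVertex (L : Set V) (x : (blowup P).Vertex) : (blowup (linkClass P L)).Vertex :=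
  vertexAt (restrict P L (BlowupCube.origin x)) ((BlowupCube.isRegion x).restrict L)

theorem classEnds_edgeLabel [Finite ι] (hP : IsCompatibleCollection P) {e : (blowup P).Edge}
    (h : edgeLabel P e ∈ baseLabels P L) : classEnds P L (edgeLabel P e) =
      s(restrictVertex L ((blowup P).src e), restrictVertex L ((blowup P).tgt e)) := by
  obtain ⟨y, hy⟩ : ∃ y : BLabel V {j : ι // (P j).link = L},
      liftLabel y = BlowupCube.label e 0 := by
    unfold edgeLabel at h
    cases hl : BlowupCube.label e 0 with
    | inl v => exact ⟨Sum.inl v, rfl⟩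
    | inr i =>
      rw [hl] at h
      rcases h with ⟨v, h, -⟩ | ⟨j, h, hj⟩
      · cases h
      · cases h
        exact ⟨Sum.inr ⟨i, hj⟩, rfl⟩
  have hf := BlowupCube.fits e 0
  rw [← hy] at hf
  have hl : Sum.map id Subtype.val (edgeLabel (linkClass P L) (edgeAt _ _ hf.restrict)) =
      edgeLabel P e := (map_edgeLabel _).trans (congrArg unoriented hy)
  rw [← hl] at h
  rw [← hl, classEnds_eq hP h]
  have h1 : (blowup (linkClass P L)).src (edgeAt _ _ hf.restrict) =
      restrictVertex L ((blowup P).src e) := by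
    refine vertex_ext ((origin_src _).trans ?_)
    exact congrArg (restrict P L) (origin_src e).symm
  have h2 : (blowup (linkClass P L)).tgt (edgeAt _ _ hf.restrict) =
      restrictVertex L ((blowup P).tgt e) := by
    refine vertex_ext ((origin_tgt _).trans ?_)
    refine (restrict_add_switch (BlowupCube.origin e) y).symm.trans ?_
    rw [hy]
    exact congrArg (restrict P L) (origin_tgt e).symm
  rw [h1, h2]

/-- An edge outside the base graph can cross the pulled-back cut only if it switches a partition
with link `L`, which makes its own link strictly smaller than `L`. A partition edge switches only
its own partition, and vertices with smaller link are excluded from `A` by `hlow`. -/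
theorem isCut_of_classCut [Finite ι] (hP : IsCompatibleCollection P)
    {C : Set (blowup (linkClass P L)).Vertex} (ha : a ∈ A) (hb : b ∉ A)
    (haL : a ∈ baseLabels P L) (hbL : b ∈ baseLabels P L)
    (hsame : ∀ c ∈ (A ∩ baseLabels P L) \ {a}, ∀ u v, classEnds P L c = s(u, v) →
      (u ∈ C ↔ v ∈ C))
    (hsa : ∀ u v, classEnds P L a = s(u, v) → ¬ (u ∈ C ↔ v ∈ C))
    (hsb : ∀ u v, classEnds P L b = s(u, v) → ¬ (u ∈ C ↔ v ∈ C))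
    (hlow : ∀ v, Sum.inl v ∈ A → ¬ lk Γ v ⊂ L) :
    IsCut P A L a b (restrictVertex L ⁻¹' C) where
  mem := ha
  notMem := hb
  lk_left := (mem_baseLabels_iff a).1 haL
  lk_right := (mem_baseLabels_iff b).1 hbL
  congr x y h := by
    have : restrictVertex L x = restrictVertex L y :=
      vertex_ext (funext fun l => h l.1 l.2)
    rw [Set.mem_preimage, Set.mem_preimage, this]
  same e he hea := by
    by_cases hL : edgeLabel P e ∈ baseLabels P L
    · exact hsame _ ⟨⟨he, hL⟩, hea⟩ _ _ (classEnds_edgeLabel hP hL)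
    · have : restrictVertex L ((blowup P).src e) = restrictVertex L ((blowup P).tgt e) := by
        refine vertex_ext (funext fun l => ?_)
        change BlowupCube.origin ((blowup P).src e) l.1 = BlowupCube.origin ((blowup P).tgt e) l.1
        rw [origin_src, origin_tgt, Pi.add_apply]
        by_contra hne
        have hsw : switch P (BlowupCube.label e 0) l.1 ≠ 0 := fun h => hne (by rw [h, add_zero])
        have h1 := switch_ne_zero hsw
        have hl : (P l.1).link = L := l.2
        rw [hl] at h1
        have h2 : lk Γ (rep P (edgeLabel P e)) ⊂ L :=
          h1.ssubset_of_ne fun h => hL ((mem_baseLabels_iff _).2 h)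
        cases hy : BlowupCube.label e 0 with
        | inl v =>
          have h3 : edgeLabel P e = Sum.inl v.1 := congrArg unoriented hy
          rw [h3] at h2 he
          exact hlow v.1 he h2
        | inr i =>
          rw [hy] at hsw
          have h3 : edgeLabel P e = Sum.inr i := congrArg unoriented hy
          have h4 : l.1 = i := not_not.1 fun h => hsw (switch_inr_of_ne h)
          rw [h3, ← h4, mem_baseLabels_iff, rep, ← link_eq] at hL
          exact hL hl
      rw [Set.mem_preimage, Set.mem_preimage, this]
  separates e he := by
    have hL : edgeLabel P e ∈ baseLabels P L := by
      rcases he with he | he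
      · rwa [he]
      · rwa [he]
    have h1 := classEnds_edgeLabel hP hL
    rcases he with he | he
    · exact hsa _ _ (he ▸ h1)
    · exact hsb _ _ (he ▸ h1)

theorem baseLabels_disjoint {L' : Set V} (h : a ∈ baseLabels P L) (h' : L ≠ L') :
    a ∉ baseLabels P L' := fun h1 =>
  h' (((mem_baseLabels_iff a).1 h).symm.trans ((mem_baseLabels_iff a).1 h1))

theorem TreeLabels.exchange [Finite ι] (hA : TreeLabels P A) {i : ι}
    (haL : a ∈ baseLabels P (P i).link) (hbL : b ∈ baseLabels P (P i).link)
    (h : IsSpanningTree (classEnds P (P i).link)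
      (insert b ((A ∩ baseLabels P (P i).link) \ {a}))) :
    TreeLabels P (insert b (A \ {a})) := by
  refine ⟨?_, fun j => ?_⟩
  · rintro c (rfl | hc)
    · exact ⟨i, hbL⟩
    · exact hA.1 c hc.1
  · by_cases hij : (P i).link = (P j).link
    · rw [← hij]
      convert h using 1
      ext c
      simp only [Set.mem_inter_iff, Set.mem_insert_iff, Set.mem_sdiff, Set.mem_singleton_iff]
      constructor
      · rintro ⟨h1 | h1, h2⟩
        · exact Or.inl h1
        · exact Or.inr ⟨⟨h1.1, h2⟩, h1.2⟩
      · rintro (rfl | h1)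
        · exact ⟨Or.inl rfl, hbL⟩
        · exact ⟨Or.inr ⟨h1.1.1, h1.2⟩, h1.1.2⟩
    · convert hA.2 j using 1
      ext c
      simp only [Set.mem_inter_iff, Set.mem_insert_iff, Set.mem_sdiff, Set.mem_singleton_iff]
      constructor
      · rintro ⟨rfl | h1, h2⟩
        · exact absurd h2 (baseLabels_disjoint hbL hij)
        · exact ⟨h1.1, h2⟩
      · rintro ⟨h1, h2⟩
        refine ⟨Or.inr ⟨h1, ?_⟩, h2⟩
        rintro rfl
        exact baseLabels_disjoint haL hij h2

/-- The exchange of a label for a label of a second tree-like set. -/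
theorem exists_exchange_step [Finite ι] [Finite V] (hP : IsCompatibleCollection P)
    (hA : TreeLabels P A) (hβ : IsCoordinate P A β) (hA' : TreeLabels P A') {i : ι} (ha : a ∈ A)
    (haL : a ∈ baseLabels P (P i).link)
    (hlow : ∀ v, Sum.inl v ∈ A → ¬ lk Γ v ⊂ (P i).link) :
    ∃ b ∈ A', b ∈ baseLabels P (P i).link ∧ b ∉ A \ {a} ∧
      TreeLabels P (insert b (A \ {a})) ∧
      ∃ β', IsCoordinate P (insert b (A \ {a})) β' ∧ IsStep P A β (insert b (A \ {a})) β' := by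
  obtain ⟨b, ⟨hb, hbL⟩, C, hbA, ht, hsame, hsa, hsb⟩ :=
    (hA.2 i).exists_exchange (hA'.2 i) ⟨ha, haL⟩
  have hbA' : b ∉ A \ {a} := fun h => hbA ⟨⟨h.1, hbL⟩, h.2⟩
  refine ⟨b, hb, hbL, hbA', hA.exchange haL hbL ht, ?_⟩
  -- If the second tree gives back the same label, the set does not change, but a Whitehead move is
  -- still owed; it is obtained by reversing the orientation of one label.
  by_cases hba : b = a
  · rw [hba, Set.insert_sdiff_singleton, Set.insert_eq_of_mem ha]
    exact hβ.exists_step_self i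
  · have hbn : b ∉ A := fun h => hbA' ⟨h, hba⟩
    exact (isCut_of_classCut hP ha hbn haL hbL hsame hsa hsb hlow).exists_step hP hβ rfl

end ExchangeStep

/-! ### Comparison of the collapse with the canonical collapse -/

section Marking

variable {V : Type u} {Γ : SimpleGraph V} {ι : Type} {P : ι → WhiteheadPartition Γ}
  {A A' : Set (V ⊕ ι)} {β β' : V ⊕ ι → Letter V} {f : MulAut (RAAG Γ)}

open WhiteheadPartition

/-- The collapse, followed by the identification with the Salvetti complex, is the canonical
collapse followed by `f`. -/
def Marks (A : Set (V ⊕ ι)) (β : V ⊕ ι → Letter V) (P : ι → WhiteheadPartition Γ)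
    (f : MulAut (RAAG Γ)) : Prop :=
  ∃ g : (blowup P).Vertex → RAAG Γ, ∀ e : (blowup P).Edge, readEdge A β e =
    g ((blowup P).src e) * f (labelElement Γ (BlowupCube.label e 0)) *
      (g ((blowup P).tgt e))⁻¹

theorem Marks.twist (h : Marks A β P f) {w : MulAut (RAAG Γ)} {g : (blowup P).Vertex → RAAG Γ}
    (h' : IsTwist w g A β A' β') : Marks A' β' P (w * f) := by
  obtain ⟨g', hg'⟩ := h
  refine ⟨fun x => g x * w (g' x), fun e => ?_⟩
  rw [h' e, hg' e, map_mul, map_mul, map_inv, MulAut.mul_apply]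
  group

/-- The coordinate of the canonical collapse. -/
theorem isCoordinate_canonical (P : ι → WhiteheadPartition Γ) :
    IsCoordinate P (Set.range Sum.inr) fun c => (rep P c, true) where
  injOn := by
    rintro (v | i) hc (w | j) hd h
    · exact congrArg Sum.inl h
    · exact absurd ⟨j, rfl⟩ hd
    · exact absurd ⟨i, rfl⟩ hc
    · exact absurd ⟨i, rfl⟩ hc
  surj v := ⟨Sum.inl v, fun ⟨_, h⟩ => Sum.inr_ne_inl h, rfl⟩
  lk_eq _ _ := rfl

theorem marks_canonical (P : ι → WhiteheadPartition Γ) :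
    Marks (Set.range Sum.inr) (fun c => (rep P c, true)) P 1 := by
  refine ⟨fun _ => 1, fun e => ?_⟩
  rw [one_mul, inv_one, mul_one, MulAut.one_apply]
  unfold readEdge letterAt edgeLabel
  cases hy : BlowupCube.label e 0 with
  | inr i => exact if_pos ⟨i, rfl⟩
  | inl v =>
    rw [if_neg (by rintro ⟨i, h⟩; cases h)]
    obtain ⟨v, s⟩ := v
    cases s <;> rfl

/-- The conjugating elements at consecutive vertices telescope along an edge path. -/
theorem prod_map_eq_conj {g : (blowup P).Vertex → RAAG Γ} {u u' : (blowup P).Edge → RAAG Γ}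
    (h : ∀ e, u' e = g ((blowup P).src e) * f (u e) * (g ((blowup P).tgt e))⁻¹)
    (l : List (blowup P).Edge) : ∀ {x y : (blowup P).Vertex}, (blowup P).IsPath x l y →
      (l.map u').prod = g x * f (l.map u).prod * (g y)⁻¹ := by
  induction l with
  | nil =>
    rintro x y rfl
    simp
  | cons e l ih =>
    rintro x y ⟨rfl, hl⟩
    rw [List.map_cons, List.prod_cons, List.map_cons, List.prod_cons, ih hl, h, map_mul]
    group

theorem Marks.exists_conj [Finite ι] [Finite V] (h : Marks A β P f) (hβ : IsCoordinate P A β)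
    (hP : IsCompatibleCollection P) (hA : TreeLabels P A) :
    ∃ g : (blowup P).Grpd → RAAG Γ, ∀ {x y : (blowup P).Grpd} (p : x ⟶ y),
      pathElement ((hβ.functor hP hA).map p) =
        g x * f (pathElement ((canonicalFunctor P).map p)) * (g y)⁻¹ := by
  obtain ⟨g, hg⟩ := h
  refine ⟨g, fun {x y} p => ?_⟩
  obtain ⟨l, hl, rfl⟩ := (blowup P).exists_hom p
  rw [hβ.pathElement_functor, pathElement_canonical]
  exact prod_map_eq_conj hg l hl

theorem Marks.nonempty_iso [Finite ι] [Finite V] (h : Marks A β P f) (hβ : IsCoordinate P A β)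
    (hP : IsCompatibleCollection P) (hA : TreeLabels P A) :
    Nonempty (hβ.functor hP hA ≅ canonicalFunctor P ⋙ realize f) := by
  obtain ⟨g, hg⟩ := h.exists_conj hβ hP hA
  refine nonempty_iso_of_conj _ _ g fun p => ?_
  rw [hg, Functor.comp_map, pathElement_realize, inv_mul_cancel_right]

/-- Collapse followed by an isomorphism agrees up to natural isomorphism with the canonical
equivalence followed by an automorphism; cancel the isomorphism. -/
theorem Marks.isEquivalence_collapse [Finite ι] [Finite V] (h : Marks A β P f)
    (hβ : IsCoordinate P A β) (hP : IsCompatibleCollection P) (hA : TreeLabels P A) :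
    ((blowup P).collapseFunctor (hypLabel P ⁻¹' A)).IsEquivalence := by
  obtain ⟨e⟩ := h.nonempty_iso hβ hP hA
  have := isEquivalence_canonical hP
  have h1 : (canonicalFunctor P ⋙ realize f).IsEquivalence := inferInstance
  have h2 : ((blowup P).collapseFunctor (hypLabel P ⁻¹' A) ⋙
      (hβ.iso hP hA).functor).IsEquivalence := Functor.isEquivalence_of_iso e.symm
  exact Functor.isEquivalence_of_comp_right _ (hβ.iso hP hA).functor

end Marking

/-! ### Natural isomorphisms between functors given on edge paths -/

namespace CubeComplex

variable {X Y Z : CubeComplex.{u}}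

theorem hom_comp_eqToHom {x y x' y' : X.Grpd} {l l' : List X.Edge} (h : X.IsPath x l y)
    (h' : X.IsPath x' l' y') (hx : x = x') (hy : y = y') (hl : l = l') :
    X.hom l h ≫ eqToHom hy = eqToHom hx ≫ X.hom l' h' := by
  subst hx hy hl
  rw [eqToHom_refl, eqToHom_refl, Category.comp_id, Category.id_comp]

/-- Functors described by the same operation on lists of edges agree up to transport along
equalities of objects; this avoids comparing functors for equality. -/
theorem nonempty_iso_of_map_hom (F G : X.Grpd ⥤ Y.Grpd) (u v : List X.Edge → List Y.Edge)
    (hobj : ∀ x, F.obj x = G.obj x)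
    (hF : ∀ (x y : X.Grpd) (l : List X.Edge) (h : X.IsPath x l y),
      ∃ h', F.map (X.hom l h) = Y.hom (u l) h')
    (hG : ∀ (x y : X.Grpd) (l : List X.Edge) (h : X.IsPath x l y),
      ∃ h', G.map (X.hom l h) = Y.hom (v l) h') (huv : ∀ l, u l = v l) : Nonempty (F ≅ G) :=
  ⟨NatIso.ofComponents (fun x => eqToIso (hobj x)) fun {x y} p => by
    obtain ⟨l, hl, rfl⟩ := X.exists_hom p
    obtain ⟨h1, e1⟩ := hF x y l hl
    obtain ⟨h2, e2⟩ := hG x y l hl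
    rw [e1, e2, eqToIso.hom, eqToIso.hom]
    exact hom_comp_eqToHom h1 h2 (hobj x) (hobj y) (huv l)⟩

theorem Iso.functor_symm (h : X.Iso Y) : Nonempty (h.functor ⋙ h.symm.functor ≅ 𝟭 _) :=
  nonempty_iso_of_map_hom _ _ (fun l => (l.map (h.equiv 1)).map (h.symm.equiv 1)) id
    (fun x => (h.equiv 0).symm_apply_apply x)
    (fun _ _ _ hl => ⟨_, (congrArg h.symm.functor.map (h.map_cls hl)).trans (h.symm.map_cls _)⟩)
    (fun _ _ _ hl => ⟨hl, rfl⟩) h.map_symm_map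

theorem Iso.functor_trans (h : X.Iso Y) (h' : Y.Iso Z) :
    Nonempty ((h.trans h').functor ≅ h.functor ⋙ h'.functor) :=
  nonempty_iso_of_map_hom _ _ (fun l => l.map ((h.trans h').equiv 1))
    (fun l => (l.map (h.equiv 1)).map (h'.equiv 1)) (fun _ => rfl)
    (fun _ _ _ hl => ⟨_, (h.trans h').map_cls hl⟩)
    (fun _ _ _ hl => ⟨_, (congrArg h'.functor.map (h.map_cls hl)).trans (h'.map_cls _)⟩)
    fun l => by rw [List.map_map]; rfl

theorem Iso.functor_refl (X : CubeComplex.{u}) : Nonempty ((Iso.refl X).functor ≅ 𝟭 _) :=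
  nonempty_iso_of_map_hom _ _ (fun l => l.map ((Iso.refl X).equiv 1)) id (fun _ => rfl)
    (fun _ _ _ hl => ⟨_, (Iso.refl X).map_cls hl⟩) (fun _ _ _ hl => ⟨hl, rfl⟩) List.map_id

end CubeComplex

/-! ### Automorphisms of the Salvetti complex -/

section SalvettiAutomorphisms

variable {V : Type u} {Γ : SimpleGraph V}

/-- The permutation of the letters given by an automorphism of the Salvetti complex. -/
def letterMap (θ : (salvetti Γ).Iso (salvetti Γ)) (v : Letter V) : Letter V :=
  (θ.equiv 1 (letterEdge Γ v)).1 0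

theorem letterMap_symm (θ : (salvetti Γ).Iso (salvetti Γ)) (v : Letter V) :
    letterMap θ.symm (letterMap θ v) = v := by
  unfold letterMap
  rw [letterEdge_eq]
  exact congrArg (fun e : (salvetti Γ).Edge => e.1 0) ((θ.equiv 1).symm_apply_apply _)

theorem letterMap_inv (θ : (salvetti Γ).Iso (salvetti Γ)) (v : Letter V) :
    letterMap θ v.inv = (letterMap θ v).inv :=
  congrArg (fun e : (salvetti Γ).Edge => e.1 0)
    (θ.comm (FaceMap.edge 1 0 : FaceMap 1 1) (letterEdge Γ v))

theorem letterMap_fst_eq (θ : (salvetti Γ).Iso (salvetti Γ)) {v w : Letter V} (h : v.1 = w.1) :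
    (letterMap θ v).1 = (letterMap θ w).1 := by
  rcases Letter.eq_or_eq_inv h with rfl | rfl
  · rfl
  · rw [letterMap_inv]
    rfl

/-- Adjacent letters span a square, whose image is a square with the image letters as its edges. -/
theorem letterMap_adj (θ : (salvetti Γ).Iso (salvetti Γ)) {v w : Letter V} (h : Γ.Adj v.1 w.1) :
    Γ.Adj (letterMap θ v).1 (letterMap θ w).1 := by
  have hsq : ∀ i j : Fin 2, i ≠ j → Γ.Adj ((![v, w] : Fin 2 → Letter V) i).1
      ((![v, w] : Fin 2 → Letter V) j).1 := by
    intro i j hij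
    fin_cases i <;> fin_cases j
    · exact absurd rfl hij
    · exact h
    · exact h.symm
    · exact absurd rfl hij
  have hD := (θ.equiv 2 ⟨![v, w], hsq⟩).2 0 1 (by decide)
  have key : ∀ j : Fin 2, letterMap θ ((![v, w] : Fin 2 → Letter V) j) =
      (θ.equiv 2 ⟨![v, w], hsq⟩).1 j := by
    intro j
    have := congrArg (fun e : (salvetti Γ).Edge => e.1 0)
      (θ.comm (FaceMap.edge 0 j : FaceMap 1 2) ⟨![v, w], hsq⟩)
    refine Eq.trans (congrArg (fun e => (θ.equiv 1 e).1 0) ?_) this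
    exact Subtype.ext (funext fun i => rfl)
  rw [← key 0, ← key 1] at hD
  exact hD

/-- The automorphism of the graph given by an automorphism of the Salvetti complex. -/
def vertexIso (θ : (salvetti Γ).Iso (salvetti Γ)) : Γ ≃g Γ where
  toFun v := (letterMap θ (v, true)).1
  invFun v := (letterMap θ.symm (v, true)).1
  left_inv v := (letterMap_fst_eq θ.symm (v := ((letterMap θ (v, true)).1, true))
    (w := letterMap θ (v, true)) rfl).trans (congrArg Prod.fst (letterMap_symm θ (v, true)))
  right_inv v := (letterMap_fst_eq θ (v := ((letterMap θ.symm (v, true)).1, true))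
    (w := letterMap θ.symm (v, true)) rfl).trans
      (congrArg Prod.fst (letterMap_symm θ.symm (v, true)))
  map_rel_iff' {v w} := by
    refine ⟨fun h => ?_, fun h => letterMap_adj θ (v := (v, true)) (w := (w, true)) h⟩
    have := letterMap_adj θ.symm (v := letterMap θ (v, true)) (w := letterMap θ (w, true)) h
    rwa [letterMap_symm, letterMap_symm] at this

theorem gen_letterMap_comm (θ : (salvetti Γ).Iso (salvetti Γ)) (v w : Letter V)
    (h : Γ.Adj v.1 w.1) : gen Γ (letterMap θ v) * gen Γ (letterMap θ w) =
      gen Γ (letterMap θ w) * gen Γ (letterMap θ v) :=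
  gen_comm (letterMap_adj θ h)

theorem lift_letterMap (θ : (salvetti Γ).Iso (salvetti Γ)) (v : Letter V) :
    RAAG.lift (Γ := Γ) (fun v => gen Γ (letterMap θ (v, true)))
      (fun v w => gen_letterMap_comm θ (v, true) (w, true)) (gen Γ v) = gen Γ (letterMap θ v) :=
  RAAG.lift_gen (fun v => gen Γ (letterMap θ v)) (gen_letterMap_comm θ)
    (fun v => by rw [letterMap_inv, gen_inv]) v

/-- The automorphism of `A_Γ` given by an automorphism of the Salvetti complex. -/
def letterAut (θ : (salvetti Γ).Iso (salvetti Γ)) : MulAut (RAAG Γ) :=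
  RAAG.aut (fun v => gen Γ (letterMap θ (v, true)))
    (fun v => gen Γ (letterMap θ.symm (v, true)))
    (fun v w => gen_letterMap_comm θ (v, true) (w, true))
    (fun v w => gen_letterMap_comm θ.symm (v, true) (w, true))
    (fun v => by
      rw [lift_letterMap]
      exact congrArg (gen Γ) (letterMap_symm θ.symm (v, true)))
    (fun v => by rw [lift_letterMap, letterMap_symm θ]; rfl)

theorem letterAut_gen (θ : (salvetti Γ).Iso (salvetti Γ)) (v : Letter V) :
    letterAut θ (gen Γ v) = gen Γ (letterMap θ v) := lift_letterMap θ v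

theorem induces_letterAut (θ : (salvetti Γ).Iso (salvetti Γ)) :
    Induces θ.functor (letterAut θ) := by
  refine ⟨1, fun x y p => ?_⟩
  obtain ⟨l, h, rfl⟩ := (salvetti Γ).exists_hom p
  refine (congrArg pathElement (θ.map_cls h)).trans ((pathElement_hom _ _).trans ?_)
  rw [pathElement_hom, map_list_prod, List.map_map, List.map_map, one_mul, inv_one, mul_one]
  congr 1
  refine List.map_congr_left fun e _ => ?_
  change gen Γ _ = letterAut θ (gen Γ (e.1 0))
  rw [letterAut_gen, letterMap, letterEdge_eq]

/-- The automorphism of `A_Γ` given by an automorphism of the graph. -/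
def graphAut (s : Γ ≃g Γ) : MulAut (RAAG Γ) :=
  RAAG.aut (fun v => PresentedGroup.of (s v)) (fun v => PresentedGroup.of (s.symm v))
    (fun _ _ h => RAAG.of_comm (s.map_rel_iff.2 h))
    (fun _ _ h => RAAG.of_comm (s.symm.map_rel_iff.2 h))
    (fun v => by rw [RAAG.lift_of, s.apply_symm_apply])
    (fun v => by rw [RAAG.lift_of, s.symm_apply_apply])

open Classical in
-- An automorphism of the complex permutes the letters compatibly with inversion. After removing the
-- induced graph automorphism only signs remain, and these are products of inversions.
theorem letterAut_mem [Finite V] (θ : (salvetti Γ).Iso (salvetti Γ)) : letterAut θ ∈ AutL Γ := by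
  have := Fintype.ofFinite V
  have hs : graphAut (vertexIso θ) ∈ AutL Γ :=
    mem_AutL_of_generator (Or.inl ⟨vertexIso θ, fun v => RAAG.aut_of _ _ _ _ _ _ v⟩)
  have hinv : ∀ v, (graphAut (vertexIso θ))⁻¹ (PresentedGroup.of v) =
      PresentedGroup.of ((vertexIso θ).symm v) := by
    intro v
    rw [MulAut.inv_apply, MulEquiv.symm_apply_eq]
    refine Eq.symm ((RAAG.aut_of _ _ _ _ _ _ _).trans ?_)
    rw [(vertexIso θ).apply_symm_apply]
  have key : letterAut θ * (graphAut (vertexIso θ))⁻¹ ∈ AutL Γ := by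
    refine mem_AutL_of_signs (Finset.univ.filter fun v =>
      (letterMap θ ((vertexIso θ).symm v, true)).2 = false) _ fun v => ?_
    rw [MulAut.mul_apply, hinv, ← gen_true, letterAut_gen]
    have h1 : (letterMap θ ((vertexIso θ).symm v, true)).1 = v :=
      (vertexIso θ).apply_symm_apply v
    rw [show letterMap θ ((vertexIso θ).symm v, true) =
      (v, (letterMap θ ((vertexIso θ).symm v, true)).2) from Prod.ext h1 rfl]
    simp only [Finset.mem_filter, Finset.mem_univ, true_and]
    cases (letterMap θ ((vertexIso θ).symm v, true)).2
    · rw [if_pos rfl, gen_false]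
    · rw [if_neg (by decide), gen_true]
  have := mul_mem key hs
  rwa [inv_mul_cancel_right] at this

end SalvettiAutomorphisms

/-! ### The chain of exchanges -/

section Factorization

variable {V : Type u} {Γ : SimpleGraph V} {ι : Type} {P : ι → WhiteheadPartition Γ}
  {A : Set (V ⊕ ι)} {T : Set (V ⊕ ι)} {J : Set ι} {β : V ⊕ ι → Letter V} {f : MulAut (RAAG Γ)}

open WhiteheadPartition

theorem treeLabels_inr [Finite ι] (hP : IsCompatibleCollection P) :
    TreeLabels P (Set.range Sum.inr) :=
  ⟨by rintro _ ⟨i, rfl⟩; exact ⟨i, Or.inr ⟨i, rfl, rfl⟩⟩, fun _ => isSpanningTree_inr hP _⟩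

/-- Spanning trees of the same base graph have the same number of edges. -/
theorem TreeLabels.eq_of_subset [Finite ι] [Finite V] {B : Set (V ⊕ ι)} (hA : TreeLabels P A)
    (hB : TreeLabels P B) (h : B ⊆ A) : B = A := by
  refine h.antisymm fun a ha => ?_
  obtain ⟨i, hi⟩ := hA.1 a ha
  have h1 := (isSpanningTree_iff.1 (hA.2 i)).2
  have h2 := (isSpanningTree_iff.1 (hB.2 i)).2
  have h3 := Set.eq_of_subset_of_ncard_le
    (Set.inter_subset_inter_left (baseLabels P (P i).link) h) (by omega) (Set.toFinite _)
  exact (h3.ge ⟨ha, hi⟩).1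

/-- A stage of the factorization: the labels in `T ⊆ A` have replaced the partitions outside
`J`. -/
structure Stage [Finite ι] (P : ι → WhiteheadPartition Γ) (A T : Set (V ⊕ ι)) (J : Set ι)
    (β : V ⊕ ι → Letter V) (f : MulAut (RAAG Γ)) : Prop where
  subset : T ⊆ A
  disjoint : ∀ j ∈ J, Sum.inr j ∉ T
  tree : TreeLabels P (T ∪ Sum.inr '' J)
  coordinate : IsCoordinate P (T ∪ Sum.inr '' J) β
  low : ∀ v, Sum.inl v ∈ T → ∀ j ∈ J, ¬ lk Γ v ⊂ (P j).link
  mem : f ∈ AutL Γ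
  marks : Marks (T ∪ Sum.inr '' J) β P f

theorem stage_canonical [Finite ι] (hP : IsCompatibleCollection P) :
    Stage P A ∅ Set.univ (fun c => (rep P c, true)) 1 where
  subset := Set.empty_subset _
  disjoint _ _ := Set.notMem_empty _
  tree := by
    rw [Set.empty_union, Set.image_univ]
    exact treeLabels_inr hP
  coordinate := by
    rw [Set.empty_union, Set.image_univ]
    exact isCoordinate_canonical P
  low _ h := absurd h (Set.notMem_empty _)
  mem := one_mem _
  marks := by
    rw [Set.empty_union, Set.image_univ]
    exact marks_canonical P

theorem Stage.exists_next [Finite ι] [Finite V] (hP : IsCompatibleCollection P)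
    (hA : TreeLabels P A) (h : Stage P A T J β f) (hJ : J.Nonempty) :
    ∃ j ∈ J, ∃ b ∉ T, ∃ (β' : V ⊕ ι → Letter V) (W : Set (Letter V)) (m : Letter V)
      (w : MulAut (RAAG Γ)), IsWhiteheadPair Γ W m ∧ WhiteheadValues W m w ∧
        Stage P A (insert b T) (J \ {j}) β' (w * f) := by
  -- A partition with maximal link is replaced first. A vertex entering `T` then never has a link
  -- strictly below that of a remaining partition, which is the condition needed for later cuts.
  obtain ⟨j, hj, hmax⟩ := (Set.toFinite J).exists_maximalFor (fun j => (P j).link) J hJ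
  have haJ : (Sum.inr j : V ⊕ ι) ∈ T ∪ Sum.inr '' J := Or.inr ⟨j, hj, rfl⟩
  obtain ⟨b, hbA, hbL, hb, ht, β', hβ', W, m, w, g, hW, hw, hv, hg⟩ :=
    exists_exchange_step hP h.tree h.coordinate hA haJ (Or.inr ⟨j, rfl, rfl⟩) (by
      rintro v (hv | ⟨i, -, hi⟩)
      · exact h.low v hv j hj
      · cases hi)
  have hset : insert b ((T ∪ Sum.inr '' J) \ {Sum.inr j}) =
      insert b T ∪ Sum.inr '' (J \ {j}) := by
    rw [Set.union_sdiff_distrib, Set.sdiff_singleton_eq_self (h.disjoint j hj),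
      Set.image_sdiff Sum.inr_injective, Set.image_singleton, Set.insert_union]
  rw [hset] at ht hβ' hg
  have hbT : b ∉ T := by
    intro hbT
    refine hb ⟨Or.inl hbT, ?_⟩
    rintro rfl
    exact h.disjoint j hj hbT
  refine ⟨j, hj, b, hbT, β', W, m, w, hW, hv, Set.insert_subset hbA h.subset, ?_, ht, hβ', ?_,
    mul_mem hw h.mem, h.marks.twist hg⟩
  · rintro i ⟨hi, hij⟩ (rfl | hiT)
    · exact hb ⟨Or.inr ⟨i, hi, rfl⟩, fun h => hij (Sum.inr_injective h)⟩
    · exact h.disjoint i hi hiT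
  · rintro v (rfl | hvT) i hi
    · rw [show lk Γ v = (P j).link from (mem_baseLabels_iff _).1 hbL]
      exact fun h' => h'.not_subset (hmax hi.1 h'.subset)
    · exact h.low v hvT i hi.1

/-- The labels that are collapsed at a stage of the factorization. -/
def mixedLabels {k : ℕ} (b : Fin k → V ⊕ Fin k) (π : Equiv.Perm (Fin k)) (i : Fin (k + 1)) :
    Set (V ⊕ Fin k) :=
  {c | ∃ j : Fin k, j.castSucc < i ∧ c = b j} ∪
    Sum.inr '' {a | ∃ j : Fin k, i ≤ j.castSucc ∧ a = π j}

/-- The exchange step is iterated `k` times. The removed partitions give the ordering `π` and the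
inserted labels the ordering `b`. At the end no partition label is left over, and the inserted
labels form a tree-like subset of `A`, hence all of `A`. -/
theorem exists_stages [Finite V] {k : ℕ} {P : Fin k → WhiteheadPartition Γ}
    {A : Set (V ⊕ Fin k)} (hP : IsCompatibleCollection P) (hA : TreeLabels P A) :
    ∃ (b : Fin k → V ⊕ Fin k) (π : Equiv.Perm (Fin k)) (f : Fin (k + 1) → MulAut (RAAG Γ)),
      Function.Injective b ∧ Set.range b = A ∧ f 0 = 1 ∧
      (∀ i, f i ∈ AutL Γ ∧ TreeLabels P (mixedLabels b π i) ∧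
        ∃ β, IsCoordinate P (mixedLabels b π i) β ∧ Marks (mixedLabels b π i) β P (f i)) ∧
      ∀ i : Fin k, ∃ (W : Set (Letter V)) (m : Letter V) (w : MulAut (RAAG Γ)),
        IsWhiteheadPair Γ W m ∧ WhiteheadValues W m w ∧ f i.succ = w * f i.castSucc := by
  let S := {s : (Set (V ⊕ Fin k) × Set (Fin k)) × (V ⊕ Fin k → Letter V) × MulAut (RAAG Γ) //
    Stage P A s.1.1 s.1.2 s.2.1 s.2.2}
  let s₀ : S := ⟨((∅, Set.univ), _, 1), stage_canonical hP⟩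
  have hstep : ∀ s : S, ∃ s' : S, s.1.1.2.Nonempty → ∃ j ∈ s.1.1.2, ∃ b ∉ s.1.1.1,
      s'.1.1.1 = insert b s.1.1.1 ∧ s'.1.1.2 = s.1.1.2 \ {j} ∧
      ∃ (W : Set (Letter V)) (m : Letter V) (w : MulAut (RAAG Γ)),
        IsWhiteheadPair Γ W m ∧ WhiteheadValues W m w ∧ s'.1.2.2 = w * s.1.2.2 := by
    intro s
    by_cases hs : s.1.1.2.Nonempty
    · obtain ⟨j, hj, b, hb, β', W, m, w, h1, h2, h3⟩ := s.2.exists_next hP hA hs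
      exact ⟨⟨((insert b s.1.1.1, s.1.1.2 \ {j}), β', w * s.1.2.2), h3⟩,
        fun _ => ⟨j, hj, b, hb, rfl, rfl, W, m, w, h1, h2, rfl⟩⟩
    -- Once no partition is left the stage is repeated; this makes the step total and does not occur
    -- among the first `k` steps.
    · exact ⟨s, fun h => absurd h hs⟩
  choose next hnext using hstep
  let s : ℕ → S := fun n => next^[n] s₀
  have hs : ∀ n, s (n + 1) = next (s n) := fun n => Function.iterate_succ_apply' next n s₀
  have hcard : ∀ n ≤ k, (s n).1.1.2.ncard = k - n := by
    intro n
    induction n with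
    | zero => exact fun _ => (Set.ncard_univ _).trans (Nat.card_fin k)
    | succ n ih =>
      intro hn
      have h1 := ih (by omega)
      obtain ⟨j, hj, b, -, -, h2, -⟩ := hnext (s n) (Set.nonempty_of_ncard_ne_zero (by omega))
      rw [hs, h2, Set.ncard_sdiff_singleton_of_mem hj, h1]
      omega
  have hdata : ∀ i : Fin k, _ := fun i : Fin k =>
    hnext (s i) (Set.nonempty_of_ncard_ne_zero (by rw [hcard i i.2.le]; omega))
  simp only [← hs] at hdata
  choose p hp b hb hT hJ hW using hdata
  have hTn : ∀ n ≤ k, (s n).1.1.1 = {c | ∃ j : Fin k, j.1 < n ∧ c = b j} := by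
    intro n
    induction n with
    | zero =>
      intro _
      refine Eq.symm (Set.eq_empty_of_forall_notMem ?_)
      rintro c ⟨j, hj, -⟩
      exact Nat.not_lt_zero _ hj
    | succ n ih =>
      intro hn
      rw [hT ⟨n, hn⟩, ih (by omega)]
      ext c
      constructor
      · rintro (rfl | ⟨j, hj, rfl⟩)
        · exact ⟨_, Nat.lt_succ_self n, rfl⟩
        · exact ⟨j, by omega, rfl⟩
      · rintro ⟨j, hj, rfl⟩
        by_cases hjn : j.1 = n
        · exact Or.inl (congrArg b (Fin.ext hjn))
        · exact Or.inr ⟨j, by omega, rfl⟩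
  have hJn : ∀ n ≤ k, (s n).1.1.2 = {a | ∀ j : Fin k, j.1 < n → a ≠ p j} := by
    intro n
    induction n with
    | zero =>
      intro _
      refine Eq.symm (Set.eq_univ_of_forall ?_)
      exact fun a j hj => absurd hj (Nat.not_lt_zero _)
    | succ n ih =>
      intro hn
      rw [hJ ⟨n, hn⟩, ih (by omega)]
      ext a
      constructor
      · rintro ⟨h1, h2⟩ j hj
        by_cases hjn : j.1 = n
        · rw [show j = ⟨n, hn⟩ from Fin.ext hjn]
          exact h2
        · exact h1 j (by omega)
      · exact fun h => ⟨fun j hj => h j (by omega), h ⟨n, hn⟩ (Nat.lt_succ_self n)⟩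
  have hpinj : Function.Injective p := by
    have key : ∀ i j : Fin k, i.1 < j.1 → p i ≠ p j := by
      intro i j hij h
      have := hp j
      rw [hJn j j.2.le] at this
      exact this i hij h.symm
    intro i j h
    rcases lt_trichotomy i.1 j.1 with h1 | h1 | h1
    · exact absurd h (key i j h1)
    · exact Fin.ext h1
    · exact absurd h.symm (key j i h1)
  have hbinj : Function.Injective b := by
    have key : ∀ i j : Fin k, i.1 < j.1 → b i ≠ b j := by
      intro i j hij h
      have := hb j
      rw [hTn j j.2.le] at this
      exact this ⟨i, hij, h.symm⟩
    intro i j h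
    rcases lt_trichotomy i.1 j.1 with h1 | h1 | h1
    · exact absurd h (key i j h1)
    · exact Fin.ext h1
    · exact absurd h.symm (key j i h1)
  let π : Equiv.Perm (Fin k) := Equiv.ofBijective p (Finite.injective_iff_bijective.1 hpinj)
  -- The partitions remaining at stage `i` are those that are removed at step `i` or later.
  have hmix : ∀ i : Fin (k + 1),
      (s i).1.1.1 ∪ Sum.inr '' (s i).1.1.2 = mixedLabels b π i := by
    intro i
    rw [hTn i (by omega), hJn i (by omega)]
    unfold mixedLabels
    congr 2
    ext a
    constructor
    · intro h
      obtain ⟨j, rfl⟩ := π.surjective a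
      refine ⟨j, ?_, rfl⟩
      by_contra hji
      exact h j (not_le.1 hji) rfl
    · rintro ⟨j, hj, rfl⟩ j' hj' h
      obtain rfl := hpinj h
      exact absurd hj (not_le.2 hj')
  refine ⟨b, π, fun i => (s i).1.2.2, hbinj, ?_, rfl, fun i => ?_, hW⟩
  · have h1 : (s k).1.1.1 = Set.range b := by
      rw [hTn k le_rfl]
      ext c
      exact ⟨fun ⟨j, _, h⟩ => ⟨j, h.symm⟩, fun ⟨j, h⟩ => ⟨j, j.2, h.symm⟩⟩
    have h2 : (s k).1.1.2 = ∅ := (Set.ncard_eq_zero (Set.toFinite _)).1 (by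
      rw [hcard k le_rfl, Nat.sub_self])
    have h3 := (s k).2.tree
    rw [h2, Set.image_empty, Set.union_empty] at h3
    rw [← h1]
    exact hA.eq_of_subset h3 (s k).2.subset
  · have h1 := (s i).2
    refine ⟨h1.mem, hmix i ▸ h1.tree, _, hmix i ▸ h1.coordinate, hmix i ▸ h1.marks⟩

end Factorization

/-! ### Roses, Whitehead moves and markings -/

section Roses

variable {V : Type u} {Γ : SimpleGraph V}

theorem realize_inv (f : MulAut (RAAG Γ)) : Nonempty (realize f ⋙ realize f⁻¹ ≅ 𝟭 _) :=
  nonempty_iso_of_conj _ _ (fun _ => 1) fun p => by simp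

theorem IsRose.of_iso {α σ : (salvetti Γ).Grpd ⥤ (salvetti Γ).Grpd} (hα : IsRose α)
    {f : MulAut (RAAG Γ)} (hf : f ∈ AutL Γ) (e : σ ≅ realize f ⋙ α) : IsRose σ := by
  obtain ⟨h, g, hg, hgl⟩ := hα
  refine ⟨Functor.isEquivalence_of_iso e.symm, g * f, ?_, ?_⟩
  · obtain ⟨e1⟩ := induces_iff.1 hg
    obtain ⟨e2⟩ := realize_comp f g
    exact induces_iff.2 ⟨e ≪≫ Functor.isoWhiskerLeft _ e1 ≪≫ e2⟩
  · exact mem_AutL.1 (mul_mem (mem_AutL.2 hgl) hf)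

/-- As `w` is an involution, `(w * f)⁻¹ = f⁻¹ * w`, so the second marking is the first one
precomposed with `w`. -/
theorem isWhiteheadMove_of_iso {α σ τ : (salvetti Γ).Grpd ⥤ (salvetti Γ).Grpd}
    {f w : MulAut (RAAG Γ)} {W : Set (Letter V)} {m : Letter V} (hW : IsWhiteheadPair Γ W m)
    (hw : WhiteheadValues W m w) (e : σ ≅ realize f⁻¹ ⋙ α) (e' : τ ≅ realize (w * f)⁻¹ ⋙ α) :
    IsWhiteheadMove σ τ := by
  refine ⟨W, m, w, realize w, hW, hw.isWhiteheadAut, induces_realize w,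
    CubeComplex.Iso.refl _, ?_⟩
  obtain ⟨e1⟩ := CubeComplex.Iso.functor_refl (salvetti Γ)
  obtain ⟨e2⟩ := realize_comp w f⁻¹
  have h : f⁻¹ * w = (w * f)⁻¹ := by
    rw [mul_inv_rev, inv_eq_of_mul_eq_one_left hw.mul_self]
  rw [h] at e2
  exact ⟨Functor.isoWhiskerRight e1 _ ≪≫ Functor.leftUnitor _ ≪≫
    Functor.isoWhiskerLeft (realize w) e ≪≫ (Functor.associator _ _ _).symm ≪≫
    Functor.isoWhiskerRight e2 α ≪≫ e'.symm⟩

variable {ι : Type} {P : ι → WhiteheadPartition Γ} {A : Set (V ⊕ ι)} {β : V ⊕ ι → Letter V}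
  {f : MulAut (RAAG Γ)}

/-- With the collapse `c` and the identification `I`, the relation `I ∘ c ≃ f ∘ c_𝒫` gives `c_𝒫 ∘
c⁻¹ ≃ f⁻¹ ∘ I`, so `I⁻¹` carries the marking `α ∘ c_𝒫 ∘ c⁻¹` to `α ∘ f⁻¹`. -/
theorem Marks.equivalent [Finite ι] [Finite V] (h : Marks A β P f) (hβ : IsCoordinate P A β)
    (hP : IsCompatibleCollection P) (hA : TreeLabels P A)
    {α σ : (salvetti Γ).Grpd ⥤ (salvetti Γ).Grpd} (e : σ ≅ realize f⁻¹ ⋙ α) :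
    (MarkedComplex.salvetti σ).Equivalent
      ((MarkedComplex.blowup α P).collapse (hypLabel P ⁻¹' A)) := by
  have hc := h.isEquivalence_collapse hβ hP hA
  refine ⟨(hβ.iso hP hA).symm, ?_⟩
  obtain ⟨e1⟩ := h.nonempty_iso hβ hP hA
  obtain ⟨e2⟩ := realize_inv f
  obtain ⟨e3⟩ := (hβ.iso hP hA).symm.functor_symm
  let c := (blowup P).collapseFunctor (hypLabel P ⁻¹' A)
  let I := (hβ.iso hP hA).functor
  let I' := (hβ.iso hP hA).symm.functor
  have e4 : (c ⋙ I) ⋙ realize f⁻¹ ≅ canonicalFunctor P :=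
    Functor.isoWhiskerRight e1 (realize f⁻¹) ≪≫ Functor.associator _ _ _ ≪≫
      Functor.isoWhiskerLeft (canonicalFunctor P) e2 ≪≫ Functor.rightUnitor _
  have e5 : I' ⋙ c.inv ⋙ c ⋙ I ≅ 𝟭 _ :=
    Functor.isoWhiskerLeft I' ((Functor.associator _ _ _).symm ≪≫
      Functor.isoWhiskerRight c.asEquivalence.counitIso I ≪≫ Functor.leftUnitor _) ≪≫ e3
  have e6 : I' ⋙ c.inv ⋙ canonicalFunctor P ⋙ α ≅ realize f⁻¹ ⋙ α :=
    Functor.isoWhiskerLeft I' (Functor.isoWhiskerLeft c.inv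
      (Functor.isoWhiskerRight e4.symm α)) ≪≫
      Functor.isoWhiskerRight e5 (realize f⁻¹ ⋙ α) ≪≫ Functor.leftUnitor _
  have h1 : compInv c (canonicalFunctor P ⋙ α) = c.inv ⋙ canonicalFunctor P ⋙ α := dif_pos hc
  exact ⟨eqToIso (congrArg (I' ⋙ ·) h1) ≪≫ e6 ≪≫ e.symm⟩

/-- An arbitrary identification `θ` is the identification by the coordinate followed by an
automorphism of the Salvetti complex, and the latter contributes the factor `letterAut`. -/
theorem Marks.induces [Finite ι] [Finite V] (h : Marks A β P f) (hβ : IsCoordinate P A β)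
    (hP : IsCompatibleCollection P) (hA : TreeLabels P A)
    (θ : ((blowup P).collapse (hypLabel P ⁻¹' A)).Iso (salvetti Γ)) :
    Induces (compInv (canonicalFunctor P)
      ((blowup P).collapseFunctor (hypLabel P ⁻¹' A) ⋙ θ.functor))
      (letterAut ((hβ.iso hP hA).symm.trans θ) * f) := by
  have hc := isEquivalence_canonical hP
  obtain ⟨e1⟩ := h.nonempty_iso hβ hP hA
  obtain ⟨e2⟩ := (hβ.iso hP hA).functor_symm
  obtain ⟨e3⟩ := (hβ.iso hP hA).symm.functor_trans θ
  obtain ⟨e4⟩ := induces_iff.1 (induces_letterAut ((hβ.iso hP hA).symm.trans θ))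
  obtain ⟨e5⟩ := realize_comp f (letterAut ((hβ.iso hP hA).symm.trans θ))
  let c := (blowup P).collapseFunctor (hypLabel P ⁻¹' A)
  let I := (hβ.iso hP hA).functor
  let I' := (hβ.iso hP hA).symm.functor
  let K := canonicalFunctor P
  have e6 : I' ⋙ θ.functor ≅ realize (letterAut ((hβ.iso hP hA).symm.trans θ)) :=
    e3.symm ≪≫ e4
  have e7 : c ⋙ θ.functor ≅ K ⋙ realize (letterAut ((hβ.iso hP hA).symm.trans θ) * f) :=
    Functor.isoWhiskerLeft c ((Functor.leftUnitor _).symm ≪≫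
      Functor.isoWhiskerRight e2.symm θ.functor) ≪≫
      Functor.isoWhiskerLeft (c ⋙ I) e6 ≪≫
      Functor.isoWhiskerRight e1 _ ≪≫ Functor.isoWhiskerLeft K e5
  have e8 : K.inv ⋙ c ⋙ θ.functor ≅
      realize (letterAut ((hβ.iso hP hA).symm.trans θ) * f) :=
    Functor.isoWhiskerLeft K.inv e7 ≪≫ (Functor.associator _ _ _).symm ≪≫
      Functor.isoWhiskerRight K.asEquivalence.counitIso _ ≪≫ Functor.leftUnitor _
  have h1 : compInv K (c ⋙ θ.functor) = K.inv ⋙ c ⋙ θ.functor := dif_pos hc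
  exact induces_iff.2 ⟨eqToIso h1 ≪≫ e8⟩

end Roses

end OutSpace

end

/-! ### Assembly of the theorem -/

theorem mainTheorem12 {V : Type u} [Finite V] (Γ : SimpleGraph V) {k : ℕ}
    (P : Fin k → OutSpace.WhiteheadPartition Γ) (hP : OutSpace.IsCompatibleCollection P)
    (H : Set (OutSpace.blowup P).Hyperplane) (hH : OutSpace.IsTreeLike P H) :
    (OutSpace.canonicalFunctor P).IsEquivalence ∧
    ((OutSpace.blowup P).collapseFunctor H).IsEquivalence ∧
    Nonempty (((OutSpace.blowup P).collapse H).Iso (OutSpace.salvetti Γ)) ∧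
    (∀ h : ((OutSpace.blowup P).collapse H).Iso (OutSpace.salvetti Γ),
      ∃ φ ∈ OutSpace.OutL Γ, ∀ f : MulAut (OutSpace.RAAG Γ),
        OutSpace.Induces (OutSpace.compInv (OutSpace.canonicalFunctor P)
          ((OutSpace.blowup P).collapseFunctor H ⋙ h.functor)) f ↔
        OutSpace.outClass f = φ) ∧
    (∀ α : (OutSpace.salvetti Γ).Grpd ⥤ (OutSpace.salvetti Γ).Grpd, OutSpace.IsRose α →
      ∃ (η : Fin k ≃ H) (π : Equiv.Perm (Fin k))
        (σ : Fin (k + 1) → ((OutSpace.salvetti Γ).Grpd ⥤ (OutSpace.salvetti Γ).Grpd)),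
        (∀ i, OutSpace.IsRose (σ i)) ∧
        σ 0 = α ∧
        (OutSpace.MarkedComplex.salvetti (σ (Fin.last k))).Equivalent
          ((OutSpace.MarkedComplex.blowup α P).collapse H) ∧
        (∀ i : Fin k, OutSpace.IsWhiteheadMove (σ i.castSucc) (σ i.succ)) ∧
        ∀ i : Fin (k + 1),
          OutSpace.IsTreeLike P (OutSpace.mixedHyperplanes P η π i) ∧
          ((OutSpace.blowup P).collapseFunctor (OutSpace.mixedHyperplanes P η π i)).IsEquivalence ∧
          (OutSpace.MarkedComplex.salvetti (σ i)).Equivalent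
            ((OutSpace.MarkedComplex.blowup α P).collapse
              (OutSpace.mixedHyperplanes P η π i))) := by
  -- Hyperplanes are determined by their labels, so from here on only the set `A` of labels matters.
  obtain ⟨A, rfl⟩ : ∃ A, H = OutSpace.hypLabel P ⁻¹' A :=
    ⟨OutSpace.dualLabels P H, Set.ext fun h => OutSpace.mem_iff_hypLabel_mem hP⟩
  have hA := (OutSpace.isTreeLike_iff hP _).1 hH
  rw [OutSpace.dualLabels_preimage hP] at hA
  obtain ⟨b, π, f, hb, hbA, hf0, hf, hW⟩ := OutSpace.exists_stages hP hA
  have hlast : OutSpace.mixedLabels b π (Fin.last k) = A := by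
    rw [← hbA]
    ext c
    constructor
    · rintro (⟨j, -, rfl⟩ | ⟨a, ⟨j, hj, -⟩, -⟩)
      · exact ⟨j, rfl⟩
      · exact absurd hj (not_le.2 (Fin.castSucc_lt_last j))
    · rintro ⟨j, rfl⟩
      exact Or.inl ⟨j, Fin.castSucc_lt_last j, rfl⟩
  obtain ⟨hfA, -, β, hβ, hm⟩ := hf (Fin.last k)
  rw [hlast] at hβ hm
  refine ⟨OutSpace.isEquivalence_canonical hP, hm.isEquivalence_collapse hβ hP hA,
    ⟨hβ.iso hP hA⟩, fun h => ?_, fun α hα => ?_⟩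
  · exact ⟨_, OutSpace.mem_AutL.1 (mul_mem (OutSpace.letterAut_mem _) hfA),
      fun g => (hm.induces hβ hP hA h).iff_outClass g⟩
  let ε : OutSpace.hypLabel P ⁻¹' A ≃ A := Equiv.ofBijective
    (fun h => ⟨OutSpace.hypLabel P h.1, h.2⟩)
    ⟨fun h h' e => Subtype.ext (OutSpace.hypLabel_injective hP (congrArg Subtype.val e)),
      fun a => by
        obtain ⟨h, hh⟩ := OutSpace.hypLabel_surjective hP a.1
        exact ⟨⟨h, show _ ∈ A from hh ▸ a.2⟩, Subtype.ext hh⟩⟩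
  let η : Fin k ≃ (OutSpace.hypLabel P ⁻¹' A : Set _) :=
    (Equiv.ofInjective b hb).trans ((Equiv.setCongr hbA).trans ε.symm)
  have hη : ∀ j, OutSpace.hypLabel P (η j) = b j := fun j =>
    congrArg Subtype.val (ε.apply_symm_apply (Equiv.setCongr hbA (Equiv.ofInjective b hb j)))
  have hmix : ∀ i, OutSpace.mixedHyperplanes P η π i =
      OutSpace.hypLabel P ⁻¹' OutSpace.mixedLabels b π i := by
    intro i
    unfold OutSpace.mixedHyperplanes OutSpace.mixedLabels
    rw [OutSpace.partitionHyperplanes_eq, Set.preimage_union]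
    congr 1
    ext h
    refine exists_congr fun j => and_congr_right fun _ => ?_
    rw [← hη]
    exact (OutSpace.hypLabel_injective hP).eq_iff.symm
  -- The first rose has to be `α` itself and not only isomorphic to it, hence the separate value at
  -- `0`.
  let σ : Fin (k + 1) → ((OutSpace.salvetti Γ).Grpd ⥤ (OutSpace.salvetti Γ).Grpd) :=
    fun i => if i = 0 then α else OutSpace.realize (f i)⁻¹ ⋙ α
  have hσ : ∀ i, Nonempty (σ i ≅ OutSpace.realize (f i)⁻¹ ⋙ α) := by
    intro i
    by_cases hi : i = 0
    · obtain ⟨e⟩ := OutSpace.realize_one (Γ := Γ)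
      rw [show σ i = α from if_pos hi, hi, hf0, inv_one]
      exact ⟨(Functor.leftUnitor α).symm ≪≫ Functor.isoWhiskerRight e.symm α⟩
    · rw [show σ i = _ from if_neg hi]
      exact ⟨Iso.refl _⟩
  have heq : ∀ i, (OutSpace.MarkedComplex.salvetti (σ i)).Equivalent
      ((OutSpace.MarkedComplex.blowup α P).collapse (OutSpace.mixedHyperplanes P η π i)) := by
    intro i
    obtain ⟨-, ht, β, hβ, hm⟩ := hf i
    obtain ⟨e⟩ := hσ i
    rw [hmix]
    exact hm.equivalent hβ hP ht e
  refine ⟨η, π, σ, fun i => ?_, if_pos rfl, ?_, fun i => ?_, fun i => ⟨?_, ?_, heq i⟩⟩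
  · obtain ⟨e⟩ := hσ i
    exact hα.of_iso (inv_mem (hf i).1) e
  · have := heq (Fin.last k)
    rwa [hmix, hlast] at this
  · obtain ⟨W, m, w, h1, h2, h3⟩ := hW i
    obtain ⟨e⟩ := hσ i.castSucc
    obtain ⟨e'⟩ := hσ i.succ
    rw [h3] at e'
    exact OutSpace.isWhiteheadMove_of_iso h1 h2 e e'
  · rw [OutSpace.isTreeLike_iff hP, hmix, OutSpace.dualLabels_preimage hP]
    exact (hf i).2.1
  · obtain ⟨-, ht, β, hβ, hm⟩ := hf i
    rw [hmix]
    exact hm.isEquivalence_collapse hβ hP ht
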